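/- Let $d\ge 1$. **Frolov's cubature rule.** Let $\xi_1<\dots<\xi_d$ be the ($d$ different, real) roots of $\prod_{j=1}^d(t-2j+1)-1$, let $\widetilde T=(\xi_i^{j-1})_{i,j=1}^d$, $T_n=(n\det\widetilde T)^{-1/d}\,\widetilde T$, $\mathbb X_n=T_n(\mathbb Z^d)$, and $$Q_n(f)=\frac1n\sum_{x\in\mathbb X_n\cap[0,1)^d}f(x),\qquad n\in\mathbb N,\ n\ge1 .$$ **Function spaces.** For $s\in\mathbb R$ let $\Psi_0,\Psi_1\in C_0^\infty(\mathbb R)$ (complex-valued) be such that for some $\varepsilon>0$ and some $L\in\mathbb N_0$ with $L+1>s$: $|\mathcal F\Psi_0(\xi)|>0$ for $|\xi|<\varepsilon$; $|\mathcal F\Psi_1(\xi)|>0$ for $\varepsilon/2<|\xi|<2\varepsilon$; and $D^\alpha\mathcal F\Psi_1(0)=0$ for $0\le\alpha\le L$, where $\mathcal F g(\xi)=\int g(y)e^{-2\pi i\xi y}\,dy$. Put $\Psi_j(x)=2^{j-1}\Psi_1(2^{j-1}x)$ for $j\ge1$, $\Psi_m(x)=\prod_{i=1}^d\Psi_{m_i}(x_i)$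 and $|m|_1=m_1+\dots+m_d$ for $m\in\mathbb N_0^d$, and $(\Psi_m*f)(x)=f(\Psi_m(x-\cdot))$ for a tempered distribution $f\in\mathcal S'(\mathbb R^d)$. For $0<p,\theta\le\infty$ (with $p<\infty$ for $\mathbf F$) define the (quasi-)norms $$\|f\|_{\mathbf B^s_{p,\theta}}=\Big(\sum_{m\in\mathbb N_0^d}2^{s|m|_1\theta}\|\Psi_m*f\|_p^\theta\Big)^{1/\theta},\qquad \|f\|_{\mathbf F^s_{p,\theta}}=\Big\|\Big(\sum_{m\in\mathbb N_0^d}2^{s|m|_1\theta}|\Psi_m*f(\cdot)|^\theta\Big)^{1/\theta}\Big\|_p$$ (with the supremum over $m$ in place of the sum if $\theta=\infty$, and the essential supremum for $p=\infty$). For $\mathbf A\in\{\mathbf B,\mathbf F\}$ let $\mathring{\mathbf A}^s_{p,\theta}$ be the space of all $f\in\mathcal S'(\mathbb R^d)$ with $\|f\|_{\mathbf A^s_{p,\theta}}<\infty$ and $\operatorname{supp} f\subset[0,1]^d$. If each element of it is (represented by) a bounded continuous function, put $$e(Q_n,\mathring{\mathbf A}^s_{p,\theta})=\sup\Big\{\Big|\int_{[0,1]^d}f(x)\,dx-Q_n(f)\Big|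 : f\in\mathring{\mathbf A}^s_{p,\theta},\ \|f\|_{\mathbf A^s_{p,\theta}}\le1\Big\}.$$ **Theorem 6.3.** Let $s=1/p$ (with $s=0$ if $p=\infty$), and let $\Psi_0,\Psi_1$ be as above for this $s$. (i) If $0<p\le\infty$ and $0<\theta\le1$, then every element of $\mathring{\mathbf B}^{1/p}_{p,\theta}$ is represented by a bounded continuous function, and there are constants $c,C>0$ independent of $n$ such that for all $n\ge1$ $$c\,n^{-1/\max\{p,1\}}\le e(Q_n,\mathring{\mathbf B}^{1/p}_{p,\theta})\le C\,n^{-1/\max\{p,1\}}$$ (where $1/\max\{p,1\}=0$ if $p=\infty$). (ii) If $0<p<1$ and $0<\theta\le\infty$, then every element of $\mathring{\mathbf F}^{1/p}_{p,\theta}$ is represented by a bounded continuous function, and there are constants $c,C>0$ independent of $n$ such that for all $n\ge1$ $$c\,n^{-1}\le e(Q_n,\mathring{\mathbf F}^{1/p}_{p,\theta})\le C\,n^{-1}.$$ -/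

import Mathlib

open MeasureTheory SchwartzMap
open scoped ENNReal FourierTransform ContDiff BoundedContinuousFunction

noncomputable section

/-! ### Frolov's cubature rule -/

/-- The polynomial `∏_{j=1}^d (t - 2j + 1) - 1` (the index `j : Fin d` is shifted by one). -/
def frolovPoly (d : ℕ) : Polynomial ℝ :=
  ∏ j : Fin d, (Polynomial.X - Polynomial.C (2 * (j : ℝ) + 1)) - 1

/-- The real roots `ξ_1, …, ξ_d` of `frolovPoly d`, listed in increasing order
(the default value `0` is never used, as the polynomial has `d` different real roots). -/
def frolovRoot (d : ℕ) (i : Fin d) : ℝ :=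
  ((frolovPoly d).roots.sort (· ≤ ·)).getD i 0

/-- The Vandermonde matrix `(ξ_i ^ (j-1))_{i,j=1}^d`. -/
def frolovMatrix (d : ℕ) : Matrix (Fin d) (Fin d) ℝ :=
  Matrix.vandermonde (frolovRoot d)

/-- The generator `T_n = (n det T)^{-1/d} T` of the lattice, where `T` is the Vandermonde matrix. -/
def frolovGenerator (d n : ℕ) : Matrix (Fin d) (Fin d) ℝ :=
  (((n : ℝ) * (frolovMatrix d).det) ^ (-(1 / (d : ℝ)))) • frolovMatrix d

/-- The lattice `X_n = T_n(ℤ^d)`. -/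
def frolovLattice (d n : ℕ) : Set (EuclideanSpace ℝ (Fin d)) :=
  {x | ∃ k : Fin d → ℤ, ∀ i, x i = (frolovGenerator d n).mulVec (fun j => (k j : ℝ)) i}

/-- Frolov's cubature formula `Q_n(f) = n⁻¹ ∑_{x ∈ X_n ∩ [0,1)^d} f(x)` (a finite sum). -/
def frolovCubature (d n : ℕ) (f : EuclideanSpace ℝ (Fin d) → ℂ) : ℂ :=
  (n : ℂ)⁻¹ * ∑ᶠ x ∈ frolovLattice d n ∩ {x | ∀ i, 0 ≤ x i ∧ x i < 1}, f x

/-! ### Local means -/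

/-- A pair of kernels `Ψ₀, Ψ₁ ∈ C_0^∞(ℝ)` satisfying, for some `ε > 0`, the Tauberian conditions,
and the moment condition of some order `L` with `L + 1 > s`. -/
structure LocalMeans (s : ℝ) where
  Ψ₀ : ℝ → ℂ
  Ψ₁ : ℝ → ℂ
  smooth₀ : ContDiff ℝ ∞ Ψ₀
  smooth₁ : ContDiff ℝ ∞ Ψ₁
  compact₀ : HasCompactSupport Ψ₀
  compact₁ : HasCompactSupport Ψ₁
  tauberian : ∃ ε : ℝ, 0 < ε ∧ (∀ ξ : ℝ, |ξ| < ε → 0 < ‖𝓕 Ψ₀ ξ‖) ∧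
    (∀ ξ : ℝ, ε / 2 < |ξ| → |ξ| < 2 * ε → 0 < ‖𝓕 Ψ₁ ξ‖)
  moment : ∃ L : ℕ, s < (L : ℝ) + 1 ∧ ∀ α : ℕ, α ≤ L → iteratedDeriv α (𝓕 Ψ₁) 0 = 0

namespace LocalMeans

variable {s : ℝ}

/-- `Ψ_0` is the given kernel, and `Ψ_j(x) = 2^{j-1} Ψ_1(2^{j-1} x)` for `j ≥ 1`. -/
def level (K : LocalMeans s) : ℕ → ℝ → ℂ
  | 0 => K.Ψ₀
  | j + 1 => fun x => (2 : ℂ) ^ j * K.Ψ₁ ((2 : ℝ) ^ j * x)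

/-- The tensor product `Ψ_m(x) = ∏_i Ψ_{m_i}(x_i)`. -/
def tensor {d : ℕ} (K : LocalMeans s) (m : Fin d → ℕ) (x : EuclideanSpace ℝ (Fin d)) : ℂ :=
  ∏ i, K.level (m i) (x i)

theorem contDiff_level (K : LocalMeans s) (j : ℕ) : ContDiff ℝ ∞ (K.level j) := by
  cases j with
  | zero => exact K.smooth₀
  | succ j =>
    exact contDiff_const.mul (K.smooth₁.comp (contDiff_const.mul contDiff_id))

theorem hasCompactSupport_level (K : LocalMeans s) (j : ℕ) : HasCompactSupport (K.level j) := by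
  cases j with
  | zero => exact K.compact₀
  | succ j =>
    have h2 : (2 : ℝ) ^ j ≠ 0 := by positivity
    exact (K.compact₁.comp_homeomorph (Homeomorph.mulLeft₀ ((2 : ℝ) ^ j) h2)).mul_left

theorem contDiff_tensor {d : ℕ} (K : LocalMeans s) (m : Fin d → ℕ) :
    ContDiff ℝ ∞ (K.tensor m) := by
  unfold tensor
  refine contDiff_prod fun i _ => (K.contDiff_level (m i)).comp ?_
  fun_prop

theorem hasCompactSupport_tensor {d : ℕ} (K : LocalMeans s) (m : Fin d → ℕ) :
    HasCompactSupport (K.tensor m) := by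
  have hc : IsCompact ((EuclideanSpace.equiv (Fin d) ℝ).symm ''
      (Set.univ.pi fun i => tsupport (K.level (m i)))) :=
    (isCompact_univ_pi fun i => K.hasCompactSupport_level (m i)).image
      (EuclideanSpace.equiv (Fin d) ℝ).symm.continuous
  refine HasCompactSupport.intro hc fun x hx => ?_
  by_contra hne
  refine hx ⟨EuclideanSpace.equiv (Fin d) ℝ x, fun i _ => ?_, by simp⟩
  exact subset_tsupport _ (Finset.prod_ne_zero_iff.1 hne i (Finset.mem_univ i))

/-- The test function `z ↦ Ψ_m(x - z)`. -/
def testFunction {d : ℕ} (K : LocalMeans s) (m : Fin d → ℕ) (x : EuclideanSpace ℝ (Fin d)) :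
    𝓢(EuclideanSpace ℝ (Fin d), ℂ) :=
  HasCompactSupport.toSchwartzMap (f := fun z => K.tensor m (x - z))
    ((K.hasCompactSupport_tensor m).comp_homeomorph (Homeomorph.subLeft x))
    ((K.contDiff_tensor m).comp (contDiff_const.sub contDiff_id))

/-- The convolution `(Ψ_m ∗ u)(x) = u(Ψ_m(x - ·))`. -/
def conv {d : ℕ} (K : LocalMeans s) (m : Fin d → ℕ) (u : 𝓢'(EuclideanSpace ℝ (Fin d), ℂ))
    (x : EuclideanSpace ℝ (Fin d)) : ℂ :=
  u (K.testFunction m x)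

end LocalMeans

/-! ### Besov and Triebel-Lizorkin spaces of dominating mixed smoothness -/

/-- The `ℓ_θ` (quasi-)norm of a family of nonnegative extended numbers, `0 < θ ≤ ∞`. -/
def ellNorm {ι : Type*} (θ : ℝ≥0∞) (a : ι → ℝ≥0∞) : ℝ≥0∞ :=
  if θ = ⊤ then ⨆ i, a i else (∑' i, a i ^ θ.toReal) ^ (1 / θ.toReal)

/-- The weight `2^{s |m|_1}`. -/
def mixedWeight {d : ℕ} (s : ℝ) (m : Fin d → ℕ) : ℝ≥0∞ :=
  ENNReal.ofReal ((2 : ℝ) ^ (s * ((∑ i, m i : ℕ) : ℝ)))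

/-- The (quasi-)norm of the Besov space `B^s_{p,θ}(ℝ^d)` of dominating mixed smoothness. -/
def besovNorm {d : ℕ} {s : ℝ} (K : LocalMeans s) (p θ : ℝ≥0∞)
    (u : 𝓢'(EuclideanSpace ℝ (Fin d), ℂ)) : ℝ≥0∞ :=
  ellNorm θ fun m : Fin d → ℕ => mixedWeight s m * eLpNorm (K.conv m u) p volume

/-- The (quasi-)norm of the Triebel-Lizorkin space `F^s_{p,θ}(ℝ^d)` of dominating mixed
smoothness (for `p < ∞`). -/
def triebelLizorkinNorm {d : ℕ} {s : ℝ} (K : LocalMeans s) (p θ : ℝ≥0∞)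
    (u : 𝓢'(EuclideanSpace ℝ (Fin d), ℂ)) : ℝ≥0∞ :=
  eLpNorm (fun x => ellNorm θ fun m : Fin d → ℕ => mixedWeight s m * ‖K.conv m u x‖ₑ) p volume

/-- The unit cube `[0,1]^d`. -/
def unitCube (d : ℕ) : Set (EuclideanSpace ℝ (Fin d)) :=
  {x | ∀ i, 0 ≤ x i ∧ x i ≤ 1}

/-- For a (quasi-)norm `N` with values in `[0,∞]` on the tempered distributions: the class of
all `u` with `N u < ∞` and support in the unit cube. -/
def cubeClass {d : ℕ} (N : 𝓢'(EuclideanSpace ℝ (Fin d), ℂ) → ℝ≥0∞) :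
    Set (𝓢'(EuclideanSpace ℝ (Fin d), ℂ)) :=
  {u | N u < ⊤ ∧ Distribution.dsupport u ⊆ unitCube d}

/-- The tempered distribution `u` is the bounded continuous function `f`. -/
def IsRepresentedBy {d : ℕ} (u : 𝓢'(EuclideanSpace ℝ (Fin d), ℂ))
    (f : EuclideanSpace ℝ (Fin d) →ᵇ ℂ) : Prop :=
  ∀ φ : 𝓢(EuclideanSpace ℝ (Fin d), ℂ), u φ = ∫ x, φ x * f x

/-- The worst-case error of Frolov's cubature rule `Q_n` on the unit ball of `cubeClass N`.
The elements of the class are evaluated through their (unique) continuous representatives. -/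
def worstCaseError {d : ℕ} (n : ℕ) (N : 𝓢'(EuclideanSpace ℝ (Fin d), ℂ) → ℝ≥0∞) : ℝ≥0∞ :=
  ⨆ (u : 𝓢'(EuclideanSpace ℝ (Fin d), ℂ)) (_ : u ∈ cubeClass N) (_ : N u ≤ 1)
    (f : EuclideanSpace ℝ (Fin d) →ᵇ ℂ) (_ : IsRepresentedBy u f),
    ‖(∫ x in unitCube d, f x) - frolovCubature d n f‖ₑ

/-- Every element of `cubeClass N` is a continuous function, and the worst-case error of `Q_n`
on its unit ball is, up to positive constants independent of `n`, equal to `n^{-r}`. -/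
def FrolovErrorOrder {d : ℕ} (N : 𝓢'(EuclideanSpace ℝ (Fin d), ℂ) → ℝ≥0∞) (r : ℝ) : Prop :=
  (∀ u ∈ cubeClass N, ∃ f : EuclideanSpace ℝ (Fin d) →ᵇ ℂ, IsRepresentedBy u f) ∧
  ∃ c C : ℝ, 0 < c ∧ 0 < C ∧ ∀ n : ℕ, 1 ≤ n →
    ENNReal.ofReal (c * (n : ℝ) ^ (-r)) ≤ worstCaseError n N ∧
      worstCaseError n N ≤ ENNReal.ofReal (C * (n : ℝ) ^ (-r))

end

/-! ### The local means on the Fourier side -/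

/-! Put q = max{p, 1}. All upper estimates pass through one endpoint norm, Σ_m 2^{|m|₁/q} ‖Ψ_m ∗
u‖_q (`LocalMeans.endpointNorm`), which is that of B^{1/q}_{q,1}.

Embeddings. For p ≥ 1 and θ ≤ 1 the Besov norm dominates the endpoint norm because ℓ_θ ⊂ ℓ_1. For p
< 1 both scales embed into B^1_{1,1}, and this is proved without maximal functions. The function
g(x, m) = |Ψ_m ∗ u (x)| is bounded, in every coordinate direction, by its integrals over finer
levels with rapidly decaying coefficients (`LocalMeans.exists_scaleFunction_le`); this is a
Nikol'skij inequality for kernels that are not band-limited. Writing g = g^{1-p} g^p and using this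
bound for the first factor, the L₁ quantity reappears on the right with the power 1 - p. It is
absorbed in the Besov case (`IsDirectionallyDominated.exists_lintegral_le_tsum`) and divided out in
the Triebel-Lizorkin case (`IsDirectionallyDominated.exists_lmarginal_rpow_le`). Both operations
need a priori finiteness, which is obtained from truncated weights with constants that do not depend
on the truncation.

Upper bound. Kernels Λ_m with compactly supported symbols, dual to the Ψ_m, give u = Σ_m Λ_m ∗ Ψ_m ∗
u (`DualMeans.integral_mul_tsum_piece`). The cubature error of one block is the integral of Ψ_m ∗ u
against E_m(y) = ∫ Λ_m - n⁻¹ Σ_x Λ_m(x - y), x running over the lattice. By Poisson summation E_m is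
a sum over the nonzero dual lattice points in a box of volume about 2^{|m|₁}. Since Frolov's
polynomial is irreducible, the coordinates of such a point have a product of size at least c n, so
that the box contains at most C 2^{|m|₁}/n of them, with no additive constant. Hence E_m is at most
C 2^{|m|₁}/n in the sup norm, and it is bounded in L₁ of a fixed cube. Hölder's inequality gives the
error n^{-1/q} 2^{|m|₁/q} ‖Ψ_m ∗ u‖_q per block (`DualMeans.exists_integral_errorWeight_le`), and
these sum to the endpoint norm.

Lower bound. The cube contains only O(n) lattice points, so a tensor product whose first factor
vanishes at their first coordinates is integrated to zero by the rule. For p < 1 the first factor is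
one bump of width about 1/n; its norm stays bounded because the smoothness 1/p is invariant under
dilation. For p ≥ 1 it is a fixed bump whose values at the O(n) coordinates are cut out by extremely
narrow bumps. These cost O(n^{1/p}) in norm and little in the integral, and the function is divided
by n^{1/p}. The Triebel-Lizorkin case follows by testing on a smaller Besov space. -/

theorem SchwartzMap.exists_one_add_norm_pow_mul_le {E F : Type*} [NormedAddCommGroup E]
    [NormedSpace ℝ E] [NormedAddCommGroup F] [NormedSpace ℝ F] (f : 𝓢(E, F)) (N : ℕ) :
    ∃ C : ℝ, 0 < C ∧ ∀ x, (1 + ‖x‖) ^ N * ‖f x‖ ≤ C := by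
  refine ⟨2 ^ N * ((Finset.Iic (N, 0)).sup fun m => SchwartzMap.seminorm ℝ m.1 m.2) f + 1,
    by positivity, fun x => ?_⟩
  have h := SchwartzMap.one_add_le_sup_seminorm_apply (𝕜 := ℝ) (m := (N, 0)) (k := N) (n := 0)
    le_rfl le_rfl f x
  rw [norm_iteratedFDeriv_zero] at h
  linarith

theorem Real.fourier_comp_mul_left_ofPos (f : ℝ → ℂ) {a : ℝ} (ha : 0 < a) (ξ : ℝ) :
    𝓕 (fun x => (a : ℂ) * f (a * x)) ξ = 𝓕 f (ξ / a) := by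
  rw [Real.fourier_real_eq, Real.fourier_real_eq]
  have := Measure.integral_comp_mul_left
    (fun v => Real.fourierChar (-(v * (ξ / a))) • f v) a
  rw [show (fun v => Real.fourierChar (-(v * ξ)) • ((a : ℂ) * f (a * v))) =
    fun v => (a : ℂ) * (Real.fourierChar (-(a * v * (ξ / a))) • f (a * v)) from ?_]
  · rw [integral_const_mul, this, abs_of_pos (inv_pos.2 ha)]
    rw [Complex.real_smul, ← mul_assoc]
    push_cast
    rw [mul_inv_cancel₀ (by exact_mod_cast ha.ne'), one_mul]
  · funext v
    rw [show a * v * (ξ / a) = v * ξ by field_simp]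
    simp only [Circle.smul_def, smul_eq_mul]
    ring

namespace LocalMeans

variable {s : ℝ}

theorem fourier_level_succ (K : LocalMeans s) (j : ℕ) (ξ : ℝ) :
    𝓕 (K.level (j + 1)) ξ = 𝓕 K.Ψ₁ (ξ / 2 ^ j) := by
  rw [← Real.fourier_comp_mul_left_ofPos K.Ψ₁ (by positivity : (0 : ℝ) < 2 ^ j) ξ]
  refine congrFun (congrArg 𝓕 (funext fun x => ?_)) ξ
  simp [level]

theorem continuous_fourier_Ψ₀ (K : LocalMeans s) : Continuous (𝓕 K.Ψ₀) :=
  (𝓕 (K.compact₀.toSchwartzMap K.smooth₀)).continuous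

theorem continuous_fourier_Ψ₁ (K : LocalMeans s) : Continuous (𝓕 K.Ψ₁) :=
  (𝓕 (K.compact₁.toSchwartzMap K.smooth₁)).continuous

theorem continuous_fourier_level (K : LocalMeans s) (j : ℕ) : Continuous (𝓕 (K.level j)) :=
  (𝓕 ((K.hasCompactSupport_level j).toSchwartzMap (K.contDiff_level j))).continuous

/-- The Fourier transforms of the kernels decay rapidly, uniformly after rescaling. -/
theorem exists_fourier_level_decay (K : LocalMeans s) (N : ℕ) :
    ∃ C : ℝ, 0 < C ∧ ∀ j ξ, (1 + |ξ| / 2 ^ j) ^ N * ‖𝓕 (K.level j) ξ‖ ≤ C := by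
  obtain ⟨C₀, h0, hC₀⟩ := SchwartzMap.exists_one_add_norm_pow_mul_le
    (𝓕 (K.compact₀.toSchwartzMap K.smooth₀)) N
  obtain ⟨C₁, h1, hC₁⟩ := SchwartzMap.exists_one_add_norm_pow_mul_le
    (𝓕 (K.compact₁.toSchwartzMap K.smooth₁)) N
  refine ⟨max C₀ C₁, lt_max_of_lt_left h0, fun j ξ => ?_⟩
  cases j with
  | zero =>
    refine le_trans ?_ (le_max_left _ _)
    simpa using! hC₀ ξ
  | succ j =>
    refine le_trans ?_ (le_max_right _ _)
    refine le_trans ?_ (hC₁ (ξ / 2 ^ j))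
    rw [fourier_level_succ, Real.norm_eq_abs, abs_div, abs_of_pos (by positivity : (0:ℝ) < 2 ^ j)]
    refine mul_le_mul_of_nonneg_right ?_ (norm_nonneg _)
    gcongr
    · norm_num
    · omega

end LocalMeans

/-- The dyadic decomposition of the line with ratio two: `|ξ| < a`, and `2^k a ≤ |ξ| < 2^{k+1} a`. -/
def dyadicRing (a : ℝ) : ℕ → Set ℝ
  | 0 => {ξ | |ξ| < a}
  | k + 1 => {ξ | 2 ^ k * a ≤ |ξ| ∧ |ξ| < 2 ^ (k + 1) * a}

theorem measurableSet_dyadicRing (a : ℝ) (k : ℕ) : MeasurableSet (dyadicRing a k) := by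
  cases k with
  | zero => exact measurableSet_lt measurable_abs measurable_const
  | succ k =>
    exact (measurableSet_le measurable_const measurable_abs).inter
      (measurableSet_lt measurable_abs measurable_const)

theorem abs_lt_of_mem_dyadicRing {a : ℝ} {k : ℕ} {ξ : ℝ} (h : ξ ∈ dyadicRing a k) :
    |ξ| < 2 ^ k * a := by
  cases k with
  | zero => simpa [dyadicRing] using h
  | succ k => exact h.2

theorem exists_mem_dyadicRing {a : ℝ} (ha : 0 < a) (m : ℕ) (ξ : ℝ) :
    |ξ| < 2 ^ m * a ∨ ∃ l, ξ ∈ dyadicRing a (m + l + 1) := by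
  by_cases h : |ξ| < 2 ^ m * a
  · exact Or.inl h
  · right
    push Not at h
    have hex : ∃ k, |ξ| < 2 ^ k * a := by
      obtain ⟨k, hk⟩ := pow_unbounded_of_one_lt (|ξ| / a) one_lt_two
      exact ⟨k, by rwa [div_lt_iff₀ ha] at hk⟩
    classical
    have hs := Nat.find_spec hex
    have hmin := fun {k} => Nat.find_min hex (m := k)
    set k := Nat.find hex
    have hk : m < k := by
      by_contra hk
      have : (2 : ℝ) ^ k ≤ 2 ^ m := pow_le_pow_right₀ one_le_two (not_lt.1 hk)
      nlinarith
    obtain ⟨l, hl⟩ := Nat.exists_eq_add_of_lt hk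
    refine ⟨l, ?_, ?_⟩
    · have := hmin (k := m + l) (by omega)
      exact not_lt.1 this
    · rw [← hl]; exact hs

namespace LocalMeans

variable {s : ℝ}

/-- The Tauberian conditions are strict inequalities on open sets. On the smaller compact sets |ξ| ≤
a and a ≤ |ξ| ≤ 2a they become uniform lower bounds, and the dyadic dilates of the second set fill
the rest of the line. -/
theorem exists_le_fourier_level (K : LocalMeans s) :
    ∃ a c : ℝ, 0 < a ∧ 0 < c ∧ ∀ k, ∀ ξ ∈ dyadicRing a k, c ≤ ‖𝓕 (K.level k) ξ‖ := by
  obtain ⟨ε, hε, h0, h1⟩ := K.tauberian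
  -- Any value strictly between ε/2 and ε would do: it is below ε, and the ring from a to 2a lies
  -- inside the ring from ε/2 to 2ε.
  set a := 3 / 4 * ε
  have hK0 : IsCompact {ξ : ℝ | |ξ| ≤ a} := by
    convert isCompact_closedBall (0 : ℝ) a using 1
    ext; simp
  have hK1 : IsCompact {ξ : ℝ | a ≤ |ξ| ∧ |ξ| ≤ 2 * a} := by
    refine (isCompact_closedBall (0 : ℝ) (2 * a)).of_isClosed_subset ?_ ?_
    · exact (isClosed_le continuous_const continuous_abs).inter
        (isClosed_le continuous_abs continuous_const)
    · intro ξ hξ; simpa using hξ.2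
  have key : ∀ (f : ℝ → ℂ) (A : Set ℝ), Continuous f → IsCompact A → (∀ ξ ∈ A, 0 < ‖f ξ‖) →
      ∃ c : ℝ, 0 < c ∧ ∀ ξ ∈ A, c ≤ ‖f ξ‖ := by
    intro f A hf hA hpos
    rcases A.eq_empty_or_nonempty with rfl | hne
    · exact ⟨1, one_pos, by simp⟩
    · obtain ⟨x, hx, hmin⟩ := hA.exists_isMinOn hne hf.norm.continuousOn
      exact ⟨‖f x‖, hpos x hx, fun ξ hξ => hmin hξ⟩
  obtain ⟨c₀, hc₀, H0⟩ := key _ _ K.continuous_fourier_Ψ₀ hK0 (fun ξ hξ => h0 ξ (by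
    have : |ξ| ≤ a := hξ
    simp only [a] at this; linarith))
  obtain ⟨c₁, hc₁, H1⟩ := key _ _ K.continuous_fourier_Ψ₁ hK1 (fun ξ hξ => by
    obtain ⟨h2, h3⟩ := hξ
    simp only [a] at h2 h3
    exact h1 ξ (by linarith) (by linarith))
  refine ⟨a, min c₀ c₁, by positivity, lt_min hc₀ hc₁, fun k ξ hξ => ?_⟩
  cases k with
  | zero =>
    exact (min_le_left _ _).trans (H0 ξ (le_of_lt (show |ξ| < a from hξ)))
  | succ k =>
    refine (min_le_right _ _).trans ?_
    rw [fourier_level_succ]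
    have h2 : (0 : ℝ) < 2 ^ k := by positivity
    refine H1 _ ⟨?_, ?_⟩
    · rw [abs_div, abs_of_pos h2, le_div_iff₀ h2]
      linarith [hξ.1]
    · rw [abs_div, abs_of_pos h2, div_le_iff₀ h2]
      have := hξ.2
      rw [pow_succ] at this
      linarith

/-- A Nikol'skij type estimate: a weight `V` on the frequency side is controlled in `L₁` after
multiplication with one kernel by the sup norms after multiplication with the finer kernels. -/
theorem exists_lintegral_fourier_level_le (K : LocalMeans s) (N : ℕ) :
    ∃ C : ℝ≥0∞, C ≠ ⊤ ∧ ∀ (V : ℝ → ℂ) (I : ℕ → ℝ≥0∞),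
      (∀ k, ∀ᵐ ξ, ‖𝓕 (K.level k) ξ * V ξ‖ₑ ≤ I k) →
      ∀ m, ∫⁻ ξ, ‖𝓕 (K.level m) ξ * V ξ‖ₑ ≤
        C * ∑' l, (2⁻¹ : ℝ≥0∞) ^ (N * l) * (2 ^ (m + l) * I (m + l)) := by
  obtain ⟨a, c, ha, hc, hac⟩ := K.exists_le_fourier_level
  obtain ⟨C, hC, hdec⟩ := K.exists_fourier_level_decay N
  -- The 1 serves the central piece, where the bound at level m itself is used unchanged.
  set C₁ : ℝ := max 1 (C * (2 / a) ^ N * c⁻¹)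
  have hC₁ : 1 ≤ C₁ := le_max_left _ _
  refine ⟨ENNReal.ofReal C₁ * ENNReal.ofReal (2 * a), by finiteness, fun V I hI m => ?_⟩
  -- All frequencies below 2^m a form one piece, on which nothing has to be gained. On the ring of
  -- level m + l the kernel of level m has decayed to 2^{-Nl}, while the kernel of level m + l is
  -- bounded below and may be inserted.
  set D : ℕ → Set ℝ := fun l => match l with
    | 0 => {ξ | |ξ| < 2 ^ m * a}
    | l + 1 => dyadicRing a (m + l + 1)
  have hD : ∀ l, ∀ ξ ∈ D l, |ξ| < 2 ^ (m + l) * a := by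
    intro l ξ hξ
    cases l with
    | zero => simpa [D] using hξ
    | succ l => exact abs_lt_of_mem_dyadicRing hξ
  have hcov : (⋃ l, D l) = Set.univ := by
    refine Set.eq_univ_of_forall fun ξ => Set.mem_iUnion.2 ?_
    rcases exists_mem_dyadicRing ha m ξ with h | ⟨l, hl⟩
    · exact ⟨0, h⟩
    · exact ⟨l + 1, hl⟩
  have hmeas : ∀ l, MeasurableSet (D l) := by
    intro l
    cases l with
    | zero => exact measurableSet_lt measurable_abs measurable_const
    | succ l => exact measurableSet_dyadicRing a _
  have hvol : ∀ l, volume (D l) ≤ ENNReal.ofReal (2 * a) * 2 ^ (m + l) := by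
    intro l
    refine (measure_mono (t := Metric.ball 0 (2 ^ (m + l) * a)) fun ξ hξ => ?_).trans ?_
    · simpa using hD l ξ hξ
    · rw [Real.volume_ball, show 2 * (2 ^ (m + l) * a) = (2 * a) * 2 ^ (m + l) by ring,
        ENNReal.ofReal_mul (by positivity), ENNReal.ofReal_pow (by norm_num)]
      simp
  have hbd : ∀ l, ∀ᵐ ξ, ξ ∈ D l → ‖𝓕 (K.level m) ξ * V ξ‖ₑ ≤
      ENNReal.ofReal C₁ * (2⁻¹) ^ (N * l) * I (m + l) := by
    intro l
    filter_upwards [hI (m + l)] with ξ hξ hmem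
    refine le_trans ?_ (mul_le_mul_right hξ _)
    have h2 : (2⁻¹ : ℝ≥0∞) = ENNReal.ofReal (2⁻¹) := by
      rw [ENNReal.ofReal_inv_of_pos (by norm_num)]; simp
    rw [h2, ← ENNReal.ofReal_pow (by norm_num), ← ENNReal.ofReal_mul (by positivity),
      ← ofReal_norm, ← ofReal_norm, ← ENNReal.ofReal_mul (by positivity)]
    refine ENNReal.ofReal_le_ofReal ?_
    rw [norm_mul, norm_mul]
    cases l with
    | zero =>
      simp only [mul_zero, pow_zero, mul_one, add_zero]
      exact le_mul_of_one_le_left (by positivity) hC₁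
    | succ l =>
      have h3 := hac _ ξ hmem
      have h4 := hdec m ξ
      have h5 : 2 ^ (m + l) * a ≤ |ξ| := hmem.1
      have h6 : (2 ^ l * a) ^ N * ‖𝓕 (K.level m) ξ‖ ≤ C := by
        refine le_trans ?_ h4
        gcongr
        rw [pow_add] at h5
        have : 2 ^ l * a ≤ |ξ| / 2 ^ m := by
          rw [le_div_iff₀ (by positivity)]
          linarith
        linarith
      have h7 : ‖𝓕 (K.level m) ξ‖ ≤ C * (2 / a) ^ N * 2⁻¹ ^ (N * (l + 1)) := by
        have h8 : (0 : ℝ) < (2 ^ l * a) ^ N := by positivity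
        rw [← le_div_iff₀' h8] at h6
        refine h6.trans (le_of_eq ?_)
        rw [mul_comm N, pow_mul, mul_assoc, ← mul_pow, div_eq_mul_inv, ← inv_pow]
        congr 2
        rw [pow_succ, inv_pow]
        field_simp
      calc ‖𝓕 (K.level m) ξ‖ * ‖V ξ‖
          ≤ (C * (2 / a) ^ N * 2⁻¹ ^ (N * (l + 1))) * (c⁻¹ * ‖𝓕 (K.level (m + (l + 1))) ξ‖ * ‖V ξ‖) := by
            refine mul_le_mul h7 ?_ (norm_nonneg _) (by positivity)
            refine le_mul_of_one_le_left (norm_nonneg _) ?_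
            rw [← div_eq_inv_mul, one_le_div hc]
            exact h3
        _ = (C * (2 / a) ^ N * c⁻¹) * 2⁻¹ ^ (N * (l + 1)) *
            (‖𝓕 (K.level (m + (l + 1))) ξ‖ * ‖V ξ‖) := by ring
        _ ≤ _ := by gcongr; exact le_max_right _ _
  calc ∫⁻ ξ, ‖𝓕 (K.level m) ξ * V ξ‖ₑ
      = ∫⁻ ξ in ⋃ l, D l, ‖𝓕 (K.level m) ξ * V ξ‖ₑ := by rw [hcov, Measure.restrict_univ]
    _ ≤ ∑' l, ∫⁻ ξ in D l, ‖𝓕 (K.level m) ξ * V ξ‖ₑ := lintegral_iUnion_le _ _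
    _ ≤ ∑' l, (ENNReal.ofReal C₁ * (2⁻¹) ^ (N * l) * I (m + l)) *
          (ENNReal.ofReal (2 * a) * 2 ^ (m + l)) := by
        refine ENNReal.tsum_le_tsum fun l => ?_
        refine (lintegral_mono_ae ((ae_restrict_iff' (hmeas l)).2 (hbd l))).trans ?_
        rw [setLIntegral_const]
        gcongr
        exact hvol l
    _ = _ := by
        rw [← ENNReal.tsum_mul_left]
        refine tsum_congr fun l => ?_
        ring

end LocalMeans

/-! ### Tempered distributions with compact support -/

section CompactSupportDistribution

variable {E : Type*} [NormedAddCommGroup E] [InnerProductSpace ℝ E] [FiniteDimensional ℝ E]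

open scoped Manifold in
-- The complement of the support is covered by open sets on which u vanishes. A smooth partition of
-- unity subordinate to this cover cuts φ into pieces annihilated by u, and compactness leaves only
-- finitely many of them.
theorem TemperedDistribution.eq_zero_of_hasCompactSupport (u : 𝓢'(E, ℂ)) (φ : 𝓢(E, ℂ))
    (hφ : HasCompactSupport φ) (h : Disjoint (tsupport φ) (Distribution.dsupport u)) :
    u φ = 0 := by
  set ι := {s : Set E // Distribution.IsVanishingOn u s ∧ IsOpen s}
  have hcov : tsupport φ ⊆ ⋃ i : ι, i.1 := by
    intro x hx
    have hx' : x ∉ Distribution.dsupport u := Set.disjoint_left.1 h hx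
    rw [Distribution.notMem_dsupport_iff] at hx'
    obtain ⟨s, h1, h2, h3⟩ := hx'
    exact Set.mem_iUnion.2 ⟨⟨s, h1, h2⟩, h3⟩
  obtain ⟨f, hf⟩ := SmoothPartitionOfUnity.exists_isSubordinate 𝓘(ℝ, E)
    (isClosed_tsupport φ) (fun i : ι => i.1) (fun i => i.2.2) hcov
  have hfin : {i | (Function.support (f i) ∩ tsupport φ).Nonempty}.Finite :=
    f.locallyFinite.finite_nonempty_inter_compact hφ
  have hsmooth : ∀ i, ContDiff ℝ ∞ (fun x => ((f i x : ℝ) : ℂ) * φ x) := fun i =>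
    (Complex.ofRealCLM.contDiff.comp (f i).contMDiff.contDiff).mul (φ.smooth ⊤)
  have hcs : ∀ i, HasCompactSupport (fun x => ((f i x : ℝ) : ℂ) * φ x) := fun i =>
    hφ.mul_left
  have hsum : φ = ∑ i ∈ hfin.toFinset, (hcs i).toSchwartzMap (hsmooth i) := by
    ext x
    rw [_root_.sum_apply]
    change φ x = ∑ i ∈ hfin.toFinset, ((f i x : ℝ) : ℂ) * φ x
    by_cases hx : x ∈ tsupport φ
    · rw [← Finset.sum_mul, ← Complex.ofReal_sum]
      have : ∑ i ∈ hfin.toFinset, f i x = 1 := by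
        rw [← f.sum_eq_one hx, finsum_eq_sum_of_support_subset]
        intro i hi
        simp only [Set.Finite.coe_toFinset, Set.mem_ofPred_eq]
        exact ⟨x, hi, hx⟩
      rw [this]; simp
    · rw [image_eq_zero_of_notMem_tsupport hx]; simp
  rw [hsum, map_sum]
  refine Finset.sum_eq_zero fun i _ => i.2.1 _ ?_
  refine (closure_mono ?_).trans (hf i)
  intro x hx hx'
  exact hx (by
    change ((f i x : ℝ) : ℂ) * φ x = 0
    have : f i x = 0 := hx'
    simp [this])

/-- Every Schwartz function is the limit of compactly supported ones with smaller support. -/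
theorem SchwartzMap.exists_tendsto_hasCompactSupport (φ : 𝓢(E, ℂ)) :
    ∃ ψ : ℕ → 𝓢(E, ℂ), (∀ n, HasCompactSupport (ψ n)) ∧ (∀ n, tsupport (ψ n) ⊆ tsupport φ) ∧
      Filter.Tendsto ψ Filter.atTop (nhds φ) := by
  let b : ContDiffBump (0 : E) := ⟨1, 2, one_pos, one_lt_two⟩
  have hb : ContDiff ℝ ∞ (fun x : E => ((b x : ℝ) : ℂ)) :=
    Complex.ofRealCLM.contDiff.comp b.contDiff
  have hbc : HasCompactSupport (fun x : E => ((b x : ℝ) : ℂ)) :=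
    b.hasCompactSupport.comp_left (g := ((↑) : ℝ → ℂ)) rfl
  let B : 𝓢(E, ℂ) := hbc.toSchwartzMap hb
  let L : ℕ → E →L[ℝ] E := fun n => ((n + 1 : ℝ)⁻¹) • ContinuousLinearMap.id ℝ E
  have hL : ∀ n, ‖L n‖ ≤ 1 := by
    intro n
    refine (L n).opNorm_le_bound zero_le_one fun x => ?_
    change ‖((n : ℝ) + 1)⁻¹ • x‖ ≤ 1 * ‖x‖
    rw [norm_smul, Real.norm_of_nonneg (by positivity)]
    gcongr
    exact inv_le_one_of_one_le₀ (by linarith [n.cast_nonneg (α := ℝ)])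
  let χ : ℕ → E → ℂ := fun n x => B (L n x)
  have hχ : ∀ n, ContDiff ℝ ∞ (χ n) := fun n => (B.smooth ⊤).comp (L n).contDiff
  have hχc : ∀ n, HasCompactSupport (χ n) := by
    intro n
    have h0 : ((n : ℝ) + 1)⁻¹ ≠ 0 := by positivity
    exact hbc.comp_homeomorph (Homeomorph.smulOfNeZero _ h0)
  have hχD : ∀ n i x, ‖iteratedFDeriv ℝ i (χ n) x‖ ≤ SchwartzMap.seminorm ℝ 0 i B := by
    intro n i x
    have h1 : iteratedFDeriv ℝ i (χ n) x =
        (iteratedFDeriv ℝ i B (L n x)).compContinuousLinearMap fun _ => L n :=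
      (L n).iteratedFDeriv_comp_right (B.smooth ⊤) x (by exact_mod_cast le_top)
    rw [h1]
    refine (ContinuousMultilinearMap.norm_compContinuousLinearMap_le _ _).trans ?_
    rw [Finset.prod_const]
    refine (mul_le_of_le_one_right (norm_nonneg _) (pow_le_one₀ (norm_nonneg _) (hL n))).trans ?_
    exact SchwartzMap.norm_iteratedFDeriv_le_seminorm ℝ B i (L n x)
  let ψ : ℕ → 𝓢(E, ℂ) := fun n =>
    ((hχc n).mul_right (f' := φ)).toSchwartzMap ((hχ n).mul (φ.smooth ⊤))
  have hψ : ∀ n x, ψ n x = χ n x * φ x := fun n x => rfl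
  refine ⟨ψ, fun n => (hχc n).mul_right, fun n => closure_mono ?_, ?_⟩
  · intro x hx hx'
    exact hx (by rw [hψ, hx', mul_zero])
  rw [(schwartz_withSeminorms ℝ E ℂ).tendsto_nhds]
  rintro ⟨k, i⟩ ε hε
  set C : ℝ := (∑ j ∈ Finset.range (i + 1), (i.choose j : ℝ) * SchwartzMap.seminorm ℝ 0 j B *
    SchwartzMap.seminorm ℝ (k + 1) (i - j) φ) + SchwartzMap.seminorm ℝ (k + 1) i φ
  have hC : 0 ≤ C := by positivity
  -- Inside the ball of radius n + 1 the cut-off is one and the difference vanishes. Outside, one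
  -- additional power of ‖x‖ in the seminorms of φ pays for the factor 1 / (n + 1).
  have hbound : ∀ n : ℕ, SchwartzMap.seminorm ℝ k i (ψ n - φ) ≤ C / (n + 1) := by
    intro n
    refine SchwartzMap.seminorm_le_bound ℝ k i _ (by positivity) fun x => ?_
    have hn : (0 : ℝ) < n + 1 := by positivity
    rcases lt_or_ge ‖x‖ (n + 1) with hx | hx
    · have hz : (⇑(ψ n - φ)) =ᶠ[nhds x] fun _ => 0 := by
        filter_upwards [Metric.ball_mem_nhds x (sub_pos.2 hx)] with y hy
        have hy' : ‖y‖ < n + 1 := by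
          have := norm_le_norm_add_norm_sub' y x
          rw [Metric.mem_ball, dist_eq_norm] at hy
          linarith
        have : χ n y = 1 := by
          change ((b (L n y) : ℝ) : ℂ) = 1
          rw [b.one_of_mem_closedBall]
          · simp
          · rw [mem_closedBall_zero_iff]
            change ‖((n : ℝ) + 1)⁻¹ • y‖ ≤ 1
            rw [norm_smul, Real.norm_of_nonneg (by positivity), inv_mul_le_iff₀ hn]
            linarith
        rw [_root_.sub_apply, hψ, this]; simp
      rw [(Filter.EventuallyEq.iteratedFDeriv (𝕜 := ℝ) hz i).eq_of_nhds]
      simp only [iteratedFDeriv_fun_zero, Pi.zero_apply, norm_zero, mul_zero]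
      positivity
    · have h1 : iteratedFDeriv ℝ i (⇑(ψ n - φ)) x =
          iteratedFDeriv ℝ i (fun y => χ n y * φ y) x - iteratedFDeriv ℝ i φ x := by
        have : (⇑(ψ n - φ)) = (fun y => χ n y * φ y) - ⇑φ := by
          ext y; rfl
        rw [this]
        exact iteratedFDeriv_sub_apply (((hχ n).mul (φ.smooth ⊤)).contDiffAt.of_le
          (by exact_mod_cast le_top)) ((φ.smooth i).contDiffAt)
      have h2 := norm_iteratedFDeriv_mul_le (𝕜 := ℝ) (hχ n) (φ.smooth ⊤) x (n := i)
        (by exact_mod_cast le_top)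
      have h3 : ∀ j, ‖x‖ ^ (k + 1) * ‖iteratedFDeriv ℝ j φ x‖ ≤
          SchwartzMap.seminorm ℝ (k + 1) j φ := fun j => SchwartzMap.le_seminorm ℝ _ _ φ x
      rw [le_div_iff₀ hn]
      calc ‖x‖ ^ k * ‖iteratedFDeriv ℝ i (⇑(ψ n - φ)) x‖ * (n + 1)
          ≤ ‖x‖ ^ k * ‖iteratedFDeriv ℝ i (⇑(ψ n - φ)) x‖ * ‖x‖ := by gcongr
        _ = ‖x‖ ^ (k + 1) * ‖iteratedFDeriv ℝ i (⇑(ψ n - φ)) x‖ := by ring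
        _ ≤ ‖x‖ ^ (k + 1) * ((∑ j ∈ Finset.range (i + 1), (i.choose j : ℝ) *
              ‖iteratedFDeriv ℝ j (χ n) x‖ * ‖iteratedFDeriv ℝ (i - j) φ x‖) +
              ‖iteratedFDeriv ℝ i φ x‖) := by
            rw [h1]
            gcongr
            exact (norm_sub_le _ _).trans (by gcongr)
        _ = (∑ j ∈ Finset.range (i + 1), (i.choose j : ℝ) *
              ‖iteratedFDeriv ℝ j (χ n) x‖ * (‖x‖ ^ (k + 1) * ‖iteratedFDeriv ℝ (i - j) φ x‖)) +
              ‖x‖ ^ (k + 1) * ‖iteratedFDeriv ℝ i φ x‖ := by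
            rw [mul_add, Finset.mul_sum]
            congr 1
            refine Finset.sum_congr rfl fun j _ => by ring
        _ ≤ C := by
            refine add_le_add (Finset.sum_le_sum fun j _ => ?_) (h3 i)
            exact mul_le_mul (mul_le_mul_of_nonneg_left (hχD n j x) (by positivity)) (h3 _)
              (by positivity) (by positivity)
  have hlim : Filter.Tendsto (fun n : ℕ => C / ((n : ℝ) + 1)) Filter.atTop (nhds 0) := by
    simpa [div_eq_mul_inv] using tendsto_one_div_add_atTop_nhds_zero_nat.const_mul C
  filter_upwards [hlim.eventually (gt_mem_nhds hε)] with n hn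
  exact (hbound n).trans_lt hn

theorem TemperedDistribution.eq_zero_of_disjoint_tsupport (u : 𝓢'(E, ℂ)) (φ : 𝓢(E, ℂ))
    (h : Disjoint (tsupport φ) (Distribution.dsupport u)) : u φ = 0 := by
  obtain ⟨ψ, h1, h2, h3⟩ := φ.exists_tendsto_hasCompactSupport
  have h4 : Filter.Tendsto (fun n => u (ψ n)) Filter.atTop (nhds (u φ)) :=
    ((map_continuous u).tendsto φ).comp h3
  refine tendsto_nhds_unique h4 ?_
  have : (fun n => u (ψ n)) = fun _ => 0 := by
    ext n
    exact u.eq_zero_of_hasCompactSupport _ (h1 n) (h.mono_left (h2 n))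
  rw [this]
  exact tendsto_const_nhds

/-- A tempered distribution with bounded support is continuous in finitely many `C^k` norms. -/
theorem TemperedDistribution.exists_norm_le_of_dsupport_subset (u : 𝓢'(E, ℂ)) {R : ℝ}
    (hR : 0 < R) (hu : Distribution.dsupport u ⊆ Metric.closedBall 0 R) :
    ∃ (C : ℝ) (n : ℕ), 0 ≤ C ∧ ∀ φ : 𝓢(E, ℂ),
      ‖u φ‖ ≤ C * ∑ i ∈ Finset.range (n + 1), SchwartzMap.seminorm ℝ 0 i φ := by
  let b : ContDiffBump (0 : E) := ⟨R + 1, R + 2, by linarith, by linarith⟩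
  have hb : ContDiff ℝ ∞ (fun x : E => ((b x : ℝ) : ℂ)) :=
    Complex.ofRealCLM.contDiff.comp b.contDiff
  have hbc : HasCompactSupport (fun x : E => ((b x : ℝ) : ℂ)) :=
    b.hasCompactSupport.comp_left (g := ((↑) : ℝ → ℂ)) rfl
  let B : 𝓢(E, ℂ) := hbc.toSchwartzMap hb
  let M : 𝓢(E, ℂ) → 𝓢(E, ℂ) := fun φ =>
    (hbc.mul_right (f' := φ)).toSchwartzMap (hb.mul (φ.smooth ⊤))
  have hM : ∀ φ x, M φ x = B x * φ x := fun φ x => rfl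
  -- The cut-off is one on the ball of radius R + 1, a neighbourhood of the support, so u does not
  -- see the replacement of φ by `M φ`. For `M φ` the polynomial weights of the Schwartz seminorms
  -- are bounded and only unweighted seminorms of φ remain.
  have huM : ∀ φ, u φ = u (M φ) := by
    intro φ
    rw [← sub_eq_zero, ← map_sub]
    refine u.eq_zero_of_disjoint_tsupport _ ?_
    have hsub : tsupport (φ - M φ : 𝓢(E, ℂ)) ⊆ (Metric.ball 0 (R + 1))ᶜ := by
      refine closure_minimal ?_ Metric.isOpen_ball.isClosed_compl
      intro x hx hx'
      apply hx
      have : B x = 1 := by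
        change ((b x : ℝ) : ℂ) = 1
        rw [b.one_of_mem_closedBall (Metric.ball_subset_closedBall hx')]; simp
      rw [_root_.sub_apply, hM, this]; simp
    refine Set.disjoint_left.2 fun x hx hxu => hsub hx ?_
    have := hu hxu
    rw [mem_closedBall_zero_iff] at this
    rw [mem_ball_zero_iff]
    linarith
  have hMs : ∀ k i, ∃ C : ℝ, 0 ≤ C ∧ ∀ φ, SchwartzMap.seminorm ℝ k i (M φ) ≤
      C * ∑ j ∈ Finset.range (i + 1), SchwartzMap.seminorm ℝ 0 j φ := by
    intro k i
    refine ⟨∑ j ∈ Finset.range (i + 1), (i.choose j : ℝ) * SchwartzMap.seminorm ℝ k j B,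
      by positivity, fun φ => ?_⟩
    refine SchwartzMap.seminorm_le_bound ℝ k i _ (by positivity) fun x => ?_
    have h2 := norm_iteratedFDeriv_mul_le (𝕜 := ℝ) hb (φ.smooth ⊤) x (n := i)
        (by exact_mod_cast le_top)
    calc ‖x‖ ^ k * ‖iteratedFDeriv ℝ i (M φ) x‖
        ≤ ‖x‖ ^ k * ∑ j ∈ Finset.range (i + 1), (i.choose j : ℝ) *
            ‖iteratedFDeriv ℝ j B x‖ * ‖iteratedFDeriv ℝ (i - j) φ x‖ := by
          gcongr
          exact h2
      _ = ∑ j ∈ Finset.range (i + 1), (i.choose j : ℝ) *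
            (‖x‖ ^ k * ‖iteratedFDeriv ℝ j B x‖) * ‖iteratedFDeriv ℝ (i - j) φ x‖ := by
          rw [Finset.mul_sum]
          refine Finset.sum_congr rfl fun j _ => by ring
      _ ≤ ∑ j ∈ Finset.range (i + 1), (i.choose j : ℝ) * SchwartzMap.seminorm ℝ k j B *
            ∑ j ∈ Finset.range (i + 1), SchwartzMap.seminorm ℝ 0 j φ := by
          refine Finset.sum_le_sum fun j hj => ?_
          refine mul_le_mul ?_ ?_ (norm_nonneg _) (by positivity)
          · gcongr
            exact SchwartzMap.le_seminorm ℝ k j B x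
          · refine (SchwartzMap.norm_iteratedFDeriv_le_seminorm ℝ φ (i - j) x).trans ?_
            refine Finset.single_le_sum (f := fun j => SchwartzMap.seminorm ℝ 0 j φ)
              (fun _ _ => by positivity) ?_
            simp only [Finset.mem_range] at hj ⊢
            omega
      _ = _ := by rw [Finset.sum_mul]
  obtain ⟨s, C₀, -, hC₀⟩ := Seminorm.bound_of_continuous (schwartz_withSeminorms ℂ E ℂ)
    ((normSeminorm ℂ ℂ).comp u.toLinearMap)
    (by
      change Continuous fun φ => ‖u φ‖
      exact (map_continuous u).norm)
  choose Cs hCs0 hCs using hMs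
  refine ⟨C₀ * ∑ m ∈ s, Cs m.1 m.2, s.sup Prod.snd,
    mul_nonneg C₀.2 (Finset.sum_nonneg fun _ _ => hCs0 _ _), fun φ => ?_⟩
  rw [huM]
  have h1 : ‖u (M φ)‖ ≤ C₀ * (s.sup (schwartzSeminormFamily ℂ E ℂ)) (M φ) := hC₀ (M φ)
  refine h1.trans ?_
  rw [mul_assoc]
  refine mul_le_mul_of_nonneg_left ?_ C₀.2
  refine Seminorm.finset_sup_apply_le (mul_nonneg (Finset.sum_nonneg fun _ _ => hCs0 _ _)
    (by positivity)) fun m hm => ?_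
  refine (hCs m.1 m.2 φ).trans ?_
  refine mul_le_mul (Finset.single_le_sum (f := fun m : ℕ × ℕ => Cs m.1 m.2)
    (fun _ _ => hCs0 _ _) hm) ?_ (by positivity) (Finset.sum_nonneg fun _ _ => hCs0 _ _)
  refine Finset.sum_le_sum_of_subset_of_nonneg ?_ (fun _ _ _ => by positivity)
  refine Finset.range_mono ?_
  have := Finset.le_sup (f := Prod.snd) hm
  omega

end CompactSupportDistribution

section CompactSupportDistribution

variable {E : Type*} [NormedAddCommGroup E] [InnerProductSpace ℝ E] [FiniteDimensional ℝ E]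
  [MeasurableSpace E] [BorelSpace E]

/-- Derivatives of 𝓕 ψ are transforms of ψ times powers of the variable. A functional of finite
order therefore becomes, on the Fourier side, continuous in a weighted L₁ norm. -/
theorem SchwartzMap.exists_seminorm_fourier_le (n : ℕ) :
    ∃ C : ℝ, 0 ≤ C ∧ ∀ ψ : 𝓢(E, ℂ),
      ∑ i ∈ Finset.range (n + 1), SchwartzMap.seminorm ℝ 0 i (𝓕 ψ) ≤
        C * ∫ v, (1 + ‖v‖) ^ n * ‖ψ v‖ := by
  have hint : ∀ (ψ : 𝓢(E, ℂ)), Integrable (fun v => (1 + ‖v‖) ^ n * ‖ψ v‖) := by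
    intro ψ
    simp_rw [add_pow, one_pow, one_mul, Finset.sum_mul]
    refine integrable_finsetSum _ fun i _ => ?_
    simpa [mul_comm, mul_assoc, mul_left_comm] using
      (ψ.integrable_pow_mul volume (n - i)).mul_const ((n.choose i : ℝ))
  have key : ∀ i ≤ n, ∀ ψ : 𝓢(E, ℂ), SchwartzMap.seminorm ℝ 0 i (𝓕 ψ) ≤
      ((2 * Real.pi) ^ i * (i + 1)) * ∫ v, (1 + ‖v‖) ^ n * ‖ψ v‖ := by
    intro i hi ψ
    refine SchwartzMap.seminorm_le_bound ℝ 0 i _ (by positivity) fun x => ?_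
    have h := Real.pow_mul_norm_iteratedFDeriv_fourier_le (f := ψ) (K := ⊤) (N := ⊤)
      (ψ.smooth ⊤) (fun k n _ _ => ψ.integrable_pow_mul_iteratedFDeriv volume k n)
      (k := i) (n := 0) le_top le_top x
    rw [← SchwartzMap.fourier_coe] at h
    refine h.trans ?_
    rw [pow_zero, mul_one, mul_assoc]
    refine mul_le_mul_of_nonneg_left ?_ (by positivity)
    refine (Finset.sum_le_card_nsmul _ _ (∫ v, (1 + ‖v‖) ^ n * ‖ψ v‖) ?_).trans ?_
    · rintro ⟨p, q⟩ hp
      simp only [Finset.mem_product, Finset.mem_range] at hp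
      have hq : q = 0 := by omega
      subst hq
      refine integral_mono (by simpa using ψ.integrable_pow_mul volume p) (hint ψ) fun v => ?_
      simp only [norm_iteratedFDeriv_zero]
      gcongr
      calc ‖v‖ ^ p ≤ (1 + ‖v‖) ^ p := by gcongr; linarith
        _ ≤ (1 + ‖v‖) ^ n := pow_le_pow_right₀ (by linarith [norm_nonneg v]) (by omega)
    · simp
  refine ⟨∑ i ∈ Finset.range (n + 1), ((2 * Real.pi) ^ i * (i + 1)), by positivity, fun ψ => ?_⟩
  rw [Finset.sum_mul]
  exact Finset.sum_le_sum fun i hi => key i (by simpa [Nat.lt_succ_iff] using hi) ψ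

/-- The functionals which are continuous for a weighted `L₁` norm are given by weights
of polynomial growth. -/
theorem exists_weight_of_norm_le (T : 𝓢(E, ℂ) →ₗ[ℂ] ℂ) (C : ℝ) (n : ℕ)
    (hT : ∀ ψ, ‖T ψ‖ ≤ C * ∫ v, (1 + ‖v‖) ^ n * ‖ψ v‖) :
    ∃ (U : E → ℂ) (N : ℕ), AEStronglyMeasurable U ∧
      Integrable (fun ξ => ((1 + ‖ξ‖) ^ N)⁻¹ * ‖U ξ‖) ∧ ∀ ψ, T ψ = ∫ ξ, U ξ * ψ ξ := by
  set k := Module.finrank ℝ E + 1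
  -- The power n cancels the weight in the hypothesis, and the further power k makes the remaining
  -- factor square integrable. By Cauchy-Schwarz the functional ψ ↦ T(ψ (1 + ‖x‖²)^{-M}) is
  -- continuous in L₂, where density of the Schwartz functions and the Riesz representation apply.
  set M : ℕ := n + k
  -- the weights
  have htg : ∀ r : ℝ, (fun x : E => (((1 + ‖x‖ ^ 2) ^ r : ℝ) : ℂ)).HasTemperateGrowth := by
    intro r; fun_prop
  set w : ℝ → E → ℂ := fun r x => (((1 + ‖x‖ ^ 2) ^ r : ℝ) : ℂ)
  have hone : ∀ x : E, (0 : ℝ) < 1 + ‖x‖ ^ 2 := fun x => by positivity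
  have hsq : ∀ x : E, 1 + ‖x‖ ≤ 2 * (1 + ‖x‖ ^ 2) := fun x => by
    nlinarith [sq_nonneg (‖x‖ - 1), sq_nonneg ‖x‖]
  have hmem : MemLp (fun x : E => (1 + ‖x‖ ^ 2) ^ (-(k : ℝ))) 2 := by
    rw [memLp_two_iff_integrable_sq_norm (by
      refine Continuous.aestronglyMeasurable ?_
      exact Continuous.rpow_const (by fun_prop) fun x => Or.inl (hone x).ne')]
    have := integrable_rpow_neg_one_add_norm_sq (E := E) (μ := volume) (r := 4 * k) (by
      simp only [k]; push_cast; linarith [(Module.finrank ℝ E).cast_nonneg (α := ℝ)])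
    refine this.congr (Filter.Eventually.of_forall fun x => ?_)
    simp only
    rw [Real.norm_of_nonneg (by positivity), ← Real.rpow_mul_natCast (hone x).le]
    congr 1; push_cast; ring
  -- the functional on `L₂`
  let A : 𝓢(E, ℂ) →L[ℂ] 𝓢(E, ℂ) := SchwartzMap.smulLeftCLM ℂ (w (-(M : ℝ)))
  let A' : 𝓢(E, ℂ) →L[ℂ] 𝓢(E, ℂ) := SchwartzMap.smulLeftCLM ℂ (w M)
  have hA : ∀ ψ x, A ψ x = w (-(M : ℝ)) x * ψ x := fun ψ x =>
    SchwartzMap.smulLeftCLM_apply_apply (htg _) ψ x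
  have hA' : ∀ ψ x, A' ψ x = w M x * ψ x := fun ψ x =>
    SchwartzMap.smulLeftCLM_apply_apply (htg _) ψ x
  have hAA' : ∀ ψ, A (A' ψ) = ψ := by
    intro ψ
    ext x
    rw [hA, hA', ← mul_assoc]
    simp only [w]
    rw [← Complex.ofReal_mul, ← Real.rpow_add (hone x)]
    simp
  let e : 𝓢(E, ℂ) →ₗ[ℂ] Lp ℂ 2 (volume : Measure E) :=
    (SchwartzMap.toLpCLM ℂ ℂ 2 volume).toLinearMap
  have he : DenseRange e := SchwartzMap.denseRange_toLpCLM (p := 2) (by simp)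
  let S : 𝓢(E, ℂ) →ₗ[ℂ] ℂ := T ∘ₗ A.toLinearMap
  have hC : 0 ≤ C ∨ ∀ ψ, T ψ = 0 := by
    by_cases hC : 0 ≤ C
    · exact Or.inl hC
    · right
      intro ψ
      have h1 : 0 ≤ ∫ v, (1 + ‖v‖) ^ n * ‖ψ v‖ := integral_nonneg fun v => by positivity
      have h2 := hT ψ
      have : ‖T ψ‖ ≤ 0 := h2.trans (mul_nonpos_of_nonpos_of_nonneg (by linarith) h1)
      simpa using this
  have hS : ∃ C', ∀ ψ, ‖S ψ‖ ≤ C' * ‖e ψ‖ := by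
    rcases hC with hC | hC
    swap
    · exact ⟨0, fun ψ => by simp [S, hC]⟩
    refine ⟨C * (2 ^ n * (∫ x : E, ‖(1 + ‖x‖ ^ 2) ^ (-(k : ℝ))‖ ^ (2 : ℝ)) ^ (1 / (2 : ℝ))),
      fun ψ => ?_⟩
    refine (hT (A ψ)).trans ?_
    rw [mul_assoc]
    refine mul_le_mul_of_nonneg_left ?_ hC
    have hψ2 : MemLp ψ (ENNReal.ofReal 2) := by simpa using ψ.memLp 2
    have hbound : ∀ v, (1 + ‖v‖) ^ n * ‖A ψ v‖ ≤
        2 ^ n * (‖(1 + ‖v‖ ^ 2) ^ (-(k : ℝ))‖ * ‖ψ v‖) := by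
      intro v
      rw [hA, norm_mul, ← mul_assoc, ← mul_assoc]
      refine mul_le_mul_of_nonneg_right ?_ (norm_nonneg _)
      simp only [w]
      rw [Complex.norm_real, Real.norm_of_nonneg (by positivity), Real.norm_of_nonneg (by positivity)]
      calc (1 + ‖v‖) ^ n * (1 + ‖v‖ ^ 2) ^ (-(M : ℝ))
          ≤ (2 * (1 + ‖v‖ ^ 2)) ^ n * (1 + ‖v‖ ^ 2) ^ (-(M : ℝ)) := by
            gcongr; exact hsq v
        _ = 2 ^ n * ((1 + ‖v‖ ^ 2) ^ (n : ℝ) * (1 + ‖v‖ ^ 2) ^ (-(M : ℝ))) := by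
            rw [mul_pow, Real.rpow_natCast, mul_assoc]
        _ = _ := by
            rw [← Real.rpow_add (hone v)]
            congr 2
            simp only [M]; push_cast; ring
    have hmem2 : MemLp (fun x : E => (1 + ‖x‖ ^ 2) ^ (-(k : ℝ))) (ENNReal.ofReal 2) := by
      simpa using hmem
    have hint : Integrable (fun v => ‖(1 + ‖v‖ ^ 2) ^ (-(k : ℝ))‖ * ‖ψ v‖) := by
      have := MemLp.integrable_mul hmem.norm (ψ.memLp 2).norm
      exact this
    calc ∫ v, (1 + ‖v‖) ^ n * ‖A ψ v‖
        ≤ ∫ v, 2 ^ n * (‖(1 + ‖v‖ ^ 2) ^ (-(k : ℝ))‖ * ‖ψ v‖) :=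
          integral_mono_of_nonneg (Filter.Eventually.of_forall fun v => by positivity)
            (hint.const_mul _) (Filter.Eventually.of_forall hbound)
      _ = 2 ^ n * ∫ v, ‖(1 + ‖v‖ ^ 2) ^ (-(k : ℝ))‖ * ‖ψ v‖ := integral_const_mul _ _
      _ ≤ 2 ^ n * ((∫ x : E, ‖(1 + ‖x‖ ^ 2) ^ (-(k : ℝ))‖ ^ (2 : ℝ)) ^ (1 / (2 : ℝ)) *
            (∫ x : E, ‖ψ x‖ ^ (2 : ℝ)) ^ (1 / (2 : ℝ))) := by
          gcongr
          have := integral_mul_norm_le_Lp_mul_Lq Real.HolderConjugate.two_two hmem2 hψ2.norm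
          simpa only [norm_norm] using this
      _ = _ := by
          rw [mul_assoc]
          congr 2
          have : ‖e ψ‖ = ‖ψ.toLp 2 volume‖ := rfl
          rw [this, SchwartzMap.norm_toLp' (by simp) (by simp)]
          simp
  let F : Lp ℂ 2 (volume : Measure E) →L[ℂ] ℂ := S.extendOfNorm e
  have hF : ∀ ψ, F (e ψ) = S ψ := fun ψ => LinearMap.extendOfNorm_eq he hS ψ
  let W : Lp ℂ 2 (volume : Measure E) := (InnerProductSpace.toDual ℂ _).symm F
  have hW : ∀ ψ, S ψ = ∫ x, (starRingEnd ℂ) (W x) * ψ x := by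
    intro ψ
    rw [← hF, ← InnerProductSpace.toDual_symm_apply, L2.inner_def]
    refine integral_congr_ae ?_
    have : (e ψ : E → ℂ) =ᵐ[volume] ψ := ψ.coeFn_toLp 2 volume
    filter_upwards [this] with x hx
    rw [hx, RCLike.inner_apply, mul_comm]
  refine ⟨fun x => (starRingEnd ℂ) (W x) * w M x, 2 * M + 2 * k, ?_, ?_, fun ψ => ?_⟩
  · exact (Complex.continuous_conj.comp_aestronglyMeasurable
      (Lp.aestronglyMeasurable W)).mul (htg _).1.continuous.aestronglyMeasurable
  · have h1 : MemLp (fun x : E => (((1 + ‖x‖) ^ (2 * M + 2 * k))⁻¹ * (1 + ‖x‖ ^ 2) ^ M : ℝ)) 2 := by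
      refine hmem.of_le (by
        refine Continuous.aestronglyMeasurable ?_
        refine Continuous.mul (Continuous.inv₀ (by fun_prop) fun x => by positivity) (by fun_prop))
        (Filter.Eventually.of_forall fun x => ?_)
      rw [Real.norm_of_nonneg (by positivity), Real.norm_of_nonneg (by positivity),
        Real.rpow_neg (hone x).le, Real.rpow_natCast, inv_mul_le_iff₀ (by positivity),
        ← div_eq_mul_inv, le_div_iff₀ (by positivity), ← pow_add]
      have : 1 + ‖x‖ ^ 2 ≤ (1 + ‖x‖) ^ 2 := by nlinarith [norm_nonneg x]
      calc (1 + ‖x‖ ^ 2) ^ (M + k) ≤ ((1 + ‖x‖) ^ 2) ^ (M + k) := by gcongr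
        _ = _ := by rw [← pow_mul]; ring_nf
    have h2 := MemLp.integrable_mul h1 (Lp.memLp W).norm
    refine h2.congr (Filter.Eventually.of_forall fun x => ?_)
    simp only [Pi.mul_apply, norm_mul, RCLike.norm_conj, w, Complex.norm_real, Real.rpow_natCast]
    rw [Real.norm_of_nonneg (by positivity)]
    ring
  · have : T ψ = S (A' ψ) := by
      change T ψ = T (A (A' ψ))
      rw [hAA']
    rw [this, hW]
    refine integral_congr_ae (Filter.Eventually.of_forall fun x => ?_)
    simp only [hA']
    ring

/-- The Fourier transform of a tempered distribution with bounded support is a function of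
polynomial growth. -/
theorem TemperedDistribution.exists_fourier_weight (u : 𝓢'(E, ℂ)) {R : ℝ}
    (hR : 0 < R) (hu : Distribution.dsupport u ⊆ Metric.closedBall 0 R) :
    ∃ (U : E → ℂ) (N : ℕ), AEStronglyMeasurable U ∧
      Integrable (fun ξ => ((1 + ‖ξ‖) ^ N)⁻¹ * ‖U ξ‖) ∧
      ∀ φ : 𝓢(E, ℂ), u φ = ∫ ξ, U ξ * (𝓕⁻ φ) ξ := by
  obtain ⟨C, n, hC, h⟩ := u.exists_norm_le_of_dsupport_subset hR hu
  obtain ⟨C', hC', h'⟩ := SchwartzMap.exists_seminorm_fourier_le (E := E) n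
  obtain ⟨U, N, h1, h2, h3⟩ := exists_weight_of_norm_le
    (u.toLinearMap ∘ₗ (SchwartzMap.fourierTransformCLM ℂ (V := E) (E := ℂ)).toLinearMap)
    (C * C') n (fun ψ => by
      change ‖u (𝓕 ψ)‖ ≤ _
      refine (h _).trans ?_
      rw [mul_assoc]
      exact mul_le_mul_of_nonneg_left (h' ψ) hC)
  refine ⟨U, N, h1, h2, fun φ => ?_⟩
  rw [← h3]
  change u φ = u (𝓕 (𝓕⁻ φ))
  rw [FourierTransform.fourier_fourierInv_eq]

end CompactSupportDistribution

/-! ### Fourier transforms of integrable functions -/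

section FourierIntegrable

variable {V : Type*} [NormedAddCommGroup V] [InnerProductSpace ℝ V] [FiniteDimensional ℝ V]
  [MeasurableSpace V] [BorelSpace V]

theorem MeasureTheory.Integrable.continuous_fourier {h : V → ℂ} (hh : Integrable h) :
    Continuous (𝓕 h) :=
  VectorFourier.fourierIntegral_continuous Real.continuous_fourierChar
    (L := innerₗ V) (by exact continuous_inner) hh

theorem MeasureTheory.Integrable.continuous_fourierInv {h : V → ℂ} (hh : Integrable h) :
    Continuous (𝓕⁻ h) := by
  have : 𝓕⁻ h = fun x => 𝓕 h (-x) := by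
    ext x; rw [Real.fourierInv_eq_fourier_neg]
  rw [this]
  exact hh.continuous_fourier.comp continuous_neg

theorem enorm_fourier_le (h : V → ℂ) (x : V) : ‖𝓕 h x‖ₑ ≤ ∫⁻ v, ‖h v‖ₑ := by
  rw [Real.fourier_eq]
  refine (enorm_integral_le_lintegral_enorm _).trans (lintegral_mono fun v => ?_)
  rw [Circle.smul_def, smul_eq_mul, enorm_mul, ← ofReal_norm (((_ : Circle) : ℂ)), Circle.norm_coe,
    ENNReal.ofReal_one, one_mul]

theorem enorm_fourierInv_le (h : V → ℂ) (x : V) : ‖𝓕⁻ h x‖ₑ ≤ ∫⁻ v, ‖h v‖ₑ := by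
  rw [Real.fourierInv_eq_fourier_neg]
  exact enorm_fourier_le h _

theorem integral_fourier_mul_eq_of_integrable {f g : V → ℂ} (hf : Integrable f)
    (hg : Integrable g) : ∫ ξ, 𝓕 f ξ * g ξ = ∫ x, f x * 𝓕 g x := by
  have := VectorFourier.integral_fourierIntegral_smul_eq_flip (L := innerₗ V)
    Real.continuous_fourierChar (by exact continuous_inner) hf hg
  rw [flip_innerₗ] at this
  exact this

theorem integral_fourierInv_mul_eq_of_integrable {f g : V → ℂ} (hf : Integrable f)
    (hg : Integrable g) : ∫ ξ, 𝓕⁻ f ξ * g ξ = ∫ x, f x * 𝓕⁻ g x := by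
  rw [Real.fourierInv_eq_fourier_comp_neg g, ← integral_fourier_mul_eq_of_integrable hf hg.comp_neg,
    ← integral_neg_eq_self]
  refine integral_congr_ae (Filter.Eventually.of_forall fun x => ?_)
  simp only [Real.fourierInv_eq_fourier_neg, neg_neg]

/-- The Fourier inversion formula almost everywhere. -/
theorem fourier_fourierInv_ae_eq {h : V → ℂ} (hh : Integrable h) (hi : Integrable (𝓕⁻ h)) :
    ∀ᵐ ξ, 𝓕 (𝓕⁻ h) ξ = h ξ := by
  -- Tested against a smooth compactly supported function, both transforms can be moved onto the
  -- test function, for which inversion is known.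
  refine ae_eq_of_integral_contDiff_smul_eq hi.continuous_fourier.locallyIntegrable
    hh.locallyIntegrable fun g hg hgc => ?_
  have h1 : ContDiff ℝ ∞ (fun x => ((g x : ℝ) : ℂ)) := Complex.ofRealCLM.contDiff.comp hg
  have h2 : HasCompactSupport (fun x => ((g x : ℝ) : ℂ)) :=
    hgc.comp_left (g := ((↑) : ℝ → ℂ)) rfl
  let φ : 𝓢(V, ℂ) := h2.toSchwartzMap h1
  have h3 : ∀ f : V → ℂ, ∫ x, g x • f x = ∫ x, f x * φ x := by
    intro f
    refine integral_congr_ae (Filter.Eventually.of_forall fun x => ?_)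
    change g x • f x = f x * ((g x : ℝ) : ℂ)
    rw [Complex.real_smul, mul_comm]
  let Fφ : 𝓢(V, ℂ) := 𝓕 φ
  have h4 : 𝓕 (φ : V → ℂ) = Fφ := (SchwartzMap.fourier_coe φ).symm
  have h5 : 𝓕⁻ (Fφ : V → ℂ) = φ := by
    rw [← SchwartzMap.fourierInv_coe, FourierTransform.fourierInv_fourier_eq]
  rw [h3, h3, integral_fourier_mul_eq_of_integrable hi φ.integrable, h4,
    integral_fourierInv_mul_eq_of_integrable hh Fφ.integrable, h5]

end FourierIntegrable

/-! ### Tensor products, and the local means as Fourier multipliers -/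

section Tensor

variable {d : ℕ}

theorem EuclideanSpace.integral_prod_eq (f : Fin d → ℝ → ℂ) :
    ∫ x : EuclideanSpace ℝ (Fin d), ∏ i, f i (x i) = ∏ i, ∫ t, f i t := by
  rw [← integral_fintype_prod_volume_eq_prod,
    ← (PiLp.volume_preserving_ofLp (Fin d)).integral_comp
      (MeasurableEquiv.toLp 2 (Fin d → ℝ)).symm.measurableEmbedding]

theorem fourier_tensor (f : Fin d → ℝ → ℂ) (ξ : EuclideanSpace ℝ (Fin d)) :
    𝓕 (fun x : EuclideanSpace ℝ (Fin d) => ∏ i, f i (x i)) ξ = ∏ i, 𝓕 (f i) (ξ i) := by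
  rw [Real.fourier_eq]
  simp_rw [Real.fourier_real_eq]
  rw [← EuclideanSpace.integral_prod_eq]
  refine integral_congr_ae (Filter.Eventually.of_forall fun x => ?_)
  simp only [Circle.smul_def, smul_eq_mul, Finset.prod_mul_distrib]
  congr 1
  rw [PiLp.inner_apply, ← Finset.sum_neg_distrib]
  simp only [RCLike.inner_apply, conj_trivial]
  simp_rw [mul_comm (ξ _)]
  simp only [Real.fourierChar_apply]
  rw [← Complex.exp_sum]
  congr 1
  push_cast
  rw [Finset.mul_sum, Finset.sum_mul]

theorem EuclideanSpace.one_add_norm_le_prod (ξ : EuclideanSpace ℝ (Fin d)) :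
    1 + ‖ξ‖ ≤ ∏ i, (1 + |ξ i|) := by
  have h1 : ‖ξ‖ ≤ ∑ i, |ξ i| := by
    rw [EuclideanSpace.norm_eq]
    refine Real.sqrt_le_left (Finset.sum_nonneg fun _ _ => abs_nonneg _) |>.2 ?_
    simpa using Finset.sum_sq_le_sq_sum_of_nonneg (s := Finset.univ) (f := fun i => |ξ i|)
      (fun _ _ => abs_nonneg _)
  have h2 : ∀ s : Finset (Fin d), 1 + ∑ i ∈ s, |ξ i| ≤ ∏ i ∈ s, (1 + |ξ i|) := by
    intro s
    induction s using Finset.induction_on with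
    | empty => simp
    | insert i s hi ih =>
      rw [Finset.sum_insert hi, Finset.prod_insert hi]
      have : 0 ≤ ∑ i ∈ s, |ξ i| := Finset.sum_nonneg fun _ _ => abs_nonneg _
      nlinarith [abs_nonneg (ξ i)]
  linarith [h2 Finset.univ]

end Tensor

namespace LocalMeans

variable {s : ℝ} {d : ℕ}

/-- The Fourier transform of the tensor product kernel `Ψ_m`. -/
noncomputable def symbol (K : LocalMeans s) (m : Fin d → ℕ) (ξ : EuclideanSpace ℝ (Fin d)) : ℂ :=
  ∏ i, 𝓕 (K.level (m i)) (ξ i)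

theorem continuous_symbol (K : LocalMeans s) (m : Fin d → ℕ) : Continuous (K.symbol m) := by
  unfold symbol
  refine continuous_finsetProd _ fun i _ => (K.continuous_fourier_level (m i)).comp ?_
  fun_prop

theorem fourier_tensor (K : LocalMeans s) (m : Fin d → ℕ) : 𝓕 (K.tensor m) = K.symbol m := by
  ext ξ
  exact _root_.fourier_tensor (fun i => K.level (m i)) ξ

theorem fourierInv_testFunction (K : LocalMeans s) (m : Fin d → ℕ)
    (x ξ : EuclideanSpace ℝ (Fin d)) :
    (𝓕⁻ (K.testFunction m x)) ξ = (Real.fourierChar (inner ℝ ξ x) : ℂ) * K.symbol m ξ := by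
  rw [SchwartzMap.fourierInv_coe, Real.fourierInv_eq, ← fourier_tensor, Real.fourier_eq,
    ← integral_const_mul, ← integral_sub_left_eq_self _ volume x]
  refine integral_congr_ae (Filter.Eventually.of_forall fun y => ?_)
  have h1 : K.testFunction m x (x - y) = K.tensor m y := by
    change K.tensor m (x - (x - y)) = _
    rw [sub_sub_cancel]
  simp only [h1, Circle.smul_def, smul_eq_mul]
  rw [← mul_assoc, ← Circle.coe_mul, ← AddChar.map_add_eq_mul, inner_sub_left,
    real_inner_comm ξ x, sub_eq_add_neg]

theorem conv_eq_fourierInv (K : LocalMeans s) (m : Fin d → ℕ)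
    {u : 𝓢'(EuclideanSpace ℝ (Fin d), ℂ)} {U : EuclideanSpace ℝ (Fin d) → ℂ}
    (hu : ∀ φ : 𝓢(EuclideanSpace ℝ (Fin d), ℂ), u φ = ∫ ξ, U ξ * (𝓕⁻ φ) ξ) :
    K.conv m u = 𝓕⁻ (fun ξ => K.symbol m ξ * U ξ) := by
  ext x
  rw [conv, hu, Real.fourierInv_eq]
  refine integral_congr_ae (Filter.Eventually.of_forall fun ξ => ?_)
  simp only [fourierInv_testFunction, Circle.smul_def, smul_eq_mul]
  ring

/-- The loss 2^{N|m|₁} is harmless: the estimate serves for the integrability of the symbol times a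
function of polynomial growth, and for a crude growth bound in m that is only used qualitatively. -/
theorem exists_norm_symbol_le (K : LocalMeans s) (d N : ℕ) :
    ∃ C : ℝ, 0 < C ∧ ∀ (m : Fin d → ℕ) ξ,
      ‖K.symbol m ξ‖ ≤ C * 2 ^ (N * ∑ i, m i) * ((1 + ‖ξ‖) ^ N)⁻¹ := by
  obtain ⟨C, hC, h⟩ := K.exists_fourier_level_decay N
  refine ⟨C ^ d, by positivity, fun m ξ => ?_⟩
  rw [← div_eq_mul_inv, le_div_iff₀ (by positivity)]
  calc ‖K.symbol m ξ‖ * (1 + ‖ξ‖) ^ N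
      ≤ (∏ i, ‖𝓕 (K.level (m i)) (ξ i)‖) * (∏ i, (1 + |ξ i|)) ^ N := by
        rw [symbol, norm_prod]
        gcongr
        exact EuclideanSpace.one_add_norm_le_prod ξ
    _ = ∏ i, ((1 + |ξ i|) ^ N * ‖𝓕 (K.level (m i)) (ξ i)‖) := by
        rw [← Finset.prod_pow, ← Finset.prod_mul_distrib]
        exact Finset.prod_congr rfl fun i _ => mul_comm _ _
    _ ≤ ∏ i : Fin d, (2 ^ (N * m i) * C) := by
        refine Finset.prod_le_prod (fun i _ => by positivity) fun i _ => ?_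
        have h1 : 1 + |ξ i| ≤ 2 ^ m i * (1 + |ξ i| / 2 ^ m i) := by
          rw [mul_add, mul_one, mul_div_cancel₀ _ (by positivity)]
          gcongr
          exact one_le_pow₀ one_le_two
        calc (1 + |ξ i|) ^ N * ‖𝓕 (K.level (m i)) (ξ i)‖
            ≤ (2 ^ m i * (1 + |ξ i| / 2 ^ m i)) ^ N * ‖𝓕 (K.level (m i)) (ξ i)‖ := by gcongr
          _ = 2 ^ (N * m i) * ((1 + |ξ i| / 2 ^ m i) ^ N * ‖𝓕 (K.level (m i)) (ξ i)‖) := by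
            rw [mul_pow, ← pow_mul, mul_comm N]; ring
          _ ≤ _ := by gcongr; exact h _ _
    _ = _ := by
        rw [Finset.prod_mul_distrib, Finset.prod_pow_eq_pow_sum, Finset.prod_const,
          Finset.mul_sum]
        simp [mul_comm]

/-- A function `U` of polynomial growth (in the mean). -/
def _root_.IsSpectralWeight (U : EuclideanSpace ℝ (Fin d) → ℂ) (N : ℕ) : Prop :=
  AEStronglyMeasurable U ∧ Integrable (fun ξ => ((1 + ‖ξ‖) ^ N)⁻¹ * ‖U ξ‖)

variable {U : EuclideanSpace ℝ (Fin d) → ℂ} {N : ℕ}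

theorem integrable_symbol_mul (K : LocalMeans s) (hU : IsSpectralWeight U N) (m : Fin d → ℕ) :
    Integrable (fun ξ => K.symbol m ξ * U ξ) := by
  obtain ⟨C, hC, h⟩ := K.exists_norm_symbol_le d N
  refine (hU.2.const_mul (C * 2 ^ (N * ∑ i, m i))).mono'
    ((K.continuous_symbol m).aestronglyMeasurable.mul hU.1)
    (Filter.Eventually.of_forall fun ξ => ?_)
  rw [norm_mul, ← mul_assoc]
  gcongr
  exact h m ξ

theorem exists_lintegral_symbol_mul_le (K : LocalMeans s) (hU : IsSpectralWeight U N) :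
    ∃ C : ℝ≥0∞, C ≠ ⊤ ∧ ∀ m : Fin d → ℕ,
      ∫⁻ ξ, ‖K.symbol m ξ * U ξ‖ₑ ≤ C * 2 ^ (N * ∑ i, m i) := by
  obtain ⟨C, hC, h⟩ := K.exists_norm_symbol_le d N
  refine ⟨ENNReal.ofReal C * ∫⁻ ξ, ‖((1 + ‖ξ‖) ^ N)⁻¹ * ‖U ξ‖‖ₑ,
    ENNReal.mul_ne_top (by finiteness) hU.2.2.ne, fun m => ?_⟩
  have h2 : (2 : ℝ≥0∞) ^ (N * ∑ i, m i) = ENNReal.ofReal (2 ^ (N * ∑ i, m i)) := by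
    rw [ENNReal.ofReal_pow (by norm_num)]; simp
  rw [mul_right_comm, h2, ← ENNReal.ofReal_mul hC.le, ← lintegral_const_mul' _ _ (by finiteness)]
  refine lintegral_mono fun ξ => ?_
  rw [← ofReal_norm, ← ofReal_norm, ← ENNReal.ofReal_mul (by positivity)]
  refine ENNReal.ofReal_le_ofReal ?_
  rw [norm_mul, norm_mul, norm_norm, Real.norm_of_nonneg (by positivity), ← mul_assoc]
  gcongr
  exact h m ξ

theorem exists_level_support (K : LocalMeans s) :
    ∃ R : ℝ, 0 < R ∧ ∀ j t, R < |t| → K.level j t = 0 := by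
  obtain ⟨R₀, h0⟩ := K.compact₀.isCompact.isBounded.subset_closedBall 0
  obtain ⟨R₁, h1⟩ := K.compact₁.isCompact.isBounded.subset_closedBall 0
  have key : ∀ (f : ℝ → ℂ) (r : ℝ), tsupport f ⊆ Metric.closedBall 0 r → ∀ t, r < |t| → f t = 0 := by
    intro f r hf t ht
    by_contra hne
    have := hf (subset_tsupport f hne)
    rw [mem_closedBall_zero_iff, Real.norm_eq_abs] at this
    linarith
  refine ⟨max 1 (max R₀ R₁), by positivity, fun j t ht => ?_⟩
  cases j with
  | zero => exact key _ _ h0 t (lt_of_le_of_lt (by simp) ht)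
  | succ j =>
    simp only [level]
    rw [key _ _ h1, mul_zero]
    rw [abs_mul, abs_of_pos (by positivity : (0 : ℝ) < 2 ^ j)]
    have : |t| ≤ 2 ^ j * |t| := le_mul_of_one_le_left (abs_nonneg _) (one_le_pow₀ one_le_two)
    exact lt_of_lt_of_le (lt_of_le_of_lt (by simp) ht) this

/-- The functions `Ψ_m ∗ u` are supported in a common cube. -/
theorem exists_conv_support (K : LocalMeans s) (d : ℕ) :
    ∃ R : ℝ, 0 < R ∧ ∀ u : 𝓢'(EuclideanSpace ℝ (Fin d), ℂ),
      Distribution.dsupport u ⊆ unitCube d →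
      ∀ m x, (∃ i, R < |x i|) → K.conv m u x = 0 := by
  obtain ⟨R, hR, h⟩ := K.exists_level_support
  refine ⟨R + 1, by positivity, fun u hu m x ⟨i, hi⟩ => ?_⟩
  refine u.eq_zero_of_hasCompactSupport _ (((K.hasCompactSupport_tensor m).comp_homeomorph
    (Homeomorph.subLeft x))) ?_
  have hsub : tsupport (K.testFunction m x) ⊆ {z | |x i - z i| ≤ R} := by
    refine closure_minimal ?_ (isClosed_le (by fun_prop) continuous_const)
    intro z hz
    by_contra hlt
    apply hz
    change K.tensor m (x - z) = 0
    exact Finset.prod_eq_zero (Finset.mem_univ i) (h _ _ (not_le.1 hlt))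
  refine Set.disjoint_left.2 fun z hz hzu => ?_
  have h1 : |x i - z i| ≤ R := hsub hz
  have h2 := hu hzu i
  rw [abs_le] at h1
  rcases lt_abs.1 hi with h3 | h3 <;> linarith [h2.1, h2.2]

theorem _root_.EuclideanSpace.hasCompactSupport_of_forall {f : EuclideanSpace ℝ (Fin d) → ℂ}
    {R : ℝ} (h : ∀ x, (∃ i, R < |x i|) → f x = 0) : HasCompactSupport f := by
  have hc : IsCompact ((EuclideanSpace.equiv (Fin d) ℝ).symm ''
      (Set.univ.pi fun _ => Set.Icc (-R) R)) :=
    (isCompact_univ_pi fun i => isCompact_Icc).image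
      (EuclideanSpace.equiv (Fin d) ℝ).symm.continuous
  refine HasCompactSupport.intro hc fun x hx => ?_
  by_contra hne
  refine hx ⟨EuclideanSpace.equiv (Fin d) ℝ x, fun i _ => ?_, by simp⟩
  by_contra hi
  refine hne (h x ⟨i, ?_⟩)
  by_contra hle
  exact hi (abs_le.1 (not_lt.1 hle))

theorem continuous_conv (K : LocalMeans s) (hU : IsSpectralWeight U N) (m : Fin d → ℕ)
    {u : 𝓢'(EuclideanSpace ℝ (Fin d), ℂ)}
    (hu : ∀ φ : 𝓢(EuclideanSpace ℝ (Fin d), ℂ), u φ = ∫ ξ, U ξ * (𝓕⁻ φ) ξ) :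
    Continuous (K.conv m u) := by
  rw [K.conv_eq_fourierInv m hu]
  exact (K.integrable_symbol_mul hU m).continuous_fourierInv

theorem _root_.exists_isSpectralWeight (u : 𝓢'(EuclideanSpace ℝ (Fin d), ℂ))
    (hu : Distribution.dsupport u ⊆ unitCube d) :
    ∃ (U : EuclideanSpace ℝ (Fin d) → ℂ) (N : ℕ), IsSpectralWeight U N ∧
      ∀ φ : 𝓢(EuclideanSpace ℝ (Fin d), ℂ), u φ = ∫ ξ, U ξ * (𝓕⁻ φ) ξ := by
  have hb : unitCube d ⊆ Metric.closedBall 0 (Real.sqrt d + 1) := by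
    intro x hx
    rw [mem_closedBall_zero_iff, EuclideanSpace.norm_eq]
    have : ∑ i, ‖x i‖ ^ 2 ≤ d := by
      refine (Finset.sum_le_card_nsmul _ _ 1 fun i _ => ?_).trans (by simp)
      rw [Real.norm_of_nonneg (hx i).1]
      exact pow_le_one₀ (hx i).1 (hx i).2
    linarith [Real.sqrt_le_sqrt this]
  obtain ⟨U, N, h1, h2, h3⟩ := u.exists_fourier_weight (R := Real.sqrt d + 1) (by positivity)
    (hu.trans hb)
  exact ⟨U, N, ⟨h1, h2⟩, h3⟩

end LocalMeans

/-! ### Domination of the local means along lines -/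

namespace LocalMeans

variable {s : ℝ} {d : ℕ}

/-- On a line parallel to a coordinate axis, the functions `Ψ_m ∗ u` are one-dimensional local
means of a common weight. -/
theorem exists_slice_weight {n : ℕ} (K : LocalMeans s) {U : EuclideanSpace ℝ (Fin (n + 1)) → ℂ}
    {N : ℕ} (hU : IsSpectralWeight U N) (m : Fin (n + 1) → ℕ) (x : Fin (n + 1) → ℝ)
    (i : Fin (n + 1)) :
    ∃ V : ℝ → ℂ, ∀ k, Integrable (fun τ => 𝓕 (K.level k) τ * V τ) ∧
      ∀ t, 𝓕⁻ (fun ξ => K.symbol (Function.update m i k) ξ * U ξ)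
        (WithLp.toLp 2 (Function.update x i t)) = 𝓕⁻ (fun τ => 𝓕 (K.level k) τ * V τ) t := by
  set e := (MeasurableEquiv.piFinSuccAbove (fun _ : Fin (n + 1) => ℝ) i).symm
  have he : MeasurePreserving e (volume.prod volume) volume :=
    (volume_preserving_piFinSuccAbove (fun _ : Fin (n + 1) => ℝ) i).symm _
  set E := e.trans (MeasurableEquiv.toLp 2 (Fin (n + 1) → ℝ))
  have hE : MeasurePreserving E (volume.prod volume) volume :=
    (PiLp.volume_preserving_toLp (Fin (n + 1))).comp he
  have hEi : ∀ τ (ξ : Fin n → ℝ), (E (τ, ξ)) i = τ := fun τ ξ =>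
    Fin.insertNth_apply_same (α := fun _ => ℝ) i τ ξ
  have hEs : ∀ τ (ξ : Fin n → ℝ) l, (E (τ, ξ)) (i.succAbove l) = ξ l := fun τ ξ l =>
    Fin.insertNth_apply_succAbove (α := fun _ => ℝ) i τ ξ l
  -- `B` collects the factors that depend neither on the level k nor on the position t in direction
  -- i. The common weight is the integral of `B` over the other frequencies.
  set B : ℝ × (Fin n → ℝ) → ℂ := fun p => (∏ l, (𝓕 (K.level (m (i.succAbove l))) (p.2 l) *
      (Real.fourierChar (p.2 l * x (i.succAbove l)) : ℂ))) * U (E p)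
  set H : ℕ → ℝ → EuclideanSpace ℝ (Fin (n + 1)) → ℂ := fun k t ξ =>
    Real.fourierChar (inner ℝ ξ (WithLp.toLp 2 (Function.update x i t))) •
      (K.symbol (Function.update m i k) ξ * U ξ)
  have hH : ∀ k t, Integrable (H k t) := by
    intro k t
    have := (VectorFourier.fourierIntegral_convergent_iff Real.continuous_fourierChar
      (L := innerₗ (EuclideanSpace ℝ (Fin (n + 1)))) (by exact continuous_inner)
      (-(WithLp.toLp 2 (Function.update x i t)))).2
      (K.integrable_symbol_mul hU (Function.update m i k))
    simpa [H] using this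
  have hHE : ∀ k t p, H k t (E p) =
      (Real.fourierChar (p.1 * t) : ℂ) * (𝓕 (K.level k) p.1 * B p) := by
    rintro k t ⟨τ, ξ⟩
    simp only [H, B, symbol, Circle.smul_def, smul_eq_mul]
    rw [PiLp.inner_apply, Fin.sum_univ_succAbove _ i, Fin.prod_univ_succAbove _ i,
      AddChar.map_add_eq_mul, Finset.prod_mul_distrib]
    simp only [hEi, hEs, Function.update_self, ne_eq, Fin.succAbove_ne, not_false_eq_true,
      Function.update_of_ne, RCLike.inner_apply, conj_trivial]
    have : (Real.fourierChar (∑ l, x (i.succAbove l) * ξ l) : ℂ) =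
        ∏ l, (Real.fourierChar (ξ l * x (i.succAbove l)) : ℂ) := by
      simp only [Real.fourierChar_apply]
      rw [← Complex.exp_sum]
      congr 1
      push_cast
      rw [Finset.mul_sum, Finset.sum_mul]
      simp_rw [mul_comm (x _ : ℂ)]
    rw [Circle.coe_mul, this, mul_comm t]
    ring
  have hint : ∀ k t, Integrable (fun p : ℝ × (Fin n → ℝ) => H k t (E p))
      (volume.prod volume) := fun k t =>
    (hE.integrable_comp_emb E.measurableEmbedding).2 (hH k t)
  refine ⟨fun τ => ∫ ξ, B (τ, ξ), fun k => ⟨?_, fun t => ?_⟩⟩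
  · have := (hint k 0).integral_prod_left
    refine this.congr (Filter.Eventually.of_forall fun τ => ?_)
    simp only [hHE, mul_zero, AddChar.map_zero_eq_one, Circle.coe_one, one_mul]
    exact integral_const_mul _ _
  · rw [Real.fourierInv_eq, Real.fourierInv_eq]
    have h1 : ∫ ξ, H k t ξ = ∫ p, H k t (E p) ∂(volume.prod volume) :=
      (hE.integral_comp E.measurableEmbedding _).symm
    change ∫ ξ, H k t ξ = _
    rw [h1, integral_prod _ (hint k t)]
    refine integral_congr_ae (Filter.Eventually.of_forall fun τ => ?_)
    simp only [hHE, Circle.smul_def, smul_eq_mul]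
    rw [integral_const_mul, integral_const_mul]
    simp [mul_comm]

/-- On a line, the sup of the function is at most the L₁ norm of its transform, and the sup of the
transform is at most the L₁ norm of the function. The Fourier side estimate for the common weight
connects the two. As the kernels are not band-limited, all finer levels enter, but with decay
2^{-Ml} of any prescribed order. -/
theorem exists_enorm_conv_le_directional (K : LocalMeans s) (M : ℕ) :
    ∃ C : ℝ≥0∞, C ≠ ⊤ ∧ ∀ (d : ℕ) (u : 𝓢'(EuclideanSpace ℝ (Fin d), ℂ)),
      Distribution.dsupport u ⊆ unitCube d → ∀ (m : Fin d → ℕ) (x : Fin d → ℝ) (i : Fin d),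
      ‖K.conv m u (WithLp.toLp 2 x)‖ₑ ≤ C * ∑' l, (2⁻¹ : ℝ≥0∞) ^ (M * l) * (2 ^ (m i + l) *
        ∫⁻ y, ‖K.conv (Function.update m i (m i + l)) u
          (WithLp.toLp 2 (Function.update x i y))‖ₑ) := by
  obtain ⟨C, hC, h⟩ := K.exists_lintegral_fourier_level_le M
  refine ⟨C, hC, fun d u hu m x i => ?_⟩
  obtain ⟨n, rfl⟩ : ∃ n, d = n + 1 := Nat.exists_eq_succ_of_ne_zero (by rintro rfl; exact i.elim0)
  obtain ⟨U, N, hU, hrep⟩ := exists_isSpectralWeight u hu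
  obtain ⟨R, hR, hsupp⟩ := K.exists_conv_support (n + 1)
  obtain ⟨V, hV⟩ := K.exists_slice_weight hU m x i
  have hconv : ∀ k t, K.conv (Function.update m i k) u (WithLp.toLp 2 (Function.update x i t)) =
      𝓕⁻ (fun τ => 𝓕 (K.level k) τ * V τ) t := fun k t => by
    rw [K.conv_eq_fourierInv _ hrep, (hV k).2]
  have hI : ∀ k, ∀ᵐ ξ, ‖𝓕 (K.level k) ξ * V ξ‖ₑ ≤ ∫⁻ y, ‖K.conv (Function.update m i k) u
          (WithLp.toLp 2 (Function.update x i y))‖ₑ := by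
    intro k
    have hcont : Continuous (𝓕⁻ (fun τ => 𝓕 (K.level k) τ * V τ)) :=
      (hV k).1.continuous_fourierInv
    have hcs : HasCompactSupport (𝓕⁻ (fun τ => 𝓕 (K.level k) τ * V τ)) := by
      refine HasCompactSupport.intro (isCompact_closedBall (0 : ℝ) R) fun t ht => ?_
      rw [← hconv]
      refine hsupp u hu _ _ ⟨i, ?_⟩
      rw [mem_closedBall_zero_iff, Real.norm_eq_abs, not_le] at ht
      simpa using ht
    -- The slices are continuous and compactly supported, so inversion recovers the multiplied
    -- weight almost everywhere as the transform of a slice.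
    filter_upwards [fourier_fourierInv_ae_eq (hV k).1 (hcont.integrable_of_hasCompactSupport hcs)]
      with ξ hξ
    rw [← hξ]
    refine (enorm_fourier_le _ _).trans (le_of_eq ?_)
    simp_rw [hconv]
  have h1 := h V _ hI (m i)
  refine le_trans ?_ h1
  have h2 := hconv (m i) (x i)
  rw [Function.update_eq_self, Function.update_eq_self] at h2
  rw [h2]
  exact enorm_fourierInv_le _ _

end LocalMeans

/-! ### Points and levels as one measure space -/

/-- The measure on `ℕ` which gives the weight `2^k` to `k`. -/
noncomputable def dyadicMeasure : Measure ℕ := Measure.count.withDensity fun k => 2 ^ k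

instance : SigmaFinite dyadicMeasure :=
  SigmaFinite.withDensity_of_ne_top' fun k => by finiteness

theorem lintegral_dyadicMeasure (f : ℕ → ℝ≥0∞) :
    ∫⁻ k, f k ∂dyadicMeasure = ∑' k, 2 ^ k * f k := by
  rw [dyadicMeasure, lintegral_withDensity_eq_lintegral_mul _ (by fun_prop) (by fun_prop),
    lintegral_count]
  rfl

/-- The measure on pairs of a point and a dyadic level. -/
noncomputable def scaleMeasure : Measure (ℝ × ℕ) := volume.prod dyadicMeasure

instance : SigmaFinite scaleMeasure := by unfold scaleMeasure; infer_instance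

theorem lintegral_scaleMeasure {f : ℝ × ℕ → ℝ≥0∞} (hf : Measurable f) :
    ∫⁻ w, f w ∂scaleMeasure = ∑' k, 2 ^ k * ∫⁻ y, f (y, k) := by
  rw [scaleMeasure, lintegral_prod_symm _ hf.aemeasurable, lintegral_dyadicMeasure]

/-- The function `(x, m) ↦ |Ψ_m ∗ u (x)|`. -/
noncomputable def LocalMeans.scaleFunction {s : ℝ} {d : ℕ} (K : LocalMeans s)
    (u : 𝓢'(EuclideanSpace ℝ (Fin d), ℂ)) (z : Fin d → ℝ × ℕ) : ℝ≥0∞ :=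
  ‖K.conv (fun i => (z i).2) u (WithLp.toLp 2 fun i => (z i).1)‖ₑ

theorem LocalMeans.measurable_scaleFunction {s : ℝ} {d : ℕ} (K : LocalMeans s)
    {u : 𝓢'(EuclideanSpace ℝ (Fin d), ℂ)} (hu : Distribution.dsupport u ⊆ unitCube d) :
    Measurable (K.scaleFunction u) := by
  obtain ⟨U, N, hU, hrep⟩ := exists_isSpectralWeight u hu
  have h1 : Measurable fun p : (Fin d → ℝ) × (Fin d → ℕ) =>
      ‖K.conv p.2 u (WithLp.toLp 2 p.1)‖ₑ := by
    refine measurable_from_prod_countable_left fun m => ?_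
    exact ((K.continuous_conv hU m hrep).comp (PiLp.continuous_toLp 2 _)).enorm.measurable
  have h2 : Measurable (fun z : Fin d → ℝ × ℕ => ((fun i => (z i).1 : Fin d → ℝ),
      (fun i => (z i).2 : Fin d → ℕ))) :=
    (measurable_pi_lambda _ fun i => measurable_fst.comp (measurable_pi_apply i)).prodMk
      (measurable_pi_lambda _ fun i => measurable_snd.comp (measurable_pi_apply i))
  have h3 : K.scaleFunction u = (fun p : (Fin d → ℝ) × (Fin d → ℕ) =>
      ‖K.conv p.2 u (WithLp.toLp 2 p.1)‖ₑ) ∘ fun z => (fun i => (z i).1, fun i => (z i).2) := by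
    funext z
    simp only [Function.comp, scaleFunction]
  rw [h3]
  exact Measurable.comp h1 h2

/-- The decaying factor `2^{-M (k - m)}` for `m ≤ k`, extended by zero. -/
noncomputable def decayKernel (M m k : ℕ) : ℝ≥0∞ := if m ≤ k then 2⁻¹ ^ (M * (k - m)) else 0

theorem tsum_decayKernel_mul (M m : ℕ) (f : ℕ → ℝ≥0∞) :
    ∑' k, decayKernel M m k * f k = ∑' l, 2⁻¹ ^ (M * l) * f (m + l) := by
  have hinj : Function.Injective (fun l => m + l) := add_right_injective m
  rw [← hinj.tsum_eq (f := fun k => decayKernel M m k * f k)]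
  · refine tsum_congr fun l => ?_
    simp [decayKernel]
  · intro k hk
    have : m ≤ k := by
      by_contra h
      simp [decayKernel, h] at hk
    exact ⟨k - m, by simp; omega⟩

/-- The weight 2^k carried by `scaleMeasure` is the factor in the directional Nikol'skij inequality,
so that inequality becomes a plain integral domination. -/
theorem LocalMeans.exists_scaleFunction_le {s : ℝ} (K : LocalMeans s) (M : ℕ) :
    ∃ C : ℝ≥0∞, C ≠ ⊤ ∧ ∀ (d : ℕ) (u : 𝓢'(EuclideanSpace ℝ (Fin d), ℂ)),
      Distribution.dsupport u ⊆ unitCube d → ∀ (z : Fin d → ℝ × ℕ) (i : Fin d),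
      K.scaleFunction u z ≤ C * ∫⁻ w, decayKernel M (z i).2 w.2 *
        K.scaleFunction u (Function.update z i w) ∂scaleMeasure := by
  obtain ⟨C, hC, h⟩ := K.exists_enorm_conv_le_directional M
  refine ⟨C, hC, fun d u hu z i => ?_⟩
  have hm := K.measurable_scaleFunction hu
  have hupd : Measurable (fun w : ℝ × ℕ => Function.update z i w) := measurable_update z
  have hk : Measurable (fun w : ℝ × ℕ => decayKernel M (z i).2 w.2) :=
    (measurable_of_countable (decayKernel M (z i).2)).comp measurable_snd
  have hint := lintegral_scaleMeasure (f := fun w => decayKernel M (z i).2 w.2 *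
    K.scaleFunction u (Function.update z i w)) (hk.mul (hm.comp hupd))
  rw [hint]
  refine (h d u hu _ _ i).trans (le_of_eq ?_)
  congr 1
  rw [← tsum_decayKernel_mul M (z i).2 (fun k => 2 ^ k * ∫⁻ y, ‖K.conv (Function.update
    (fun j => (z j).2) i k) u (WithLp.toLp 2 (Function.update (fun j => (z j).1) i y))‖ₑ)]
  refine tsum_congr fun k => ?_
  dsimp only
  rw [lintegral_const_mul' _ _ (by unfold decayKernel; split_ifs <;> finiteness), ← mul_assoc,
    ← mul_assoc, mul_comm (decayKernel _ _ _)]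
  congr 1
  refine lintegral_congr fun y => ?_
  unfold scaleFunction
  have h1 : (fun j => (Function.update z i (y, k) j).2) = Function.update (fun j => (z j).2) i k := by
    ext j; by_cases hj : j = i
    · subst hj; simp
    · simp [hj]
  have h2 : (fun j => (Function.update z i (y, k) j).1) = Function.update (fun j => (z j).1) i y := by
    ext j; by_cases hj : j = i
    · subst hj; simp
    · simp [hj]
  rw [h1, h2]

theorem dyadicMeasure_singleton (k : ℕ) : dyadicMeasure {k} = 2 ^ k := by
  rw [dyadicMeasure, withDensity_apply _ (measurableSet_singleton k)]
  simp

theorem lintegral_pi_scaleMeasure {d : ℕ} {f : (Fin d → ℝ × ℕ) → ℝ≥0∞} (hf : Measurable f) :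
    ∫⁻ z, f z ∂Measure.pi (fun _ => scaleMeasure) =
      ∑' m : Fin d → ℕ, 2 ^ (∑ i, m i) * ∫⁻ x : Fin d → ℝ, f (fun i => (x i, m i)) := by
  have h : MeasurePreserving (MeasurableEquiv.arrowProdEquivProdArrow ℝ ℕ (Fin d)).symm
      ((volume : Measure (Fin d → ℝ)).prod (Measure.pi fun _ => dyadicMeasure))
      (Measure.pi fun _ => scaleMeasure) :=
    (measurePreserving_arrowProdEquivProdArrow ℝ ℕ (Fin d) (fun _ => volume)
      (fun _ => dyadicMeasure)).symm _
  have h2 := lintegral_prod_symm (μ := volume) (ν := Measure.pi fun _ => dyadicMeasure) (fun p => f ((MeasurableEquiv.arrowProdEquivProdArrow ℝ ℕ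
    (Fin d)).symm p)) (hf.comp h.measurable).aemeasurable
  rw [← h.lintegral_comp hf, h2, lintegral_countable']
  refine tsum_congr fun m => ?_
  rw [mul_comm, Measure.pi_singleton]
  simp only [dyadicMeasure_singleton, Finset.prod_pow_eq_pow_sum]
  rfl

theorem decayKernel_self (M m : ℕ) : decayKernel M m m = 1 := by simp [decayKernel]

theorem decayKernel_le_one (M m k : ℕ) : decayKernel M m k ≤ 1 := by
  unfold decayKernel
  split_ifs
  · exact pow_le_one' (by simp) _
  · simp

theorem decayKernel_ne_top (M m k : ℕ) : decayKernel M m k ≠ ⊤ :=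
  ne_top_of_le_ne_top ENNReal.one_ne_top (decayKernel_le_one M m k)

theorem decayKernel_mul_le (M m k l : ℕ) :
    decayKernel M m k * decayKernel M k l ≤ decayKernel M m l := by
  unfold decayKernel
  by_cases h1 : m ≤ k
  · by_cases h2 : k ≤ l
    · rw [if_pos h1, if_pos h2, if_pos (h1.trans h2), ← pow_add, ← mul_add]
      exact le_of_eq (by congr 2; omega)
    · simp [h2]
  · simp [h1]

/-! ### Abstract embeddings for p < 1 -/

/-- The function `G` of points and levels is dominated, in each direction, by its averages over
finer levels. -/
def IsDirectionallyDominated {d : ℕ} (C : ℝ≥0∞) (M : ℕ) (G : (Fin d → ℝ × ℕ) → ℝ≥0∞) : Prop :=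
  Measurable G ∧ ∀ z i, G z ≤ C * ∫⁻ w, decayKernel M (z i).2 w.2 *
    G (Function.update z i w) ∂scaleMeasure

/-- The directional domination is applied once for each coordinate in s. Successive kernels combine
by `decayKernel_mul_le`, and coordinates outside s are not moved, so that they contribute the factor
one. -/
theorem IsDirectionallyDominated.le_lmarginal {d : ℕ} {C : ℝ≥0∞} {M : ℕ}
    {G : (Fin d → ℝ × ℕ) → ℝ≥0∞} (hG : IsDirectionallyDominated C M G) (hC : C ≠ ⊤)
    (s : Finset (Fin d)) (z : Fin d → ℝ × ℕ) :
    G z ≤ C ^ s.card * lmarginal (fun _ => scaleMeasure) s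
      (fun w => (∏ i, decayKernel M (z i).2 (w i).2) * G w) z := by
  have hmeas : ∀ z : Fin d → ℝ × ℕ,
      Measurable fun w : Fin d → ℝ × ℕ => (∏ i, decayKernel M (z i).2 (w i).2) * G w := by
    intro z
    refine Measurable.mul (Finset.measurable_prod _ fun i _ => ?_) hG.1
    exact (measurable_of_countable (decayKernel M (z i).2)).comp
      (measurable_snd.comp (measurable_pi_apply i))
  induction s using Finset.induction generalizing z with
  | empty => simp [decayKernel_self]
  | insert i s hi ih =>
    rw [lmarginal_insert _ (hmeas z) hi, Finset.card_insert_of_notMem hi, pow_succ', mul_assoc]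
    refine (hG.2 z i).trans ?_
    gcongr
    rw [← lintegral_const_mul' _ _ (by finiteness)]
    refine lintegral_mono fun v => ?_
    calc decayKernel M (z i).2 v.2 * G (Function.update z i v)
        ≤ decayKernel M (z i).2 v.2 * (C ^ s.card * lmarginal (fun _ => scaleMeasure) s
          (fun w => (∏ j, decayKernel M (Function.update z i v j).2 (w j).2) * G w)
          (Function.update z i v)) := by gcongr; exact ih _
      _ = C ^ s.card * (decayKernel M (z i).2 v.2 * lmarginal (fun _ => scaleMeasure) s
          (fun w => (∏ j, decayKernel M (Function.update z i v j).2 (w j).2) * G w)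
          (Function.update z i v)) := by ring
      _ ≤ _ := by
        gcongr
        unfold lmarginal
        rw [← lintegral_const_mul' _ _ (decayKernel_ne_top _ _ _)]
        refine lintegral_mono fun y => ?_
        dsimp only
        rw [← mul_assoc]
        gcongr
        rw [← Finset.mul_prod_erase _ _ (Finset.mem_univ i),
          ← Finset.mul_prod_erase _ (fun j => decayKernel M (z j).2 _) (Finset.mem_univ i),
          ← mul_assoc]
        gcongr ?_ * ?_
        · rw [Function.update_self]
          exact decayKernel_mul_le _ _ _ _
        · refine Finset.prod_le_prod' fun j hj => ?_
          rw [Function.update_of_ne (Finset.ne_of_mem_erase hj)]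

theorem tsum_decayKernel_le (k : ℕ) : ∑' m, decayKernel 1 m k ≤ 2 := by
  have h : ∀ m ∉ Finset.range (k + 1), decayKernel 1 m k = 0 := by
    intro m hm
    rw [Finset.mem_range, not_lt] at hm
    simp only [decayKernel, ite_eq_right_iff]
    omega
  rw [tsum_eq_sum h, ← Finset.sum_range_reflect]
  calc ∑ j ∈ Finset.range (k + 1), decayKernel 1 (k + 1 - 1 - j) k
      = ∑ j ∈ Finset.range (k + 1), (2⁻¹ : ℝ≥0∞) ^ j := by
        refine Finset.sum_congr rfl fun j hj => ?_
        rw [Finset.mem_range] at hj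
        rw [decayKernel, if_pos (by omega)]
        congr 1
        omega
    _ ≤ ∑' j : ℕ, (2⁻¹ : ℝ≥0∞) ^ j := ENNReal.sum_le_tsum _
    _ = 2 := by rw [ENNReal.tsum_geometric, ENNReal.one_sub_inv_two, inv_inv]

theorem ENNReal.tsum_pi_prod {ι : Type*} {d : ℕ} (f : Fin d → ι → ℝ≥0∞) :
    ∑' m : Fin d → ι, ∏ i, f i (m i) = ∏ i, ∑' k, f i k := by
  induction d with
  | zero => simp
  | succ d ih =>
    rw [← (Fin.consEquiv fun _ => ι).tsum_eq, ENNReal.tsum_prod', Fin.prod_univ_succ, ← ih,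
      ← ENNReal.tsum_mul_right]
    refine tsum_congr fun k => ?_
    rw [← ENNReal.tsum_mul_left]
    refine tsum_congr fun m => ?_
    simp [Fin.consEquiv, Fin.prod_univ_succ]

theorem lintegral_le_rpow_mul_lintegral_rpow {X : Type*} [MeasurableSpace X] {μ : Measure X}
    {g : X → ℝ≥0∞} {A : ℝ≥0∞} (hA : A ≠ ⊤) (hg : ∀ x, g x ≤ A) {p : ℝ} (hp : 0 < p) (hp1 : p < 1) :
    ∫⁻ x, g x ∂μ ≤ A ^ (1 - p) * ∫⁻ x, g x ^ p ∂μ := by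
  rw [← lintegral_const_mul' _ _ (ENNReal.rpow_ne_top_of_nonneg (by linarith) hA)]
  refine lintegral_mono fun x => ?_
  calc g x = g x ^ (1 - p) * g x ^ p := by
        rw [← ENNReal.rpow_add_of_nonneg _ _ (by linarith) hp.le]; simp
    _ ≤ _ := by
        gcongr
        exact hg x

/-- A crude form of Young's inequality: a weighted geometric mean is at most the maximum, hence at
most the sum. The small factor δ in front of a makes the later absorption possible. -/
theorem ENNReal.rpow_mul_rpow_le_add {a b δ : ℝ≥0∞} (hδ : δ ≠ 0) (hδ' : δ ≠ ⊤) {p : ℝ} (hp : 0 < p)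
    (hp1 : p < 1) : a ^ (1 - p) * b ^ p ≤ δ * a + (δ⁻¹) ^ ((1 - p) / p) * b := by
  have h1 : a ^ (1 - p) * b ^ p = (δ * a) ^ (1 - p) * ((δ⁻¹) ^ ((1 - p) / p) * b) ^ p := by
    rw [ENNReal.mul_rpow_of_nonneg _ _ (by linarith), ENNReal.mul_rpow_of_nonneg _ _ hp.le,
      ← ENNReal.rpow_mul, div_mul_cancel₀ _ hp.ne', ENNReal.inv_rpow]
    have : δ ^ (1 - p) * (δ ^ (1 - p))⁻¹ = 1 :=
      ENNReal.mul_inv_cancel (by simp [hδ, hδ']) (ENNReal.rpow_ne_top_of_nonneg (by linarith) hδ')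
    calc _ = (δ ^ (1 - p) * (δ ^ (1 - p))⁻¹) * (a ^ (1 - p) * b ^ p) := by rw [this, one_mul]
      _ = _ := by ring
  rw [h1]
  set x := δ * a
  set y := (δ⁻¹) ^ ((1 - p) / p) * b
  have hm : ∀ {t}, t ≤ max x y → t ≤ x + y := fun h =>
    h.trans (max_le le_self_add le_add_self)
  refine hm ?_
  calc x ^ (1 - p) * y ^ p ≤ max x y ^ (1 - p) * max x y ^ p := by
        gcongr
        · exact le_max_left _ _
        · exact le_max_right _ _
    _ = max x y := by
        rw [← ENNReal.rpow_add_of_nonneg _ _ (by linarith) hp.le]; simp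

theorem mixedWeight_inv_rpow {d : ℕ} {p : ℝ} (hp : 0 < p) (m : Fin d → ℕ) :
    mixedWeight p⁻¹ m ^ p = 2 ^ (∑ i, m i) := by
  rw [mixedWeight, ENNReal.ofReal_rpow_of_pos (by positivity), ← Real.rpow_mul (by norm_num),
    mul_right_comm, inv_mul_cancel₀ hp.ne', one_mul, Real.rpow_natCast, ENNReal.ofReal_pow (by norm_num)]
  simp

/-- The pattern of B^{1/p}_{p,1} ⊂ B^1_{1,1}. Let a_m be the L₁ terms, b_m the L_p terms, and T_m
the sum of the a_k over finer levels with decaying coefficients. Domination bounds G at level m by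
C^d T_m, so g = g^{1-p} g^p yields a_m ≤ (C^d T_m)^{1-p} b_m^p. Since Σ T_m ≤ 2^d Σ a_m, Young's
inequality with small δ lets half of Σ a_m be absorbed, which requires this sum to be finite. -/
theorem IsDirectionallyDominated.exists_lintegral_le_tsum {C : ℝ≥0∞} (hC : C ≠ ⊤) (d : ℕ) {p : ℝ}
    (hp : 0 < p) (hp1 : p < 1) :
    ∃ D : ℝ≥0∞, D ≠ ⊤ ∧ ∀ G : (Fin d → ℝ × ℕ) → ℝ≥0∞, IsDirectionallyDominated C 1 G →
      ∫⁻ z, G z ∂Measure.pi (fun _ => scaleMeasure) ≠ ⊤ →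
      ∫⁻ z, G z ∂Measure.pi (fun _ => scaleMeasure) ≤
        D * ∑' m : Fin d → ℕ, mixedWeight p⁻¹ m *
          (∫⁻ x : Fin d → ℝ, G (fun i => (x i, m i)) ^ p) ^ (1 / p) := by
  -- Chosen so that δ C^d 2^d ≤ 1/2; the added one keeps δ finite when C is zero.
  set δ : ℝ≥0∞ := (2 * (2 ^ d * C ^ d + 1))⁻¹ with hδ
  have hδ0 : δ ≠ 0 := by rw [hδ, ENNReal.inv_ne_zero]; finiteness
  have hδt : δ ≠ ⊤ := by rw [hδ, ENNReal.inv_ne_top]; simp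
  have hδC : δ * (C ^ d * 2 ^ d) ≤ 2⁻¹ := by
    rw [hδ, ENNReal.mul_inv (by simp) (by simp), mul_assoc]
    refine mul_le_of_le_one_right' ?_
    rw [← ENNReal.div_eq_inv_mul]
    refine ENNReal.div_le_of_le_mul ?_
    rw [one_mul, mul_comm]
    exact le_self_add
  set Cδ : ℝ≥0∞ := (δ⁻¹) ^ ((1 - p) / p) with hCδ
  have hCδt : Cδ ≠ ⊤ := ENNReal.rpow_ne_top_of_nonneg (div_nonneg (by linarith) hp.le)
    (ENNReal.inv_ne_top.2 hδ0)
  refine ⟨2 * Cδ, by finiteness, fun G hG hfin => ?_⟩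
  set a : (Fin d → ℕ) → ℝ≥0∞ := fun m => 2 ^ (∑ i, m i) *
    ∫⁻ x : Fin d → ℝ, G (fun i => (x i, m i)) with ha
  set b : (Fin d → ℕ) → ℝ≥0∞ := fun m => mixedWeight p⁻¹ m *
          (∫⁻ x : Fin d → ℝ, G (fun i => (x i, m i)) ^ p) ^ (1 / p) with hb
  set T : (Fin d → ℕ) → ℝ≥0∞ := fun m => ∑' k : Fin d → ℕ, (∏ i, decayKernel 1 (m i) (k i)) * a k
    with hT
  have hGa : ∫⁻ z, G z ∂Measure.pi (fun _ => scaleMeasure) = ∑' m, a m :=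
    lintegral_pi_scaleMeasure hG.1
  have hTle : ∀ m, T m ≤ ∑' m, a m := fun m => ENNReal.tsum_le_tsum fun k =>
    mul_le_of_le_one_left' (Finset.prod_le_one' fun i _ => decayKernel_le_one _ _ _)
  have hTt : ∀ m, T m ≠ ⊤ := fun m => ne_top_of_le_ne_top (hGa ▸ hfin) (hTle m)
  have hGT : ∀ (m : Fin d → ℕ) (x : Fin d → ℝ), G (fun i => (x i, m i)) ≤ C ^ d * T m := by
    intro m x
    have h := hG.le_lmarginal hC Finset.univ (fun i => (x i, m i))
    rw [lmarginal_univ, Finset.card_univ, Fintype.card_fin] at h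
    refine h.trans (le_of_eq ?_)
    have hmeas : Measurable fun w : Fin d → ℝ × ℕ =>
        (∏ i, decayKernel 1 (m i) (w i).2) * G w := by
      refine Measurable.mul (Finset.measurable_prod _ fun i _ => ?_) hG.1
      exact (measurable_of_countable (decayKernel 1 (m i))).comp
        (measurable_snd.comp (measurable_pi_apply i))
    rw [lintegral_pi_scaleMeasure hmeas]
    congr 1
    refine tsum_congr fun k => ?_
    dsimp only
    rw [lintegral_const_mul' _ _ (ENNReal.prod_ne_top fun i _ => decayKernel_ne_top _ _ _)]
    simp only [ha]
    ring
  have hab : ∀ m, a m ≤ δ * (C ^ d * T m) + Cδ * b m := by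
    intro m
    refine le_trans ?_ (ENNReal.rpow_mul_rpow_le_add hδ0 hδt hp hp1)
    have h := lintegral_le_rpow_mul_lintegral_rpow (μ := (volume : Measure (Fin d → ℝ)))
      (ENNReal.mul_ne_top (by finiteness) (hTt m)) (hGT m) hp hp1
    calc a m ≤ 2 ^ (∑ i, m i) * ((C ^ d * T m) ^ (1 - p) *
          ∫⁻ x : Fin d → ℝ, G (fun i => (x i, m i)) ^ p) := by simp only [ha]; gcongr
      _ = _ := by
        simp only [hb]
        rw [ENNReal.mul_rpow_of_nonneg _ _ hp.le, mixedWeight_inv_rpow hp, ← ENNReal.rpow_mul,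
          one_div_mul_cancel hp.ne', ENNReal.rpow_one]
        ring
  have hsumT : ∑' m, T m ≤ 2 ^ d * ∑' k, a k := by
    simp only [hT]
    rw [ENNReal.tsum_comm, ← ENNReal.tsum_mul_left]
    refine ENNReal.tsum_le_tsum fun k => ?_
    rw [ENNReal.tsum_mul_right]
    gcongr
    rw [ENNReal.tsum_pi_prod (fun i m => decayKernel 1 m (k i))]
    refine (Finset.prod_le_prod' fun i _ => tsum_decayKernel_le (k i)).trans ?_
    simp
  rw [hGa] at hfin ⊢
  have h1 : ∑' m, a m ≤ 2⁻¹ * ∑' m, a m + Cδ * ∑' m, b m := by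
    calc ∑' m, a m ≤ ∑' m, (δ * (C ^ d * T m) + Cδ * b m) := ENNReal.tsum_le_tsum hab
      _ = δ * (C ^ d * ∑' m, T m) + Cδ * ∑' m, b m := by
        rw [ENNReal.tsum_add, ENNReal.tsum_mul_left, ENNReal.tsum_mul_left, ENNReal.tsum_mul_left]
      _ ≤ δ * (C ^ d * (2 ^ d * ∑' k, a k)) + Cδ * ∑' m, b m := by gcongr
      _ = δ * (C ^ d * 2 ^ d) * (∑' k, a k) + Cδ * ∑' m, b m := by ring
      _ ≤ _ := by gcongr
  have h2 : 2⁻¹ * ∑' m, a m + 2⁻¹ * ∑' m, a m = ∑' m, a m := by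
    rw [← add_mul, ENNReal.inv_two_add_inv_two, one_mul]
  have h3 : 2⁻¹ * ∑' m, a m ≤ Cδ * ∑' m, b m := by
    have hne : (2⁻¹ : ℝ≥0∞) * ∑' m, a m ≠ ⊤ := ENNReal.mul_ne_top (by simp) hfin
    refine (ENNReal.add_le_add_iff_left hne).1 ?_
    rw [h2]
    exact h1
  calc ∑' m, a m = 2 * (2⁻¹ * ∑' m, a m) := by
        rw [← mul_assoc, ENNReal.mul_inv_cancel (by simp) (by simp), one_mul]
    _ ≤ 2 * (Cδ * ∑' m, b m) := by gcongr
    _ = _ := by ring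

theorem ENNReal.tsum_two_pow_mul_le (b c : ℝ≥0∞) :
    ∑' k : ℕ, (if 2 ^ k * c ≤ b then 2 ^ k * c else 0) ≤ 2 * b := by
  refine ENNReal.tsum_le_of_sum_range_le fun K => ?_
  induction K with
  | zero => simp
  | succ K ih =>
    by_cases h : 2 ^ K * c ≤ b
    · calc ∑ k ∈ Finset.range (K + 1), (if 2 ^ k * c ≤ b then 2 ^ k * c else 0)
          ≤ ∑ k ∈ Finset.range (K + 1), 2 ^ k * c := by
            refine Finset.sum_le_sum fun k _ => ?_
            split_ifs <;> simp
        _ = ((2 ^ (K + 1) - 1 : ℕ) : ℝ≥0∞) * c := by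
            have h2 : ∑ k ∈ Finset.range (K + 1), 2 ^ k = 2 ^ (K + 1) - 1 := by
              simpa using Nat.geomSum_eq (le_refl 2) (K + 1)
            rw [← Finset.sum_mul, ← h2]
            simp
        _ ≤ (2 ^ (K + 1) : ℕ) * c := by gcongr; exact Nat.sub_le _ _
        _ = 2 * (2 ^ K * c) := by push_cast; ring
        _ ≤ _ := by gcongr
    · rw [Finset.sum_range_succ, if_neg h, add_zero]
      exact ih

theorem ENNReal.tsum_rpow_mul_le {r : ℝ} (hr : 0 < r) (b c : ℝ≥0∞) :
    ∑' k : ℕ, (if 2⁻¹ ^ k * b ≤ c then (2⁻¹ ^ k * b) ^ r else 0) ≤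
      (1 - 2⁻¹ ^ r)⁻¹ * c ^ r := by
  classical
  by_cases h : ∃ k : ℕ, 2⁻¹ ^ k * b ≤ c
  · set k₀ := Nat.find h
    have hk₀ : 2⁻¹ ^ k₀ * b ≤ c := Nat.find_spec h
    have hsupp : ∀ k, k < k₀ → (if 2⁻¹ ^ k * b ≤ c then (2⁻¹ ^ k * b) ^ r else 0) = 0 :=
      fun k hk => if_neg (Nat.find_min h hk)
    have hinj : Function.Injective (fun l => k₀ + l) := add_right_injective k₀
    rw [← hinj.tsum_eq]
    · rw [← ENNReal.tsum_geometric, ← ENNReal.tsum_mul_right]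
      refine ENNReal.tsum_le_tsum fun l => ?_
      have : (2⁻¹ ^ (k₀ + l) * b : ℝ≥0∞) ≤ 2⁻¹ ^ l * c := by
        rw [add_comm, pow_add, mul_assoc]
        gcongr
      calc _ ≤ (2⁻¹ ^ (k₀ + l) * b : ℝ≥0∞) ^ r := by split_ifs <;> simp
        _ ≤ (2⁻¹ ^ l * c) ^ r := by gcongr
        _ = _ := by
          rw [ENNReal.mul_rpow_of_nonneg _ _ hr.le, ← ENNReal.rpow_natCast, ← ENNReal.rpow_mul,
            mul_comm (l : ℝ), ENNReal.rpow_mul, ENNReal.rpow_natCast]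
    · intro k hk
      have : k₀ ≤ k := by
        by_contra hlt
        exact hk (hsupp k (not_le.1 hlt))
      exact ⟨k - k₀, by simp; omega⟩
  · push Not at h
    simp [fun k => (h k).not_ge]

/-- The sum is split where 2^k A^p crosses b. On the coarse side N_k ≤ A gives an increasing
geometric sum, and on the fine side the second bound gives a decreasing one because 1/p > 1. Both
are controlled by the term at the crossing, of size A^{1-p} b. Summability is thus gained from a
mere supremum over the levels. -/
theorem ENNReal.exists_tsum_two_pow_mul_le {p : ℝ} (hp : 0 < p) (hp1 : p < 1) :
    ∃ D : ℝ≥0∞, D ≠ ⊤ ∧ ∀ (N : ℕ → ℝ≥0∞) (A b : ℝ≥0∞), A ≠ ⊤ → (∀ k, N k ≤ A) →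
      (∀ k, N k ^ p ≤ 2⁻¹ ^ k * b) → ∑' k, 2 ^ k * N k ≤ D * (A ^ (1 - p) * b) := by
  have hr : 0 < 1 / p - 1 := by rw [sub_pos, lt_div_iff₀ hp]; linarith
  have h2r : (2⁻¹ : ℝ≥0∞) ^ (1 / p - 1) < 1 := ENNReal.rpow_lt_one (by simp) hr
  refine ⟨2 + (1 - 2⁻¹ ^ (1 / p - 1))⁻¹, ?_, fun N A b hA h1 h2 => ?_⟩
  · have : (1 - (2⁻¹ : ℝ≥0∞) ^ (1 / p - 1))⁻¹ ≠ ⊤ := by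
      rw [ENNReal.inv_ne_top]
      exact (tsub_pos_of_lt h2r).ne'
    finiteness
  have hk : ∀ k : ℕ, (2 : ℝ≥0∞) ^ k * 2⁻¹ ^ k = 1 := fun k => by
    rw [← mul_pow, ENNReal.mul_inv_cancel (by simp) (by simp), one_pow]
  have hA1 : A = A ^ (1 - p) * A ^ p := by
    rw [← ENNReal.rpow_add_of_nonneg _ _ (by linarith) hp.le]; simp
  have hterm : ∀ k, 2 ^ k * N k ≤ A ^ (1 - p) * (if 2 ^ k * A ^ p ≤ b then 2 ^ k * A ^ p else 0) +
      b * (if 2⁻¹ ^ k * b ≤ A ^ p then (2⁻¹ ^ k * b) ^ (1 / p - 1) else 0) := by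
    intro k
    by_cases h : 2 ^ k * A ^ p ≤ b
    · rw [if_pos h]
      refine le_trans ?_ le_self_add
      calc 2 ^ k * N k ≤ 2 ^ k * A := by gcongr; exact h1 k
        _ = 2 ^ k * (A ^ (1 - p) * A ^ p) := by rw [← hA1]
        _ = _ := by ring
    · have h' : 2⁻¹ ^ k * b ≤ A ^ p := by
        calc 2⁻¹ ^ k * b ≤ 2⁻¹ ^ k * (2 ^ k * A ^ p) := by gcongr; exact (not_le.1 h).le
          _ = A ^ p := by rw [← mul_assoc, mul_comm (2⁻¹ ^ k) (2 ^ k), hk, one_mul]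
      rw [if_pos h']
      refine le_trans ?_ le_add_self
      have : N k ≤ (2⁻¹ ^ k * b) ^ (1 / p) := by
        rw [← ENNReal.rpow_le_rpow_iff hp, ← ENNReal.rpow_mul, one_div_mul_cancel hp.ne',
          ENNReal.rpow_one]
        exact h2 k
      calc 2 ^ k * N k ≤ 2 ^ k * (2⁻¹ ^ k * b) ^ (1 / p) := by gcongr
        _ = 2 ^ k * ((2⁻¹ ^ k * b) ^ (1 / p - 1) * (2⁻¹ ^ k * b)) := by
          congr 1
          conv_rhs => rw [← ENNReal.rpow_one (2⁻¹ ^ k * b), ← ENNReal.rpow_mul, one_mul,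
            ← ENNReal.rpow_add_of_nonneg _ _ hr.le zero_le_one]
          congr 1
          ring
        _ = (2 ^ k * 2⁻¹ ^ k) * (b * (2⁻¹ ^ k * b) ^ (1 / p - 1)) := by ring
        _ = _ := by rw [hk, one_mul]
  calc ∑' k, 2 ^ k * N k ≤ _ := ENNReal.tsum_le_tsum hterm
    _ ≤ A ^ (1 - p) * (2 * b) + b * ((1 - 2⁻¹ ^ (1 / p - 1))⁻¹ * (A ^ p) ^ (1 / p - 1)) := by
      rw [ENNReal.tsum_add, ENNReal.tsum_mul_left, ENNReal.tsum_mul_left]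
      gcongr
      · exact ENNReal.tsum_two_pow_mul_le _ _
      · exact ENNReal.tsum_rpow_mul_le hr _ _
    _ = _ := by
      rw [← ENNReal.rpow_mul, mul_sub, mul_one_div_cancel hp.ne', mul_one]
      ring

/-- With S the integral of N, the summation over levels is applied for each fixed y with A = C S and
then integrated in y. The outcome is S ≤ const · S^{1-p} ∫ h, and the finite power S^{1-p} is
divided out. -/
theorem exists_lintegral_scaleMeasure_rpow_le {C D : ℝ≥0∞} (hC : C ≠ ⊤) (hD : D ≠ ⊤) {p : ℝ}
    (hp : 0 < p) (hp1 : p < 1) :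
    ∃ E : ℝ≥0∞, E ≠ ⊤ ∧ ∀ (N : ℝ × ℕ → ℝ≥0∞) (h : ℝ → ℝ≥0∞), Measurable N →
      (∀ w, N w ≤ C * ∫⁻ v, N v ∂scaleMeasure) → (∀ w, N w ^ p ≤ 2⁻¹ ^ w.2 * (D * h w.1)) →
      ∫⁻ v, N v ∂scaleMeasure ≠ ⊤ → (∫⁻ v, N v ∂scaleMeasure) ^ p ≤ E * ∫⁻ y, h y := by
  obtain ⟨E, hE, hsum⟩ := ENNReal.exists_tsum_two_pow_mul_le hp hp1
  refine ⟨E * C ^ (1 - p) * D, ?_, fun N h hN h1 h2 hfin => ?_⟩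
  · have := ENNReal.rpow_ne_top_of_nonneg (by linarith : 0 ≤ 1 - p) hC
    finiteness
  set S := ∫⁻ v, N v ∂scaleMeasure with hS
  have hmain : S ≤ E * C ^ (1 - p) * D * S ^ (1 - p) * ∫⁻ y, h y := by
    have hSp := ENNReal.rpow_ne_top_of_nonneg (by linarith : 0 ≤ 1 - p) hfin
    have hCp := ENNReal.rpow_ne_top_of_nonneg (by linarith : 0 ≤ 1 - p) hC
    have hSeq : S = ∑' k, 2 ^ k * ∫⁻ y, N (y, k) := lintegral_scaleMeasure hN
    refine hSeq.trans_le ?_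
    rw [← lintegral_const_mul' _ _ (by finiteness)]
    have : ∀ k : ℕ, 2 ^ k * ∫⁻ y, N (y, k) = ∫⁻ y, 2 ^ k * N (y, k) := fun k =>
      (lintegral_const_mul' _ _ (by finiteness)).symm
    simp_rw [this]
    have hmk : ∀ k : ℕ, Measurable fun y => (2 : ℝ≥0∞) ^ k * N (y, k) := fun k =>
      (hN.comp measurable_prodMk_right).const_mul _
    rw [← lintegral_tsum fun k => (hmk k).aemeasurable]
    refine lintegral_mono fun y => ?_
    refine (hsum (fun k => N (y, k)) (C * S) (D * h y) (by finiteness) (fun k => h1 _)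
      (fun k => h2 (y, k))).trans (le_of_eq ?_)
    rw [ENNReal.mul_rpow_of_nonneg _ _ (by linarith)]
    ring
  rcases eq_or_ne S 0 with h0 | h0
  · rw [h0, ENNReal.zero_rpow_of_pos hp]
    exact zero_le
  have hS1 : S ^ (1 - p) * S ^ p = S := by
    rw [← ENNReal.rpow_add_of_nonneg _ _ (by linarith) hp.le]; simp
  have hSp := ENNReal.rpow_ne_top_of_nonneg (by linarith : 0 ≤ 1 - p) hfin
  have hSp0 : S ^ (1 - p) ≠ 0 := by simp [ENNReal.rpow_eq_zero_iff, h0, hfin]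
  rw [← ENNReal.mul_le_mul_iff_right hSp0 hSp, hS1]
  refine hmain.trans (le_of_eq (by ring))

/-- The total level `2^{-∑_{i ∉ s} m_i}`. -/
noncomputable def coLevelWeight {d : ℕ} (s : Finset (Fin d)) (z : Fin d → ℝ × ℕ) : ℝ≥0∞ :=
  ∏ i ∈ sᶜ, 2⁻¹ ^ (z i).2

/-- The pattern of F^{1/p}_{p,∞} ⊂ B^1_{1,1}: the one-dimensional step is used in one direction
after the other. Integrating out the coordinate i uses up the factor 2^{-m_i} of the co-level
weight. The hypothesis on ⊤ supplies the finiteness needed for the division in each step. -/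
theorem IsDirectionallyDominated.exists_lmarginal_rpow_le {C : ℝ≥0∞} (hC : C ≠ ⊤) {d M : ℕ}
    {p : ℝ} (hp : 0 < p) (hp1 : p < 1) (s : Finset (Fin d)) :
    ∃ D : ℝ≥0∞, D ≠ ⊤ ∧ D ≠ 0 ∧ ∀ (G : (Fin d → ℝ × ℕ) → ℝ≥0∞) (H : (Fin d → ℝ) → ℝ≥0∞),
      IsDirectionallyDominated C M G → Measurable H →
      (∀ z, G z ^ p ≤ coLevelWeight ∅ z * H (fun i => (z i).1)) →
      (∀ s z, lmarginal (fun _ => volume) s H (fun i => (z i).1) ≠ ⊤ →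
        lmarginal (fun _ => scaleMeasure) s G z ≠ ⊤) →
      ∀ z, lmarginal (fun _ => scaleMeasure) s G z ^ p ≤
        D * (coLevelWeight s z * lmarginal (fun _ => volume) s H (fun i => (z i).1)) := by
  induction s using Finset.induction with
  | empty => exact ⟨1, by simp, by simp, fun G H hG hH hGH hfin z => by simpa using hGH z⟩
  | insert i s hi ih =>
    obtain ⟨D, hD, hD0, ih⟩ := ih
    obtain ⟨E, hE, hmain⟩ := exists_lintegral_scaleMeasure_rpow_le hC hD hp hp1
    refine ⟨E + 1, by finiteness, by simp, fun G H hG hH hGH hfin z => ?_⟩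
    set c := coLevelWeight (insert i s) z with hc
    have hc0 : c ≠ 0 := Finset.prod_ne_zero_iff.2 fun j _ => by simp
    have hct : c ≠ ⊤ := ENNReal.prod_ne_top fun j _ => by finiteness
    -- An infinite right-hand side leaves nothing to prove, provided that the constant is not zero;
    -- hence the `E + 1`. Otherwise the finiteness hypothesis applies.
    by_cases htop : lmarginal (fun _ => volume) (insert i s) H (fun i => (z i).1) = ⊤
    · rw [htop, ENNReal.mul_top hc0, ENNReal.mul_top (by simp)]
      exact le_top
    have hx : ∀ w : ℝ × ℕ, (fun j => (Function.update z i w j).1) =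
        Function.update (fun j => (z j).1) i w.1 := by
      intro w
      ext j
      by_cases hj : j = i
      · subst hj; simp
      · simp [hj]
    have hcw : ∀ w : ℝ × ℕ, coLevelWeight s (Function.update z i w) = 2⁻¹ ^ w.2 * c := by
      intro w
      have : sᶜ = insert i (insert i s)ᶜ := by
        ext j
        simp only [Finset.mem_compl, Finset.mem_insert]
        by_cases hj : j = i
        · subst hj; simp [hi]
        · simp [hj]
      rw [coLevelWeight, this, Finset.prod_insert (by simp), Function.update_self, hc,
        coLevelWeight]
      congr 1
      refine Finset.prod_congr rfl fun j hj => ?_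
      rw [Function.update_of_ne]
      rintro rfl
      simp at hj
    have hGi : ∀ z, lmarginal (fun _ => scaleMeasure) (insert i s) G z =
        ∫⁻ v, lmarginal (fun _ => scaleMeasure) s G (Function.update z i v) ∂scaleMeasure :=
      fun z => lmarginal_insert _ hG.1 hi z
    have hHi : ∀ x, lmarginal (fun _ => (volume : Measure ℝ)) (insert i s) H x =
        ∫⁻ y, lmarginal (fun _ => volume) s H (Function.update x i y) :=
      fun x => lmarginal_insert _ hH hi x
    have key := hmain (fun w => lmarginal (fun _ => scaleMeasure) s G (Function.update z i w))
      (fun y => c * lmarginal (fun _ => volume) s H (Function.update (fun j => (z j).1) i y))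
      ((hG.1.lmarginal _).comp (measurable_update z)) ?_ ?_ ?_
    · rw [← hGi, lintegral_const_mul' _ _ hct, ← hHi] at key
      refine key.trans ?_
      gcongr
      exact le_self_add
    · intro w
      -- Domination in direction i survives integration over the other coordinates, and the decay of
      -- the kernel is not needed here.
      rw [← hGi, ← lmarginal_update_of_mem _ (Finset.mem_insert_self i s) _ z w,
        lmarginal_insert' _ hG.1 hi]
      unfold lmarginal
      rw [← lintegral_const_mul' _ _ hC]
      refine lintegral_mono fun y => ?_
      refine (hG.2 _ i).trans ?_
      gcongr
      exact lintegral_mono fun v => mul_le_of_le_one_left' (decayKernel_le_one _ _ _)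
    · intro w
      refine (ih G H hG hH hGH hfin _).trans (le_of_eq ?_)
      rw [hx, hcw]
      ring
    · rw [← hGi]
      exact hfin _ _ htop

/-! ### Truncation and a priori finiteness -/

/-- The truncated weight `∏ 2^{-b (m_i - T)₊}`. -/
noncomputable def truncWeight {d : ℕ} (b T : ℕ) (z : Fin d → ℝ × ℕ) : ℝ≥0∞ :=
  ∏ i, 2⁻¹ ^ (b * ((z i).2 - T))

theorem measurable_truncWeight {d : ℕ} (b T : ℕ) :
    Measurable (truncWeight b T : (Fin d → ℝ × ℕ) → ℝ≥0∞) := by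
  refine Finset.measurable_prod _ fun i _ => ?_
  exact (measurable_of_countable fun k : ℕ => (2⁻¹ : ℝ≥0∞) ^ (b * (k - T))).comp
      (measurable_snd.comp (measurable_pi_apply i))

theorem truncWeight_le_one {d : ℕ} (b T : ℕ) (z : Fin d → ℝ × ℕ) : truncWeight b T z ≤ 1 :=
  Finset.prod_le_one' fun i _ => pow_le_one' (by simp) _

theorem truncWeight_mono {d : ℕ} (b : ℕ) (z : Fin d → ℝ × ℕ) :
    Monotone fun T => truncWeight b T z := fun T T' h => by
  refine Finset.prod_le_prod' fun i _ => pow_le_pow_right_of_le_one' (by simp) ?_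
  gcongr

theorem iSup_truncWeight_mul {d : ℕ} (b : ℕ) (z : Fin d → ℝ × ℕ) (g : ℝ≥0∞) :
    ⨆ T, truncWeight b T z * g = g := by
  refine le_antisymm (iSup_le fun T => mul_le_of_le_one_left' (truncWeight_le_one b T z)) ?_
  refine le_iSup_of_le (∑ i, (z i).2) ?_
  have : truncWeight b (∑ i, (z i).2) z = 1 := by
    refine Finset.prod_eq_one fun i hi => ?_
    have := Finset.single_le_sum (f := fun i => (z i).2) (fun _ _ => Nat.zero_le _) hi
    rw [Nat.sub_eq_zero_of_le this, mul_zero, pow_zero]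
  rw [this, one_mul]

/-- Since (k - T)₊ ≤ (k - m) + (m - T)₊ for m ≤ k, the truncated weight costs b orders of the
decaying kernel and leaves one. The constant C is the same for every T, which allows the limit T →
∞. -/
theorem IsDirectionallyDominated.truncWeight_mul {d : ℕ} {C : ℝ≥0∞} {b : ℕ}
    {G : (Fin d → ℝ × ℕ) → ℝ≥0∞} (hG : IsDirectionallyDominated C (b + 1) G) (T : ℕ) :
    IsDirectionallyDominated C 1 fun z => truncWeight b T z * G z := by
  refine ⟨(measurable_truncWeight b T).mul hG.1, fun z i => ?_⟩
  have ht : truncWeight b T z ≠ ⊤ := ne_top_of_le_ne_top (by simp) (truncWeight_le_one b T z)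
  calc truncWeight b T z * G z ≤ truncWeight b T z * (C * ∫⁻ w, decayKernel (b + 1) (z i).2 w.2 *
        G (Function.update z i w) ∂scaleMeasure) := by gcongr; exact hG.2 z i
    _ = C * ∫⁻ w, truncWeight b T z * (decayKernel (b + 1) (z i).2 w.2 *
        G (Function.update z i w)) ∂scaleMeasure := by rw [lintegral_const_mul' _ _ ht]; ring
    _ ≤ _ := by
      gcongr C * ?_
      refine lintegral_mono fun w => ?_
      rw [← mul_assoc, ← mul_assoc]
      gcongr ?_ * _
      rw [truncWeight, truncWeight, ← Finset.mul_prod_erase _ _ (Finset.mem_univ i),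
        ← Finset.mul_prod_erase _ (fun j => 2⁻¹ ^ (b * ((Function.update z i w j).2 - T)))
          (Finset.mem_univ i)]
      have : ∏ x ∈ Finset.univ.erase i, (2⁻¹ : ℝ≥0∞) ^ (b * ((Function.update z i w x).2 - T)) =
          ∏ x ∈ Finset.univ.erase i, 2⁻¹ ^ (b * ((z x).2 - T)) :=
        Finset.prod_congr rfl fun j hj => by
          rw [Function.update_of_ne (Finset.ne_of_mem_erase hj)]
      rw [this, mul_right_comm, ← mul_assoc]
      gcongr ?_ * _
      rw [Function.update_self]
      unfold decayKernel
      split_ifs with h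
      · rw [← pow_add, ← pow_add]
        refine pow_le_pow_right_of_le_one' (by simp) ?_
        have h1 : w.2 - T ≤ (w.2 - (z i).2) + ((z i).2 - T) := by omega
        calc 1 * (w.2 - (z i).2) + b * (w.2 - T) ≤ 1 * (w.2 - (z i).2) +
            b * ((w.2 - (z i).2) + ((z i).2 - T)) := by gcongr
          _ = _ := by ring
      · simp

theorem lmarginal_const_mul_prod {d : ℕ} {X : Type*} [MeasurableSpace X] {μ : Measure X}
    [SigmaFinite μ] {A : ℝ≥0∞} {φ : Fin d → X → ℝ≥0∞} (hφ : ∀ i, Measurable (φ i))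
    (s : Finset (Fin d)) (z : Fin d → X) :
    lmarginal (fun _ => μ) s (fun z => A * ∏ i, φ i (z i)) z =
      A * ((∏ i ∈ sᶜ, φ i (z i)) * ∏ i ∈ s, ∫⁻ x, φ i x ∂μ) := by
  have hmeas : Measurable fun z : Fin d → X => A * ∏ i, φ i (z i) :=
    (Finset.measurable_prod _ fun i _ => (hφ i).comp (measurable_pi_apply i)).const_mul _
  induction s using Finset.induction generalizing z with
  | empty => simp
  | insert i s hi ih =>
    rw [lmarginal_insert _ hmeas hi]
    simp_rw [ih]
    have : sᶜ = insert i (insert i s)ᶜ := by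
      ext j
      simp only [Finset.mem_compl, Finset.mem_insert]
      by_cases hj : j = i
      · subst hj; simp [hi]
      · simp [hj]
    have h2 : ∀ v, ∏ j ∈ sᶜ, φ j (Function.update z i v j) =
        φ i v * ∏ j ∈ (insert i s)ᶜ, φ j (z j) := by
      intro v
      rw [this, Finset.prod_insert (by simp), Function.update_self]
      congr 1
      refine Finset.prod_congr rfl fun j hj => ?_
      rw [Function.update_of_ne]
      rintro rfl
      simp at hj
    simp_rw [h2]
    rw [Finset.prod_insert hi]
    have h3 : ∀ v, A * (φ i v * (∏ j ∈ (insert i s)ᶜ, φ j (z j)) * ∏ j ∈ s, ∫⁻ x, φ j x ∂μ) =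
        φ i v * (A * ((∏ j ∈ (insert i s)ᶜ, φ j (z j)) * ∏ j ∈ s, ∫⁻ x, φ j x ∂μ)) :=
      fun v => by ring
    simp_rw [h3]
    rw [lintegral_mul_const _ (hφ i)]
    ring

theorem EuclideanSpace.lintegral_prod_eq {d : ℕ} {φ : Fin d → ℝ → ℝ≥0∞}
    (hφ : ∀ i, Measurable (φ i)) :
    ∫⁻ x : EuclideanSpace ℝ (Fin d), ∏ i, φ i (x i) = ∏ i, ∫⁻ t, φ i t := by
  have h := lmarginal_const_mul_prod (μ := volume) (A := 1) hφ Finset.univ (fun _ => 0)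
  rw [lmarginal_univ] at h
  simp only [one_mul, Finset.compl_univ, Finset.prod_empty] at h
  rw [← h, ← volume_pi]
  exact (PiLp.volume_preserving_ofLp (Fin d)).lintegral_comp_emb
    (MeasurableEquiv.toLp 2 (Fin d → ℝ)).symm.measurableEmbedding fun x => ∏ i, φ i (x i)

/-- A purely qualitative bound, with A and N depending on u. It says that a damping by a
sufficiently high power of 2^{-m_i} makes everything integrable. -/
theorem LocalMeans.exists_scaleFunction_le_prod {s : ℝ} {d : ℕ} (K : LocalMeans s)
    {u : 𝓢'(EuclideanSpace ℝ (Fin d), ℂ)} (hu : Distribution.dsupport u ⊆ unitCube d) :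
    ∃ (A : ℝ≥0∞) (N : ℕ) (R : ℝ), A ≠ ⊤ ∧ ∀ z, K.scaleFunction u z ≤
      A * ∏ i, 2 ^ (N * (z i).2) * (Set.Icc (-R) R).indicator 1 (z i).1 := by
  obtain ⟨U, N, hU, hrep⟩ := exists_isSpectralWeight u hu
  obtain ⟨A, hA, hle⟩ := K.exists_lintegral_symbol_mul_le hU
  obtain ⟨R, hR, hsupp⟩ := K.exists_conv_support d
  refine ⟨A, N, R, hA, fun z => ?_⟩
  by_cases h : ∃ i, R < |(z i).1|
  · have : K.scaleFunction u z = 0 := by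
      rw [scaleFunction, hsupp u hu _ _ h, enorm_zero]
    rw [this]
    exact zero_le
  · push Not at h
    have h1 : ∀ i, (Set.Icc (-R) R).indicator (1 : ℝ → ℝ≥0∞) (z i).1 = 1 := fun i =>
      Set.indicator_of_mem (s := Set.Icc (-R) R) (abs_le.1 (h i)) _
    simp only [h1, mul_one, Finset.prod_pow_eq_pow_sum, ← Finset.mul_sum]
    refine le_trans ?_ (hle fun i => (z i).2)
    rw [scaleFunction, K.conv_eq_fourierInv _ hrep]
    exact enorm_fourierInv_le _ _

/-- Beyond T the damping 2^{-(N+2)k} beats the growth 2^{Nk} and the weight 2^k of the measure, with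
a summable 2^{-k} to spare. -/
theorem lmarginal_truncWeight_mul_ne_top {d : ℕ} {G : (Fin d → ℝ × ℕ) → ℝ≥0∞} {A : ℝ≥0∞} {N : ℕ}
    {R : ℝ} (hA : A ≠ ⊤)
    (hG : ∀ z, G z ≤ A * ∏ i, 2 ^ (N * (z i).2) * (Set.Icc (-R) R).indicator 1 (z i).1)
    (T : ℕ) (s : Finset (Fin d)) (z : Fin d → ℝ × ℕ) :
    lmarginal (fun _ => scaleMeasure) s (fun z => truncWeight (N + 2) T z * G z) z ≠ ⊤ := by
  set φ : ℝ × ℕ → ℝ≥0∞ := fun w => 2⁻¹ ^ ((N + 2) * (w.2 - T)) *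
    (2 ^ (N * w.2) * (Set.Icc (-R) R).indicator 1 w.1) with hφ
  have hφm : Measurable φ := by
    refine Measurable.mul ?_ (Measurable.mul ?_ ?_)
    · exact (measurable_of_countable fun k : ℕ => (2⁻¹ : ℝ≥0∞) ^ ((N + 2) * (k - T))).comp
        measurable_snd
    · exact (measurable_of_countable fun k : ℕ => (2 : ℝ≥0∞) ^ (N * k)).comp measurable_snd
    · exact (measurable_const.indicator measurableSet_Icc).comp measurable_fst
  have hind : ∀ y, (Set.Icc (-R) R).indicator (1 : ℝ → ℝ≥0∞) y ≠ ⊤ := fun y => by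
    by_cases h : y ∈ Set.Icc (-R) R <;> simp [h]
  have hφt : ∀ w, φ w ≠ ⊤ := fun w => by
    have := hind w.1
    simp only [hφ]
    finiteness
  have hint : ∫⁻ w, φ w ∂scaleMeasure ≠ ⊤ := by
    rw [lintegral_scaleMeasure hφm]
    refine ne_top_of_le_ne_top (b := ∑' k : ℕ, 2⁻¹ ^ k * (2 ^ ((N + 2) * T) *
      volume (Set.Icc (-R) R))) ?_ (ENNReal.tsum_le_tsum fun k => ?_)
    · rw [ENNReal.tsum_mul_right, ENNReal.tsum_geometric, ENNReal.one_sub_inv_two, inv_inv,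
        Real.volume_Icc]
      finiteness
    · have hk : ∀ k : ℕ, (2 : ℝ≥0∞) ^ k * 2⁻¹ ^ k = 1 := fun k => by
        rw [← mul_pow, ENNReal.mul_inv_cancel (by simp) (by simp), one_pow]
      simp only [hφ]
      rw [lintegral_const_mul' _ _ (by finiteness), lintegral_const_mul' _ _ (by finiteness),
        lintegral_indicator_one measurableSet_Icc, ← mul_assoc, ← mul_assoc, ← mul_assoc]
      gcongr ?_ * _
      calc (2 : ℝ≥0∞) ^ k * 2⁻¹ ^ ((N + 2) * (k - T)) * 2 ^ (N * k)
          = 2⁻¹ ^ ((N + 2) * (k - T)) * 2 ^ ((N + 1) * k) * (2 ^ k * 2⁻¹ ^ k) := by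
            rw [hk]; ring
        _ = 2⁻¹ ^ k * (2⁻¹ ^ ((N + 2) * (k - T)) * 2 ^ ((N + 2) * k)) := by ring
        _ ≤ 2⁻¹ ^ k * (2⁻¹ ^ ((N + 2) * (k - T)) * 2 ^ ((N + 2) * (k - T) + (N + 2) * T)) := by
            gcongr
            · norm_num
            · rw [← mul_add]
              gcongr
              omega
        _ = 2⁻¹ ^ k * 2 ^ ((N + 2) * T) * (2 ^ ((N + 2) * (k - T)) * 2⁻¹ ^ ((N + 2) * (k - T))) := by
            rw [pow_add]; ring
        _ = _ := by rw [hk, mul_one]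
  refine ne_top_of_le_ne_top ?_ (lmarginal_mono (g := fun z => A * ∏ i, φ (z i)) (fun z => ?_) z)
  · rw [lmarginal_const_mul_prod fun _ => hφm]
    have h1 : ∏ i ∈ s, ∫⁻ x, φ x ∂scaleMeasure ≠ ⊤ := ENNReal.prod_ne_top fun i _ => hint
    have : ∏ i ∈ sᶜ, φ (z i) ≠ ⊤ := ENNReal.prod_ne_top fun i _ => hφt _
    finiteness
  · calc truncWeight (N + 2) T z * G z ≤ truncWeight (N + 2) T z * (A * ∏ i,
          2 ^ (N * (z i).2) * (Set.Icc (-R) R).indicator 1 (z i).1) := by gcongr; exact hG z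
      _ = A * ∏ i, φ (z i) := by
        simp only [hφ, truncWeight]
        rw [Finset.prod_mul_distrib (f := fun i => 2⁻¹ ^ ((N + 2) * ((z i).2 - T)))]
        ring

theorem lmarginal_eq_iSup_truncWeight {d : ℕ} {G : (Fin d → ℝ × ℕ) → ℝ≥0∞} (hG : Measurable G)
    (b : ℕ) (s : Finset (Fin d)) (z : Fin d → ℝ × ℕ) :
    lmarginal (fun _ => scaleMeasure) s G z =
      ⨆ T, lmarginal (fun _ => scaleMeasure) s (fun z => truncWeight b T z * G z) z := by
  unfold lmarginal
  rw [← lintegral_iSup]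
  · simp_rw [iSup_truncWeight_mul]
  · exact fun T => ((measurable_truncWeight b T).mul hG).comp measurable_updateFinset
  · exact fun T T' h y => mul_le_mul_left (truncWeight_mono b _ h) _

/-! ### Embeddings into the endpoint space -/

namespace LocalMeans

theorem isDirectionallyDominated_scaleFunction {s : ℝ} (K : LocalMeans s) (M : ℕ) :
    ∃ C : ℝ≥0∞, C ≠ ⊤ ∧ ∀ (d : ℕ) (u : 𝓢'(EuclideanSpace ℝ (Fin d), ℂ)),
      Distribution.dsupport u ⊆ unitCube d → IsDirectionallyDominated C M (K.scaleFunction u) := by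
  obtain ⟨C, hC, h⟩ := K.exists_scaleFunction_le M
  exact ⟨C, hC, fun d u hu => ⟨K.measurable_scaleFunction hu, h d u hu⟩⟩

/-- The abstract embedding needs a finite left-hand side. It is therefore applied first to the
truncations, whose integrals are finite, and monotone convergence in T gives finiteness of the full
integral whenever the right-hand side is finite. -/
theorem exists_lintegral_scaleFunction_le_tsum {s : ℝ} (K : LocalMeans s) (d : ℕ) {p : ℝ}
    (hp : 0 < p) (hp1 : p < 1) :
    ∃ D : ℝ≥0∞, D ≠ ⊤ ∧ ∀ u : 𝓢'(EuclideanSpace ℝ (Fin d), ℂ),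
      Distribution.dsupport u ⊆ unitCube d →
      ∫⁻ z, K.scaleFunction u z ∂Measure.pi (fun _ => scaleMeasure) ≤
        D * ∑' m : Fin d → ℕ, mixedWeight p⁻¹ m *
          (∫⁻ x : Fin d → ℝ, K.scaleFunction u (fun i => (x i, m i)) ^ p) ^ (1 / p) := by
  obtain ⟨C, hC, hK⟩ := K.isDirectionallyDominated_scaleFunction 1
  obtain ⟨D, hD, hmain⟩ := IsDirectionallyDominated.exists_lintegral_le_tsum hC d hp hp1
  refine ⟨D + 1, by finiteness, fun u hu => ?_⟩
  set S := ∑' m : Fin d → ℕ, mixedWeight p⁻¹ m *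
          (∫⁻ x : Fin d → ℝ, K.scaleFunction u (fun i => (x i, m i)) ^ p) ^ (1 / p) with hS
  rcases eq_or_ne S ⊤ with htop | htop
  · rw [htop, ENNReal.mul_top (by simp)]
    exact le_top
  refine (hmain _ (hK d u hu) ?_).trans (by gcongr; exact le_self_add)
  obtain ⟨A, N, R, hA, hgrow⟩ := K.exists_scaleFunction_le_prod hu
  -- These auxiliary constants depend on u through the growth exponent N. They only establish
  -- finiteness and do not enter the final constant.
  obtain ⟨C', hC', hK'⟩ := K.isDirectionallyDominated_scaleFunction (N + 2 + 1)
  obtain ⟨D', hD', hmain'⟩ := IsDirectionallyDominated.exists_lintegral_le_tsum hC' d hp hp1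
  have h0 : ∀ G : (Fin d → ℝ × ℕ) → ℝ≥0∞, ∫⁻ z, G z ∂Measure.pi (fun _ => scaleMeasure) =
      lmarginal (fun _ => scaleMeasure) Finset.univ G (fun _ => (0, 0)) := fun G => by
    rw [lmarginal_univ]
  refine ne_top_of_le_ne_top (ENNReal.mul_ne_top hD' htop) ?_
  rw [h0, lmarginal_eq_iSup_truncWeight (K.measurable_scaleFunction hu) (N + 2)]
  refine iSup_le fun T => ?_
  rw [← h0]
  refine (hmain' _ ((hK' d u hu).truncWeight_mul T) ?_).trans ?_
  · rw [h0]
    exact lmarginal_truncWeight_mul_ne_top hA hgrow T _ _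
  · gcongr
    refine ENNReal.tsum_le_tsum fun m => ?_
    gcongr with x
    exact mul_le_of_le_one_left' (truncWeight_le_one _ _ _)

/-- Here H is the p-th power of the supremum of 2^{|m|₁/p} |Ψ_m ∗ u|, so |Ψ_m ∗ u|^p ≤ 2^{-|m|₁} H,
as the step by step integration requires. Finiteness comes from truncation as in the Besov case, now
for every set of integrated directions. -/
theorem exists_lintegral_scaleFunction_rpow_le {s : ℝ} (K : LocalMeans s) (d : ℕ) {p : ℝ}
    (hp : 0 < p) (hp1 : p < 1) :
    ∃ D : ℝ≥0∞, D ≠ ⊤ ∧ ∀ u : 𝓢'(EuclideanSpace ℝ (Fin d), ℂ),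
      Distribution.dsupport u ⊆ unitCube d →
      (∫⁻ z, K.scaleFunction u z ∂Measure.pi (fun _ => scaleMeasure)) ^ p ≤
        D * ∫⁻ x : Fin d → ℝ, (⨆ m : Fin d → ℕ, mixedWeight p⁻¹ m *
          K.scaleFunction u (fun i => (x i, m i))) ^ p := by
  obtain ⟨C, hC, hK⟩ := K.isDirectionallyDominated_scaleFunction 1
  obtain ⟨D, hD, -, hmain⟩ := IsDirectionallyDominated.exists_lmarginal_rpow_le (M := 1) hC hp hp1
    (Finset.univ : Finset (Fin d))
  refine ⟨D, by finiteness, fun u hu => ?_⟩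
  set H : (Fin d → ℝ) → ℝ≥0∞ := fun x => (⨆ m : Fin d → ℕ, mixedWeight p⁻¹ m *
          K.scaleFunction u (fun i => (x i, m i))) ^ p with hHdef
  have hGm := K.measurable_scaleFunction hu
  have hH : Measurable H := by
    refine Measurable.pow_const (.iSup fun m => Measurable.const_mul (hGm.comp ?_) _) _
    exact measurable_pi_lambda _ fun i => (measurable_pi_apply i).prodMk measurable_const
  have hGH : ∀ z, K.scaleFunction u z ^ p ≤ coLevelWeight ∅ z * H (fun i => (z i).1) := by
    intro z
    have h1 : (coLevelWeight ∅ z : ℝ≥0∞) * 2 ^ (∑ i, (z i).2) = 1 := by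
      rw [coLevelWeight, Finset.compl_empty, Finset.prod_pow_eq_pow_sum, ← mul_pow,
        ENNReal.inv_mul_cancel (by simp) (by simp), one_pow]
    calc K.scaleFunction u z ^ p = coLevelWeight ∅ z * (mixedWeight p⁻¹ (fun i => (z i).2) *
          K.scaleFunction u z) ^ p := by
          rw [ENNReal.mul_rpow_of_nonneg _ _ hp.le, mixedWeight_inv_rpow hp, ← mul_assoc, h1,
            one_mul]
      _ ≤ _ := by
        simp only [hHdef]
        gcongr
        exact le_iSup (fun m : Fin d → ℕ => mixedWeight p⁻¹ m *
          K.scaleFunction u (fun i => ((z i).1, m i))) (fun i => (z i).2)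
  have key := hmain _ H (hK d u hu) hH hGH ?_ (fun _ => (0, 0))
  · rw [lmarginal_univ, lmarginal_univ] at key
    simpa [coLevelWeight, volume_pi] using key
  · intro t z hz
    obtain ⟨A, N, R, hA, hgrow⟩ := K.exists_scaleFunction_le_prod hu
    obtain ⟨C', hC', hK'⟩ := K.isDirectionallyDominated_scaleFunction (N + 2 + 1)
    obtain ⟨D', hD', -, hmain'⟩ := IsDirectionallyDominated.exists_lmarginal_rpow_le (M := 1)
      hC' hp hp1 t
    set B := D' * (coLevelWeight t z * lmarginal (fun _ => volume) t H (fun i => (z i).1)) with hB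
    have hBt : B ≠ ⊤ := by
      have : coLevelWeight t z ≠ ⊤ := ENNReal.prod_ne_top fun j _ => by finiteness
      finiteness
    refine ne_top_of_le_ne_top (b := B ^ (1 / p))
      (ENNReal.rpow_ne_top_of_nonneg (by positivity) hBt) ?_
    rw [lmarginal_eq_iSup_truncWeight hGm (N + 2)]
    refine iSup_le fun T => ?_
    rw [← ENNReal.rpow_le_rpow_iff hp, ← ENNReal.rpow_mul, one_div_mul_cancel hp.ne',
      ENNReal.rpow_one]
    refine hmain' _ H ((hK' d u hu).truncWeight_mul T) hH (fun z => ?_) (fun t z _ => ?_) z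
    · refine le_trans ?_ (hGH z)
      gcongr
      exact mul_le_of_le_one_left' (truncWeight_le_one _ _ _)
    · exact lmarginal_truncWeight_mul_ne_top hA hgrow T t z

end LocalMeans

theorem ellNorm_top {ι : Type*} (a : ι → ℝ≥0∞) : ellNorm ⊤ a = ⨆ i, a i := if_pos rfl

theorem ellNorm_of_ne_top {ι : Type*} {θ : ℝ≥0∞} (hθ : θ ≠ ⊤) (a : ι → ℝ≥0∞) :
    ellNorm θ a = (∑' i, a i ^ θ.toReal) ^ (1 / θ.toReal) := if_neg hθ

theorem ellNorm_one {ι : Type*} (a : ι → ℝ≥0∞) : ellNorm 1 a = ∑' i, a i := by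
  simp [ellNorm_of_ne_top]

theorem le_ellNorm {ι : Type*} {θ : ℝ≥0∞} (hθ : θ ≠ 0) (a : ι → ℝ≥0∞) (i : ι) :
    a i ≤ ellNorm θ a := by
  rcases eq_or_ne θ ⊤ with rfl | h
  · rw [ellNorm_top]
    exact le_iSup a i
  · have hp := ENNReal.toReal_pos hθ h
    rw [ellNorm_of_ne_top h, ← ENNReal.rpow_le_rpow_iff hp, ← ENNReal.rpow_mul,
      one_div_mul_cancel hp.ne', ENNReal.rpow_one]
    exact ENNReal.le_tsum i

/-- Each entry is at most the ℓ_θ norm N, hence a_i^{θ'} ≤ N^{θ'-θ} a_i^θ, and summation gives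
N^{θ'}. -/
theorem ellNorm_anti {ι : Type*} {θ θ' : ℝ≥0∞} (hθ : θ ≠ 0) (h : θ ≤ θ') (a : ι → ℝ≥0∞) :
    ellNorm θ' a ≤ ellNorm θ a := by
  rcases eq_or_ne θ' ⊤ with rfl | h'
  · rw [ellNorm_top]
    exact iSup_le fun i => le_ellNorm hθ a i
  · have ht : θ ≠ ⊤ := ne_top_of_le_ne_top h' h
    have hp := ENNReal.toReal_pos hθ ht
    have hpp : θ.toReal ≤ θ'.toReal := ENNReal.toReal_mono h' h
    have hp' : 0 < θ'.toReal := hp.trans_le hpp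
    set N := ellNorm θ a with hN
    have hNp : N ^ θ.toReal = ∑' i, a i ^ θ.toReal := by
      rw [hN, ellNorm_of_ne_top ht, ← ENNReal.rpow_mul, one_div_mul_cancel hp.ne',
        ENNReal.rpow_one]
    rw [ellNorm_of_ne_top h', ← ENNReal.rpow_le_rpow_iff hp', ← ENNReal.rpow_mul,
      one_div_mul_cancel hp'.ne', ENNReal.rpow_one]
    calc ∑' i, a i ^ θ'.toReal ≤ ∑' i, N ^ (θ'.toReal - θ.toReal) * a i ^ θ.toReal := by
          refine ENNReal.tsum_le_tsum fun i => ?_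
          calc a i ^ θ'.toReal = a i ^ (θ'.toReal - θ.toReal) * a i ^ θ.toReal := by
                rw [← ENNReal.rpow_add_of_nonneg _ _ (by linarith) hp.le, sub_add_cancel]
            _ ≤ _ := by
              gcongr
              exact le_ellNorm hθ a i
      _ = N ^ θ'.toReal := by
        rw [ENNReal.tsum_mul_left, ← hNp, ← ENNReal.rpow_add_of_nonneg _ _ (by linarith) hp.le,
          sub_add_cancel]

/-- The norm of the space `B^{1/q}_{q,1}`, computed from the kernels `K`. -/
noncomputable def LocalMeans.endpointNorm {s : ℝ} {d : ℕ} (K : LocalMeans s) (q : ℝ≥0∞)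
    (u : 𝓢'(EuclideanSpace ℝ (Fin d), ℂ)) : ℝ≥0∞ :=
  ∑' m : Fin d → ℕ, mixedWeight (q⁻¹).toReal m * eLpNorm (K.conv m u) q volume

namespace LocalMeans

variable {d : ℕ}

theorem endpointNorm_le_besovNorm {p θ : ℝ≥0∞} (K : LocalMeans (p⁻¹).toReal) (hθ : θ ≠ 0)
    (hθ1 : θ ≤ 1) (u : 𝓢'(EuclideanSpace ℝ (Fin d), ℂ)) :
    K.endpointNorm p u ≤ besovNorm K p θ u := by
  unfold endpointNorm besovNorm
  rw [← ellNorm_one (fun m : Fin d → ℕ => mixedWeight (p⁻¹).toReal m *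
    eLpNorm (K.conv m u) p volume)]
  exact ellNorm_anti hθ hθ1 _

theorem mixedWeight_one (m : Fin d → ℕ) : mixedWeight 1 m = 2 ^ (∑ i, m i) := by
  rw [mixedWeight, one_mul, Real.rpow_natCast, ENNReal.ofReal_pow (by norm_num)]
  simp

theorem lintegral_scaleFunction_rpow {s : ℝ} (K : LocalMeans s)
    (u : 𝓢'(EuclideanSpace ℝ (Fin d), ℂ)) (m : Fin d → ℕ) (p : ℝ) :
    ∫⁻ x : Fin d → ℝ, K.scaleFunction u (fun i => (x i, m i)) ^ p =
      ∫⁻ x, ‖K.conv m u x‖ₑ ^ p :=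
  (PiLp.volume_preserving_toLp (Fin d)).lintegral_comp_emb
    (MeasurableEquiv.toLp 2 (Fin d → ℝ)).measurableEmbedding fun x => ‖K.conv m u x‖ₑ ^ p

/-- This identity, next to the Nikol'skij factor, is the reason for weighting the levels by powers
of two in `scaleMeasure`. -/
theorem endpointNorm_one {s : ℝ} (K : LocalMeans s) {u : 𝓢'(EuclideanSpace ℝ (Fin d), ℂ)}
    (hu : Distribution.dsupport u ⊆ unitCube d) :
    K.endpointNorm 1 u = ∫⁻ z, K.scaleFunction u z ∂Measure.pi (fun _ => scaleMeasure) := by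
  rw [lintegral_pi_scaleMeasure (K.measurable_scaleFunction hu), endpointNorm]
  refine tsum_congr fun m => ?_
  rw [inv_one, ENNReal.toReal_one, mixedWeight_one, eLpNorm_one_eq_lintegral_enorm]
  have := K.lintegral_scaleFunction_rpow u m 1
  simp only [ENNReal.rpow_one] at this
  rw [this]

theorem exists_endpointNorm_one_le_besovNorm {p θ : ℝ≥0∞} (K : LocalMeans (p⁻¹).toReal)
    (hp : 0 < p) (hp1 : p < 1) (hθ : θ ≠ 0) (hθ1 : θ ≤ 1) (d : ℕ) :
    ∃ D : ℝ≥0∞, D ≠ ⊤ ∧ ∀ u : 𝓢'(EuclideanSpace ℝ (Fin d), ℂ),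
      Distribution.dsupport u ⊆ unitCube d → K.endpointNorm 1 u ≤ D * besovNorm K p θ u := by
  have hpt : p ≠ ⊤ := hp1.ne_top
  have hp' : 0 < p.toReal := ENNReal.toReal_pos hp.ne' hpt
  have hp1' : p.toReal < 1 := by
    rw [← ENNReal.toReal_one]
    exact (ENNReal.toReal_lt_toReal hpt (by simp)).2 hp1
  obtain ⟨D, hD, h⟩ := K.exists_lintegral_scaleFunction_le_tsum d hp' hp1'
  refine ⟨D, hD, fun u hu => ?_⟩
  rw [K.endpointNorm_one hu]
  refine (h u hu).trans ?_
  gcongr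
  refine le_trans (le_of_eq ?_) (ellNorm_anti hθ hθ1 _)
  rw [ellNorm_one]
  refine tsum_congr fun m => ?_
  have hw : mixedWeight p.toReal⁻¹ m = mixedWeight (p⁻¹).toReal m := by rw [ENNReal.toReal_inv]
  rw [lintegral_scaleFunction_rpow, eLpNorm_eq_lintegral_rpow_enorm_toReal hp.ne' hpt, hw]

/-- Only the supremum over the levels is used, which is the largest space θ = ∞; therefore every
fine index is admitted. -/
theorem exists_endpointNorm_one_le_triebelLizorkinNorm {p θ : ℝ≥0∞}
    (K : LocalMeans (p⁻¹).toReal) (hp : 0 < p) (hp1 : p < 1) (hθ : θ ≠ 0) (d : ℕ) :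
    ∃ D : ℝ≥0∞, D ≠ ⊤ ∧ ∀ u : 𝓢'(EuclideanSpace ℝ (Fin d), ℂ),
      Distribution.dsupport u ⊆ unitCube d →
      K.endpointNorm 1 u ≤ D * triebelLizorkinNorm K p θ u := by
  have hpt : p ≠ ⊤ := hp1.ne_top
  have hp' : 0 < p.toReal := ENNReal.toReal_pos hp.ne' hpt
  have hp1' : p.toReal < 1 := by
    rw [← ENNReal.toReal_one]
    exact (ENNReal.toReal_lt_toReal hpt (by simp)).2 hp1
  obtain ⟨D, hD, h⟩ := K.exists_lintegral_scaleFunction_rpow_le d hp' hp1'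
  refine ⟨D ^ (1 / p.toReal), ENNReal.rpow_ne_top_of_nonneg (by positivity) hD, fun u hu => ?_⟩
  rw [K.endpointNorm_one hu]
  have h1 : ∀ x : EuclideanSpace ℝ (Fin d), (⨆ m : Fin d → ℕ, mixedWeight (p⁻¹).toReal m *
      ‖K.conv m u x‖ₑ) ≤ ellNorm θ fun m : Fin d → ℕ => mixedWeight (p⁻¹).toReal m *
      ‖K.conv m u x‖ₑ := fun x => iSup_le fun m =>
    le_ellNorm hθ (fun m : Fin d → ℕ => mixedWeight (p⁻¹).toReal m * ‖K.conv m u x‖ₑ) m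
  have h2 : ∫⁻ x : Fin d → ℝ, (⨆ m : Fin d → ℕ, mixedWeight p.toReal⁻¹ m *
      K.scaleFunction u (fun i => (x i, m i))) ^ p.toReal =
      ∫⁻ x, (⨆ m : Fin d → ℕ, mixedWeight (p⁻¹).toReal m * ‖K.conv m u x‖ₑ) ^ p.toReal := by
    have hw : ∀ m : Fin d → ℕ, mixedWeight p.toReal⁻¹ m = mixedWeight (p⁻¹).toReal m :=
      fun m => by rw [ENNReal.toReal_inv]
    simp_rw [hw]
    exact (PiLp.volume_preserving_toLp (Fin d)).lintegral_comp_emb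
      (MeasurableEquiv.toLp 2 (Fin d → ℝ)).measurableEmbedding fun x =>
        (⨆ m : Fin d → ℕ, mixedWeight (p⁻¹).toReal m * ‖K.conv m u x‖ₑ) ^ p.toReal
  have h3 := h u hu
  rw [h2] at h3
  rw [triebelLizorkinNorm, eLpNorm_eq_lintegral_rpow_enorm_toReal hp.ne' hpt,
    ← ENNReal.mul_rpow_of_nonneg _ _ (by positivity), ← ENNReal.rpow_le_rpow_iff hp',
    ← ENNReal.rpow_mul, one_div_mul_cancel hp'.ne', ENNReal.rpow_one]
  refine h3.trans ?_
  gcongr with x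
  rw [enorm_eq_self]
  exact h1 x

end LocalMeans

/-! ### Dual kernels with compactly supported symbols -/

theorem ContDiff.div_of_tsupport {f g : ℝ → ℂ} {n : WithTop ℕ∞} (hf : ContDiff ℝ n f)
    (hg : ContDiff ℝ n g) (h : ∀ x ∈ tsupport f, g x ≠ 0) : ContDiff ℝ n (fun x => f x / g x) := by
  rw [contDiff_iff_contDiffAt]
  intro x
  by_cases hx : x ∈ tsupport f
  · simp_rw [div_eq_mul_inv]
    exact hf.contDiffAt.mul (hg.contDiffAt.inv (h x hx))
  · have h0 : f =ᶠ[nhds x] 0 := notMem_tsupport_iff_eventuallyEq.1 hx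
    refine (contDiffAt_const (c := (0 : ℂ))).congr_of_eventuallyEq ?_
    filter_upwards [h0] with y hy
    simp [hy]

/-- Symbols of a pair of kernels dual to the local means `K`, i.e. a smooth dyadic resolution of
unity is obtained from the products of the symbols. -/
structure DualMeans {s : ℝ} (K : LocalMeans s) where
  sym₀ : 𝓢(ℝ, ℂ)
  sym₁ : 𝓢(ℝ, ℂ)
  radius : ℝ
  radius_pos : 0 < radius
  sym₀_eq_zero : ∀ ξ, radius < |ξ| → sym₀ ξ = 0
  sym₁_eq_zero : ∀ ξ, radius < |ξ| → sym₁ ξ = 0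
  cutoff : ℝ → ℂ
  norm_cutoff_le : ∀ ξ, ‖cutoff ξ‖ ≤ 1
  cutoff_eventually : ∀ᶠ ξ in nhds (0 : ℝ), cutoff ξ = 1
  sym₀_mul : ∀ ξ, sym₀ ξ * 𝓕 K.Ψ₀ ξ = cutoff ξ
  sym₁_mul : ∀ ξ, sym₁ ξ * 𝓕 K.Ψ₁ ξ = cutoff (ξ / 2) - cutoff ξ

/-- With a smooth cut-off θ around the origin, the symbols are θ / 𝓕 Ψ₀ and (θ(·/2) - θ) / 𝓕 Ψ₁.
They are smooth because the Tauberian conditions exclude zeros of the denominators on the supports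
of the numerators. -/
theorem LocalMeans.nonempty_dualMeans {s : ℝ} (K : LocalMeans s) : Nonempty (DualMeans K) := by
  obtain ⟨ε, hε, h₀, h₁⟩ := K.tauberian
  -- The radii put the support of θ inside |ξ| < ε, and that of θ(·/2) - θ inside 3ε/5 ≤ |ξ| ≤ 9ε/5,
  -- hence inside the ring from ε/2 to 2ε.
  let b : ContDiffBump (0 : ℝ) := ⟨3 / 5 * ε, 9 / 10 * ε, by positivity, by linarith⟩
  set θ : ℝ → ℂ := fun x => ((b x : ℝ) : ℂ) with hθ
  have hθs : ContDiff ℝ ∞ θ := Complex.ofRealCLM.contDiff.comp b.contDiff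
  have hθ0 : ∀ x, 9 / 10 * ε ≤ |x| → θ x = 0 := fun x hx => by
    have : b x = 0 := b.zero_of_le_dist (by simpa [b, Real.dist_eq] using hx)
    simp [hθ, this]
  have hθ1 : ∀ x, |x| ≤ 3 / 5 * ε → θ x = 1 := fun x hx => by
    have : b x = 1 := b.one_of_mem_closedBall (by simpa [b, Real.dist_eq] using hx)
    simp [hθ, this]
  have hF₀ : ContDiff ℝ ∞ (𝓕 K.Ψ₀) := (𝓕 (K.compact₀.toSchwartzMap K.smooth₀)).smooth _
  have hF₁ : ContDiff ℝ ∞ (𝓕 K.Ψ₁) := (𝓕 (K.compact₁.toSchwartzMap K.smooth₁)).smooth _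
  set η : ℝ → ℂ := fun x => θ (x / 2) - θ x with hη
  have hηs : ContDiff ℝ ∞ η := (hθs.comp (contDiff_id.div_const 2)).sub hθs
  have ht₀ : tsupport θ ⊆ {x | |x| ≤ 9 / 10 * ε} := by
    refine closure_minimal (fun x hx => ?_) (isClosed_le continuous_abs continuous_const)
    by_contra hlt
    exact hx (hθ0 x (not_le.1 hlt).le)
  have ht₁ : tsupport η ⊆ {x | 3 / 5 * ε ≤ |x| ∧ |x| ≤ 9 / 5 * ε} := by
    refine closure_minimal (fun x hx => ?_) ((isClosed_le continuous_const continuous_abs).inter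
      (isClosed_le continuous_abs continuous_const))
    have h2 : |x / 2| = |x| / 2 := by rw [abs_div, abs_two]
    constructor
    · by_contra hlt
      rw [not_le] at hlt
      exact hx (by simp only [hη]; rw [hθ1 x hlt.le, hθ1 _ (by rw [h2]; linarith [abs_nonneg x]), sub_self])
    · by_contra hlt
      rw [not_le] at hlt
      exact hx (by simp only [hη]; rw [hθ0 x (by linarith), hθ0 _ (by rw [h2]; linarith), sub_self])
  have hne₀ : ∀ x ∈ tsupport θ, 𝓕 K.Ψ₀ x ≠ 0 := fun x hx => by
    have : |x| ≤ 9 / 10 * ε := ht₀ hx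
    exact norm_pos_iff.1 (h₀ x (by linarith))
  have hne₁ : ∀ x ∈ tsupport η, 𝓕 K.Ψ₁ x ≠ 0 := fun x hx => by
    have := ht₁ hx
    exact norm_pos_iff.1 (h₁ x (by linarith [this.1]) (by linarith [this.2]))
  have hz₀ : ∀ x, 2 * ε < |x| → θ x / 𝓕 K.Ψ₀ x = 0 := fun x hx => by
    rw [hθ0 x (by linarith), zero_div]
  have hz₁ : ∀ x, 2 * ε < |x| → η x / 𝓕 K.Ψ₁ x = 0 := fun x hx => by
    rw [image_eq_zero_of_notMem_tsupport (f := η) fun h => ?_, zero_div]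
    linarith [(ht₁ h).2]
  have hc : ∀ f : ℝ → ℂ, (∀ x, 2 * ε < |x| → f x = 0) → HasCompactSupport f := fun f hf =>
    HasCompactSupport.intro (isCompact_closedBall (0 : ℝ) (2 * ε)) fun x hx => hf x (by
      simpa [Real.dist_eq] using hx)
  refine ⟨{
    sym₀ := (hc _ hz₀).toSchwartzMap (hθs.div_of_tsupport hF₀ hne₀)
    sym₁ := (hc _ hz₁).toSchwartzMap (hηs.div_of_tsupport hF₁ hne₁)
    radius := 2 * ε
    radius_pos := by positivity
    sym₀_eq_zero := hz₀
    sym₁_eq_zero := hz₁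
    cutoff := θ
    norm_cutoff_le := fun ξ => ?_
    cutoff_eventually := ?_
    sym₀_mul := fun ξ => ?_
    sym₁_mul := fun ξ => ?_ }⟩
  · simp only [hθ, Complex.norm_real, Real.norm_eq_abs]
    rw [abs_of_nonneg b.nonneg]
    exact b.le_one
  · filter_upwards [Metric.closedBall_mem_nhds (0 : ℝ) (by positivity : 0 < 3 / 5 * ε)] with ξ hξ
    exact hθ1 ξ (by simpa [Real.dist_eq] using hξ)
  · change θ ξ / 𝓕 K.Ψ₀ ξ * 𝓕 K.Ψ₀ ξ = θ ξ
    by_cases h : ξ ∈ tsupport θ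
    · exact div_mul_cancel₀ _ (hne₀ ξ h)
    · rw [image_eq_zero_of_notMem_tsupport h, zero_div, zero_mul]
  · change η ξ / 𝓕 K.Ψ₁ ξ * 𝓕 K.Ψ₁ ξ = η ξ
    by_cases h : ξ ∈ tsupport η
    · exact div_mul_cancel₀ _ (hne₁ ξ h)
    · rw [image_eq_zero_of_notMem_tsupport h, zero_div, zero_mul]

namespace DualMeans

variable {s : ℝ} {K : LocalMeans s} (D : DualMeans K) {d : ℕ}

/-- The symbol of level `k`. -/
noncomputable def levelSymbol : ℕ → ℝ → ℂ
  | 0 => D.sym₀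
  | j + 1 => fun ξ => D.sym₁ (ξ / 2 ^ j)

/-- The kernel of level `k`. -/
noncomputable def levelKernel (k : ℕ) : ℝ → ℂ := 𝓕⁻ (D.levelSymbol k)

/-- The symbol of a multi-level. -/
noncomputable def symbol (m : Fin d → ℕ) (ξ : EuclideanSpace ℝ (Fin d)) : ℂ :=
  ∏ i, D.levelSymbol (m i) (ξ i)

/-- The kernel of a multi-level. -/
noncomputable def kernel (m : Fin d → ℕ) (x : EuclideanSpace ℝ (Fin d)) : ℂ :=
  ∏ i, D.levelKernel (m i) (x i)

theorem continuous_levelSymbol (k : ℕ) : Continuous (D.levelSymbol k) := by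
  cases k with
  | zero => exact D.sym₀.continuous
  | succ j => exact D.sym₁.continuous.comp (continuous_id.div_const _)

theorem levelSymbol_eq_zero {k : ℕ} {ξ : ℝ} (h : D.radius * 2 ^ k < |ξ|) :
    D.levelSymbol k ξ = 0 := by
  cases k with
  | zero => exact D.sym₀_eq_zero ξ (by simpa using h)
  | succ j =>
    refine D.sym₁_eq_zero _ ?_
    rw [abs_div, abs_of_pos (by positivity : (0 : ℝ) < 2 ^ j), lt_div_iff₀ (by positivity)]
    refine lt_of_le_of_lt ?_ h
    gcongr
    · exact D.radius_pos.le
    · norm_num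
    · omega

theorem exists_norm_levelSymbol_le : ∃ B : ℝ, 0 < B ∧ ∀ k ξ, ‖D.levelSymbol k ξ‖ ≤ B := by
  obtain ⟨C₀, h0, hC₀⟩ := D.sym₀.exists_one_add_norm_pow_mul_le 0
  obtain ⟨C₁, h1, hC₁⟩ := D.sym₁.exists_one_add_norm_pow_mul_le 0
  refine ⟨max C₀ C₁, lt_max_of_lt_left h0, fun k ξ => ?_⟩
  cases k with
  | zero => exact le_max_of_le_left (by simpa [levelSymbol] using hC₀ ξ)
  | succ j => exact le_max_of_le_right (by simpa [levelSymbol] using hC₁ (ξ / 2 ^ j))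

theorem continuous_symbol (m : Fin d → ℕ) : Continuous (D.symbol m) := by
  unfold symbol
  exact continuous_finsetProd _ fun i _ => (D.continuous_levelSymbol (m i)).comp (by fun_prop)

theorem symbol_eq_zero {m : Fin d → ℕ} {ξ : EuclideanSpace ℝ (Fin d)} {i : Fin d}
    (h : D.radius * 2 ^ (m i) < |ξ i|) : D.symbol m ξ = 0 :=
  Finset.prod_eq_zero (Finset.mem_univ i) (D.levelSymbol_eq_zero h)

theorem exists_norm_symbol_le (d : ℕ) :
    ∃ B : ℝ, 0 < B ∧ ∀ (m : Fin d → ℕ) ξ, ‖D.symbol m ξ‖ ≤ B := by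
  obtain ⟨B, hB, h⟩ := D.exists_norm_levelSymbol_le
  refine ⟨B ^ d, by positivity, fun m ξ => ?_⟩
  rw [symbol, norm_prod]
  calc ∏ i, ‖D.levelSymbol (m i) (ξ i)‖ ≤ ∏ _i : Fin d, B :=
        Finset.prod_le_prod (fun _ _ => norm_nonneg _) fun i _ => h _ _
    _ = B ^ d := by simp

theorem hasCompactSupport_symbol (m : Fin d → ℕ) : HasCompactSupport (D.symbol m) := by
  refine EuclideanSpace.hasCompactSupport_of_forall (R := ∑ i, D.radius * 2 ^ (m i))
    fun x ⟨i, hi⟩ => D.symbol_eq_zero (i := i) (lt_of_le_of_lt ?_ hi)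
  exact Finset.single_le_sum (f := fun i => D.radius * 2 ^ (m i))
    (fun j _ => mul_nonneg D.radius_pos.le (by positivity)) (Finset.mem_univ i)

theorem integrable_symbol (m : Fin d → ℕ) : Integrable (D.symbol m) :=
  (D.continuous_symbol m).integrable_of_hasCompactSupport (D.hasCompactSupport_symbol m)

theorem fourierInv_symbol (m : Fin d → ℕ) : 𝓕⁻ (D.symbol m) = D.kernel m := by
  ext x
  rw [Real.fourierInv_eq_fourier_neg, kernel]
  have := _root_.fourier_tensor (fun i => D.levelSymbol (m i)) (-x)
  refine Eq.trans this (Finset.prod_congr rfl fun i _ => ?_)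
  rw [levelKernel, Real.fourierInv_eq_fourier_neg]
  rfl

theorem continuous_kernel (m : Fin d → ℕ) : Continuous (D.kernel m) := by
  rw [← fourierInv_symbol]
  exact (D.integrable_symbol m).continuous_fourierInv

theorem levelKernel_succ (j : ℕ) (x : ℝ) :
    D.levelKernel (j + 1) x = 2 ^ j * (𝓕⁻ D.sym₁) (2 ^ j * x) := by
  have h2 : (0 : ℝ) < (2 ^ j)⁻¹ := by positivity
  have h := Real.fourier_comp_mul_left_ofPos D.sym₁ h2 (-x)
  rw [levelKernel, Real.fourierInv_eq_fourier_neg, SchwartzMap.fourierInv_coe,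
    Real.fourierInv_eq_fourier_neg]
  have e1 : -(2 ^ j * x) = -x / (2 ^ j)⁻¹ := by field_simp
  rw [e1, ← h, Real.fourier_real_eq, Real.fourier_real_eq, ← integral_const_mul]
  refine integral_congr_ae (Filter.Eventually.of_forall fun v => ?_)
  simp only [levelSymbol, Circle.smul_def, smul_eq_mul]
  have : (2 : ℂ) ^ j ≠ 0 := pow_ne_zero _ two_ne_zero
  push_cast
  rw [inv_mul_eq_div]
  field_simp

theorem exists_norm_levelKernel_le (E : ℕ) : ∃ C : ℝ, 0 < C ∧ ∀ k x,
    (1 + 2 ^ k * |x|) ^ E * ‖D.levelKernel k x‖ ≤ C * 2 ^ k := by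
  obtain ⟨C₀, h0, hC₀⟩ := (𝓕⁻ D.sym₀).exists_one_add_norm_pow_mul_le E
  obtain ⟨C₁, h1, hC₁⟩ := (𝓕⁻ D.sym₁).exists_one_add_norm_pow_mul_le E
  -- The factor 2^E pays for the index shift: the kernel of level j + 1 is dilated by 2^j only.
  refine ⟨C₀ + 2 ^ E * C₁, by positivity, fun k x => ?_⟩
  cases k with
  | zero =>
    have := hC₀ x
    rw [SchwartzMap.fourierInv_coe, Real.norm_eq_abs] at this
    simp only [pow_zero, one_mul, mul_one]
    have h3 : 0 ≤ 2 ^ E * C₁ := by positivity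
    exact this.trans (by linarith)
  | succ j =>
    have := hC₁ (2 ^ j * x)
    rw [Real.norm_eq_abs, abs_mul, abs_of_pos (by positivity : (0 : ℝ) < 2 ^ j)] at this
    rw [levelKernel_succ, norm_mul, norm_pow, Complex.norm_ofNat]
    calc (1 + 2 ^ (j + 1) * |x|) ^ E * (2 ^ j * ‖(𝓕⁻ D.sym₁) (2 ^ j * x)‖)
        ≤ (2 * (1 + 2 ^ j * |x|)) ^ E * (2 ^ j * ‖(𝓕⁻ D.sym₁) (2 ^ j * x)‖) := by
          gcongr
          rw [pow_succ]
          linarith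
      _ = 2 ^ E * 2 ^ j * ((1 + 2 ^ j * |x|) ^ E * ‖(𝓕⁻ D.sym₁) (2 ^ j * x)‖) := by
          rw [mul_pow]; ring
      _ ≤ 2 ^ E * 2 ^ j * C₁ := by gcongr
      _ ≤ _ := by
        rw [pow_succ]
        have h3 : 0 ≤ C₀ * (2 ^ j * 2) := by positivity
        have h4 : 0 ≤ 2 ^ E * C₁ * 2 ^ j := by positivity
        nlinarith

/-- The sum telescopes, each level j + 1 contributing a difference of the cut-off at the consecutive
scales 2^{j+1} and 2^j. -/
theorem sum_levelSymbol_mul (J : ℕ) (ξ : ℝ) :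
    ∑ k ∈ Finset.range (J + 1), D.levelSymbol k ξ * 𝓕 (K.level k) ξ = D.cutoff (ξ / 2 ^ J) := by
  induction J with
  | zero => simpa [levelSymbol, LocalMeans.level] using D.sym₀_mul ξ
  | succ J ih =>
    rw [Finset.sum_range_succ, ih, LocalMeans.fourier_level_succ]
    have := D.sym₁_mul (ξ / 2 ^ J)
    rw [levelSymbol, this, pow_succ, div_div]
    ring

theorem sum_symbol_mul (J : ℕ) (ξ : EuclideanSpace ℝ (Fin d)) :
    ∑ m ∈ Fintype.piFinset fun _ : Fin d => Finset.range (J + 1), D.symbol m ξ * K.symbol m ξ =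
      ∏ i, D.cutoff (ξ i / 2 ^ J) := by
  simp_rw [← D.sum_levelSymbol_mul]
  rw [Finset.prod_univ_sum]
  refine Finset.sum_congr rfl fun m _ => ?_
  rw [symbol, LocalMeans.symbol, Finset.prod_mul_distrib]

end DualMeans

/-! ### Size of the building blocks -/

/-- Hölder's inequality with the dual norm of w interpolated between L_∞ and L₁. It is obtained by
comparing the L₁ and L_q norms for the finite-mass measure w dμ ≤ A dμ, which covers q = 1 and q = ∞
without conjugate exponents. It is used for the dual kernels as well as for the weights of the error
functional. -/
theorem lintegral_enorm_mul_le {X E : Type*} [MeasurableSpace X] [NormedAddCommGroup E]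
    {μ : Measure X} {g : X → E} (hg : AEStronglyMeasurable g μ) {w : X → ℝ≥0∞}
    (hw : Measurable w) {A B : ℝ≥0∞} (hA : ∀ᵐ x ∂μ, w x ≤ A) (hB : ∫⁻ x, w x ∂μ ≤ B) {q : ℝ≥0∞}
    (hq : 1 ≤ q) :
    ∫⁻ x, w x * ‖g x‖ₑ ∂μ ≤
      A ^ (q⁻¹).toReal * B ^ (1 - (q⁻¹).toReal) * eLpNorm g q μ := by
  have hr : (q⁻¹).toReal ≤ 1 := by
    rw [← ENNReal.toReal_one]
    exact ENNReal.toReal_mono (by simp) (ENNReal.inv_le_one.2 hq)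
  rcases eq_or_ne A 0 with rfl | hA0
  · have : ∫⁻ x, w x * ‖g x‖ₑ ∂μ = 0 := by
      refine (lintegral_congr_ae (g := fun _ => 0) ?_).trans lintegral_zero
      filter_upwards [hA] with x hx
      simp [nonpos_iff_eq_zero.1 hx]
    rw [this]
    exact zero_le
  set ν := μ.withDensity w with hν
  have hνμ : ν ≤ A • μ := by
    refine Measure.le_iff.2 fun s hs => ?_
    rw [withDensity_apply _ hs, Measure.smul_apply, smul_eq_mul]
    calc ∫⁻ x in s, w x ∂μ ≤ ∫⁻ _ in s, A ∂μ := lintegral_mono_ae (ae_restrict_of_ae hA)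
      _ = _ := by simp
  have hac : ν ≪ μ := withDensity_absolutelyContinuous _ _
  have h1 : ∫⁻ x, w x * ‖g x‖ₑ ∂μ = eLpNorm g 1 ν := by
    rw [eLpNorm_one_eq_lintegral_enorm, hν, lintegral_withDensity_eq_lintegral_mul₀ hw.aemeasurable
      hg.enorm]
    rfl
  have hu : ν Set.univ ≤ B := by
    rw [hν, withDensity_apply _ MeasurableSet.univ, Measure.restrict_univ]
    exact hB
  rw [h1]
  refine (eLpNorm_le_eLpNorm_mul_rpow_measure_univ hq (hg.mono_ac hac)).trans ?_
  have h2 : eLpNorm g q ν ≤ A ^ (q⁻¹).toReal * eLpNorm g q μ := by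
    refine (eLpNorm_mono_measure g hνμ).trans (le_of_eq ?_)
    rw [eLpNorm_smul_measure_of_ne_zero hA0, one_div, smul_eq_mul]
  have h3 : (1 : ℝ) / (1 : ℝ≥0∞).toReal - 1 / q.toReal = 1 - (q⁻¹).toReal := by
    rw [ENNReal.toReal_one, ENNReal.toReal_inv]; norm_num
  rw [h3]
  calc eLpNorm g q ν * ν Set.univ ^ (1 - (q⁻¹).toReal)
      ≤ (A ^ (q⁻¹).toReal * eLpNorm g q μ) * B ^ (1 - (q⁻¹).toReal) := by gcongr
    _ = _ := by ring

/-- The decaying weight `∏ (1 + |x_i|)^{-E}`. -/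
noncomputable def tensorDecay {d : ℕ} (E : ℕ) (x : EuclideanSpace ℝ (Fin d)) : ℝ :=
  ∏ i, ((1 + |x i|) ^ E)⁻¹

theorem tensorDecay_pos {d : ℕ} (E : ℕ) (x : EuclideanSpace ℝ (Fin d)) : 0 < tensorDecay E x :=
  Finset.prod_pos fun i _ => by positivity

theorem tensorDecay_le_mul {d : ℕ} {R : ℝ} (hR : 0 < R) (E : ℕ) (x y : EuclideanSpace ℝ (Fin d))
    (hy : ∀ i, |y i| ≤ R) :
    tensorDecay E (x - y) ≤ (1 + R) ^ (E * d) * tensorDecay E x := by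
  have : (1 + R) ^ (E * d) = ∏ _i : Fin d, (1 + R) ^ E := by simp [pow_mul]
  rw [tensorDecay, tensorDecay, this, ← Finset.prod_mul_distrib]
  refine Finset.prod_le_prod (fun i _ => by positivity) fun i _ => ?_
  rw [← div_eq_mul_inv, le_div_iff₀ (by positivity), inv_mul_le_iff₀ (by positivity), ← mul_pow]
  refine pow_le_pow_left₀ (by positivity) ?_ _
  have h1 : |x i| ≤ |(x - y) i| + |y i| := by
    have := abs_add_le ((x - y) i) (y i)
    simpa using this
  nlinarith [hy i, abs_nonneg ((x - y) i)]

theorem lintegral_dyadic_decay (k : ℕ) : ∫⁻ t : ℝ, ENNReal.ofReal (2 ^ k * ((1 + 2 ^ k * |t|) ^ 2)⁻¹) =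
    ∫⁻ t : ℝ, ENNReal.ofReal (((1 + |t|) ^ 2)⁻¹) := by
  have h2 : (0 : ℝ) < 2 ^ k := by positivity
  have h := lintegral_map_equiv (μ := (volume : Measure ℝ))
    (fun t : ℝ => ENNReal.ofReal (((1 + |t|) ^ 2)⁻¹))
    (Homeomorph.mulLeft₀ ((2 : ℝ) ^ k) h2.ne').toMeasurableEquiv
  have h3 : Measure.map (Homeomorph.mulLeft₀ ((2 : ℝ) ^ k) h2.ne').toMeasurableEquiv volume =
      ENNReal.ofReal |(2 ^ k : ℝ)⁻¹| • (volume : Measure ℝ) :=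
    Real.map_volume_mul_left h2.ne'
  rw [h3, lintegral_smul_measure, abs_of_pos (by positivity)] at h
  have h4 : ∀ t : ℝ, ENNReal.ofReal (2 ^ k * ((1 + 2 ^ k * |t|) ^ 2)⁻¹) =
      ENNReal.ofReal (2 ^ k) * ENNReal.ofReal (((1 + |2 ^ k * t|) ^ 2)⁻¹) := fun t => by
    rw [← ENNReal.ofReal_mul h2.le, abs_mul, abs_of_pos h2]
  simp_rw [h4]
  rw [lintegral_const_mul' _ _ (by finiteness)]
  change ENNReal.ofReal (2 ^ k) * ∫⁻ t : ℝ, ENNReal.ofReal (((1 + |2 ^ k * t|) ^ 2)⁻¹) = _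
  have h5 : (∫⁻ t : ℝ, ENNReal.ofReal (((1 + |2 ^ k * t|) ^ 2)⁻¹)) =
    ENNReal.ofReal (2 ^ k)⁻¹ • ∫⁻ t : ℝ, ENNReal.ofReal (((1 + |t|) ^ 2)⁻¹) := h.symm
  rw [h5, smul_eq_mul, ← mul_assoc, ← ENNReal.ofReal_mul h2.le, mul_inv_cancel₀ h2.ne',
    ENNReal.ofReal_one, one_mul]

theorem lintegral_decay_ne_top : ∫⁻ t : ℝ, ENNReal.ofReal (((1 + |t|) ^ 2)⁻¹) ≠ ⊤ := by
  have h : Integrable fun t : ℝ => (1 + ‖t‖) ^ (-(2 : ℝ)) :=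
    integrable_one_add_norm (by simp)
  refine ne_top_of_le_ne_top h.2.ne (lintegral_mono fun t => ?_)
  rw [← ofReal_norm]
  refine ENNReal.ofReal_le_ofReal ?_
  dsimp only
  have h0 : 0 < 1 + |t| := by positivity
  rw [Real.norm_eq_abs t, Real.rpow_neg h0.le, Real.rpow_two]
  exact le_abs_self _

namespace DualMeans

variable {s : ℝ} {K : LocalMeans s} (D : DualMeans K)

/-- Of E + 2 orders of decay at the scales 2^{-m_i}, the first E are weakened to decay at scale one,
uniformly in m. The other two stay in a factor whose L₁ norm does not depend on m. -/
theorem exists_norm_kernel_le (d E : ℕ) : ∃ C : ℝ, 0 < C ∧ ∀ (m : Fin d → ℕ) x,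
    ‖D.kernel m x‖ ≤ C * tensorDecay E x * ∏ i, (2 ^ (m i) * ((1 + 2 ^ (m i) * |x i|) ^ 2)⁻¹) := by
  obtain ⟨C, hC, h⟩ := D.exists_norm_levelKernel_le (E + 2)
  refine ⟨C ^ d, by positivity, fun m x => ?_⟩
  have : C ^ d = ∏ _i : Fin d, C := by simp
  rw [kernel, norm_prod, this, tensorDecay, ← Finset.prod_mul_distrib, ← Finset.prod_mul_distrib]
  refine Finset.prod_le_prod (fun _ _ => norm_nonneg _) fun i _ => ?_
  have h1 := h (m i) (x i)
  have h2 : (1 + |x i|) ^ E ≤ (1 + 2 ^ (m i) * |x i|) ^ E := by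
    gcongr
    exact le_mul_of_one_le_left (abs_nonneg _) (one_le_pow₀ (by norm_num))
  rw [show C * ((1 + |x i|) ^ E)⁻¹ * (2 ^ m i * ((1 + 2 ^ m i * |x i|) ^ 2)⁻¹) =
    (C * 2 ^ m i) / ((1 + |x i|) ^ E * (1 + 2 ^ m i * |x i|) ^ 2) by field_simp,
    le_div_iff₀ (by positivity)]
  refine le_trans ?_ h1
  rw [pow_add, mul_comm]
  gcongr

/-- The size of the functions `Λ_m * g` for a function `g` supported in a fixed cube. -/
theorem exists_lintegral_kernel_le (d E : ℕ) {R : ℝ} (hR : 0 < R) :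
    ∃ C : ℝ, 0 < C ∧ ∀ (q : ℝ≥0∞), 1 ≤ q → ∀ (m : Fin d → ℕ) (g : EuclideanSpace ℝ (Fin d) → ℂ),
      Continuous g → (∀ y, (∃ i, R < |y i|) → g y = 0) → ∀ x,
      ∫⁻ y, ‖D.kernel m (x - y)‖ₑ * ‖g y‖ₑ ≤
        ENNReal.ofReal (C * tensorDecay E x) * (mixedWeight (q⁻¹).toReal m * eLpNorm g q volume) := by
  obtain ⟨C, hC, h⟩ := D.exists_norm_kernel_le d E
  set I := ∫⁻ t : ℝ, ENNReal.ofReal (((1 + |t|) ^ 2)⁻¹) with hI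
  set C' : ℝ := C * (1 + R) ^ (E * d) * (1 + I.toReal ^ d) with hC'
  have hIt : I ≠ ⊤ := lintegral_decay_ne_top
  refine ⟨C', by positivity, fun q hq m g hg hgR x => ?_⟩
  have hr : (q⁻¹).toReal ≤ 1 := by
    rw [← ENNReal.toReal_one]
    exact ENNReal.toReal_mono (by simp) (ENNReal.inv_le_one.2 hq)
  have hr0 : 0 ≤ (q⁻¹).toReal := ENNReal.toReal_nonneg
  set r := (q⁻¹).toReal with hrdef
  set Q : Set (EuclideanSpace ℝ (Fin d)) := {y | ∀ i, |y i| ≤ R} with hQ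
  have hQm : MeasurableSet Q := by
    have : Q = ⋂ i, {y | |y i| ≤ R} := by ext; simp [hQ]
    rw [this]
    exact MeasurableSet.iInter fun i => measurableSet_le (by fun_prop) measurable_const
  set a := C * (1 + R) ^ (E * d) * tensorDecay E x with ha
  have ha0 : 0 < a := mul_pos (by positivity) (tensorDecay_pos _ _)
  have hker : ∀ y ∈ Q, ‖D.kernel m (x - y)‖ ≤
      a * ∏ i, (2 ^ (m i) * ((1 + 2 ^ (m i) * |(x - y) i|) ^ 2)⁻¹) := by
    intro y hy
    refine (h m (x - y)).trans ?_
    have hP : 0 ≤ ∏ i, ((2 : ℝ) ^ (m i) * ((1 + 2 ^ (m i) * |(x - y) i|) ^ 2)⁻¹) :=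
      Finset.prod_nonneg fun i _ => by positivity
    refine mul_le_mul_of_nonneg_right ?_ hP
    rw [ha, mul_assoc C]
    exact mul_le_mul_of_nonneg_left (tensorDecay_le_mul hR E x y hy) hC.le
  have hA : ∀ᵐ y ∂volume.restrict Q, ‖D.kernel m (x - y)‖ₑ ≤
      ENNReal.ofReal (a * 2 ^ (∑ i, m i)) := by
    refine (ae_restrict_iff' hQm).2 (Filter.Eventually.of_forall fun y hy => ?_)
    rw [← ofReal_norm]
    refine ENNReal.ofReal_le_ofReal ((hker y hy).trans ?_)
    gcongr
    rw [← Finset.prod_pow_eq_pow_sum]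
    refine Finset.prod_le_prod (fun i _ => by positivity) fun i _ => ?_
    refine mul_le_of_le_one_right (by positivity) (inv_le_one_of_one_le₀ (one_le_pow₀ ?_))
    linarith [show (0 : ℝ) ≤ 2 ^ m i * |(x - y) i| by positivity]
  have hB : ∫⁻ y in Q, ‖D.kernel m (x - y)‖ₑ ≤ ENNReal.ofReal a * I ^ d := by
    calc ∫⁻ y in Q, ‖D.kernel m (x - y)‖ₑ
        ≤ ∫⁻ y in Q, ENNReal.ofReal a *
          ∏ i, ENNReal.ofReal (2 ^ (m i) * ((1 + 2 ^ (m i) * |(x - y) i|) ^ 2)⁻¹) := by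
          refine setLIntegral_mono' hQm fun y hy => ?_
          rw [← ENNReal.ofReal_prod_of_nonneg fun i _ => by positivity, ← ENNReal.ofReal_mul ha0.le,
            ← ofReal_norm]
          exact ENNReal.ofReal_le_ofReal (hker y hy)
      _ ≤ ∫⁻ y, ENNReal.ofReal a *
          ∏ i, ENNReal.ofReal (2 ^ (m i) * ((1 + 2 ^ (m i) * |(x - y) i|) ^ 2)⁻¹) :=
          setLIntegral_le_lintegral _ _
      _ = ENNReal.ofReal a * ∫⁻ y : EuclideanSpace ℝ (Fin d),
          ∏ i, ENNReal.ofReal (2 ^ (m i) * ((1 + 2 ^ (m i) * |y i|) ^ 2)⁻¹) := by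
          rw [lintegral_const_mul' _ _ (by finiteness)]
          congr 1
          exact lintegral_sub_left_eq_self (fun y : EuclideanSpace ℝ (Fin d) =>
            ∏ i, ENNReal.ofReal (2 ^ (m i) * ((1 + 2 ^ (m i) * |y i|) ^ 2)⁻¹)) x
      _ = _ := by
          rw [EuclideanSpace.lintegral_prod_eq (φ := fun i t =>
            ENNReal.ofReal (2 ^ (m i) * ((1 + 2 ^ (m i) * |t|) ^ 2)⁻¹)) fun i => by fun_prop]
          simp_rw [lintegral_dyadic_decay]
          simp [hI]
  have hgm : eLpNorm g q (volume.restrict Q) ≤ eLpNorm g q volume :=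
    eLpNorm_mono_measure g Measure.restrict_le_self
  have hLHS : ∫⁻ y, ‖D.kernel m (x - y)‖ₑ * ‖g y‖ₑ =
      ∫⁻ y in Q, ‖D.kernel m (x - y)‖ₑ * ‖g y‖ₑ := by
    refine (setLIntegral_eq_of_support_subset fun y hy => ?_).symm
    by_contra hyQ
    simp only [hQ, Set.mem_ofPred_eq, not_forall, not_le] at hyQ
    simp [hgR y hyQ] at hy
  rw [hLHS]
  refine (lintegral_enorm_mul_le hg.aestronglyMeasurable.restrict
    ((D.continuous_kernel m).comp (continuous_const.sub continuous_id)).enorm.measurable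
    hA hB hq).trans ?_
  rw [← hrdef, ← mul_assoc]
  gcongr ?_ * ?_
  have hI1 : (I ^ d) ^ (1 - r) ≤ ENNReal.ofReal (1 + I.toReal ^ d) := by
    calc (I ^ d) ^ (1 - r) ≤ (1 + I ^ d) ^ (1 - r) := by gcongr; exact le_add_self
      _ ≤ (1 + I ^ d) ^ (1 : ℝ) := by
        refine ENNReal.rpow_le_rpow_of_exponent_le le_self_add (by linarith)
      _ = _ := by
        rw [ENNReal.rpow_one, ENNReal.ofReal_add (by norm_num) (by positivity), ENNReal.ofReal_one,
          ← ENNReal.toReal_pow, ENNReal.ofReal_toReal (by finiteness)]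
  have hw : ENNReal.ofReal (2 ^ (∑ i, m i)) ^ r = mixedWeight r m := by
    rw [mixedWeight, ENNReal.ofReal_rpow_of_pos (by positivity), ← Real.rpow_natCast,
      ← Real.rpow_mul (by norm_num), mul_comm r]
  calc ENNReal.ofReal (a * 2 ^ (∑ i, m i)) ^ r * (ENNReal.ofReal a * I ^ d) ^ (1 - r)
      = (ENNReal.ofReal a ^ r * ENNReal.ofReal a ^ (1 - r)) * mixedWeight r m *
          (I ^ d) ^ (1 - r) := by
        rw [ENNReal.ofReal_mul ha0.le, ENNReal.mul_rpow_of_nonneg _ _ hr0,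
          ENNReal.mul_rpow_of_nonneg _ _ (by linarith), hw]
        ring
    _ = ENNReal.ofReal a * mixedWeight r m * (I ^ d) ^ (1 - r) := by
        rw [← ENNReal.rpow_add_of_nonneg _ _ hr0 (by linarith)]
        simp
    _ ≤ ENNReal.ofReal a * mixedWeight r m * ENNReal.ofReal (1 + I.toReal ^ d) := by gcongr
    _ = ENNReal.ofReal (C' * tensorDecay E x) * mixedWeight r m := by
        rw [mul_right_comm, ← ENNReal.ofReal_mul ha0.le]
        congr 2
        rw [ha, hC']
        ring

end DualMeans

/-- The real number `2^{|m|/q} ‖Ψ_m ∗ u‖_q`. -/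
noncomputable def LocalMeans.endpointTerm {s : ℝ} {d : ℕ} (K : LocalMeans s) (q : ℝ≥0∞)
    (u : 𝓢'(EuclideanSpace ℝ (Fin d), ℂ)) (m : Fin d → ℕ) : ℝ :=
  (mixedWeight (q⁻¹).toReal m * eLpNorm (K.conv m u) q volume).toReal

theorem LocalMeans.summable_endpointTerm {s : ℝ} {d : ℕ} (K : LocalMeans s) {q : ℝ≥0∞}
    {u : 𝓢'(EuclideanSpace ℝ (Fin d), ℂ)} (h : K.endpointNorm q u ≠ ⊤) :
    Summable (K.endpointTerm q u) :=
  ENNReal.summable_toReal h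

theorem LocalMeans.ofReal_endpointTerm {s : ℝ} {d : ℕ} (K : LocalMeans s) {q : ℝ≥0∞}
    {u : 𝓢'(EuclideanSpace ℝ (Fin d), ℂ)} (h : K.endpointNorm q u ≠ ⊤) (m : Fin d → ℕ) :
    ENNReal.ofReal (K.endpointTerm q u m) =
      mixedWeight (q⁻¹).toReal m * eLpNorm (K.conv m u) q volume :=
  ENNReal.ofReal_toReal (ENNReal.ne_top_of_tsum_ne_top h m)

theorem LocalMeans.endpointTerm_nonneg {s : ℝ} {d : ℕ} (K : LocalMeans s) (q : ℝ≥0∞)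
    (u : 𝓢'(EuclideanSpace ℝ (Fin d), ℂ)) (m : Fin d → ℕ) : 0 ≤ K.endpointTerm q u m :=
  ENNReal.toReal_nonneg

theorem LocalMeans.tsum_endpointTerm {s : ℝ} {d : ℕ} (K : LocalMeans s) {q : ℝ≥0∞}
    {u : 𝓢'(EuclideanSpace ℝ (Fin d), ℂ)} (h : K.endpointNorm q u ≠ ⊤) :
    ENNReal.ofReal (∑' m, K.endpointTerm q u m) = K.endpointNorm q u := by
  rw [ENNReal.ofReal_tsum_of_nonneg (K.endpointTerm_nonneg q u) (K.summable_endpointTerm h)]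
  exact tsum_congr fun m => K.ofReal_endpointTerm h m

theorem LocalMeans.continuous_conv_of_dsupport {s : ℝ} {d : ℕ} (K : LocalMeans s)
    {u : 𝓢'(EuclideanSpace ℝ (Fin d), ℂ)} (hu : Distribution.dsupport u ⊆ unitCube d)
    (m : Fin d → ℕ) : Continuous (K.conv m u) := by
  obtain ⟨U, N, hU, hrep⟩ := exists_isSpectralWeight u hu
  exact K.continuous_conv hU m hrep

theorem LocalMeans.hasCompactSupport_conv {s : ℝ} {d : ℕ} (K : LocalMeans s)
    {u : 𝓢'(EuclideanSpace ℝ (Fin d), ℂ)} (hu : Distribution.dsupport u ⊆ unitCube d)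
    (m : Fin d → ℕ) : HasCompactSupport (K.conv m u) := by
  obtain ⟨R, hR, hsupp⟩ := K.exists_conv_support d
  exact EuclideanSpace.hasCompactSupport_of_forall (hsupp u hu m)

/-! ### The reproducing formula and continuous representatives -/

namespace DualMeans

variable {s : ℝ} {K : LocalMeans s} (D : DualMeans K) {d : ℕ}

/-- The building block `Λ_m ∗ Ψ_m ∗ u` of the distribution `u`. -/
noncomputable def piece (u : 𝓢'(EuclideanSpace ℝ (Fin d), ℂ)) (m : Fin d → ℕ)
    (x : EuclideanSpace ℝ (Fin d)) : ℂ :=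
  ∫ y, D.kernel m (x - y) * K.conv m u y

/-- The bound is summable in m by finiteness of the endpoint norm, and it decays in x at any
polynomial rate. This one estimate yields uniform convergence of the series, its integration term by
term, and its summation over the lattice. -/
theorem exists_norm_piece_le (d E : ℕ) : ∃ C : ℝ, 0 < C ∧ ∀ q : ℝ≥0∞, 1 ≤ q →
    ∀ u : 𝓢'(EuclideanSpace ℝ (Fin d), ℂ), Distribution.dsupport u ⊆ unitCube d →
    K.endpointNorm q u ≠ ⊤ → ∀ m x,
      ‖D.piece u m x‖ ≤ C * tensorDecay E x * K.endpointTerm q u m := by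
  obtain ⟨R, hR, hsupp⟩ := K.exists_conv_support d
  obtain ⟨C, hC, h⟩ := D.exists_lintegral_kernel_le d E hR
  refine ⟨C, hC, fun q hq u hu hfin m x => ?_⟩
  have h0 : 0 ≤ C * tensorDecay E x := mul_nonneg hC.le (tensorDecay_pos E x).le
  have h1 := h q hq m (K.conv m u) (K.continuous_conv_of_dsupport hu m) (hsupp u hu m) x
  rw [← K.ofReal_endpointTerm hfin, ← ENNReal.ofReal_mul h0] at h1
  rw [← ENNReal.ofReal_le_ofReal_iff (mul_nonneg h0 (K.endpointTerm_nonneg q u m)), ofReal_norm]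
  refine le_trans (enorm_integral_le_lintegral_enorm _) ?_
  simpa only [enorm_mul] using h1

theorem piece_eq_fourierInv {u : 𝓢'(EuclideanSpace ℝ (Fin d), ℂ)}
    (hu : Distribution.dsupport u ⊆ unitCube d) {U : EuclideanSpace ℝ (Fin d) → ℂ} {N : ℕ}
    (hU : IsSpectralWeight U N)
    (hrep : ∀ φ : 𝓢(EuclideanSpace ℝ (Fin d), ℂ), u φ = ∫ ξ, U ξ * (𝓕⁻ φ) ξ) (m : Fin d → ℕ) :
    D.piece u m = 𝓕⁻ (fun ξ => D.symbol m ξ * (K.symbol m ξ * U ξ)) := by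
  ext x
  have hg : Integrable (K.conv m u) :=
    (K.continuous_conv hU m hrep).integrable_of_hasCompactSupport (K.hasCompactSupport_conv hu m)
  set h : EuclideanSpace ℝ (Fin d) → ℂ := fun ξ =>
    (Real.fourierChar (inner ℝ ξ x) : ℂ) * D.symbol m ξ with hh
  have hhc : Continuous h := by
    refine Continuous.mul ?_ (D.continuous_symbol m)
    exact continuous_subtype_val.comp (Real.continuous_fourierChar.comp (by fun_prop))
  have hhi : Integrable h := hhc.integrable_of_hasCompactSupport (D.hasCompactSupport_symbol m).mul_left
  have hFh : ∀ y, 𝓕 h y = D.kernel m (x - y) := by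
    intro y
    rw [← D.fourierInv_symbol, Real.fourierInv_eq, Real.fourier_eq]
    refine integral_congr_ae (Filter.Eventually.of_forall fun ξ => ?_)
    simp only [hh, Circle.smul_def, smul_eq_mul]
    rw [inner_sub_right, ← mul_assoc, ← Circle.coe_mul, ← AddChar.map_add_eq_mul, neg_add_eq_sub]
  have hae : ∀ᵐ ξ, 𝓕 (K.conv m u) ξ = K.symbol m ξ * U ξ := by
    have hi : Integrable (𝓕⁻ (fun ξ => K.symbol m ξ * U ξ)) := by
      rw [← K.conv_eq_fourierInv m hrep]; exact hg
    have := fourier_fourierInv_ae_eq (K.integrable_symbol_mul hU m) hi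
    rwa [← K.conv_eq_fourierInv m hrep] at this
  have h1 := integral_fourier_mul_eq_of_integrable hg hhi
  rw [Real.fourierInv_eq, piece]
  simp_rw [hFh] at h1
  calc ∫ y, D.kernel m (x - y) * K.conv m u y = ∫ y, K.conv m u y * D.kernel m (x - y) := by
        simp_rw [mul_comm]
    _ = ∫ ξ, 𝓕 (K.conv m u) ξ * h ξ := h1.symm
    _ = _ := by
      refine integral_congr_ae ?_
      filter_upwards [hae] with ξ hξ
      rw [hξ]
      simp only [hh, Circle.smul_def, smul_eq_mul]
      ring

theorem integrable_symbol_mul {U : EuclideanSpace ℝ (Fin d) → ℂ} {N : ℕ}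
    (hU : IsSpectralWeight U N) (m : Fin d → ℕ) :
    Integrable (fun ξ => D.symbol m ξ * (K.symbol m ξ * U ξ)) := by
  obtain ⟨B, hB, h⟩ := D.exists_norm_symbol_le d
  exact (K.integrable_symbol_mul hU m).bdd_mul (D.continuous_symbol m).aestronglyMeasurable
    (Filter.Eventually.of_forall (h m))

theorem continuous_piece {u : 𝓢'(EuclideanSpace ℝ (Fin d), ℂ)}
    (hu : Distribution.dsupport u ⊆ unitCube d) (m : Fin d → ℕ) : Continuous (D.piece u m) := by
  obtain ⟨U, N, hU, hrep⟩ := exists_isSpectralWeight u hu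
  rw [D.piece_eq_fourierInv hu hU hrep]
  exact (D.integrable_symbol_mul hU m).continuous_fourierInv

theorem _root_.tendsto_piFinset_range (d : ℕ) :
    Filter.Tendsto (fun J => Fintype.piFinset fun _ : Fin d => Finset.range (J + 1)) Filter.atTop
      Filter.atTop := by
  refine Filter.tendsto_atTop_finset_of_monotone (fun J J' h => ?_) fun m => ⟨∑ i, m i, ?_⟩
  · refine Fintype.piFinset_subset _ _ fun i => Finset.range_mono (by omega)
  · rw [Fintype.mem_piFinset]
    intro i
    rw [Finset.mem_range]
    have := Finset.single_le_sum (f := m) (fun _ _ => Nat.zero_le _) (Finset.mem_univ i)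
    omega

theorem tendsto_cutoff (ξ : EuclideanSpace ℝ (Fin d)) :
    Filter.Tendsto (fun J : ℕ => ∏ i, D.cutoff (ξ i / 2 ^ J)) Filter.atTop (nhds 1) := by
  rw [show (1 : ℂ) = ∏ _i : Fin d, 1 by simp]
  refine tendsto_finsetProd _ fun i _ => ?_
  have h1 : Filter.Tendsto (fun J : ℕ => ξ i / 2 ^ J) Filter.atTop (nhds 0) :=
    tendsto_const_nhds.div_atTop (tendsto_pow_atTop_atTop_of_one_lt one_lt_two)
  exact tendsto_const_nhds.congr' ((h1.eventually D.cutoff_eventually).mono fun J hJ => hJ.symm)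

theorem integrable_spectralWeight_mul {U : EuclideanSpace ℝ (Fin d) → ℂ} {N : ℕ}
    (hU : IsSpectralWeight U N) (ψ : 𝓢(EuclideanSpace ℝ (Fin d), ℂ)) :
    Integrable fun ξ => U ξ * ψ ξ := by
  obtain ⟨c, hc, hcb⟩ := ψ.exists_one_add_norm_pow_mul_le N
  refine (hU.2.const_mul c).mono' (hU.1.mul ψ.continuous.aestronglyMeasurable)
    (Filter.Eventually.of_forall fun ξ => ?_)
  rw [norm_mul]
  have : ‖ψ ξ‖ ≤ c * ((1 + ‖ξ‖) ^ N)⁻¹ := by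
    rw [← div_eq_mul_inv, le_div_iff₀ (by positivity), mul_comm]
    exact hcb ξ
  calc ‖U ξ‖ * ‖ψ ξ‖ ≤ ‖U ξ‖ * (c * ((1 + ‖ξ‖) ^ N)⁻¹) := by gcongr
    _ = _ := by ring

theorem sum_integral_mul_piece {u : 𝓢'(EuclideanSpace ℝ (Fin d), ℂ)}
    (hu : Distribution.dsupport u ⊆ unitCube d) {U : EuclideanSpace ℝ (Fin d) → ℂ} {N : ℕ}
    (hU : IsSpectralWeight U N)
    (hrep : ∀ φ : 𝓢(EuclideanSpace ℝ (Fin d), ℂ), u φ = ∫ ξ, U ξ * (𝓕⁻ φ) ξ)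
    (φ : 𝓢(EuclideanSpace ℝ (Fin d), ℂ)) (J : ℕ) :
    ∑ m ∈ Fintype.piFinset fun _ : Fin d => Finset.range (J + 1),
      ∫ x, φ x * D.piece u m x = ∫ ξ, (∏ i, D.cutoff (ξ i / 2 ^ J)) * (U ξ * (𝓕⁻ φ) ξ) := by
  have hψ := integrable_spectralWeight_mul hU (𝓕⁻ φ)
  have h3 : ∀ m, ∫ x, φ x * D.piece u m x =
      ∫ ξ, D.symbol m ξ * K.symbol m ξ * (U ξ * (𝓕⁻ φ) ξ) := by
    intro m
    have h := integral_fourierInv_mul_eq_of_integrable (D.integrable_symbol_mul hU m) φ.integrable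
    rw [← D.piece_eq_fourierInv hu hU hrep] at h
    calc ∫ x, φ x * D.piece u m x = ∫ x, D.piece u m x * φ x := by simp_rw [mul_comm]
      _ = ∫ ξ, D.symbol m ξ * (K.symbol m ξ * U ξ) * 𝓕⁻ (φ : EuclideanSpace ℝ (Fin d) → ℂ) ξ := h
      _ = _ := by
        rw [← SchwartzMap.fourierInv_coe]
        simp_rw [mul_assoc]
  obtain ⟨B, hB, hBs⟩ := D.exists_norm_symbol_le d
  obtain ⟨B', hB', hBs'⟩ := K.exists_norm_symbol_le d 0
  simp_rw [h3]
  rw [← integral_finsetSum]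
  · simp_rw [← Finset.sum_mul, D.sum_symbol_mul]
  · intro m _
    refine hψ.bdd_mul (c := B * B')
      ((D.continuous_symbol m).mul (K.continuous_symbol m)).aestronglyMeasurable
      (Filter.Eventually.of_forall fun ξ => ?_)
    rw [norm_mul]
    gcongr
    · exact hBs m ξ
    · simpa using hBs' m ξ

theorem tendsto_integral_cutoff {w : EuclideanSpace ℝ (Fin d) → ℂ} (hw : Integrable w) :
    Filter.Tendsto (fun J : ℕ => ∫ ξ, (∏ i, D.cutoff (ξ i / 2 ^ J)) * w ξ) Filter.atTop
      (nhds (∫ ξ, w ξ)) := by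
  refine tendsto_integral_of_dominated_convergence (fun ξ => ‖w ξ‖)
    (fun J => ?_) hw.norm (fun J => Filter.Eventually.of_forall fun ξ => ?_)
    (Filter.Eventually.of_forall fun ξ => ?_)
  · refine AEStronglyMeasurable.mul ?_ hw.1
    simp_rw [← D.sum_symbol_mul]
    exact (continuous_finsetSum _ fun m _ =>
      (D.continuous_symbol m).mul (K.continuous_symbol m)).aestronglyMeasurable
  · rw [norm_mul, norm_prod]
    refine mul_le_of_le_one_left (norm_nonneg _) ?_
    exact Finset.prod_le_one (fun _ _ => norm_nonneg _) fun i _ => D.norm_cutoff_le _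
  · simpa using (D.tendsto_cutoff ξ).mul_const (w ξ)

theorem hasSum_integral_mul_piece {q : ℝ≥0∞} (hq : 1 ≤ q) {u : 𝓢'(EuclideanSpace ℝ (Fin d), ℂ)}
    (hu : Distribution.dsupport u ⊆ unitCube d) (hfin : K.endpointNorm q u ≠ ⊤)
    {φ : EuclideanSpace ℝ (Fin d) → ℂ} (hφ : Integrable φ) :
    HasSum (fun m => ∫ x, φ x * D.piece u m x) (∫ x, φ x * ∑' m, D.piece u m x) := by
  obtain ⟨C, hC, hpiece⟩ := D.exists_norm_piece_le d 0
  have hle : ∀ m x, ‖D.piece u m x‖ ≤ C * K.endpointTerm q u m := fun m x => by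
    simpa [tensorDecay] using hpiece q hq u hu hfin m x
  have hint : ∀ m, Integrable fun x => φ x * D.piece u m x := fun m =>
    hφ.mul_bdd (D.continuous_piece hu m).aestronglyMeasurable
      (Filter.Eventually.of_forall (hle m))
  have hsum : Summable fun m => ∫ x, ‖φ x * D.piece u m x‖ := by
    refine Summable.of_nonneg_of_le (fun m => integral_nonneg fun _ => norm_nonneg _) (fun m => ?_)
      ((K.summable_endpointTerm hfin).mul_left (C * ∫ x, ‖φ x‖))
    calc ∫ x, ‖φ x * D.piece u m x‖ ≤ ∫ x, ‖φ x‖ * (C * K.endpointTerm q u m) := by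
          refine integral_mono (hint m).norm (hφ.norm.mul_const _) fun x => ?_
          dsimp only
          rw [norm_mul]
          gcongr
          exact hle m x
      _ = _ := by rw [integral_mul_const]; ring
  have h1 := hasSum_integral_of_summable_integral_norm hint hsum
  simp_rw [tsum_mul_left] at h1
  exact h1

/-- Over the cubes of levels m_i ≤ J the partial sums telescope to the frequency cut-off at scale
2^J, which tends boundedly to one, so they converge to u φ. The same partial sums converge to the
integral on the right by absolute summability. -/
theorem integral_mul_tsum_piece {q : ℝ≥0∞} (hq : 1 ≤ q) {u : 𝓢'(EuclideanSpace ℝ (Fin d), ℂ)}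
    (hu : Distribution.dsupport u ⊆ unitCube d) (hfin : K.endpointNorm q u ≠ ⊤)
    (φ : 𝓢(EuclideanSpace ℝ (Fin d), ℂ)) :
    u φ = ∫ x, φ x * ∑' m, D.piece u m x := by
  obtain ⟨U, N, hU, hrep⟩ := exists_isSpectralWeight u hu
  have h1 := (D.hasSum_integral_mul_piece hq hu hfin φ.integrable).comp (tendsto_piFinset_range d)
  refine tendsto_nhds_unique ?_ h1
  rw [hrep]
  refine (D.tendsto_integral_cutoff (integrable_spectralWeight_mul hU (𝓕⁻ φ))).congr fun J => ?_
  exact (D.sum_integral_mul_piece hu hU hrep φ J).symm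

theorem exists_isRepresentedBy {q : ℝ≥0∞} (hq : 1 ≤ q) {u : 𝓢'(EuclideanSpace ℝ (Fin d), ℂ)}
    (hu : Distribution.dsupport u ⊆ unitCube d) (hfin : K.endpointNorm q u ≠ ⊤) :
    ∃ f : EuclideanSpace ℝ (Fin d) →ᵇ ℂ, (∀ x, f x = ∑' m, D.piece u m x) ∧
      IsRepresentedBy u f := by
  obtain ⟨C, hC, hpiece⟩ := D.exists_norm_piece_le d 0
  have hle : ∀ m x, ‖D.piece u m x‖ ≤ C * K.endpointTerm q u m := fun m x => by
    simpa [tensorDecay] using hpiece q hq u hu hfin m x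
  have hs := (K.summable_endpointTerm hfin).mul_left C
  refine ⟨BoundedContinuousFunction.ofNormedAddCommGroup (fun x => ∑' m, D.piece u m x)
    (continuous_tsum (fun m => D.continuous_piece hu m) hs hle)
    (∑' m, C * K.endpointTerm q u m) fun x => tsum_of_norm_bounded hs.hasSum fun m => hle m x,
    fun x => rfl, fun φ => D.integral_mul_tsum_piece hq hu hfin φ⟩

end DualMeans

/-! ### Uniqueness and support of the continuous representative -/

theorem IsRepresentedBy.eq {d : ℕ} {u : 𝓢'(EuclideanSpace ℝ (Fin d), ℂ)}
    {f g : EuclideanSpace ℝ (Fin d) →ᵇ ℂ} (hf : IsRepresentedBy u f) (hg : IsRepresentedBy u g) :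
    f = g := by
  have h : (f : EuclideanSpace ℝ (Fin d) → ℂ) =ᵐ[volume] g := by
    refine ae_eq_of_integral_contDiff_smul_eq f.continuous.locallyIntegrable
      g.continuous.locallyIntegrable fun φ hφ hc => ?_
    have h1 : ContDiff ℝ ∞ (fun x => ((φ x : ℝ) : ℂ)) := Complex.ofRealCLM.contDiff.comp hφ
    have h2 : HasCompactSupport (fun x => ((φ x : ℝ) : ℂ)) :=
      hc.comp_left (g := ((↑) : ℝ → ℂ)) rfl
    have h3 := (hf (h2.toSchwartzMap h1)).symm.trans (hg (h2.toSchwartzMap h1))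
    simp_rw [Complex.real_smul]
    exact h3
  ext x
  exact congrFun (Continuous.ae_eq_iff_eq volume f.continuous g.continuous |>.1 h) x

theorem isClosed_unitCube (d : ℕ) : IsClosed (unitCube d) := by
  have : unitCube d = ⋂ i, (fun x : EuclideanSpace ℝ (Fin d) => x i) ⁻¹' Set.Icc 0 1 := by
    ext; simp [unitCube]
  rw [this]
  exact isClosed_iInter fun i => isClosed_Icc.preimage (by fun_prop)

theorem mem_closure_compl_unitCube {d : ℕ} {x : EuclideanSpace ℝ (Fin d)}
    (hx : ¬ ∀ i, 0 < x i ∧ x i < 1) : x ∈ closure (unitCube d)ᶜ := by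
  push Not at hx
  obtain ⟨i, hi⟩ := hx
  obtain ⟨σ, hσ⟩ : ∃ σ : ℝ, ∀ t > 0, ¬ (0 ≤ x i + σ * t ∧ x i + σ * t ≤ 1) := by
    by_cases h0 : 0 < x i
    · exact ⟨1, fun t ht h => by linarith [hi h0, h.2]⟩
    · exact ⟨-1, fun t ht h => by linarith [h.1]⟩
  refine mem_closure_of_tendsto (f := fun t : ℝ => x + (σ * t) • EuclideanSpace.single i (1 : ℝ))
    (b := nhdsWithin (0 : ℝ) (Set.Ioi 0)) ?_ ?_
  · have : ContinuousAt (fun t : ℝ => x + (σ * t) • EuclideanSpace.single i (1 : ℝ)) 0 := by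
      fun_prop
    have h3 := this.tendsto.mono_left (nhdsWithin_le_nhds (s := Set.Ioi 0))
    simpa using h3
  · filter_upwards [self_mem_nhdsWithin] with t ht
    intro hmem
    have := hmem i
    simp only [PiLp.add_apply, PiLp.smul_apply, PiLp.single_apply, if_true,
      smul_eq_mul, mul_one] at this
    exact hσ t ht this

theorem IsRepresentedBy.ae_eq_zero {d : ℕ} {u : 𝓢'(EuclideanSpace ℝ (Fin d), ℂ)}
    {f : EuclideanSpace ℝ (Fin d) →ᵇ ℂ} (hf : IsRepresentedBy u f)
    (hu : Distribution.dsupport u ⊆ unitCube d) : ∀ᵐ x, x ∈ (unitCube d)ᶜ → f x = 0 := by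
  refine (isClosed_unitCube d).isOpen_compl.ae_eq_zero_of_integral_contDiff_smul_eq_zero
    (f.continuous.locallyIntegrable.locallyIntegrableOn _) fun φ hφ hc hs => ?_
  have h1 : ContDiff ℝ ∞ (fun x => ((φ x : ℝ) : ℂ)) := Complex.ofRealCLM.contDiff.comp hφ
  have h2 : HasCompactSupport (fun x => ((φ x : ℝ) : ℂ)) :=
    hc.comp_left (g := ((↑) : ℝ → ℂ)) rfl
  obtain ⟨Φ, hΦ⟩ : ∃ Φ : 𝓢(EuclideanSpace ℝ (Fin d), ℂ),
      (Φ : EuclideanSpace ℝ (Fin d) → ℂ) = fun x => ((φ x : ℝ) : ℂ) := ⟨h2.toSchwartzMap h1, rfl⟩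
  have h3 := hf Φ
  have h4 : tsupport (fun x => ((φ x : ℝ) : ℂ)) ⊆ tsupport φ :=
    closure_mono fun x hx => by
      intro h0
      exact hx (by simp [h0])
  rw [u.eq_zero_of_hasCompactSupport Φ (by rw [hΦ]; exact h2) (by
    rw [hΦ]
    exact Set.disjoint_of_subset_right hu (Set.disjoint_left.2 fun x hx => hs (h4 hx)))] at h3
  simp_rw [Complex.real_smul]
  rw [hΦ] at h3
  exact h3.symm

/-- By continuity the function vanishes on the boundary of the cube too, since boundary points are
limits of exterior points. Hence the cubature sum over the half-open cube may be extended to the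
whole lattice. -/
theorem IsRepresentedBy.eq_zero_of_notMem {d : ℕ} {u : 𝓢'(EuclideanSpace ℝ (Fin d), ℂ)}
    {f : EuclideanSpace ℝ (Fin d) →ᵇ ℂ} (hf : IsRepresentedBy u f)
    (hu : Distribution.dsupport u ⊆ unitCube d) {x : EuclideanSpace ℝ (Fin d)}
    (hx : ¬ ∀ i, 0 < x i ∧ x i < 1) : f x = 0 := by
  have h1 := hf.ae_eq_zero hu
  have h2 : ∀ x ∈ (unitCube d)ᶜ, f x = 0 := by
    intro x hx
    by_contra hne
    have hU : IsOpen ((unitCube d)ᶜ ∩ f ⁻¹' {0}ᶜ) :=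
      (isClosed_unitCube d).isOpen_compl.inter (isOpen_compl_singleton.preimage f.continuous)
    have h0 : volume ((unitCube d)ᶜ ∩ f ⁻¹' {0}ᶜ) = 0 := by
      rw [ae_iff] at h1
      refine measure_mono_null (fun y hy => ?_) h1
      exact fun h => hy.2 (h hy.1)
    exact (hU.measure_pos volume ⟨x, hx, hne⟩).ne' h0
  exact (isClosed_singleton.preimage f.continuous : IsClosed (f ⁻¹' {0})).closure_subset_iff.2
    (fun y hy => h2 y hy) (mem_closure_compl_unitCube hx)

/-! ### Arithmetic of Frolov's lattice -/

open Polynomial in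
/-- The polynomial `frolovPoly d` with integer coefficients. -/
noncomputable def frolovPolyInt (d : ℕ) : ℤ[X] := ∏ j : Fin d, (X - C (2 * (j : ℤ) + 1)) - 1

section

open Polynomial

theorem map_frolovPolyInt (d : ℕ) : (frolovPolyInt d).map (Int.castRingHom ℝ) = frolovPoly d := by
  simp only [frolovPolyInt, frolovPoly, Polynomial.map_sub, Polynomial.map_prod, map_X, map_C,
    Polynomial.map_one]
  simp

theorem natDegree_frolovProd (d : ℕ) :
    (∏ j : Fin d, (X - C (2 * (j : ℤ) + 1))).natDegree = d := by
  rw [natDegree_prod_of_monic _ _ fun j _ => monic_X_sub_C _]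
  simp only [natDegree_X_sub_C]
  simp

theorem monic_frolovPolyInt {d : ℕ} (hd : 1 ≤ d) : (frolovPolyInt d).Monic := by
  refine (monic_prod_of_monic _ _ fun j _ => monic_X_sub_C _).sub_of_left ?_
  rw [degree_eq_natDegree (monic_prod_of_monic _ _ fun j _ => monic_X_sub_C _).ne_zero,
    natDegree_frolovProd, degree_one]
  exact_mod_cast hd

theorem natDegree_frolovPolyInt {d : ℕ} (hd : 1 ≤ d) : (frolovPolyInt d).natDegree = d := by
  rw [frolovPolyInt, natDegree_sub_eq_left_of_natDegree_lt, natDegree_frolovProd]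
  rw [natDegree_frolovProd, natDegree_one]
  exact hd

theorem eval_frolovPolyInt (d : ℕ) (j : Fin d) : (frolovPolyInt d).eval (2 * (j : ℤ) + 1) = -1 := by
  rw [frolovPolyInt, eval_sub, eval_prod, Finset.prod_eq_zero (Finset.mem_univ j) (by simp)]
  simp

/-- If the polynomial is g h with monic factors of lower degree, then g h = -1 at the d odd nodes,
so g and h take there the values 1 and -1 in some order and g + h vanishes. Having degree below d,
the sum g + h is zero, which contradicts that both are monic. -/
theorem irreducible_frolovPolyInt {d : ℕ} (hd : 1 ≤ d) : Irreducible (frolovPolyInt d) := by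
  have hP := monic_frolovPolyInt hd
  have hdeg := natDegree_frolovPolyInt hd
  have hne : frolovPolyInt d ≠ 1 := fun h => by simp [h] at hdeg; omega
  rw [hP.irreducible_iff_natDegree']
  refine ⟨hne, fun g h hg hh hgh hmem => ?_⟩
  rw [Finset.mem_Ioc] at hmem
  have hsum : g.natDegree + h.natDegree = d := by
    rw [← hg.natDegree_mul hh, hgh, hdeg]
  have hg1 : g.natDegree < d := by omega
  have hh1 : h.natDegree < d := by omega
  have hval : ∀ j : Fin d, (g + h).eval (2 * (j : ℤ) + 1) = 0 := by
    intro j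
    have h1 : g.eval (2 * (j : ℤ) + 1) * h.eval (2 * (j : ℤ) + 1) = -1 := by
      rw [← eval_mul, hgh, eval_frolovPolyInt]
    rw [eval_add]
    rcases Int.isUnit_iff.1 (IsUnit.of_mul_eq_one (a := g.eval (2 * (j : ℤ) + 1)) (-h.eval (2 * (j : ℤ) + 1)) (by linarith)) with h2 | h2 <;>
      rw [h2] at h1 ⊢ <;> linarith
  have hzero : g + h = 0 := by
    refine Polynomial.eq_zero_of_natDegree_lt_card_of_eval_eq_zero (g + h)
      (f := fun j : Fin d => 2 * (j : ℤ) + 1) (fun a b hab => ?_) hval ?_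
    · have : (a : ℤ) = b := by linarith
      exact Fin.ext (by exact_mod_cast this)
    · rw [Fintype.card_fin]
      exact (natDegree_add_le _ _).trans_lt (max_lt hg1 hh1)
  have h3 : g = -h := eq_neg_of_add_eq_zero_left hzero
  have h4 := hg.leadingCoeff
  rw [h3, leadingCoeff_neg, hh.leadingCoeff] at h4
  omega

/-- By Gauss's lemma the polynomial is irreducible over ℚ, hence the minimal polynomial of each of
its roots. -/
theorem aeval_ne_zero_of_natDegree_lt {d : ℕ} (hd : 1 ≤ d) {ξ : ℝ}
    (hξ : (frolovPoly d).eval ξ = 0) {q : ℤ[X]} (hq : q ≠ 0) (hdeg : q.natDegree < d) :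
    aeval ξ q ≠ 0 := by
  intro h
  have hP := monic_frolovPolyInt hd
  have hirr : Irreducible ((frolovPolyInt d).map (algebraMap ℤ ℚ)) :=
    (hP.irreducible_iff_irreducible_map_fraction_map).1 (irreducible_frolovPolyInt hd)
  have hroot : aeval ξ ((frolovPolyInt d).map (algebraMap ℤ ℚ)) = 0 := by
    rw [aeval_map_algebraMap, ← eval_map_algebraMap]
    rw [← map_frolovPolyInt] at hξ
    exact hξ
  have hmin := minpoly.eq_of_irreducible_of_monic hirr hroot (hP.map _)
  have hdvd : minpoly ℚ ξ ∣ q.map (algebraMap ℤ ℚ) :=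
    minpoly.dvd ℚ ξ (by rw [aeval_map_algebraMap, h])
  have hinj : Function.Injective (algebraMap ℤ ℚ) := Int.cast_injective
  have hq' : q.map (algebraMap ℤ ℚ) ≠ 0 := (Polynomial.map_ne_zero_iff hinj).2 hq
  have := natDegree_le_of_dvd hdvd hq'
  rw [← hmin, hP.natDegree_map, natDegree_frolovPolyInt hd,
    natDegree_map_eq_of_injective hinj] at this
  omega

theorem eval_frolovPoly (d : ℕ) (t : ℝ) :
    (frolovPoly d).eval t = ∏ j : Fin d, (t - (2 * (j : ℝ) + 1)) - 1 := by
  simp [frolovPoly, eval_prod]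

/-- Between 2k and 2k + 2 only the factor with j = k changes its sign. -/
theorem prod_odd_mul_prod_odd_neg {d : ℕ} (k : Fin d) :
    (∏ j : Fin d, (2 * (k : ℤ) - (2 * (j : ℤ) + 1))) *
      (∏ j : Fin d, (2 * ((k : ℤ) + 1) - (2 * (j : ℤ) + 1))) < 0 := by
  rw [← Finset.prod_mul_distrib, ← Finset.mul_prod_erase _ _ (Finset.mem_univ k)]
  refine mul_neg_of_neg_of_pos (by ring_nf; norm_num) (Finset.prod_pos fun j hj => ?_)
  have hne : (k : ℤ) ≠ j := fun h => Finset.ne_of_mem_erase hj (Fin.ext (by exact_mod_cast h.symm))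
  rcases lt_or_gt_of_ne hne with h | h
  · exact mul_pos_of_neg_of_neg (by omega) (by omega)
  · exact mul_pos (by omega) (by omega)

theorem eval_frolovPoly_even_ne_zero {d : ℕ} (k : Fin d) : (frolovPoly d).eval (2 * (k : ℝ)) ≠ 0 := by
  have hd : 1 ≤ d := by have := k.2; omega
  intro h
  rcases Nat.lt_or_ge 1 d with h1 | h1
  · refine aeval_ne_zero_of_natDegree_lt hd h (q := X - C (2 * (k : ℤ))) (X_sub_C_ne_zero _) ?_ ?_
    · rw [natDegree_X_sub_C]
      exact h1
    · rw [map_sub, aeval_X, aeval_C]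
      simp
  · obtain rfl : d = 1 := le_antisymm h1 hd
    rw [eval_frolovPoly] at h
    fin_cases k
    norm_num at h

/-- The products at 2k and 2k + 2 are nonzero integers of opposite sign, so subtracting one still
leaves values of weakly opposite sign. The left end point is not a root, which makes the d half-open
intervals disjoint and the roots distinct. -/
theorem exists_frolovPoly_root {d : ℕ} (k : Fin d) :
    ∃ t : ℝ, 2 * (k : ℝ) < t ∧ t ≤ 2 * ((k : ℝ) + 1) ∧ (frolovPoly d).eval t = 0 := by
  have hne := eval_frolovPoly_even_ne_zero k
  set F₀ : ℤ := ∏ j : Fin d, (2 * (k : ℤ) - (2 * (j : ℤ) + 1)) with hF₀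
  set F₁ : ℤ := ∏ j : Fin d, (2 * ((k : ℤ) + 1) - (2 * (j : ℤ) + 1)) with hF₁
  have hlt : F₀ * F₁ < 0 := prod_odd_mul_prod_odd_neg k
  have e0 : (frolovPoly d).eval (2 * (k : ℝ)) = ((F₀ - 1 : ℤ) : ℝ) := by
    rw [eval_frolovPoly, hF₀]; push_cast; rfl
  have e1 : (frolovPoly d).eval (2 * ((k : ℝ) + 1)) = ((F₁ - 1 : ℤ) : ℝ) := by
    rw [eval_frolovPoly, hF₁]; push_cast; rfl
  have hle : 2 * (k : ℝ) ≤ 2 * ((k : ℝ) + 1) := by linarith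
  have hcont : ContinuousOn (fun t => (frolovPoly d).eval t)
      (Set.Icc (2 * (k : ℝ)) (2 * ((k : ℝ) + 1))) := (frolovPoly d).continuous.continuousOn
  have hmem : ∃ t ∈ Set.Icc (2 * (k : ℝ)) (2 * ((k : ℝ) + 1)), (frolovPoly d).eval t = 0 := by
    rcases mul_neg_iff.1 hlt with ⟨h0, h1⟩ | ⟨h0, h1⟩
    · refine intermediate_value_Icc' hle hcont ⟨?_, ?_⟩
      · rw [e1]; exact_mod_cast (by omega : F₁ - 1 ≤ 0)
      · rw [e0]; exact_mod_cast (by omega : 0 ≤ F₀ - 1)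
    · refine intermediate_value_Icc hle hcont ⟨?_, ?_⟩
      · rw [e0]; exact_mod_cast (by omega : F₀ - 1 ≤ 0)
      · rw [e1]; exact_mod_cast (by omega : 0 ≤ F₁ - 1)
  obtain ⟨t, ht, h0⟩ := hmem
  refine ⟨t, lt_of_le_of_ne ht.1 fun h => hne (h ▸ h0), ht.2, h0⟩

theorem frolovPoly_roots {d : ℕ} (hd : 1 ≤ d) :
    (frolovPoly d).roots.card = d ∧ (frolovPoly d).roots.Nodup := by
  choose r hr1 hr2 hr3 using fun k : Fin d => exists_frolovPoly_root k
  have hP : (frolovPoly d).Monic := by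
    rw [← map_frolovPolyInt]; exact (monic_frolovPolyInt hd).map _
  have hdeg : (frolovPoly d).natDegree = d := by
    rw [← map_frolovPolyInt, (monic_frolovPolyInt hd).natDegree_map, natDegree_frolovPolyInt hd]
  have hinj : Function.Injective r := by
    intro a b hab
    by_contra hne
    rcases lt_or_gt_of_ne hne with h | h
    · have : (a : ℝ) + 1 ≤ b := by exact_mod_cast h
      linarith [hr2 a, hr1 b]
    · have : (b : ℝ) + 1 ≤ a := by exact_mod_cast h
      linarith [hr2 b, hr1 a]
  have hle : (Finset.univ.map ⟨r, hinj⟩).val ≤ (frolovPoly d).roots := by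
    rw [Multiset.le_iff_subset (Finset.nodup _)]
    intro t ht
    rw [Finset.mem_val, Finset.mem_map] at ht
    obtain ⟨k, -, rfl⟩ := ht
    exact (mem_roots hP.ne_zero).2 (hr3 k)
  have heq : (Finset.univ.map ⟨r, hinj⟩).val = (frolovPoly d).roots := by
    refine Multiset.eq_of_le_of_card_le hle ?_
    rw [Finset.card_val, Finset.card_map, Finset.card_univ, Fintype.card_fin]
    exact (card_roots' _).trans hdeg.le
  rw [← heq]
  refine ⟨?_, Finset.nodup _⟩
  rw [Finset.card_val, Finset.card_map, Finset.card_univ, Fintype.card_fin]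

theorem frolovRoot_eq {d : ℕ} (i : Fin d) :
    frolovRoot d i = ((frolovPoly d).roots.sort (· ≤ ·))[(i : ℕ)]'(by
      rw [Multiset.length_sort, (frolovPoly_roots (by have := i.2; omega)).1]; exact i.2) := by
  rw [frolovRoot, List.getD_eq_getElem]

theorem strictMono_frolovRoot (d : ℕ) : StrictMono (frolovRoot d) := by
  intro i j hij
  have hd : 1 ≤ d := by have := i.2; omega
  rw [frolovRoot_eq, frolovRoot_eq]
  have hs : ((frolovPoly d).roots.sort (· ≤ ·)).SortedLT := by
    have hn : ((frolovPoly d).roots.sort (· ≤ ·)).Nodup := by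
      rw [← Multiset.coe_nodup, Multiset.sort_eq]
      exact (frolovPoly_roots hd).2
    exact ((Multiset.pairwise_sort (frolovPoly d).roots (· ≤ ·)).and hn |>.imp
      lt_iff_le_and_ne.2).sortedLT
  exact hs.getElem_lt_getElem_of_lt hij

theorem eval_frolovRoot {d : ℕ} (i : Fin d) : (frolovPoly d).eval (frolovRoot d i) = 0 := by
  have hmem : frolovRoot d i ∈ (frolovPoly d).roots := by
    rw [frolovRoot_eq, ← Multiset.mem_sort (r := (· ≤ ·))]
    exact List.getElem_mem _
  exact (mem_roots'.1 hmem).2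

theorem det_frolovMatrix_pos (d : ℕ) : 0 < (frolovMatrix d).det := by
  rw [frolovMatrix, Matrix.det_vandermonde]
  refine Finset.prod_pos fun i _ => Finset.prod_pos fun j hj => ?_
  rw [Finset.mem_Ioi] at hj
  exact sub_pos.2 (strictMono_frolovRoot d hj)

/-- The matrix of the multiplication by `q` modulo `frolovPolyInt d`. -/
noncomputable def frolovMulMatrix (d : ℕ) (q : ℤ[X]) : Matrix (Fin d) (Fin d) ℤ :=
  fun j l => ((X ^ (j : ℕ) * q) %ₘ frolovPolyInt d).coeff l

/-- The Vandermonde matrix diagonalises the multiplication by q, with the values of q at the roots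
as eigenvalues. Their product and their sum are thus determinant and trace of an integer matrix. -/
theorem frolovMatrix_mul_mulMatrix {d : ℕ} (hd : 1 ≤ d) (q : ℤ[X]) :
    frolovMatrix d * ((frolovMulMatrix d q).map (Int.castRingHom ℝ)).transpose =
      Matrix.diagonal (fun i => aeval (frolovRoot d i) q) * frolovMatrix d := by
  have hP := monic_frolovPolyInt hd
  have hne : frolovPolyInt d ≠ 1 := fun h => by
    have := natDegree_frolovPolyInt hd
    simp [h] at this; omega
  ext i j
  rw [Matrix.diagonal_mul, Matrix.mul_apply]
  simp only [frolovMatrix, Matrix.vandermonde_apply, Matrix.transpose_apply, Matrix.map_apply,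
    frolovMulMatrix]
  set r := (X ^ (j : ℕ) * q) %ₘ frolovPolyInt d with hr
  have hrd : r.natDegree < d := by
    have := natDegree_modByMonic_lt (X ^ (j : ℕ) * q) hP hne
    rwa [natDegree_frolovPolyInt hd] at this
  have h1 : aeval (frolovRoot d i) r = frolovRoot d i ^ (j : ℕ) * aeval (frolovRoot d i) q := by
    have hz : aeval (frolovRoot d i) (frolovPolyInt d) = 0 := by
      rw [← eval_map_algebraMap]
      have := eval_frolovRoot i
      rw [← map_frolovPolyInt] at this
      exact this
    have h2 := congrArg (aeval (frolovRoot d i)) (modByMonic_add_div (X ^ (j : ℕ) * q) (frolovPolyInt d))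
    rw [map_add, map_mul, hz, zero_mul, add_zero, map_mul, map_pow, aeval_X] at h2
    exact h2
  rw [mul_comm, ← h1, aeval_eq_sum_range' hrd, Finset.sum_range]
  refine Finset.sum_congr rfl fun l _ => ?_
  simp [zsmul_eq_mul, mul_comm]

theorem prod_aeval_frolovRoot {d : ℕ} (hd : 1 ≤ d) (q : ℤ[X]) :
    ∏ i, aeval (frolovRoot d i) q = ((frolovMulMatrix d q).det : ℝ) := by
  have h := congrArg Matrix.det (frolovMatrix_mul_mulMatrix hd q)
  rw [Matrix.det_mul, Matrix.det_mul, Matrix.det_transpose, Matrix.det_diagonal, mul_comm] at h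
  have h2 := mul_right_cancel₀ (det_frolovMatrix_pos d).ne' h
  rw [← h2]
  exact ((Int.castRingHom ℝ).map_det _).symm

theorem sum_aeval_frolovRoot {d : ℕ} (hd : 1 ≤ d) (q : ℤ[X]) :
    ∑ i, aeval (frolovRoot d i) q = ((frolovMulMatrix d q).trace : ℝ) := by
  have h := frolovMatrix_mul_mulMatrix hd q
  have hu : IsUnit (frolovMatrix d).det := (det_frolovMatrix_pos d).ne'.isUnit
  have h2 : frolovMatrix d * ((frolovMulMatrix d q).map (Int.castRingHom ℝ)).transpose *
      (frolovMatrix d)⁻¹ = Matrix.diagonal (fun i => aeval (frolovRoot d i) q) := by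
    rw [h, Matrix.mul_assoc, Matrix.mul_nonsing_inv _ hu, Matrix.mul_one]
  have h3 := congrArg Matrix.trace h2
  rw [Matrix.trace_mul_comm, ← Matrix.mul_assoc, Matrix.nonsing_inv_mul _ hu, Matrix.one_mul,
    Matrix.trace_transpose, Matrix.trace_diagonal] at h3
  rw [← h3]
  simp [Matrix.trace]

/-- Points whose image under the transposed Vandermonde matrix is integral and nonzero stay away
from the coordinate hyperplanes. -/
theorem exists_le_prod_abs {d : ℕ} (hd : 1 ≤ d) :
    ∃ c : ℝ, 0 < c ∧ ∀ (y : Fin d → ℝ) (k : Fin d → ℤ), y ≠ 0 →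
      (frolovMatrix d).transpose.mulVec y = (fun j => (k j : ℝ)) → c ≤ ∏ i, |y i| := by
  set V := frolovMatrix d with hV
  have hVd : V.det ≠ 0 := (det_frolovMatrix_pos d).ne'
  -- S is the trace form VᵀV, which is integral. From Vᵀ y = k Cramer's rule gives det S · y = V
  -- (adj S) k, so the coordinates of det S · y are the values at the roots of an integer polynomial
  -- of degree below d. Their product is a nonzero integer, which yields the constant (det S)^{-d}.
  set S : Matrix (Fin d) (Fin d) ℤ :=
    Matrix.of fun j l => (frolovMulMatrix d (X ^ ((j : ℕ) + l))).trace with hS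
  have hSV : S.map (Int.castRingHom ℝ) = V.transpose * V := by
    ext j l
    rw [Matrix.mul_apply]
    simp only [hS, Matrix.of_apply, Matrix.map_apply, Matrix.transpose_apply, hV, frolovMatrix,
      Matrix.vandermonde_apply]
    have := sum_aeval_frolovRoot hd (X ^ ((j : ℕ) + l))
    simp only [map_pow, aeval_X] at this
    simp only [eq_intCast]
    rw [← this]
    simp [pow_add]
  have hSdet : ((S.det : ℤ) : ℝ) = V.det ^ 2 := by
    have := (Int.castRingHom ℝ).map_det S
    rw [eq_intCast] at this
    rw [this]
    change (S.map (Int.castRingHom ℝ)).det = _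
    rw [hSV, Matrix.det_mul, Matrix.det_transpose, sq]
  have hS0 : 0 < ((S.det : ℤ) : ℝ) := by rw [hSdet]; positivity
  refine ⟨(((S.det : ℤ) : ℝ) ^ d)⁻¹, by positivity, fun y k hy hk => ?_⟩
  set b : Fin d → ℤ := S.adjugate.mulVec k with hb
  set B : ℤ[X] := ∑ j : Fin d, C (b j) * X ^ (j : ℕ) with hB
  have hBdeg : B.natDegree < d := by
    refine lt_of_le_of_lt (natDegree_sum_le_of_forall_le (n := d - 1) _ _ fun j _ => ?_) (by omega)
    refine (natDegree_C_mul_X_pow_le _ _).trans ?_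
    have := j.2; omega
  have hBeval : ∀ i, aeval (frolovRoot d i) B = V.mulVec (fun j => (b j : ℝ)) i := by
    intro i
    simp only [hB, map_sum, map_mul, aeval_C, map_pow, aeval_X, Matrix.mulVec, dotProduct, hV,
      frolovMatrix, Matrix.vandermonde_apply]
    exact Finset.sum_congr rfl fun j _ => by rw [mul_comm]; rfl
  have hyB : ∀ i, ((S.det : ℤ) : ℝ) * y i = aeval (frolovRoot d i) B := by
    have h1 : V.transpose.mulVec (V.mulVec (fun j => (b j : ℝ))) =
        V.transpose.mulVec (((S.det : ℤ) : ℝ) • y) := by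
      rw [Matrix.mulVec_mulVec, ← hSV, Matrix.mulVec_smul, hk]
      have h2 : S.mulVec b = S.det • k := by
        rw [hb, Matrix.mulVec_mulVec, Matrix.mul_adjugate, Matrix.smul_mulVec, Matrix.one_mulVec]
      ext j
      have h3 := congrArg (fun z : ℤ => (z : ℝ)) (congrFun h2 j)
      simp only [Matrix.mulVec, dotProduct, Pi.smul_apply, smul_eq_mul] at h3 ⊢
      rw [Int.cast_mul, Int.cast_sum] at h3
      rw [← h3]
      exact Finset.sum_congr rfl fun l _ => by
        rw [Int.cast_mul, Matrix.map_apply, eq_intCast]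
    have hinj : Function.Injective V.transpose.mulVec :=
      Matrix.mulVec_injective_iff_isUnit.2 ((Matrix.isUnit_iff_isUnit_det _).2
        (by rw [Matrix.det_transpose]; exact hVd.isUnit))
    intro i
    rw [hBeval, hinj h1]
    rfl
  have hB0 : B ≠ 0 := by
    intro h0
    refine hy (funext fun i => ?_)
    have := hyB i
    rw [h0, map_zero] at this
    exact (mul_eq_zero.1 this).resolve_left hS0.ne'
  have hdet : ∏ i, (((S.det : ℤ) : ℝ) * y i) = ((frolovMulMatrix d B).det : ℝ) := by
    rw [← prod_aeval_frolovRoot hd]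
    exact Finset.prod_congr rfl fun i _ => hyB i
  have hdet0 : (frolovMulMatrix d B).det ≠ 0 := by
    have : ((frolovMulMatrix d B).det : ℝ) ≠ 0 := by
      rw [← prod_aeval_frolovRoot hd, Finset.prod_ne_zero_iff]
      exact fun i _ => aeval_ne_zero_of_natDegree_lt hd (eval_frolovRoot i) hB0 hBdeg
    exact_mod_cast this
  have h1 : (1 : ℝ) ≤ |((frolovMulMatrix d B).det : ℝ)| := by
    exact_mod_cast Int.one_le_abs hdet0
  rw [← hdet, Finset.abs_prod] at h1
  simp only [abs_mul, abs_of_pos hS0, Finset.prod_mul_distrib, Finset.prod_const,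
    Finset.card_univ, Fintype.card_fin] at h1
  rwa [inv_le_iff_one_le_mul₀' (by positivity)]

end

/-! ### Lattice sums and Poisson summation -/

/-- The integer point with coordinates `k`. -/
noncomputable def intPoint {d : ℕ} (k : Fin d → ℤ) : EuclideanSpace ℝ (Fin d) :=
  WithLp.toLp 2 fun i => (k i : ℝ)

@[simp]
theorem intPoint_apply {d : ℕ} (k : Fin d → ℤ) (i : Fin d) : intPoint k i = (k i : ℝ) := rfl

@[simp]
theorem intPoint_zero {d : ℕ} : intPoint (0 : Fin d → ℤ) = 0 := by
  ext i; simp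

theorem intPoint_add {d : ℕ} (k l : Fin d → ℤ) : intPoint (k + l) = intPoint k + intPoint l := by
  ext i; simp

theorem summable_tensorDecay_intPoint (d : ℕ) :
    Summable fun k : Fin d → ℤ => tensorDecay 2 (intPoint k) := by
  have h1 : Summable fun j : ℤ => ((1 + |(j : ℝ)|) ^ 2)⁻¹ := by
    have h0 : Summable fun j : ℤ => (1 : ℝ) / (j : ℝ) ^ 2 :=
      Real.summable_one_div_int_pow.2 (by norm_num)
    refine Summable.of_norm_bounded_eventually h0 ?_
    rw [Filter.eventually_cofinite]
    refine (Set.finite_singleton (0 : ℤ)).subset fun j hj => ?_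
    by_contra hne
    refine hj ?_
    have h2 : 0 < |(j : ℝ)| := abs_pos.2 (by exact_mod_cast hne)
    rw [Real.norm_of_nonneg (by positivity), one_div, ← sq_abs (j : ℝ)]
    gcongr
    linarith
  have h2 := ENNReal.tsum_pi_prod (d := d)
    (fun (_ : Fin d) (j : ℤ) => ENNReal.ofReal (((1 + |(j : ℝ)|) ^ 2)⁻¹))
  have h3 : ∀ k : Fin d → ℤ, ENNReal.ofReal (tensorDecay 2 (intPoint k)) =
      ∏ i, ENNReal.ofReal (((1 + |(k i : ℝ)|) ^ 2)⁻¹) := fun k => by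
    rw [tensorDecay, ENNReal.ofReal_prod_of_nonneg fun i _ => by positivity]
    rfl
  refine (ENNReal.summable_toReal (f := fun k : Fin d → ℤ => ENNReal.ofReal (tensorDecay 2 (intPoint k)))
    ?_).congr fun k => ENNReal.toReal_ofReal (tensorDecay_pos _ _).le
  simp_rw [h3]
  rw [h2]
  refine ENNReal.prod_ne_top fun i _ => ?_
  rw [← ENNReal.ofReal_tsum_of_nonneg (fun _ => by positivity) h1]
  exact ENNReal.ofReal_ne_top

/-- Decay of a product of powers is preserved, up to the exponent, by linear isomorphisms. -/
theorem exists_tensorDecay_comp_le {d : ℕ} (T : EuclideanSpace ℝ (Fin d) ≃L[ℝ] EuclideanSpace ℝ (Fin d))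
    (E : ℕ) : ∃ C : ℝ, 0 < C ∧ ∀ v, tensorDecay (E * d) (T v) ≤ C * tensorDecay E v := by
  set M : ℝ := ‖(T.symm : EuclideanSpace ℝ (Fin d) →L[ℝ] EuclideanSpace ℝ (Fin d))‖ with hM
  refine ⟨(1 + M) ^ (E * d), by positivity, fun v => ?_⟩
  have hP : 0 < ∏ j, (1 + |T v j|) := Finset.prod_pos fun _ _ => by positivity
  have h1 : ∀ i, 1 + |v i| ≤ (1 + M) * ∏ j, (1 + |T v j|) := fun i => by
    have h2 : |v i| ≤ ‖v‖ := by simpa using PiLp.norm_apply_le v i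
    have h3 : ‖v‖ ≤ M * ‖T v‖ := by
      simpa using (T.symm : EuclideanSpace ℝ (Fin d) →L[ℝ] EuclideanSpace ℝ (Fin d)).le_opNorm (T v)
    have h4 := EuclideanSpace.one_add_norm_le_prod (T v)
    calc 1 + |v i| ≤ (1 + M) * (1 + ‖T v‖) := by nlinarith [norm_nonneg (T v), norm_nonneg v, norm_nonneg (T.symm : EuclideanSpace ℝ (Fin d) →L[ℝ] EuclideanSpace ℝ (Fin d))]
      _ ≤ _ := by gcongr
  have h5 : ∏ i, (1 + |v i|) ^ E ≤ ((1 + M) * ∏ j, (1 + |T v j|)) ^ (E * d) := by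
    calc ∏ i, (1 + |v i|) ^ E ≤ ∏ _i : Fin d, ((1 + M) * ∏ j, (1 + |T v j|)) ^ E :=
          Finset.prod_le_prod (fun _ _ => by positivity) fun i _ => by
            gcongr
            exact h1 i
      _ = _ := by simp [pow_mul]
  have e1 : tensorDecay (E * d) (T v) = ((∏ j, (1 + |T v j|)) ^ (E * d))⁻¹ := by
    rw [tensorDecay, Finset.prod_inv_distrib, Finset.prod_pow]
  have e2 : tensorDecay E v = (∏ i, (1 + |v i|) ^ E)⁻¹ := by
    rw [tensorDecay, Finset.prod_inv_distrib]
  have h6 : 0 < ∏ i, (1 + |v i|) ^ E := Finset.prod_pos fun _ _ => by positivity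
  rw [e1, e2, ← div_eq_mul_inv, le_div_iff₀ h6, inv_mul_le_iff₀ (by positivity)]
  rw [mul_pow] at h5
  linarith

section latticeSum

variable {d : ℕ} (T : EuclideanSpace ℝ (Fin d) ≃L[ℝ] EuclideanSpace ℝ (Fin d))

theorem exists_tensorDecay_lattice_le {R : ℝ} (hR : 0 < R) : ∃ C : ℝ, 0 < C ∧
    ∀ (k : Fin d → ℤ) (y : EuclideanSpace ℝ (Fin d)), (∀ i, |y i| ≤ R) →
      tensorDecay (2 * d) (T (intPoint k) - y) ≤ C * tensorDecay 2 (intPoint k) := by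
  obtain ⟨C, hC, h⟩ := exists_tensorDecay_comp_le T 2
  refine ⟨(1 + R) ^ (2 * d * d) * C, by positivity, fun k y hy => ?_⟩
  refine (tensorDecay_le_mul hR _ _ _ hy).trans ?_
  rw [mul_assoc ((1 + R) ^ (2 * d * d))]
  exact mul_le_mul_of_nonneg_left (h _) (by positivity)

theorem summable_lattice {Φ : EuclideanSpace ℝ (Fin d) → ℂ} {C : ℝ}
    (hb : ∀ x, ‖Φ x‖ ≤ C * tensorDecay (2 * d) x) (y : EuclideanSpace ℝ (Fin d)) :
    Summable fun k => Φ (T (intPoint k) - y) := by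
  have hC : 0 ≤ C := by
    by_contra hC
    have := (norm_nonneg _).trans (hb 0)
    nlinarith [tensorDecay_pos (2 * d) (0 : EuclideanSpace ℝ (Fin d))]
  obtain ⟨C', hC', h⟩ := exists_tensorDecay_lattice_le T (R := 1 + ‖y‖) (by positivity)
  refine Summable.of_norm_bounded ((summable_tensorDecay_intPoint d).mul_left (C * C')) fun k => ?_
  refine (hb _).trans ?_
  rw [mul_assoc]
  gcongr
  refine h k y fun i => ?_
  have : |y i| ≤ ‖y‖ := by simpa using PiLp.norm_apply_le y i
  linarith

theorem continuous_latticeSum {Φ : EuclideanSpace ℝ (Fin d) → ℂ} (hΦ : Continuous Φ) {C : ℝ}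
    (hb : ∀ x, ‖Φ x‖ ≤ C * tensorDecay (2 * d) x) :
    Continuous fun y => ∑' k, Φ (T (intPoint k) - y) := by
  have hC : 0 ≤ C := by
    by_contra hC
    have := (norm_nonneg _).trans (hb 0)
    nlinarith [tensorDecay_pos (2 * d) (0 : EuclideanSpace ℝ (Fin d))]
  rw [continuous_iff_continuousAt]
  intro y
  obtain ⟨C', hC', h⟩ := exists_tensorDecay_lattice_le T (R := 1 + ‖y‖) (by positivity)
  refine ContinuousOn.continuousAt (s := Metric.ball 0 (1 + ‖y‖)) ?_
    (Metric.isOpen_ball.mem_nhds (by simp))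
  refine continuousOn_tsum (u := fun k => C * C' * tensorDecay 2 (intPoint k))
    (fun k => (hΦ.comp (continuous_const.sub continuous_id)).continuousOn)
    ((summable_tensorDecay_intPoint d).mul_left (C * C')) fun k z hz => ?_
  refine (hb _).trans ?_
  rw [mul_assoc]
  gcongr
  refine h k z fun i => ?_
  have h1 : |z i| ≤ ‖z‖ := by simpa using PiLp.norm_apply_le z i
  rw [mem_ball_zero_iff] at hz
  linarith

end latticeSum

theorem integrable_tensorDecay (d : ℕ) :
    Integrable fun x : EuclideanSpace ℝ (Fin d) => tensorDecay 2 x := by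
  refine ⟨?_, ?_⟩
  · refine Continuous.aestronglyMeasurable ?_
    unfold tensorDecay
    refine continuous_finsetProd _ fun i _ => Continuous.inv₀ (by fun_prop) fun x => by positivity
  · rw [hasFiniteIntegral_iff_ofReal (.of_forall fun x => (tensorDecay_pos _ _).le)]
    have h := EuclideanSpace.lintegral_prod_eq (d := d)
      (φ := fun _ t => ENNReal.ofReal (((1 + |t|) ^ 2)⁻¹)) fun i => by fun_prop
    have h3 : ∀ x : EuclideanSpace ℝ (Fin d), ENNReal.ofReal (tensorDecay 2 x) =
        ∏ i, ENNReal.ofReal (((1 + |x i|) ^ 2)⁻¹) := fun k => by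
      rw [tensorDecay, ENNReal.ofReal_prod_of_nonneg fun i _ => by positivity]
    simp_rw [h3]
    rw [h]
    exact (ENNReal.prod_ne_top fun i _ => lintegral_decay_ne_top).lt_top

/-- The half-open unit cube with lower corner `k`. -/
def latticeCell {d : ℕ} (k : Fin d → ℤ) : Set (EuclideanSpace ℝ (Fin d)) :=
  {x | ∀ i, x i ∈ Set.Ioc (k i : ℝ) (k i + 1)}

theorem mem_latticeCell {d : ℕ} {k : Fin d → ℤ} {x : EuclideanSpace ℝ (Fin d)} :
    x ∈ latticeCell k ↔ ∀ i, x i ∈ Set.Ioc (k i : ℝ) (k i + 1) := Iff.rfl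

theorem mem_latticeCell_iff {d : ℕ} {k : Fin d → ℤ} {x : EuclideanSpace ℝ (Fin d)} :
    x ∈ latticeCell k ↔ k = fun i => ⌈x i⌉ - 1 := by
  rw [mem_latticeCell, funext_iff]
  refine forall_congr' fun i => ?_
  have h : k i = ⌈x i⌉ - 1 ↔ ⌈x i⌉ = k i + 1 := by omega
  rw [h, Int.ceil_eq_iff]
  simp

theorem measurableSet_latticeCell {d : ℕ} (k : Fin d → ℤ) : MeasurableSet (latticeCell k) := by
  have : latticeCell k = ⋂ i, (fun x : EuclideanSpace ℝ (Fin d) => x i) ⁻¹'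
      Set.Ioc (k i : ℝ) (k i + 1) := by
    ext x; rw [mem_latticeCell, Set.mem_iInter]; rfl
  rw [this]
  refine MeasurableSet.iInter fun i => measurableSet_Ioc.preimage ?_
  fun_prop

theorem hasSum_integral_latticeCell {d : ℕ} {V : Type*} [NormedAddCommGroup V] [NormedSpace ℝ V]
    {G : EuclideanSpace ℝ (Fin d) → V} (hG : Integrable G) :
    HasSum (fun k => ∫ x in latticeCell (0 : Fin d → ℤ), G (x + intPoint k)) (∫ x, G x) := by
  have hU : ⋃ k : Fin d → ℤ, latticeCell k = Set.univ := by
    ext x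
    simp [mem_latticeCell_iff]
  have hd : Pairwise (Function.onFun Disjoint (latticeCell : (Fin d → ℤ) → _)) := by
    intro k l hkl
    refine Set.disjoint_left.2 fun x hk hl => hkl ?_
    rw [mem_latticeCell_iff] at hk hl
    rw [hk, hl]
  have h := hasSum_integral_iUnion measurableSet_latticeCell hd (hG.integrableOn (s := ⋃ k, latticeCell k))
  rw [hU, setIntegral_univ] at h
  refine h.congr_fun fun k => ?_
  rw [← integral_indicator (measurableSet_latticeCell _),
    ← integral_indicator (measurableSet_latticeCell _),
    ← integral_add_right_eq_self ((latticeCell k).indicator G) (intPoint k)]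
  refine integral_congr_ae (.of_forall fun x => ?_)
  have : x + intPoint k ∈ latticeCell k ↔ x ∈ latticeCell (0 : Fin d → ℤ) := by
    simp only [mem_latticeCell, PiLp.add_apply, intPoint_apply, Set.mem_Ioc]
    refine forall_congr' fun i => ?_
    simp only [Pi.zero_apply, Int.cast_zero]
    constructor <;> rintro ⟨h1, h2⟩ <;> constructor <;> linarith
  change _ = (latticeCell k).indicator G (x + intPoint k)
  by_cases hx : x ∈ latticeCell (0 : Fin d → ℤ)
  · rw [Set.indicator_of_mem hx, Set.indicator_of_mem (this.2 hx)]
  · rw [Set.indicator_of_notMem hx, Set.indicator_of_notMem (fun h => hx (this.1 h))]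

/-- The projection of the Euclidean space onto the torus. -/
noncomputable def torusProj (d : ℕ) : C(EuclideanSpace ℝ (Fin d), UnitAddTorus (Fin d)) where
  toFun v := fun i => ((v i : ℝ) : UnitAddCircle)
  continuous_toFun := continuous_pi fun i =>
    (AddCircle.continuous_mk' (1 : ℝ)).comp (by fun_prop)

theorem isQuotientMap_torusProj (d : ℕ) : Topology.IsQuotientMap (torusProj d) := by
  have h1 : IsOpenQuotientMap
      (Pi.map fun (_ : Fin d) (t : ℝ) => (t : UnitAddCircle)) :=
    IsOpenQuotientMap.piMap fun _ => QuotientAddGroup.isOpenQuotientMap_mk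
  exact h1.isQuotientMap.comp (EuclideanSpace.equiv (Fin d) ℝ).toHomeomorph.isQuotientMap

theorem torusProj_eq_iff {d : ℕ} {v w : EuclideanSpace ℝ (Fin d)} (h : torusProj d v = torusProj d w) :
    ∃ k : Fin d → ℤ, w = v + intPoint k := by
  have h1 : ∀ i, ∃ k : ℤ, w i = v i + k := fun i => by
    have h2 : ((v i : ℝ) : UnitAddCircle) = ((w i : ℝ) : UnitAddCircle) := congrFun h i
    rw [eq_comm, QuotientAddGroup.eq_iff_sub_mem, AddSubgroup.mem_zmultiples_iff] at h2
    obtain ⟨k, hk⟩ := h2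
    refine ⟨k, ?_⟩
    rw [zsmul_one] at hk
    linarith
  choose k hk using h1
  exact ⟨k, by ext i; simp [hk]⟩

theorem mFourier_torusProj {d : ℕ} (l : Fin d → ℤ) (v : EuclideanSpace ℝ (Fin d)) :
    UnitAddTorus.mFourier (-l) (torusProj d v) = Complex.exp (((-2 * Real.pi * inner ℝ v (intPoint l) : ℝ) : ℂ) * Complex.I) := by
  change ∏ i, fourier ((-l) i) ((v i : ℝ) : UnitAddCircle) = _
  rw [PiLp.inner_apply, Finset.mul_sum, Complex.ofReal_sum, Finset.sum_mul, Complex.exp_sum]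
  refine Finset.prod_congr rfl fun i _ => ?_
  rw [fourier_coe_apply]
  congr 1
  simp
  ring

theorem mFourierCoeff_eq_integral_latticeCell {d : ℕ} (G : UnitAddTorus (Fin d) → ℂ) (l : Fin d → ℤ) :
    UnitAddTorus.mFourierCoeff G l = ∫ v in latticeCell (0 : Fin d → ℤ),
      Complex.exp (((-2 * Real.pi * inner ℝ v (intPoint l) : ℝ) : ℂ) * Complex.I) * G (torusProj d v) := by
  rw [UnitAddTorus.mFourierCoeff_eq_integral G l 0,
    ← (PiLp.volume_preserving_ofLp (Fin d)).setIntegral_preimage_emb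
      (MeasurableEquiv.toLp 2 (Fin d → ℝ)).symm.measurableEmbedding]
  have : (WithLp.ofLp ⁻¹' {x : Fin d → ℝ | ∀ i, x i ∈ Set.Ioc ((0 : Fin d → ℝ) i) ((0 : Fin d → ℝ) i + 1)} :
      Set (EuclideanSpace ℝ (Fin d))) = latticeCell (0 : Fin d → ℤ) := by
    ext x
    simp [mem_latticeCell]
  rw [this]
  refine integral_congr_ae (.of_forall fun v => ?_)
  change UnitAddTorus.mFourier (-l) (torusProj d v) * _ = _
  rw [mFourier_torusProj]
  rfl

/-- **Poisson summation** for the integer lattice, for functions with a band-limited transform. -/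
theorem tsum_intPoint_eq_tsum_fourier {d : ℕ} {F : EuclideanSpace ℝ (Fin d) → ℂ} (hF : Continuous F)
    (hFi : Integrable F) {C : ℝ} (hb : ∀ x, ‖F x‖ ≤ C * tensorDecay (2 * d) x)
    (hs : Summable fun l : Fin d → ℤ => 𝓕 F (intPoint l)) :
    ∑' k, F (intPoint k) = ∑' l, 𝓕 F (intPoint l) := by
  set g : EuclideanSpace ℝ (Fin d) → ℂ := fun v => ∑' k, F (v + intPoint k) with hg
  have hsum : ∀ v, Summable fun k => F (v + intPoint k) := fun v => by
    have := summable_lattice (ContinuousLinearEquiv.refl ℝ _) hb (-v)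
    refine this.congr fun k => ?_
    rw [sub_neg_eq_add, add_comm]; rfl
  have hgc : Continuous g := by
    have := (continuous_latticeSum (ContinuousLinearEquiv.refl ℝ _) hF hb).comp continuous_neg
    refine this.congr fun v => tsum_congr fun k => ?_
    rw [sub_neg_eq_add, add_comm]; rfl
  have hper : ∀ v l, g (v + intPoint l) = g v := fun v l => by
    simp only [hg]
    rw [← (Equiv.addLeft l).tsum_eq fun k => F (v + intPoint k)]
    refine tsum_congr fun k => ?_
    rw [Equiv.coe_addLeft, intPoint_add, add_assoc]
  -- The periodisation descends to a continuous function on the torus. Its Fourier coefficients are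
  -- the values of 𝓕 F at the integer points, and the formula is its summable Fourier series at the
  -- origin.
  have hfac : Function.FactorsThrough (⟨g, hgc⟩ : C(EuclideanSpace ℝ (Fin d), ℂ)) (torusProj d) :=
    fun v w h => by
      obtain ⟨k, rfl⟩ := torusProj_eq_iff h
      exact (hper v k).symm
  obtain ⟨G, hGg⟩ : ∃ G : C(UnitAddTorus (Fin d), ℂ), ∀ v, G (torusProj d v) = g v :=
    ⟨(isQuotientMap_torusProj d).lift ⟨g, hgc⟩ hfac, fun v =>
      DFunLike.congr_fun ((isQuotientMap_torusProj d).lift_comp ⟨g, hgc⟩ hfac) v⟩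
  have hcoeff : ∀ l, UnitAddTorus.mFourierCoeff G l = 𝓕 F (intPoint l) := fun l => by
    rw [mFourierCoeff_eq_integral_latticeCell, Real.fourier_eq']
    have hchar : ∀ v k, Complex.exp (((-2 * Real.pi * inner ℝ (v + intPoint k) (intPoint l) : ℝ) : ℂ) * Complex.I) =
        Complex.exp (((-2 * Real.pi * inner ℝ v (intPoint l) : ℝ) : ℂ) * Complex.I) := fun v k => by
      rw [← mFourier_torusProj, ← mFourier_torusProj]
      congr 1
      ext i
      change (((v + intPoint k) i : ℝ) : UnitAddCircle) = ((v i : ℝ) : UnitAddCircle)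
      rw [QuotientAddGroup.eq_iff_sub_mem, AddSubgroup.mem_zmultiples_iff]
      exact ⟨k i, by simp⟩
    have hi : Integrable fun v =>
        Complex.exp (((-2 * Real.pi * inner ℝ v (intPoint l) : ℝ) : ℂ) * Complex.I) • F v := by
      refine hFi.bdd_mul (c := 1) (by fun_prop) (.of_forall fun v => ?_)
      rw [Complex.norm_exp_ofReal_mul_I]
    rw [← (hasSum_integral_latticeCell hi).tsum_eq]
    have hchar' : ∀ v k, Complex.exp (((-2 * Real.pi * inner ℝ (v + intPoint k) (intPoint l) : ℝ) : ℂ) * Complex.I) • F (v + intPoint k) =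
        Complex.exp (((-2 * Real.pi * inner ℝ v (intPoint l) : ℝ) : ℂ) * Complex.I) * F (v + intPoint k) := fun v k => by
      rw [hchar, smul_eq_mul]
    simp_rw [hchar', hGg, hg, ← tsum_mul_left]
    refine (hasSum_integral_of_summable_integral_norm (fun k => ?_) ?_).tsum_eq.symm
    · refine ((hFi.comp_add_right (intPoint k)).bdd_mul (c := 1) (by fun_prop)
        (.of_forall fun v => ?_)).integrableOn
      rw [Complex.norm_exp_ofReal_mul_I]
    · refine (hasSum_integral_latticeCell hFi.norm).summable.congr fun k => ?_
      simp_rw [norm_mul, Complex.norm_exp_ofReal_mul_I, one_mul]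
  have hs' : Summable (UnitAddTorus.mFourierCoeff G) := hs.congr fun l => (hcoeff l).symm
  have h0 := (UnitAddTorus.hasSum_mFourier_series_apply_of_summable hs' 0).tsum_eq
  have e0 : G 0 = ∑' k, F (intPoint k) := by
    have h1 := hGg 0
    have h2 : torusProj d 0 = 0 := by ext i; exact AddCircle.coe_zero (p := 1)
    rw [h2] at h1
    rw [h1]
    simp [hg]
  rw [← e0, ← h0]
  refine tsum_congr fun l => ?_
  rw [hcoeff]
  have : UnitAddTorus.mFourier l (0 : UnitAddTorus (Fin d)) = 1 := by
    change ∏ i, fourier (l i) (0 : UnitAddCircle) = 1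
    simp
  rw [this, smul_eq_mul, mul_one]

theorem integral_comp_continuousLinearEquiv {d : ℕ}
    (T : EuclideanSpace ℝ (Fin d) ≃L[ℝ] EuclideanSpace ℝ (Fin d)) (h : EuclideanSpace ℝ (Fin d) → ℂ) :
    ∫ v, h (T v) = ((|LinearMap.det (T : EuclideanSpace ℝ (Fin d) →ₗ[ℝ] EuclideanSpace ℝ (Fin d))|⁻¹ : ℝ) : ℂ) *
      ∫ x, h x := by
  have hdet := T.toLinearEquiv.isUnit_det'.ne_zero
  have h1 := Measure.map_linearMap_addHaar_eq_smul_addHaar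
    (volume : Measure (EuclideanSpace ℝ (Fin d))) hdet
  have h2 := integral_map_equiv (μ := volume) T.toHomeomorph.toMeasurableEquiv h
  have h3 : Measure.map T.toHomeomorph.toMeasurableEquiv (volume : Measure (EuclideanSpace ℝ (Fin d))) =
    ENNReal.ofReal |(LinearMap.det (T : EuclideanSpace ℝ (Fin d) →ₗ[ℝ] EuclideanSpace ℝ (Fin d)))⁻¹| • volume := h1
  rw [h3, integral_smul_measure, ENNReal.toReal_ofReal (abs_nonneg _), abs_inv] at h2
  rw [← Complex.real_smul]
  exact h2.symm

theorem fourier_comp_continuousLinearEquiv_sub {d : ℕ}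
    (T : EuclideanSpace ℝ (Fin d) ≃L[ℝ] EuclideanSpace ℝ (Fin d)) (Λ : EuclideanSpace ℝ (Fin d) → ℂ)
    (y w : EuclideanSpace ℝ (Fin d)) :
    𝓕 (fun v => Λ (T v - y)) w =
      ((|LinearMap.det (T : EuclideanSpace ℝ (Fin d) →ₗ[ℝ] EuclideanSpace ℝ (Fin d))|⁻¹ : ℝ) : ℂ) *
      (Complex.exp (((-2 * Real.pi * inner ℝ (T.symm y) w : ℝ) : ℂ) * Complex.I) *
        𝓕 Λ (ContinuousLinearMap.adjoint
          (T.symm : EuclideanSpace ℝ (Fin d) →L[ℝ] EuclideanSpace ℝ (Fin d)) w)) := by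
  rw [Real.fourier_eq', Real.fourier_eq']
  have h1 := integral_comp_continuousLinearEquiv T fun x =>
    Complex.exp (((-2 * Real.pi * inner ℝ (T.symm x) w : ℝ) : ℂ) * Complex.I) * Λ (x - y)
  simp only [ContinuousLinearEquiv.symm_apply_apply] at h1
  simp only [smul_eq_mul]
  rw [h1, ← integral_add_right_eq_self _ y]
  congr 1
  rw [← integral_const_mul]
  refine integral_congr_ae (.of_forall fun x => ?_)
  dsimp only
  rw [add_sub_cancel_right, ← mul_assoc, ← Complex.exp_add]
  congr 2
  rw [ContinuousLinearMap.adjoint_inner_right, map_add, inner_add_left]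
  push_cast
  ring

/-- The error of an equal weight lattice rule on a band-limited function. -/
theorem norm_fourier_zero_sub_latticeSum_le {d : ℕ}
    (T : EuclideanSpace ℝ (Fin d) ≃L[ℝ] EuclideanSpace ℝ (Fin d)) {Λ : EuclideanSpace ℝ (Fin d) → ℂ}
    (hΛ : Continuous Λ) (hΛi : Integrable Λ) {C : ℝ} (hb : ∀ x, ‖Λ x‖ ≤ C * tensorDecay (2 * d * d) x)
    {B : ℝ} (hB : ∀ ξ, ‖𝓕 Λ ξ‖ ≤ B) (s : Finset (Fin d → ℤ)) (h0 : 0 ∉ s)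
    (hs : ∀ l, l ≠ 0 → l ∉ s → 𝓕 Λ (ContinuousLinearMap.adjoint
      (T.symm : EuclideanSpace ℝ (Fin d) →L[ℝ] EuclideanSpace ℝ (Fin d)) (intPoint l)) = 0)
    (y : EuclideanSpace ℝ (Fin d)) :
    ‖𝓕 Λ 0 - ((|LinearMap.det (T : EuclideanSpace ℝ (Fin d) →ₗ[ℝ] EuclideanSpace ℝ (Fin d))| : ℝ) : ℂ) *
      ∑' k, Λ (T (intPoint k) - y)‖ ≤ s.card * B := by
  set D : ℝ := |LinearMap.det (T : EuclideanSpace ℝ (Fin d) →ₗ[ℝ] EuclideanSpace ℝ (Fin d))| with hD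
  have hD0 : 0 < D := abs_pos.2 T.toLinearEquiv.isUnit_det'.ne_zero
  have hC : 0 ≤ C := by
    by_contra hC
    have := (norm_nonneg _).trans (hb 0)
    nlinarith [tensorDecay_pos (2 * d * d) (0 : EuclideanSpace ℝ (Fin d))]
  have hFT := fun l => fourier_comp_continuousLinearEquiv_sub T Λ y (intPoint l)
  rw [← hD] at hFT
  have hzero : ∀ l ∉ insert 0 s, 𝓕 (fun v => Λ (T v - y)) (intPoint l) = 0 := fun l hl => by
    rw [Finset.mem_insert, not_or] at hl
    rw [hFT, hs l hl.1 hl.2]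
    simp
  -- Composition with T divides the decay exponent by d: the `2 * d * d` of the hypothesis becomes
  -- the `2 * d` required for Poisson summation.
  obtain ⟨C₁, hC₁, h₁⟩ := exists_tensorDecay_comp_le T (2 * d)
  have hFb : ∀ v, ‖Λ (T v - y)‖ ≤ C * ((1 + (1 + ‖y‖)) ^ (2 * d * d * d) * C₁) * tensorDecay (2 * d) v := by
    intro v
    refine (hb _).trans ?_
    rw [mul_assoc C]
    refine mul_le_mul_of_nonneg_left ?_ hC
    have h2 := tensorDecay_le_mul (R := 1 + ‖y‖) (by positivity) (2 * d * d) (T v) y fun i => by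
      have : |y i| ≤ ‖y‖ := by simpa using PiLp.norm_apply_le y i
      linarith
    refine h2.trans ?_
    rw [mul_assoc ((1 + (1 + ‖y‖)) ^ (2 * d * d * d))]
    exact mul_le_mul_of_nonneg_left (h₁ v) (by positivity)
  have hFi : Integrable fun v => Λ (T v - y) := by
    have := (hΛi.comp_sub_right y)
    have h1 := Measure.map_linearMap_addHaar_eq_smul_addHaar
      (volume : Measure (EuclideanSpace ℝ (Fin d))) T.toLinearEquiv.isUnit_det'.ne_zero
    have h2 : Integrable (fun x => Λ (x - y))
        (Measure.map T.toHomeomorph.toMeasurableEquiv (volume : Measure (EuclideanSpace ℝ (Fin d)))) := by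
      have h3 := this.smul_measure (c := ENNReal.ofReal
        |(LinearMap.det (T : EuclideanSpace ℝ (Fin d) →ₗ[ℝ] EuclideanSpace ℝ (Fin d)))⁻¹|)
        ENNReal.ofReal_ne_top
      exact h1 ▸ h3
    exact (integrable_map_equiv _ _).1 h2
  have hP := tsum_intPoint_eq_tsum_fourier (F := fun v => Λ (T v - y))
    (hΛ.comp (T.continuous.sub continuous_const)) hFi hFb
    (summable_of_hasFiniteSupport ((insert 0 s).finite_toSet.subset fun l hl => by
      by_contra h; exact hl (hzero l h)))
  rw [hP, tsum_eq_sum (s := insert 0 s) hzero, Finset.sum_insert h0, hFT 0]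
  simp only [intPoint_zero, map_zero, inner_zero_right, mul_zero, Complex.ofReal_zero, zero_mul,
    Complex.exp_zero, one_mul]
  have hDD : ((D : ℝ) : ℂ) * ((D⁻¹ : ℝ) : ℂ) = 1 := by
    rw [← Complex.ofReal_mul, mul_inv_cancel₀ hD0.ne', Complex.ofReal_one]
  rw [mul_add, ← mul_assoc, hDD, one_mul, sub_add_cancel_left, norm_neg, Finset.mul_sum]
  refine (norm_sum_le _ _).trans ?_
  rw [← nsmul_eq_mul]
  refine Finset.sum_le_card_nsmul _ _ _ fun l _ => ?_
  rw [hFT, ← mul_assoc, hDD, one_mul, norm_mul, Complex.norm_exp_ofReal_mul_I, one_mul]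
  exact hB _

/-! ### Counting points of the lattice and of its dual -/

/-- A set of points in a box, any two of which (and the origin) have a large product of coordinate
distances, is small. -/
theorem mul_card_le_of_separated {d : ℕ} (hd : 1 ≤ d) {ι : Type*} (s : Finset ι) (z : ι → Fin d → ℝ)
    {δ : ℝ} (hδ : 0 < δ) {A : Fin d → ℝ} (hA : ∀ i, 0 < A i)
    (hsep : ∀ a ∈ s, ∀ b ∈ s, a ≠ b → δ ≤ ∏ i, |z a i - z b i|)
    (hnz : ∀ a ∈ s, δ ≤ ∏ i, |z a i|) (hbox : ∀ a ∈ s, ∀ i, |z a i| ≤ A i) :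
    δ * s.card ≤ 3 * ∏ i, (2 * A i) := by
  rcases s.eq_empty_or_nonempty with rfl | ⟨a₀, ha₀⟩
  · have : 0 ≤ ∏ i, (2 * A i) := Finset.prod_nonneg fun i _ => by have := hA i; positivity
    simpa
  set i₀ : Fin d := ⟨0, hd⟩
  set P : ℝ := ∏ i ∈ Finset.univ.erase i₀, (2 * A i) with hP
  have hP0 : 0 < P := Finset.prod_pos fun i _ => by have := hA i; positivity
  have hPA : ∏ i, (2 * A i) = 2 * A i₀ * P := (Finset.mul_prod_erase _ _ (Finset.mem_univ i₀)).symm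
  -- In all coordinates but one, distances inside the box are at most the side lengths. The
  -- remaining coordinate must then differ by at least w, and the points are counted by their
  -- projections to this single axis.
  set w : ℝ := δ / P with hw
  have hw0 : 0 < w := by positivity
  have hd' : ∀ a ∈ s, ∀ b ∈ s, a ≠ b → w ≤ |z a i₀ - z b i₀| := by
    intro a ha b hb hab
    have h := hsep a ha b hb hab
    rw [← Finset.mul_prod_erase _ _ (Finset.mem_univ i₀)] at h
    have h2 : ∏ i ∈ Finset.univ.erase i₀, |z a i - z b i| ≤ P :=
      Finset.prod_le_prod (fun _ _ => abs_nonneg _) fun i _ => by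
        have h3 := abs_sub (z a i) (z b i)
        linarith [hbox a ha i, hbox b hb i]
    rw [hw, div_le_iff₀ hP0]
    exact h.trans (mul_le_mul_of_nonneg_left h2 (abs_nonneg _))
  have hmaps : ∀ a ∈ s, ⌊z a i₀ / w⌋ ∈ Finset.Icc ⌊-A i₀ / w⌋ ⌊A i₀ / w⌋ := fun a ha => by
    have h := abs_le.1 (hbox a ha i₀)
    rw [Finset.mem_Icc]
    constructor <;> apply Int.floor_le_floor <;> gcongr
    · exact h.1
    · exact h.2
  have hinj : Set.InjOn (fun a => ⌊z a i₀ / w⌋) s := by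
    intro a ha b hb hab
    by_contra hne
    have h1 := Int.abs_sub_lt_one_of_floor_eq_floor hab
    rw [← sub_div, abs_div, abs_of_pos hw0, div_lt_one hw0] at h1
    exact absurd (hd' a ha b hb hne) (not_le.2 h1)
  have hcard := Finset.card_le_card_of_injOn _ hmaps hinj
  rw [Int.card_Icc] at hcard
  have hA0 := hA i₀
  have hle : ⌊-A i₀ / w⌋ ≤ ⌊A i₀ / w⌋ + 1 := by
    have : ⌊-A i₀ / w⌋ ≤ ⌊A i₀ / w⌋ := by
      apply Int.floor_le_floor
      gcongr
      linarith
    omega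
  have hcard' : (s.card : ℝ) ≤ 2 * A i₀ / w + 2 := by
    have h1 : (s.card : ℤ) ≤ ⌊A i₀ / w⌋ + 1 - ⌊-A i₀ / w⌋ := by omega
    have h2 : (s.card : ℝ) ≤ ⌊A i₀ / w⌋ + 1 - ⌊-A i₀ / w⌋ := by exact_mod_cast h1
    have h3 := Int.floor_le (A i₀ / w)
    have h4 := Int.lt_floor_add_one (-A i₀ / w)
    rw [neg_div] at h4 h2
    have : 2 * A i₀ / w = A i₀ / w + A i₀ / w := by ring
    linarith
  have hX : 2 * A i₀ / w = (∏ i, (2 * A i)) / δ := by rw [hPA, hw]; field_simp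
  -- Separation from the origin makes the volume of a box containing one of the points at least δ.
  -- This absorbs the additive 2 of the one-dimensional count into the factor 3, and it gives no
  -- points at all in small boxes.
  have hX1 : 1 ≤ (∏ i, (2 * A i)) / δ := by
    rw [le_div_iff₀ hδ, one_mul]
    refine (hnz a₀ ha₀).trans (Finset.prod_le_prod (fun _ _ => abs_nonneg _) fun i _ => ?_)
    linarith [hbox a₀ ha₀ i, hA i]
  rw [hX] at hcard'
  have : (s.card : ℝ) ≤ 3 * ((∏ i, (2 * A i)) / δ) := by linarith
  calc δ * s.card ≤ δ * (3 * ((∏ i, (2 * A i)) / δ)) := by gcongr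
    _ = _ := by field_simp

/-- The scaling factor of the generator of the lattice. -/
noncomputable def frolovScale (d n : ℕ) : ℝ := ((n : ℝ) * (frolovMatrix d).det) ^ (-(1 / (d : ℝ)))

theorem frolovGenerator_eq (d n : ℕ) : frolovGenerator d n = frolovScale d n • frolovMatrix d := rfl

theorem frolovScale_pos (d : ℕ) {n : ℕ} (hn : 1 ≤ n) : 0 < frolovScale d n := by
  have := det_frolovMatrix_pos d
  have : (0 : ℝ) < n := by exact_mod_cast hn
  unfold frolovScale
  positivity

theorem frolovScale_pow {d n : ℕ} (hd : 1 ≤ d) (hn : 1 ≤ n) :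
    frolovScale d n ^ d = ((n : ℝ) * (frolovMatrix d).det)⁻¹ := by
  have := det_frolovMatrix_pos d
  have h1 : (0 : ℝ) < n := by exact_mod_cast hn
  have h2 : (0 : ℝ) < d := by exact_mod_cast hd
  rw [frolovScale, ← Real.rpow_natCast, ← Real.rpow_mul (by positivity), neg_mul,
    one_div_mul_cancel h2.ne', Real.rpow_neg_one]

theorem det_frolovGenerator {d n : ℕ} (hd : 1 ≤ d) (hn : 1 ≤ n) :
    (frolovGenerator d n).det = (n : ℝ)⁻¹ := by
  have := det_frolovMatrix_pos d
  rw [frolovGenerator_eq, Matrix.det_smul, Fintype.card_fin, frolovScale_pow hd hn]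
  field_simp

theorem exists_frolovEquiv {d n : ℕ} (hd : 1 ≤ d) (hn : 1 ≤ n) :
    ∃ T : EuclideanSpace ℝ (Fin d) ≃L[ℝ] EuclideanSpace ℝ (Fin d),
      (∀ v i, T v i = (frolovGenerator d n).mulVec (WithLp.ofLp v) i) ∧
      LinearMap.det (T : EuclideanSpace ℝ (Fin d) →ₗ[ℝ] EuclideanSpace ℝ (Fin d)) = (n : ℝ)⁻¹ := by
  have hn0 : (n : ℝ) ≠ 0 := by positivity
  set L : EuclideanSpace ℝ (Fin d) →ₗ[ℝ] EuclideanSpace ℝ (Fin d) :=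
    Matrix.toEuclideanLin (frolovGenerator d n) with hL
  have hdet : LinearMap.det L = (n : ℝ)⁻¹ := by
    rw [hL, ← det_frolovGenerator hd hn, Matrix.toEuclideanLin_eq_toLin_orthonormal,
      LinearMap.det_toLin]
  have hne : LinearMap.det L ≠ 0 := by rw [hdet]; exact inv_ne_zero hn0
  refine ⟨(LinearMap.equivOfDetNeZero L hne).toContinuousLinearEquiv, fun v i => rfl, ?_⟩
  rw [← hdet]
  congr 1

/-- The transposed generator maps the points of the dual lattice to the integer points. -/
theorem transpose_mulVec_adjoint_symm {d n : ℕ}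
    {T : EuclideanSpace ℝ (Fin d) ≃L[ℝ] EuclideanSpace ℝ (Fin d)}
    (hT : ∀ v i, T v i = (frolovGenerator d n).mulVec (WithLp.ofLp v) i) (w : EuclideanSpace ℝ (Fin d)) :
    (frolovGenerator d n).transpose.mulVec (WithLp.ofLp (ContinuousLinearMap.adjoint
      (T.symm : EuclideanSpace ℝ (Fin d) →L[ℝ] EuclideanSpace ℝ (Fin d)) w)) = WithLp.ofLp w := by
  set z := ContinuousLinearMap.adjoint
      (T.symm : EuclideanSpace ℝ (Fin d) →L[ℝ] EuclideanSpace ℝ (Fin d)) w with hz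
  ext j
  have h := ContinuousLinearMap.adjoint_inner_right
    (T.symm : EuclideanSpace ℝ (Fin d) →L[ℝ] EuclideanSpace ℝ (Fin d)) (T (EuclideanSpace.single j 1)) w
  rw [← hz] at h
  simp only [ContinuousLinearEquiv.coe_coe, ContinuousLinearEquiv.symm_apply_apply] at h
  rw [EuclideanSpace.inner_single_left, PiLp.inner_apply] at h
  simp only [map_one, one_mul] at h
  rw [← h, Matrix.mulVec, dotProduct]
  refine Finset.sum_congr rfl fun i _ => ?_
  rw [hT]
  simp [Matrix.mulVec, dotProduct, mul_comm, PiLp.single_apply]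

/-- Lower bound for the coordinate products of the points of the dual lattice. -/
theorem exists_le_prod_abs_adjoint_symm {d : ℕ} (hd : 1 ≤ d) :
    ∃ c : ℝ, 0 < c ∧ ∀ n : ℕ, 1 ≤ n → ∀ T : EuclideanSpace ℝ (Fin d) ≃L[ℝ] EuclideanSpace ℝ (Fin d),
      (∀ v i, T v i = (frolovGenerator d n).mulVec (WithLp.ofLp v) i) → ∀ l : Fin d → ℤ, l ≠ 0 →
      c * n ≤ ∏ i, |ContinuousLinearMap.adjoint
        (T.symm : EuclideanSpace ℝ (Fin d) →L[ℝ] EuclideanSpace ℝ (Fin d)) (intPoint l) i| := by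
  obtain ⟨c, hc, h⟩ := exists_le_prod_abs hd
  have hV := det_frolovMatrix_pos d
  refine ⟨c * (frolovMatrix d).det, by positivity, fun n hn T hT l hl => ?_⟩
  have hz := transpose_mulVec_adjoint_symm hT (intPoint l)
  set z := ContinuousLinearMap.adjoint
      (T.symm : EuclideanSpace ℝ (Fin d) →L[ℝ] EuclideanSpace ℝ (Fin d)) (intPoint l) with hzdef
  have hs := frolovScale_pos d hn
  have h1 : (frolovMatrix d).transpose.mulVec (frolovScale d n • WithLp.ofLp z) =
      fun j => (l j : ℝ) := by
    rw [Matrix.mulVec_smul, ← Matrix.smul_mulVec, ← Matrix.transpose_smul, ← frolovGenerator_eq, hz]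
    rfl
  have h2 : frolovScale d n • WithLp.ofLp z ≠ 0 := by
    intro h0
    rw [h0, Matrix.mulVec_zero] at h1
    refine hl (funext fun j => ?_)
    have := congrFun h1 j
    simpa using this.symm
  have h3 := h _ l h2 h1
  simp only [Pi.smul_apply, smul_eq_mul, abs_mul, Finset.prod_mul_distrib, Finset.prod_const,
    Finset.card_univ, Fintype.card_fin, abs_of_pos hs, frolovScale_pow hd hn] at h3
  have hn0 : (0 : ℝ) < n := by exact_mod_cast hn
  rw [inv_mul_eq_div, le_div_iff₀ (by positivity)] at h3
  calc c * (frolovMatrix d).det * n = c * (n * (frolovMatrix d).det) := by ring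
    _ ≤ _ := h3

/-- The number of nonzero points of the dual lattice in a box. -/
theorem exists_card_dual_le {d : ℕ} (hd : 1 ≤ d) :
    ∃ C : ℝ, 0 < C ∧ ∀ n : ℕ, 1 ≤ n → ∀ T : EuclideanSpace ℝ (Fin d) ≃L[ℝ] EuclideanSpace ℝ (Fin d),
      (∀ v i, T v i = (frolovGenerator d n).mulVec (WithLp.ofLp v) i) → ∀ A : Fin d → ℝ, (∀ i, 0 < A i) →
      ∃ s : Finset (Fin d → ℤ), (∀ l, l ∈ s ↔ l ≠ 0 ∧ ∀ i, |ContinuousLinearMap.adjoint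
        (T.symm : EuclideanSpace ℝ (Fin d) →L[ℝ] EuclideanSpace ℝ (Fin d)) (intPoint l) i| ≤ A i) ∧
        n * s.card ≤ C * ∏ i, A i := by
  obtain ⟨c, hc, h⟩ := exists_le_prod_abs_adjoint_symm hd
  refine ⟨c⁻¹ * 3 * 2 ^ d, by positivity, fun n hn T hT A hA => ?_⟩
  have hn0 : (0 : ℝ) < n := by exact_mod_cast hn
  have hz := h n hn T hT
  set z : (Fin d → ℤ) → EuclideanSpace ℝ (Fin d) := fun l => ContinuousLinearMap.adjoint
        (T.symm : EuclideanSpace ℝ (Fin d) →L[ℝ] EuclideanSpace ℝ (Fin d)) (intPoint l) with hzdef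
  have hsub : ∀ k l i, z k i - z l i = z (k - l) i := fun k l i => by
    have : intPoint (k - l) = intPoint k - intPoint l := by ext j; simp
    simp only [hzdef]
    rw [this, map_sub]
    rfl
  have key : ∀ s : Finset (Fin d → ℤ), (∀ l ∈ s, l ≠ 0 ∧ ∀ i, |z l i| ≤ A i) →
      n * (s.card : ℝ) ≤ c⁻¹ * 3 * 2 ^ d * ∏ i, A i := fun s hs => by
    have h1 := mul_card_le_of_separated hd s (fun l i => z l i) (δ := c * n) (by positivity) hA
      (fun a _ b _ hab => by
        simp only [hsub]
        exact hz _ (sub_ne_zero.2 hab)) (fun a ha => hz a (hs a ha).1) fun a ha => (hs a ha).2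
    rw [Finset.prod_mul_distrib, Finset.prod_const, Finset.card_univ, Fintype.card_fin] at h1
    calc n * (s.card : ℝ) = c⁻¹ * (c * n * s.card) := by field_simp
      _ ≤ c⁻¹ * (3 * (2 ^ d * ∏ i, A i)) := by gcongr
      _ = _ := by ring
  -- The bound for arbitrary finite subsets also shows that the whole set is finite.
  have hfin : {l : Fin d → ℤ | l ≠ 0 ∧ ∀ i, |z l i| ≤ A i}.Finite := by
    by_contra hinf
    obtain ⟨N, hN⟩ := exists_nat_gt (c⁻¹ * 3 * 2 ^ d * ∏ i, A i)
    obtain ⟨s, hs, hcard⟩ := Set.Infinite.exists_subset_card_eq hinf N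
    have h1 := key s fun l hl => hs hl
    rw [hcard] at h1
    have : (1 : ℝ) ≤ n := by exact_mod_cast hn
    nlinarith [(Nat.cast_nonneg N : (0 : ℝ) ≤ N)]
  refine ⟨hfin.toFinset, fun l => hfin.mem_toFinset, key _ fun l hl => hfin.mem_toFinset.1 hl⟩

/-- The number of lattice points in a box of fixed size. -/
theorem exists_card_lattice_le {d : ℕ} (hd : 1 ≤ d) {R : ℝ} (hR : 0 ≤ R) :
    ∃ C : ℝ, 0 < C ∧ ∀ n : ℕ, 1 ≤ n → ∀ T : EuclideanSpace ℝ (Fin d) ≃L[ℝ] EuclideanSpace ℝ (Fin d),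
      (∀ v i, T v i = (frolovGenerator d n).mulVec (WithLp.ofLp v) i) →
      ∀ (u : EuclideanSpace ℝ (Fin d)) (s : Finset (Fin d → ℤ)),
        (∀ k ∈ s, ∀ i, |T (intPoint k) i - u i| ≤ R) → (s.card : ℝ) ≤ C * n := by
  set V := frolovMatrix d with hV
  have hV0 := det_frolovMatrix_pos d
  set v : ℝ := R * ∑ j, ∑ i, |V⁻¹ j i| with hv
  have hv0 : 0 ≤ v := by positivity
  refine ⟨(2 * v + 1 * (V.det⁻¹) ^ (1 / (d : ℝ))) ^ d * V.det, by positivity, fun n hn T hT u s hs => ?_⟩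
  have hn0 : (0 : ℝ) < n := by exact_mod_cast hn
  have hc := frolovScale_pos d hn
  set c := frolovScale d n with hcdef
  have hinv : V⁻¹ * V = 1 := Matrix.nonsing_inv_mul _ hV0.ne'.isUnit
  set t : Fin d → ℝ := c⁻¹ • V⁻¹.mulVec (WithLp.ofLp u) with ht
  set M : ℝ := c⁻¹ * v with hM
  have hM0 : 0 ≤ M := by positivity
  have hk : ∀ k ∈ s, ∀ j, |(k j : ℝ) - t j| ≤ M := fun k hk j => by
    have h1 : (fun j => (k j : ℝ)) = c⁻¹ • V⁻¹.mulVec (WithLp.ofLp (T (intPoint k))) := by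
      have h2 : WithLp.ofLp (T (intPoint k)) = c • V.mulVec (fun j => (k j : ℝ)) := by
        ext i
        rw [hT, frolovGenerator_eq, Matrix.smul_mulVec]
        rfl
      rw [h2, Matrix.mulVec_smul, Matrix.mulVec_mulVec, hinv, Matrix.one_mulVec, smul_smul,
        inv_mul_cancel₀ hc.ne', one_smul]
    have h2 := congrFun h1 j
    rw [h2, ht, Pi.smul_apply, Pi.smul_apply, smul_eq_mul, smul_eq_mul, ← mul_sub, abs_mul,
      abs_of_pos (inv_pos.2 hc), hM]
    gcongr
    rw [Matrix.mulVec, Matrix.mulVec, dotProduct, dotProduct, ← Finset.sum_sub_distrib]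
    calc |∑ i, (V⁻¹ j i * T (intPoint k) i - V⁻¹ j i * u i)| ≤ ∑ i, |V⁻¹ j i| * R := by
          refine (Finset.abs_sum_le_sum_abs _ _).trans (Finset.sum_le_sum fun i _ => ?_)
          rw [← mul_sub, abs_mul]
          exact mul_le_mul_of_nonneg_left (hs k hk i) (abs_nonneg _)
      _ = R * ∑ i, |V⁻¹ j i| := by rw [← Finset.sum_mul, mul_comm]
      _ ≤ v := by
          rw [hv]
          exact mul_le_mul_of_nonneg_left (Finset.single_le_sum (f := fun j => ∑ i, |V⁻¹ j i|)
            (fun _ _ => by positivity) (Finset.mem_univ j)) hR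
  have hsub : s ⊆ Fintype.piFinset fun j => Finset.Icc ⌈t j - M⌉ ⌊t j + M⌋ := fun k hks => by
    rw [Fintype.mem_piFinset]
    intro j
    have := abs_le.1 (hk k hks j)
    rw [Finset.mem_Icc, Int.ceil_le, Int.le_floor]
    constructor <;> linarith [this.1, this.2]
  have h1 := Finset.card_le_card hsub
  rw [Fintype.card_piFinset] at h1
  have h2 : ∀ j, ((Finset.Icc ⌈t j - M⌉ ⌊t j + M⌋).card : ℝ) ≤ 2 * M + 1 := fun j => by
    rw [Int.card_Icc]
    rcases le_total 0 (⌊t j + M⌋ + 1 - ⌈t j - M⌉) with h | h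
    · have h3 : (((⌊t j + M⌋ + 1 - ⌈t j - M⌉).toNat : ℤ) : ℝ) = ⌊t j + M⌋ + 1 - ⌈t j - M⌉ := by
        rw [Int.toNat_of_nonneg h]; push_cast; ring
      rw [Int.cast_natCast] at h3
      rw [h3]
      linarith [Int.floor_le (t j + M), Int.le_ceil (t j - M)]
    · rw [Int.toNat_of_nonpos h]
      simp only [Nat.cast_zero]
      positivity
  have h3 : (s.card : ℝ) ≤ (2 * M + 1) ^ d := by
    calc (s.card : ℝ) ≤ ∏ j, ((Finset.Icc ⌈t j - M⌉ ⌊t j + M⌋).card : ℝ) := by exact_mod_cast h1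
      _ ≤ ∏ _j : Fin d, (2 * M + 1) := Finset.prod_le_prod (fun _ _ => by positivity) fun j _ => h2 j
      _ = _ := by simp
  -- The scale is largest for n = 1. Hence the side 2M + 1 of the box of integer points is at most a
  -- constant times c⁻¹, and c^{-d} = n det V.
  have hcle : c ≤ (V.det⁻¹) ^ (1 / (d : ℝ)) := by
    rw [hcdef, frolovScale, Real.rpow_neg (by positivity), ← Real.inv_rpow (by positivity)]
    refine Real.rpow_le_rpow (by positivity) ?_ (by positivity)
    refine inv_anti₀ hV0 (le_mul_of_one_le_left hV0.le (by exact_mod_cast hn))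
  have hcpow : (c⁻¹) ^ d = n * V.det := by
    rw [inv_pow, hcdef, frolovScale_pow hd hn, inv_inv]
  calc (s.card : ℝ) ≤ (2 * M + 1) ^ d := h3
    _ = (c⁻¹ * (2 * v + 1 * c)) ^ d := by
        congr 1
        rw [hM]
        field_simp
    _ ≤ (c⁻¹ * (2 * v + 1 * (V.det⁻¹) ^ (1 / (d : ℝ)))) ^ d := by gcongr
    _ = _ := by rw [mul_pow, hcpow]; ring

/-! ### The error functional on one frequency band -/

namespace DualMeans

variable {s : ℝ} {K : LocalMeans s} (D : DualMeans K) {d : ℕ}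

theorem exists_norm_kernel_le_tensorDecay (d E : ℕ) : ∃ C : ℝ, 0 < C ∧ ∀ (m : Fin d → ℕ) x,
    ‖D.kernel m x‖ ≤ C * 2 ^ (∑ i, m i) * tensorDecay E x := by
  obtain ⟨C, hC, h⟩ := D.exists_norm_kernel_le d E
  refine ⟨C, hC, fun m x => (h m x).trans ?_⟩
  rw [mul_right_comm, ← Finset.prod_pow_eq_pow_sum]
  refine mul_le_mul_of_nonneg_right ?_ (tensorDecay_pos _ _).le
  gcongr with i
  refine mul_le_of_le_one_right (by positivity) (inv_le_one_of_one_le₀ (one_le_pow₀ ?_))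
  linarith [show (0 : ℝ) ≤ 2 ^ m i * |x i| by positivity]

theorem integrable_kernel (m : Fin d → ℕ) : Integrable (D.kernel m) := by
  obtain ⟨C, hC, h⟩ := D.exists_norm_kernel_le_tensorDecay d 2
  exact ((integrable_tensorDecay d).const_mul (C * 2 ^ (∑ i, m i))).mono'
    (D.continuous_kernel m).aestronglyMeasurable (.of_forall (h m))

theorem fourier_kernel (m : Fin d → ℕ) : 𝓕 (D.kernel m) = D.symbol m := by
  rw [← D.fourierInv_symbol m]
  refine (D.continuous_symbol m).fourier_fourierInv_eq (D.integrable_symbol m) ?_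
  refine (D.integrable_kernel m).comp_neg.congr (.of_forall fun x => ?_)
  dsimp only
  rw [← D.fourierInv_symbol m, Real.fourierInv_eq_fourier_neg, neg_neg]

theorem integral_kernel (m : Fin d → ℕ) : ∫ x, D.kernel m x = D.symbol m 0 := by
  rw [← D.fourier_kernel, Real.fourier_eq']
  simp

theorem exists_lintegral_enorm_kernel_le (d : ℕ) : ∃ C : ℝ, 0 < C ∧ ∀ m : Fin d → ℕ,
    ∫⁻ x, ‖D.kernel m x‖ₑ ≤ ENNReal.ofReal C := by
  obtain ⟨C, hC, h⟩ := D.exists_norm_kernel_le d 0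
  set I := ∫⁻ t : ℝ, ENNReal.ofReal (((1 + |t|) ^ 2)⁻¹) with hI
  have hIt : I ≠ ⊤ := lintegral_decay_ne_top
  refine ⟨C * (1 + I.toReal ^ d), by positivity, fun m => ?_⟩
  have hle : ∀ x : EuclideanSpace ℝ (Fin d), ‖D.kernel m x‖ₑ ≤ ENNReal.ofReal C *
      ∏ i, ENNReal.ofReal (2 ^ (m i) * ((1 + 2 ^ (m i) * |x i|) ^ 2)⁻¹) := fun x => by
    rw [← ENNReal.ofReal_prod_of_nonneg fun i _ => by positivity, ← ENNReal.ofReal_mul hC.le,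
      ← ofReal_norm]
    refine ENNReal.ofReal_le_ofReal ?_
    simpa [tensorDecay] using h m x
  refine (lintegral_mono hle).trans ?_
  rw [lintegral_const_mul' _ _ ENNReal.ofReal_ne_top, EuclideanSpace.lintegral_prod_eq
    (φ := fun i t => ENNReal.ofReal (2 ^ (m i) * ((1 + 2 ^ (m i) * |t|) ^ 2)⁻¹)) fun i => by fun_prop]
  simp_rw [lintegral_dyadic_decay]
  rw [← hI, Finset.prod_const, Finset.card_univ, Fintype.card_fin, ENNReal.ofReal_mul hC.le,
    ← ENNReal.ofReal_toReal (ENNReal.pow_ne_top hIt), ENNReal.toReal_pow]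
  gcongr
  linarith

/-- The kernel of the error functional of the lattice rule on the band `m`. -/
noncomputable def errorWeight (n : ℕ) (T : EuclideanSpace ℝ (Fin d) ≃L[ℝ] EuclideanSpace ℝ (Fin d))
    (m : Fin d → ℕ) (y : EuclideanSpace ℝ (Fin d)) : ℂ :=
  D.symbol m 0 - (n : ℂ)⁻¹ * ∑' k, D.kernel m (T (intPoint k) - y)

theorem continuous_errorWeight (n : ℕ)
    (T : EuclideanSpace ℝ (Fin d) ≃L[ℝ] EuclideanSpace ℝ (Fin d)) (m : Fin d → ℕ) :
    Continuous (D.errorWeight n T m) := by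
  obtain ⟨C, hC, h⟩ := D.exists_norm_kernel_le_tensorDecay d (2 * d)
  exact continuous_const.sub (continuous_const.mul
    (continuous_latticeSum T (D.continuous_kernel m) (h m)))

/-- Poisson summation cancels the mean value. What remains are the nonzero dual lattice points in
the box supporting the symbol, at most a constant times 2^{|m|₁}/n many, each with a bounded
contribution. -/
theorem exists_norm_errorWeight_le (hd : 1 ≤ d) : ∃ C : ℝ, 0 < C ∧ ∀ n : ℕ, 1 ≤ n →
    ∀ T : EuclideanSpace ℝ (Fin d) ≃L[ℝ] EuclideanSpace ℝ (Fin d),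
      (∀ v i, T v i = (frolovGenerator d n).mulVec (WithLp.ofLp v) i) →
      LinearMap.det (T : EuclideanSpace ℝ (Fin d) →ₗ[ℝ] EuclideanSpace ℝ (Fin d)) = (n : ℝ)⁻¹ →
      ∀ m y, ‖D.errorWeight n T m y‖ ≤ C * 2 ^ (∑ i, m i) * (n : ℝ)⁻¹ := by
  obtain ⟨B, hB, hsym⟩ := D.exists_norm_symbol_le d
  obtain ⟨C, hC, hcard⟩ := exists_card_dual_le hd
  obtain ⟨C₁, hC₁, hker⟩ := D.exists_norm_kernel_le_tensorDecay d (2 * d * d)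
  refine ⟨C * D.radius ^ d * B, by have := D.radius_pos; positivity, fun n hn T hT hdet m y => ?_⟩
  have hn0 : (0 : ℝ) < n := by exact_mod_cast hn
  obtain ⟨t, ht, hle⟩ := hcard n hn T hT (fun i => D.radius * 2 ^ (m i))
    fun i => by have := D.radius_pos; positivity
  have h := norm_fourier_zero_sub_latticeSum_le T (D.continuous_kernel m) (D.integrable_kernel m)
    (hker m) (B := B) (by rw [D.fourier_kernel]; exact hsym m) t (by simp [ht])
    (fun l hl hlt => by
      rw [D.fourier_kernel]
      rw [ht, not_and, not_forall] at hlt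
      obtain ⟨i, hi⟩ := hlt hl
      exact D.symbol_eq_zero (not_le.1 hi)) y
  rw [D.fourier_kernel, hdet, abs_of_pos (inv_pos.2 hn0)] at h
  rw [errorWeight]
  push_cast at h
  refine h.trans ?_
  rw [Finset.prod_mul_distrib, Finset.prod_const, Finset.card_univ, Fintype.card_fin,
    Finset.prod_pow_eq_pow_sum] at hle
  rw [le_mul_inv_iff₀ hn0]
  calc (t.card : ℝ) * B * n = n * t.card * B := by ring
    _ ≤ C * (D.radius ^ d * 2 ^ (∑ i, m i)) * B := by gcongr
    _ = _ := by ring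

/-- No cancellation is used: the kernels are bounded in L₁ uniformly in m, and after translation the
cube Q meets the lattice at most C n times, which the factor n⁻¹ compensates. -/
theorem exists_lintegral_errorWeight_le (hd : 1 ≤ d) {R : ℝ} (hR : 0 < R) : ∃ C : ℝ, 0 < C ∧
    ∀ n : ℕ, 1 ≤ n → ∀ T : EuclideanSpace ℝ (Fin d) ≃L[ℝ] EuclideanSpace ℝ (Fin d),
      (∀ v i, T v i = (frolovGenerator d n).mulVec (WithLp.ofLp v) i) →
      ∀ m, ∫⁻ y in {y : EuclideanSpace ℝ (Fin d) | ∀ i, |y i| ≤ R}, ‖D.errorWeight n T m y‖ₑ ≤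
        ENNReal.ofReal C := by
  obtain ⟨B, hB, hsym⟩ := D.exists_norm_symbol_le d
  obtain ⟨C, hC, hcard⟩ := exists_card_lattice_le hd hR.le
  obtain ⟨C₁, hC₁, hker⟩ := D.exists_lintegral_enorm_kernel_le d
  set Q : Set (EuclideanSpace ℝ (Fin d)) := {y | ∀ i, |y i| ≤ R} with hQ
  have hQm : MeasurableSet Q := by
    have : Q = ⋂ i, {y | |y i| ≤ R} := by ext; simp [hQ]
    rw [this]
    exact MeasurableSet.iInter fun i => measurableSet_le (by fun_prop) measurable_const
  have hQv : volume Q ≠ ⊤ := by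
    refine ((Metric.isBounded_iff_subset_closedBall 0).2 ⟨(1 + R) ^ d, fun x hx => ?_⟩).measure_lt_top.ne
    rw [mem_closedBall_zero_iff]
    have h1 := EuclideanSpace.one_add_norm_le_prod x
    have h2 : ∏ i, (1 + |x i|) ≤ ∏ _i : Fin d, (1 + R) :=
      Finset.prod_le_prod (fun i _ => by positivity) fun i _ => by linarith [hx i]
    rw [Finset.prod_const, Finset.card_univ, Fintype.card_fin] at h2
    linarith
  refine ⟨B * (volume Q).toReal + C * C₁, by positivity, fun n hn T hT m => ?_⟩
  have hn0 : (0 : ℝ) < n := by exact_mod_cast hn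
  have hmeas : ∀ k : Fin d → ℤ, Measurable fun y => ‖D.kernel m (T (intPoint k) - y)‖ₑ := fun k =>
    ((D.continuous_kernel m).comp (continuous_const.sub continuous_id)).measurable.enorm
  have hpt : ∀ y, ‖D.errorWeight n T m y‖ₑ ≤ ENNReal.ofReal B +
      ENNReal.ofReal ((n : ℝ)⁻¹) * ∑' k, ‖D.kernel m (T (intPoint k) - y)‖ₑ := fun y => by
    rw [errorWeight]
    refine enorm_sub_le.trans (add_le_add ?_ ?_)
    · rw [← ofReal_norm]
      exact ENNReal.ofReal_le_ofReal (hsym m 0)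
    · rw [enorm_mul]
      refine mul_le_mul' ?_ (enorm_tsum_le_tsum_enorm)
      rw [← ofReal_norm, norm_inv, RCLike.norm_natCast]
  have hcount : ∀ x : EuclideanSpace ℝ (Fin d),
      ∑' k, Q.indicator (fun _ => (1 : ℝ≥0∞)) (T (intPoint k) - x) ≤ ENNReal.ofReal (C * n) := by
    intro x
    rw [ENNReal.tsum_eq_iSup_sum]
    refine iSup_le fun t => ?_
    classical
    have h1 := hcard n hn T hT x (t.filter fun k => T (intPoint k) - x ∈ Q) fun k hk i =>
      (Finset.mem_filter.1 hk).2 i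
    calc ∑ k ∈ t, Q.indicator (fun _ => (1 : ℝ≥0∞)) (T (intPoint k) - x)
        = ∑ k ∈ t, if T (intPoint k) - x ∈ Q then (1 : ℝ≥0∞) else 0 :=
          Finset.sum_congr rfl fun k _ => by rw [Set.indicator_apply]
      _ = ((t.filter fun k => T (intPoint k) - x ∈ Q).card : ℝ≥0∞) := by
          rw [← Finset.sum_filter, Finset.sum_const, nsmul_eq_mul, mul_one]
      _ ≤ ENNReal.ofReal (C * n) := by
          rw [← ENNReal.ofReal_natCast]
          exact ENNReal.ofReal_le_ofReal h1
  have hsum : ∫⁻ y in Q, ∑' k, ‖D.kernel m (T (intPoint k) - y)‖ₑ ≤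
      ENNReal.ofReal (C * n) * ENNReal.ofReal C₁ := by
    calc ∫⁻ y in Q, ∑' k, ‖D.kernel m (T (intPoint k) - y)‖ₑ
        = ∑' k, ∫⁻ y in Q, ‖D.kernel m (T (intPoint k) - y)‖ₑ :=
          lintegral_tsum fun k => (hmeas k).aemeasurable
      _ = ∑' k, ∫⁻ x, Q.indicator (fun _ => (1 : ℝ≥0∞)) (T (intPoint k) - x) * ‖D.kernel m x‖ₑ := by
          refine tsum_congr fun k => ?_
          rw [← lintegral_indicator hQm, ← lintegral_sub_left_eq_self _ (T (intPoint k))]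
          refine lintegral_congr fun x => ?_
          by_cases hx : T (intPoint k) - x ∈ Q
          · rw [Set.indicator_of_mem hx, Set.indicator_of_mem hx, sub_sub_cancel, one_mul]
          · rw [Set.indicator_of_notMem hx, Set.indicator_of_notMem hx, zero_mul]
      _ = ∫⁻ x, (∑' k, Q.indicator (fun _ => (1 : ℝ≥0∞)) (T (intPoint k) - x)) * ‖D.kernel m x‖ₑ := by
          simp_rw [← ENNReal.tsum_mul_right]
          refine (lintegral_tsum fun k => ?_).symm
          refine Measurable.aemeasurable (Measurable.mul ?_ (D.continuous_kernel m).measurable.enorm)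
          exact (measurable_const.indicator hQm).comp (measurable_const.sub measurable_id)
      _ ≤ ∫⁻ x, ENNReal.ofReal (C * n) * ‖D.kernel m x‖ₑ :=
          lintegral_mono fun x => mul_le_mul' (hcount x) le_rfl
      _ ≤ _ := by
          rw [lintegral_const_mul' _ _ ENNReal.ofReal_ne_top]
          gcongr
          exact hker m
  calc ∫⁻ y in Q, ‖D.errorWeight n T m y‖ₑ
      ≤ ∫⁻ y in Q, (ENNReal.ofReal B +
        ENNReal.ofReal ((n : ℝ)⁻¹) * ∑' k, ‖D.kernel m (T (intPoint k) - y)‖ₑ) :=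
        lintegral_mono fun y => hpt y
    _ = ENNReal.ofReal B * volume Q + ENNReal.ofReal ((n : ℝ)⁻¹) *
        ∫⁻ y in Q, ∑' k, ‖D.kernel m (T (intPoint k) - y)‖ₑ := by
        rw [lintegral_add_left measurable_const, setLIntegral_const,
          lintegral_const_mul' _ _ ENNReal.ofReal_ne_top]
    _ ≤ ENNReal.ofReal B * ENNReal.ofReal (volume Q).toReal + ENNReal.ofReal ((n : ℝ)⁻¹) *
        (ENNReal.ofReal (C * n) * ENNReal.ofReal C₁) := by
        rw [ENNReal.ofReal_toReal hQv]
        gcongr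
    _ = ENNReal.ofReal (B * (volume Q).toReal + C * C₁) := by
        rw [← ENNReal.ofReal_mul hB.le, ← ENNReal.ofReal_mul (by positivity),
          ← ENNReal.ofReal_mul (by positivity), ← ENNReal.ofReal_add (by positivity) (by positivity)]
        congr 2
        field_simp

end DualMeans

/-! ### The error bound in the endpoint norm -/

theorem intPoint_injective {d : ℕ} : Function.Injective (intPoint (d := d)) := fun k l h => by
  ext i
  have := congrArg (fun x : EuclideanSpace ℝ (Fin d) => x i) h
  simpa using this

theorem frolovLattice_eq_range {d n : ℕ} {T : EuclideanSpace ℝ (Fin d) ≃L[ℝ] EuclideanSpace ℝ (Fin d)}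
    (hT : ∀ v i, T v i = (frolovGenerator d n).mulVec (WithLp.ofLp v) i) :
    frolovLattice d n = Set.range fun k => T (intPoint k) := by
  ext x
  constructor
  · rintro ⟨k, hk⟩
    refine ⟨k, ?_⟩
    ext i
    dsimp only
    rw [hT, hk]
    rfl
  · rintro ⟨k, rfl⟩
    exact ⟨k, fun i => hT _ i⟩

theorem finite_setOf_lattice {d n : ℕ} (hd : 1 ≤ d) (hn : 1 ≤ n)
    {T : EuclideanSpace ℝ (Fin d) ≃L[ℝ] EuclideanSpace ℝ (Fin d)}
    (hT : ∀ v i, T v i = (frolovGenerator d n).mulVec (WithLp.ofLp v) i) :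
    {k | ∀ i, |T (intPoint k) i| ≤ 1}.Finite := by
  obtain ⟨C, hC, h⟩ := exists_card_lattice_le hd zero_le_one
  by_contra hinf
  obtain ⟨N, hN⟩ := exists_nat_gt (C * n)
  obtain ⟨s, hs, hcard⟩ := Set.Infinite.exists_subset_card_eq hinf N
  have h1 := h n hn T hT 0 s fun k hk i => by
    have := hs hk i
    simpa using this
  rw [hcard] at h1
  linarith

theorem frolovCubature_eq_tsum {d n : ℕ} (hd : 1 ≤ d) (hn : 1 ≤ n)
    {T : EuclideanSpace ℝ (Fin d) ≃L[ℝ] EuclideanSpace ℝ (Fin d)}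
    (hT : ∀ v i, T v i = (frolovGenerator d n).mulVec (WithLp.ofLp v) i)
    {f : EuclideanSpace ℝ (Fin d) → ℂ} (hf : ∀ x, (¬ ∀ i, 0 < x i ∧ x i < 1) → f x = 0) :
    frolovCubature d n f = (n : ℂ)⁻¹ * ∑' k, f (T (intPoint k)) := by
  rw [frolovCubature]
  congr 1
  have h1 : (frolovLattice d n ∩ {x | ∀ i, 0 ≤ x i ∧ x i < 1}) ∩ Function.support f =
      frolovLattice d n ∩ Function.support f := by
    ext x
    constructor
    · exact fun h => ⟨h.1.1, h.2⟩
    · refine fun h => ⟨⟨h.1, ?_⟩, h.2⟩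
      have : ∀ i, 0 < x i ∧ x i < 1 := by
        by_contra hx
        exact h.2 (hf x hx)
      exact fun i => ⟨(this i).1.le, (this i).2⟩
  rw [finsum_mem_inter_support_eq f _ _ h1, frolovLattice_eq_range hT,
    finsum_mem_range (g := fun k => T (intPoint k)) (T.injective.comp intPoint_injective)]
  refine (tsum_eq_finsum ?_).symm
  refine (finite_setOf_lattice hd hn hT).subset fun k hk i => ?_
  have : ∀ i, 0 < T (intPoint k) i ∧ T (intPoint k) i < 1 := by
    by_contra hx
    exact hk (hf _ hx)
  rw [abs_of_pos (this i).1]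
  exact (this i).2.le

namespace DualMeans

variable {s : ℝ} {K : LocalMeans s} (D : DualMeans K) {d : ℕ}

theorem integral_piece {u : 𝓢'(EuclideanSpace ℝ (Fin d), ℂ)}
    (hu : Distribution.dsupport u ⊆ unitCube d) (m : Fin d → ℕ) :
    ∫ x, D.piece u m x = ∫ y, D.symbol m 0 * K.conv m u y := by
  have hg : Integrable (K.conv m u) :=
    (K.continuous_conv_of_dsupport hu m).integrable_of_hasCompactSupport (K.hasCompactSupport_conv hu m)
  have h := integral_convolution (L := (ContinuousLinearMap.mul ℂ ℂ).flip) hg (D.integrable_kernel m)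
    (μ := volume) (ν := volume)
  rw [integral_const_mul, ← D.integral_kernel]
  exact h

theorem tsum_piece {u : 𝓢'(EuclideanSpace ℝ (Fin d), ℂ)}
    (hu : Distribution.dsupport u ⊆ unitCube d) (m : Fin d → ℕ)
    (T : EuclideanSpace ℝ (Fin d) ≃L[ℝ] EuclideanSpace ℝ (Fin d)) :
    ∑' k, D.piece u m (T (intPoint k)) =
      ∫ y, (∑' k, D.kernel m (T (intPoint k) - y)) * K.conv m u y := by
  obtain ⟨R, hR, hsupp⟩ := K.exists_conv_support d
  obtain ⟨C, hC, hker⟩ := D.exists_norm_kernel_le_tensorDecay d (2 * d)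
  obtain ⟨C', hC', hdec⟩ := exists_tensorDecay_lattice_le T hR
  have hgc := K.continuous_conv_of_dsupport hu m
  have hgs := K.hasCompactSupport_conv hu m
  have hg : Integrable (K.conv m u) := hgc.integrable_of_hasCompactSupport hgs
  have hint : ∀ k, Integrable fun y => D.kernel m (T (intPoint k) - y) * K.conv m u y := fun k =>
    (((D.continuous_kernel m).comp (continuous_const.sub continuous_id)).mul hgc
      ).integrable_of_hasCompactSupport hgs.mul_left
  have h := hasSum_integral_of_summable_integral_norm hint ?_
  · simp_rw [tsum_mul_right] at h
    exact h.tsum_eq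
  · refine Summable.of_nonneg_of_le (fun k => integral_nonneg fun _ => norm_nonneg _) (fun k => ?_)
      ((summable_tensorDecay_intPoint d).mul_left (C * 2 ^ (∑ i, m i) * C' * ∫ y, ‖K.conv m u y‖))
    calc ∫ y, ‖D.kernel m (T (intPoint k) - y) * K.conv m u y‖
        ≤ ∫ y, C * 2 ^ (∑ i, m i) * (C' * tensorDecay 2 (intPoint k)) * ‖K.conv m u y‖ := by
          refine integral_mono (hint k).norm (hg.norm.const_mul _) fun y => ?_
          dsimp only
          rw [norm_mul]
          by_cases hy : ∃ i, R < |y i|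
          · rw [hsupp u hu m y hy]
            simp
          · simp only [not_exists, not_lt] at hy
            gcongr
            refine (hker m _).trans ?_
            gcongr
            exact hdec k y hy
      _ = _ := by rw [integral_const_mul]; ring

theorem integral_piece_sub {u : 𝓢'(EuclideanSpace ℝ (Fin d), ℂ)}
    (hu : Distribution.dsupport u ⊆ unitCube d) (m : Fin d → ℕ) (n : ℕ)
    (T : EuclideanSpace ℝ (Fin d) ≃L[ℝ] EuclideanSpace ℝ (Fin d)) :
    (∫ x, D.piece u m x) - (n : ℂ)⁻¹ * ∑' k, D.piece u m (T (intPoint k)) =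
      ∫ y, D.errorWeight n T m y * K.conv m u y := by
  obtain ⟨C, hC, hker⟩ := D.exists_norm_kernel_le_tensorDecay d (2 * d)
  have hgc := K.continuous_conv_of_dsupport hu m
  have hgs := K.hasCompactSupport_conv hu m
  have hc := continuous_latticeSum T (D.continuous_kernel m) (hker m)
  rw [D.integral_piece hu, D.tsum_piece hu, ← integral_const_mul, ← integral_sub]
  · refine integral_congr_ae (.of_forall fun y => ?_)
    dsimp only
    rw [errorWeight]
    ring
  · exact (continuous_const.mul hgc).integrable_of_hasCompactSupport hgs.mul_left
  · exact (continuous_const.mul (hc.mul hgc)).integrable_of_hasCompactSupport hgs.mul_left.mul_left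

/-- Interpolating the sup bound 2^{|m|₁}/n with the uniform L₁ bound produces (2^{|m|₁}/n)^{1/q}.
Its numerator is the weight in the endpoint norm and its denominator the rate of convergence. -/
theorem exists_integral_errorWeight_le (hd : 1 ≤ d) : ∃ C : ℝ, 0 < C ∧
    ∀ n : ℕ, 1 ≤ n → ∀ T : EuclideanSpace ℝ (Fin d) ≃L[ℝ] EuclideanSpace ℝ (Fin d),
      (∀ v i, T v i = (frolovGenerator d n).mulVec (WithLp.ofLp v) i) →
      LinearMap.det (T : EuclideanSpace ℝ (Fin d) →ₗ[ℝ] EuclideanSpace ℝ (Fin d)) = (n : ℝ)⁻¹ →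
      ∀ q : ℝ≥0∞, 1 ≤ q → ∀ u : 𝓢'(EuclideanSpace ℝ (Fin d), ℂ),
        Distribution.dsupport u ⊆ unitCube d → K.endpointNorm q u ≠ ⊤ → ∀ m,
        ‖∫ y, D.errorWeight n T m y * K.conv m u y‖ ≤
          C * (n : ℝ) ^ (-(q⁻¹).toReal) * K.endpointTerm q u m := by
  obtain ⟨R, hR, hsupp⟩ := K.exists_conv_support d
  obtain ⟨A, hA, hsup⟩ := D.exists_norm_errorWeight_le hd
  obtain ⟨B, hB, hL⟩ := D.exists_lintegral_errorWeight_le hd hR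
  refine ⟨(1 + A) * (1 + B), by positivity, fun n hn T hT hdet q hq u hu hfin m => ?_⟩
  have hn0 : (0 : ℝ) < n := by exact_mod_cast hn
  set Q : Set (EuclideanSpace ℝ (Fin d)) := {y | ∀ i, |y i| ≤ R} with hQ
  have hgc := K.continuous_conv_of_dsupport hu m
  set r := (q⁻¹).toReal with hr
  have hr0 : 0 ≤ r := ENNReal.toReal_nonneg
  have hr1 : r ≤ 1 := by
    rw [← ENNReal.toReal_one]
    exact ENNReal.toReal_mono (by simp) (ENNReal.inv_le_one.2 hq)
  have h1 := lintegral_enorm_mul_le (μ := volume.restrict Q) hgc.aestronglyMeasurable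
    (w := fun y => ‖D.errorWeight n T m y‖ₑ) (D.continuous_errorWeight n T m).measurable.enorm
    (A := ENNReal.ofReal (A * 2 ^ (∑ i, m i) * (n : ℝ)⁻¹)) (B := ENNReal.ofReal B)
    (.of_forall fun y => by
      rw [← ofReal_norm]
      exact ENNReal.ofReal_le_ofReal (hsup n hn T hT hdet m y)) (hL n hn T hT m) hq
  have h2 : ENNReal.ofReal ‖∫ y, D.errorWeight n T m y * K.conv m u y‖ ≤
      ∫⁻ y in Q, ‖D.errorWeight n T m y‖ₑ * ‖K.conv m u y‖ₑ := by
    rw [ofReal_norm]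
    refine (enorm_integral_le_lintegral_enorm _).trans ?_
    rw [← lintegral_indicator]
    · refine lintegral_mono fun y => ?_
      by_cases hy : y ∈ Q
      · rw [Set.indicator_of_mem hy, enorm_mul]
      · have : ∃ i, R < |y i| := by
          by_contra h
          exact hy fun i => not_lt.1 fun hi => h ⟨i, hi⟩
        rw [hsupp u hu m y this]
        simp
    · have : Q = ⋂ i, {y | |y i| ≤ R} := by ext; simp [hQ]
      rw [this]
      exact MeasurableSet.iInter fun i => measurableSet_le (by fun_prop) measurable_const
  have h3 : (1 + A) * (1 + B) * (n : ℝ) ^ (-r) * K.endpointTerm q u m =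
    ((1 + A) * (1 + B) * (n : ℝ) ^ (-r)) * K.endpointTerm q u m := rfl
  have h4 : 0 ≤ (1 + A) * (1 + B) * (n : ℝ) ^ (-r) := by positivity
  rw [← ENNReal.ofReal_le_ofReal_iff (mul_nonneg h4 (K.endpointTerm_nonneg q u m)),
    ENNReal.ofReal_mul h4, K.ofReal_endpointTerm hfin, mixedWeight]
  refine h2.trans (h1.trans ?_)
  rw [← mul_assoc]
  refine mul_le_mul' ?_ (eLpNorm_restrict_le _ _ _ _)
  rw [ENNReal.ofReal_rpow_of_nonneg (by positivity) hr0,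
    ENNReal.ofReal_rpow_of_nonneg hB.le (by linarith), ← ENNReal.ofReal_mul (by positivity),
    ← ENNReal.ofReal_mul h4]
  refine ENNReal.ofReal_le_ofReal ?_
  rw [Real.mul_rpow (by positivity) (by positivity), Real.mul_rpow hA.le (by positivity),
    Real.inv_rpow hn0.le, ← Real.rpow_neg hn0.le, ← Real.rpow_natCast_mul (by norm_num), mul_comm (_ : ℝ) r]
  have hA1 : A ^ r ≤ 1 + A := by
    calc A ^ r ≤ (1 + A) ^ r := Real.rpow_le_rpow hA.le (by linarith) hr0
      _ ≤ (1 + A) ^ (1 : ℝ) := Real.rpow_le_rpow_of_exponent_le (by linarith) hr1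
      _ = 1 + A := Real.rpow_one _
  have hB1 : B ^ (1 - r) ≤ 1 + B := by
    calc B ^ (1 - r) ≤ (1 + B) ^ (1 - r) := Real.rpow_le_rpow hB.le (by linarith) (by linarith)
      _ ≤ (1 + B) ^ (1 : ℝ) := Real.rpow_le_rpow_of_exponent_le (by linarith) (by linarith)
      _ = 1 + B := Real.rpow_one _
  calc A ^ r * (2 : ℝ) ^ (r * ((∑ i, m i : ℕ) : ℝ)) * (n : ℝ) ^ (-r) * B ^ (1 - r)
      ≤ (1 + A) * (2 : ℝ) ^ (r * ((∑ i, m i : ℕ) : ℝ)) * (n : ℝ) ^ (-r) * (1 + B) := by gcongr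
    _ = _ := by ring

/-- The error of Frolov's rule is controlled by the endpoint norms. -/
theorem _root_.LocalMeans.exists_error_le (K : LocalMeans s) (hd : 1 ≤ d) : ∃ C : ℝ, 0 < C ∧ ∀ n : ℕ, 1 ≤ n → ∀ q : ℝ≥0∞, 1 ≤ q →
    ∀ u : 𝓢'(EuclideanSpace ℝ (Fin d), ℂ), Distribution.dsupport u ⊆ unitCube d →
    K.endpointNorm q u ≠ ⊤ → ∀ f : EuclideanSpace ℝ (Fin d) →ᵇ ℂ, IsRepresentedBy u f →
    ‖(∫ x in unitCube d, f x) - frolovCubature d n f‖ₑ ≤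
      ENNReal.ofReal (C * (n : ℝ) ^ (-(q⁻¹).toReal)) * K.endpointNorm q u := by
  obtain ⟨D⟩ := K.nonempty_dualMeans
  obtain ⟨C, hC, hweight⟩ := D.exists_integral_errorWeight_le hd
  -- Decay of order `2 * d` is needed to sum over the points T k, decay of order 2 to integrate over
  -- space.
  obtain ⟨C₁, hC₁, hpiece⟩ := D.exists_norm_piece_le d (2 * d)
  obtain ⟨C₂, hC₂, hpiece2⟩ := D.exists_norm_piece_le d 2
  refine ⟨C, hC, fun n hn q hq u hu hfin f hf => ?_⟩
  obtain ⟨T, hT, hdet⟩ := exists_frolovEquiv hd hn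
  obtain ⟨f', hf'eq, hf'⟩ := D.exists_isRepresentedBy hq hu hfin
  obtain rfl := hf.eq hf'
  have h0 : ∀ x, (¬ ∀ i, 0 < x i ∧ x i < 1) → f x = 0 := fun x hx => hf.eq_zero_of_notMem hu hx
  have hterm := K.summable_endpointTerm hfin
  have e1 : HasSum (fun m => ∫ x, D.piece u m x) (∫ x in unitCube d, f x) := by
    have hset : ∫ x in unitCube d, f x = ∫ x, f x :=
      setIntegral_eq_integral_of_forall_compl_eq_zero fun x hx => h0 x fun h =>
        hx fun i => ⟨(h i).1.le, (h i).2.le⟩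
    rw [hset]
    simp_rw [hf'eq]
    have hint : ∀ m, Integrable (D.piece u m) := fun m =>
      (((integrable_tensorDecay d).const_mul C₂).mul_const (K.endpointTerm q u m)).mono'
        (D.continuous_piece hu m).aestronglyMeasurable (.of_forall (hpiece2 q hq u hu hfin m))
    refine hasSum_integral_of_summable_integral_norm hint ?_
    refine Summable.of_nonneg_of_le (fun m => integral_nonneg fun _ => norm_nonneg _) (fun m => ?_)
      (hterm.mul_left (C₂ * ∫ x : EuclideanSpace ℝ (Fin d), tensorDecay 2 x))
    refine (integral_mono (hint m).norm
      (((integrable_tensorDecay d).const_mul C₂).mul_const (K.endpointTerm q u m))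
      (hpiece2 q hq u hu hfin m)).trans_eq ?_
    rw [integral_mul_const, integral_const_mul]
  have e2 : HasSum (fun m => ∑' k, D.piece u m (T (intPoint k))) (∑' k, f (T (intPoint k))) := by
    obtain ⟨C₃, hC₃, hdec⟩ := exists_tensorDecay_lattice_le T (one_pos)
    have hle : ∀ p : (Fin d → ℕ) × (Fin d → ℤ), ‖D.piece u p.1 (T (intPoint p.2))‖ ≤
        K.endpointTerm q u p.1 * (C₁ * C₃ * tensorDecay 2 (intPoint p.2)) := fun p => by
      refine (hpiece q hq u hu hfin p.1 _).trans ?_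
      have := hdec p.2 0 (by simp)
      rw [sub_zero] at this
      rw [mul_comm, mul_assoc C₁]
      have h0 := K.endpointTerm_nonneg q u p.1
      gcongr
    have hsum : Summable fun p : (Fin d → ℕ) × (Fin d → ℤ) => D.piece u p.1 (T (intPoint p.2)) :=
      Summable.of_norm_bounded (hterm.mul_of_nonneg ((summable_tensorDecay_intPoint d).mul_left (C₁ * C₃))
        (K.endpointTerm_nonneg q u) fun k => by have := tensorDecay_pos 2 (intPoint k); positivity) hle
    simp_rw [hf'eq]
    rw [Summable.tsum_comm (f := fun m k => D.piece u m (T (intPoint k))) hsum]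
    exact hsum.prod.hasSum
  have e3 := e1.sub (e2.mul_left (n : ℂ)⁻¹)
  rw [← frolovCubature_eq_tsum hd hn hT h0] at e3
  simp_rw [D.integral_piece_sub hu] at e3
  have hb := tsum_of_norm_bounded (hterm.mul_left (C * (n : ℝ) ^ (-(q⁻¹).toReal))).hasSum
    fun m => hweight n hn T hT hdet q hq u hu hfin m
  rw [e3.tsum_eq, tsum_mul_left] at hb
  rw [← ofReal_norm, ← K.tsum_endpointTerm hfin, ← ENNReal.ofReal_mul (by positivity)]
  exact ENNReal.ofReal_le_ofReal hb

end DualMeans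

/-! ### Local means of narrow bumps -/

/-- A function with vanishing derivatives at the origin is small near the origin. -/
theorem norm_le_of_iteratedDeriv_eq_zero {M : ℝ} (L : ℕ) {G : ℝ → ℂ} (hG : ContDiff ℝ ∞ G)
    (h0 : ∀ α ≤ L, iteratedDeriv α G 0 = 0) (hM : ∀ x, ‖iteratedDeriv (L + 1) G x‖ ≤ M) (x : ℝ) :
    ‖G x‖ ≤ M * |x| ^ (L + 1) := by
  have key : ∀ (G : ℝ → ℂ) (B : ℝ) (x : ℝ), Differentiable ℝ G → G 0 = 0 →
      (∀ y, |y| ≤ |x| → ‖deriv G y‖ ≤ B) → ‖G x‖ ≤ B * |x| := by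
    intro G B x hd hG0 hB
    have h := Convex.norm_image_sub_le_of_norm_deriv_le (s := Metric.closedBall (0 : ℝ) |x|)
      (f := G) (C := B) (x := 0) (y := x) (fun y _ => hd y)
      (fun y hy => hB y (by simpa using hy)) (convex_closedBall _ _) (by simp) (by simp)
    simpa [hG0] using h
  induction L generalizing G x with
  | zero =>
    have h1 := key G M x (hG.differentiable (by simp)) (by simpa using h0 0 le_rfl)
      (fun y _ => by simpa [iteratedDeriv_one] using hM y)
    simpa using h1
  | succ L ih =>
    have hM0 : 0 ≤ M := (norm_nonneg _).trans (hM 0)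
    have hG' : ContDiff ℝ ∞ (deriv G) := (contDiff_infty_iff_deriv.1 hG).2
    have h1 := key G (M * |x| ^ (L + 1)) x (hG.differentiable (by simp))
      (by simpa using h0 0 (by omega)) (fun y hy => by
        refine (ih hG' (fun α hα => ?_) (fun z => ?_) y).trans ?_
        · rw [← iteratedDeriv_succ']
          exact h0 _ (by omega)
        · rw [← iteratedDeriv_succ']
          exact hM z
        · gcongr)
    rw [pow_succ, ← mul_assoc]
    exact h1

namespace LocalMeans

variable {s : ℝ} (K : LocalMeans s)

theorem exists_norm_fourier_Ψ₁_le {L : ℕ} (hL : ∀ α ≤ L, iteratedDeriv α (𝓕 K.Ψ₁) 0 = 0) :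
    ∃ M : ℝ, 0 < M ∧ ∀ ξ, ‖𝓕 K.Ψ₁ ξ‖ ≤ M * |ξ| ^ (L + 1) := by
  set G : 𝓢(ℝ, ℂ) := 𝓕 (K.compact₁.toSchwartzMap K.smooth₁) with hG
  have hGe : 𝓕 K.Ψ₁ = G := rfl
  refine ⟨SchwartzMap.seminorm ℝ 0 (L + 1) G + 1, by positivity, fun ξ => ?_⟩
  rw [hGe] at hL ⊢
  refine norm_le_of_iteratedDeriv_eq_zero L (G.smooth ⊤) hL (fun x => ?_) ξ
  have h1 := SchwartzMap.norm_iteratedFDeriv_le_seminorm ℝ G (L + 1) x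
  rw [norm_iteratedFDeriv_eq_norm_iteratedDeriv] at h1
  linarith

end LocalMeans

theorem norm_fourierInv_comp_const_sub (g : ℝ → ℂ) (z η : ℝ) :
    ‖𝓕⁻ (fun v => g (z - v)) η‖ = ‖𝓕 g η‖ := by
  rw [Real.fourierInv_eq_fourier_neg, Real.fourier_real_eq_integral_exp_smul,
    Real.fourier_real_eq_integral_exp_smul, ← integral_sub_left_eq_self _ volume z]
  have : ∀ w : ℝ, Complex.exp (((-2 * Real.pi * (z - w) * -η : ℝ) : ℂ) * Complex.I) • g (z - (z - w)) =
      Complex.exp (((2 * Real.pi * z * η : ℝ) : ℂ) * Complex.I) *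
        (Complex.exp (((-2 * Real.pi * w * η : ℝ) : ℂ) * Complex.I) • g w) := fun w => by
    rw [sub_sub_cancel, smul_eq_mul, smul_eq_mul, ← mul_assoc, ← Complex.exp_add]
    congr 2
    push_cast
    ring
  simp_rw [this]
  rw [integral_const_mul, norm_mul, Complex.norm_exp_ofReal_mul_I, one_mul]

/-- Cancellation in the convolution of a fine kernel with vanishing moments and a smooth function. -/
theorem exists_norm_integral_dilation_le {Ψ h : ℝ → ℂ} (hΨ : Integrable Ψ) {n : ℕ} {M : ℝ}
    (hM : 0 < M) (hΨM : ∀ ξ, ‖𝓕 Ψ ξ‖ ≤ M * |ξ| ^ n) (hh : ContDiff ℝ ∞ h) (hc : HasCompactSupport h) :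
    ∃ C : ℝ, 0 < C ∧ ∀ ε z : ℝ, 0 < ε → ‖∫ v, (ε * Ψ (ε * (z - v))) * h v‖ ≤ C * (ε⁻¹) ^ n := by
  set H : 𝓢(ℝ, ℂ) := hc.toSchwartzMap hh with hH
  have hHe : ∀ v, 𝓕⁻ (𝓕 (H : ℝ → ℂ)) v = h v := fun v => by
    rw [H.continuous.fourierInv_fourier_eq H.integrable (𝓕 H).integrable]
    rfl
  have hint : Integrable fun η => |η| ^ n * ‖𝓕 H η‖ := by
    simpa using (𝓕 H).integrable_pow_mul volume n
  have hnn : 0 ≤ ∫ η, |η| ^ n * ‖𝓕 H η‖ := integral_nonneg fun _ => by positivity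
  refine ⟨M * (1 + ∫ η, |η| ^ n * ‖𝓕 H η‖), by positivity, fun ε z hε => ?_⟩
  set g : ℝ → ℂ := fun w => ε * Ψ (ε * w) with hg
  have hgi : Integrable g := (hΨ.comp_mul_left' hε.ne').const_mul _
  have hgF : ∀ η, 𝓕 g η = 𝓕 Ψ (η / ε) := fun η => by
    rw [← Real.fourier_comp_mul_left_ofPos Ψ hε η]
  have h1 : ∫ v, (ε * Ψ (ε * (z - v))) * h v = ∫ η, 𝓕⁻ (fun v => g (z - v)) η * 𝓕 (H : ℝ → ℂ) η := by
    rw [integral_fourierInv_mul_eq_of_integrable (hgi.comp_sub_left z) (𝓕 H).integrable]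
    refine integral_congr_ae (.of_forall fun v => ?_)
    dsimp only
    rw [← hHe]
  rw [h1]
  calc ‖∫ η, 𝓕⁻ (fun v => g (z - v)) η * 𝓕 (H : ℝ → ℂ) η‖
      ≤ ∫ η, M * (ε⁻¹) ^ n * (|η| ^ n * ‖𝓕 H η‖) := by
        refine norm_integral_le_of_norm_le (hint.const_mul _) (.of_forall fun η => ?_)
        rw [norm_mul, norm_fourierInv_comp_const_sub, hgF]
        have h2 := hΨM (η / ε)
        rw [abs_div, abs_of_pos hε, div_eq_mul_inv |η|, mul_pow] at h2
        have e : (𝓕 (H : ℝ → ℂ)) η = 𝓕 H η := rfl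
        rw [e]
        calc ‖𝓕 Ψ (η / ε)‖ * ‖𝓕 H η‖ ≤ (M * (|η| ^ n * (ε⁻¹) ^ n)) * ‖𝓕 H η‖ := by
              gcongr
          _ = _ := by ring
    _ = M * (∫ η, |η| ^ n * ‖𝓕 H η‖) * (ε⁻¹) ^ n := by rw [integral_const_mul]; ring
    _ ≤ _ := by gcongr; linarith

theorem exists_norm_integral_dilation_le' {Ψ h : ℝ → ℂ} (hΨ : Continuous Ψ) (hΨc : HasCompactSupport Ψ)
    (hh : Continuous h) (hc : HasCompactSupport h) :
    ∃ C : ℝ, 0 < C ∧ ∀ ε z : ℝ, 0 < ε → ‖∫ v, (ε * Ψ (ε * (z - v))) * h v‖ ≤ C * ε := by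
  obtain ⟨B, hB⟩ := hΨ.bounded_above_of_compact_support hΨc
  have hB0 : 0 ≤ B := (norm_nonneg _).trans (hB 0)
  have hhi := (hh.integrable_of_hasCompactSupport hc (μ := volume)).norm
  have hnn : 0 ≤ ∫ v, ‖h v‖ := integral_nonneg fun _ => norm_nonneg _
  refine ⟨1 + B * ∫ v, ‖h v‖, by positivity, fun ε z hε => ?_⟩
  calc ‖∫ v, (ε * Ψ (ε * (z - v))) * h v‖ ≤ ∫ v, ε * B * ‖h v‖ := by
        refine norm_integral_le_of_norm_le (hhi.const_mul _) (.of_forall fun v => ?_)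
        rw [norm_mul, norm_mul, Complex.norm_real, Real.norm_of_nonneg hε.le]
        gcongr
        exact hB _
    _ = (B * ∫ v, ‖h v‖) * ε := by rw [integral_const_mul]; ring
    _ ≤ _ := by gcongr; linarith

/-- The function `x ↦ h(2^N (x - t))`. -/
noncomputable def dyadicBump (h : ℝ → ℂ) (N : ℕ) (t x : ℝ) : ℂ := h (2 ^ N * (x - t))

namespace LocalMeans

variable {s : ℝ} (K : LocalMeans s)

/-- The convolution `Ψ_j ∗ g` on the real line. -/
noncomputable def levelConv (j : ℕ) (g : ℝ → ℂ) (x : ℝ) : ℂ := ∫ y, K.level j (x - y) * g y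

/-- Rescaling to a bump of unit width turns the kernel of level j into one dilated by 2^{j-N}, so
that only the ratio of the two scales matters. -/
theorem levelConv_dyadicBump (j : ℕ) (h : ℝ → ℂ) (N : ℕ) (t x : ℝ) :
    K.levelConv j (dyadicBump h N t) x =
      ∫ v, ((2 ^ N : ℂ)⁻¹ * K.level j ((2 ^ N)⁻¹ * (2 ^ N * (x - t) - v))) * h v := by
  have h2 : (0 : ℝ) < 2 ^ N := by positivity
  set φ : ℝ → ℂ := fun v => K.level j ((2 ^ N)⁻¹ * (2 ^ N * (x - t) - v)) * h v with hφ
  have h3 : K.levelConv j (dyadicBump h N t) x = ∫ y, φ (2 ^ N * (y - t)) := by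
    rw [levelConv]
    refine integral_congr_ae (.of_forall fun y => ?_)
    simp only [hφ, dyadicBump]
    congr 2
    field_simp
    ring
  rw [h3, integral_sub_right_eq_self (fun y => φ (2 ^ N * y)) t, Measure.integral_comp_mul_left,
    abs_of_pos (inv_pos.2 h2), Complex.real_smul, ← integral_const_mul]
  refine integral_congr_ae (.of_forall fun v => ?_)
  simp only [hφ]
  push_cast
  ring

theorem exists_norm_levelConv_dyadicBump_le {L : ℕ} (hL : ∀ α ≤ L, iteratedDeriv α (𝓕 K.Ψ₁) 0 = 0)
    {h : ℝ → ℂ} (hh : ContDiff ℝ ∞ h) (hc : HasCompactSupport h) :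
    ∃ C : ℝ, 0 < C ∧ ∀ j N t x, ‖K.levelConv j (dyadicBump h N t) x‖ ≤ C * (2 ^ j / 2 ^ N) ∧
      (N ≤ j → ‖K.levelConv j (dyadicBump h N t) x‖ ≤ C * (2 ^ N / 2 ^ j) ^ (L + 1)) := by
  obtain ⟨M, hM, hΨ⟩ := K.exists_norm_fourier_Ψ₁_le hL
  obtain ⟨C₁, hC₁, h1⟩ := exists_norm_integral_dilation_le
    (K.smooth₁.continuous.integrable_of_hasCompactSupport K.compact₁) hM hΨ hh hc
  obtain ⟨C₂, hC₂, h2⟩ := exists_norm_integral_dilation_le' K.smooth₁.continuous K.compact₁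
    hh.continuous hc
  obtain ⟨C₃, hC₃, h3⟩ := exists_norm_integral_dilation_le' K.smooth₀.continuous K.compact₀
    hh.continuous hc
  have e0 : ∀ N t x, ‖K.levelConv 0 (dyadicBump h N t) x‖ ≤ C₃ * (2 ^ N)⁻¹ := fun N t x => by
    rw [levelConv_dyadicBump]
    have := h3 (2 ^ N)⁻¹ (2 ^ N * (x - t)) (by positivity)
    push_cast at this
    exact this
  have e1 : ∀ i N t x, K.levelConv (i + 1) (dyadicBump h N t) x =
      ∫ v, (((2 ^ i / 2 ^ N : ℝ) : ℂ) * K.Ψ₁ ((2 ^ i / 2 ^ N) * (2 ^ N * (x - t) - v))) * h v := fun i N t x => by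
    rw [levelConv_dyadicBump]
    refine integral_congr_ae (.of_forall fun v => ?_)
    simp only [level]
    rw [← mul_assoc ((2 : ℂ) ^ N)⁻¹, ← mul_assoc ((2 : ℝ) ^ i), div_eq_mul_inv]
    push_cast
    ring
  refine ⟨C₃ + C₂ + C₁ * 2 ^ (L + 1), by positivity, fun j N t x => ⟨?_, fun hNj => ?_⟩⟩
  · cases j with
    | zero =>
      refine (e0 N t x).trans ?_
      rw [pow_zero, one_div]
      gcongr
      linarith [show 0 < C₁ * 2 ^ (L + 1) by positivity]
    | succ i =>
      rw [e1]
      refine (h2 _ _ (by positivity)).trans ?_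
      gcongr
      · linarith [show 0 < C₁ * 2 ^ (L + 1) by positivity]
      · norm_num
      · omega
  · cases j with
    -- The kernel of level 0 has no vanishing moments, but N ≤ 0 leaves only N = 0, where the
    -- trivial bound suffices.
    | zero =>
      obtain rfl : N = 0 := by omega
      refine (e0 0 t x).trans ?_
      simp only [pow_zero, inv_one, mul_one, div_one, one_pow]
      linarith [show 0 < C₁ * 2 ^ (L + 1) by positivity]
    | succ i =>
      rw [e1]
      refine (h1 _ _ (by positivity)).trans ?_
      rw [inv_div, pow_succ (2 : ℝ) i]
      calc C₁ * (2 ^ N / 2 ^ i : ℝ) ^ (L + 1)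
          = C₁ * 2 ^ (L + 1) * (2 ^ N / (2 ^ i * 2)) ^ (L + 1) := by
            rw [mul_assoc, ← mul_pow]
            congr 2
            field_simp
        _ ≤ _ := by gcongr; linarith

theorem exists_levelConv_dyadicBump_support {h : ℝ → ℂ} (hc : HasCompactSupport h) :
    ∃ R : ℝ, 0 < R ∧ ∀ j N t x, R < |x - t| * 2 ^ (min j N) →
      K.levelConv j (dyadicBump h N t) x = 0 := by
  have key : ∀ f : ℝ → ℂ, HasCompactSupport f → ∃ R : ℝ, 0 < R ∧ ∀ y, f y ≠ 0 → |y| ≤ R := by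
    intro f hf
    obtain ⟨R, h0⟩ := hf.isCompact.isBounded.subset_closedBall 0
    refine ⟨|R| + 1, by positivity, fun y hy => ?_⟩
    have := h0 (subset_tsupport f hy)
    rw [mem_closedBall_zero_iff, Real.norm_eq_abs] at this
    linarith [le_abs_self R]
  obtain ⟨R₀, hR₀, h0⟩ := key _ K.compact₀
  obtain ⟨R₁, hR₁, h1⟩ := key _ K.compact₁
  obtain ⟨R₂, hR₂, h2⟩ := key _ hc
  have hlev : ∀ j y, K.level j y ≠ 0 → |y| * 2 ^ j ≤ R₀ + 2 * R₁ := fun j y hy => by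
    cases j with
    | zero =>
      rw [pow_zero, mul_one]
      linarith [h0 y hy]
    | succ i =>
      have := h1 (2 ^ i * y) (right_ne_zero_of_mul hy)
      rw [abs_mul, abs_of_pos (by positivity : (0 : ℝ) < 2 ^ i)] at this
      rw [pow_succ]
      linarith
  refine ⟨R₀ + 2 * R₁ + R₂, by positivity, fun j N t x hx => ?_⟩
  rw [levelConv]
  refine (integral_congr_ae (.of_forall fun y => ?_)).trans (integral_zero _ _)
  by_contra hne
  have a1 := hlev j _ (left_ne_zero_of_mul hne)
  have a2 := h2 _ (right_ne_zero_of_mul hne)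
  rw [abs_mul, abs_of_pos (by positivity : (0 : ℝ) < 2 ^ N)] at a2
  have b1 : |x - y| * 2 ^ (min j N) ≤ |x - y| * 2 ^ j := by
    gcongr
    · norm_num
    · exact min_le_left _ _
  have b2 : 2 ^ (min j N) * |y - t| ≤ 2 ^ N * |y - t| := by
    gcongr
    · norm_num
    · exact min_le_right _ _
  have b3 : |x - t| * 2 ^ (min j N) ≤ (|x - y| + |y - t|) * 2 ^ (min j N) := by
    gcongr
    exact abs_sub_le x y t
  nlinarith

theorem continuous_levelConv (j : ℕ) {g : ℝ → ℂ} (hg : Continuous g) :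
    Continuous (K.levelConv j g) := by
  have h := HasCompactSupport.continuous_convolution_right (L := (ContinuousLinearMap.mul ℂ ℂ).flip)
    (μ := volume) (K.hasCompactSupport_level j) (f := g) hg.locallyIntegrable
    (K.contDiff_level j).continuous
  exact h

theorem levelConv_sum (j : ℕ) {ι : Type*} (F : Finset ι) (α : ι → ℂ) {g : ι → ℝ → ℂ}
    (hg : ∀ t, Continuous (g t)) (hc : ∀ t, HasCompactSupport (g t)) (x : ℝ) :
    K.levelConv j (fun y => ∑ t ∈ F, α t * g t y) x = ∑ t ∈ F, α t * K.levelConv j (g t) x := by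
  simp only [levelConv, Finset.mul_sum]
  rw [integral_finsetSum]
  · refine Finset.sum_congr rfl fun t _ => ?_
    rw [← integral_const_mul]
    refine integral_congr_ae (.of_forall fun y => ?_)
    dsimp only
    ring
  · intro t _
    refine Continuous.integrable_of_hasCompactSupport ?_ ((hc t).mul_left.mul_left)
    exact ((K.contDiff_level j).continuous.comp (continuous_const.sub continuous_id)).mul
      (continuous_const.mul (hg t))

end LocalMeans

theorem eLpNorm_le_of_bounded_of_support {X E : Type*} [MeasurableSpace X] [NormedAddCommGroup E]
    {μ : Measure X} {g : X → E} {A : ℝ} (hA : ∀ x, ‖g x‖ ≤ A) {S : Set X} (hS : ∀ x, x ∉ S → g x = 0)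
    (p : ℝ≥0∞) : eLpNorm g p μ ≤ μ S ^ (p⁻¹).toReal * ENNReal.ofReal A := by
  have hsub : Function.support g ⊆ S := fun x hx => by
    by_contra h
    exact hx (hS x h)
  rw [← eLpNorm_restrict_eq_of_support_subset hsub]
  refine (eLpNorm_le_of_ae_bound (.of_forall hA)).trans_eq ?_
  rw [Measure.restrict_apply_univ, ENNReal.toReal_inv]

theorem norm_sum_le_of_forall_eq {ι E : Type*} [NormedAddCommGroup E] (F : Finset ι) (v : ι → E)
    {A : ℝ} (hA : 0 ≤ A) (hv : ∀ t ∈ F, ‖v t‖ ≤ A)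
    (h : ∀ t ∈ F, ∀ t' ∈ F, v t ≠ 0 → v t' ≠ 0 → t = t') : ‖∑ t ∈ F, v t‖ ≤ A := by
  by_cases h0 : ∃ t ∈ F, v t ≠ 0
  · obtain ⟨t, ht, hne⟩ := h0
    rw [Finset.sum_eq_single t (fun t' ht' hne' => by
      by_contra h1
      exact hne' (h t' ht' t ht h1 hne)) (fun h => absurd ht h)]
    exact hv t ht
  · rw [Finset.sum_eq_zero fun t ht => by
      by_contra h1
      exact h0 ⟨t, ht, h1⟩]
    simpa

/-- Exponential decay away from the index `c`. -/
noncomputable def levelDecay (δ : ℝ) (c j : ℕ) : ℝ := 2 ^ (-(δ * |(j : ℝ) - c|))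

theorem levelDecay_pos (δ : ℝ) (c j : ℕ) : 0 < levelDecay δ c j := by
  unfold levelDecay; positivity

theorem levelDecay_eq_of_le {δ : ℝ} {c j : ℕ} (h : j ≤ c) :
    levelDecay δ c j = 2 ^ (δ * ((j : ℝ) - c)) := by
  have : (j : ℝ) ≤ c := by exact_mod_cast h
  rw [levelDecay, abs_of_nonpos (by linarith)]
  congr 1; ring

theorem levelDecay_eq_of_ge {δ : ℝ} {c j : ℕ} (h : c ≤ j) :
    levelDecay δ c j = 2 ^ (-(δ * ((j : ℝ) - c))) := by
  have : (c : ℝ) ≤ j := by exact_mod_cast h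
  rw [levelDecay, abs_of_nonneg (by linarith)]

theorem two_pow_div_two_pow (a b : ℕ) : (2 : ℝ) ^ a / 2 ^ b = 2 ^ ((a : ℝ) - b) := by
  rw [Real.rpow_sub two_pos, Real.rpow_natCast, Real.rpow_natCast]

namespace LocalMeans

variable {s : ℝ} (K : LocalMeans s)

/-- The size of the local means of a sum of narrow, separated bumps. -/
theorem exists_eLpNorm_levelConv_le {p : ℝ≥0∞} (hs : s = (p⁻¹).toReal) {h : ℝ → ℂ}
    (hh : ContDiff ℝ ∞ h) (hc : HasCompactSupport h) :
    ∃ C R δ : ℝ, 0 < C ∧ 0 < δ ∧ ∀ (F : Finset ℝ) (J N : ℕ) (α : ℝ → ℂ), (∀ t, ‖α t‖ ≤ 1) →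
      (∀ t ∈ F, ∀ t' ∈ F, t ≠ t' → 2 * R < |t - t'| * 2 ^ J) → F.card * 2 ^ J ≤ 2 ^ N → ∀ j : ℕ,
      ENNReal.ofReal (2 ^ (s * (j : ℝ))) *
        eLpNorm (K.levelConv j fun x => ∑ t ∈ F, α t * dyadicBump h N t x) p volume ≤
      ENNReal.ofReal (C * (F.card : ℝ) ^ s * (levelDecay δ N j + levelDecay δ J j)) := by
  obtain ⟨L, hsL, hL⟩ := K.moment
  obtain ⟨C, hC, hb⟩ := K.exists_norm_levelConv_dyadicBump_le hL hh hc
  obtain ⟨R, hR, hsupp⟩ := K.exists_levelConv_dyadicBump_support hc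
  -- Below the levels of the bumps the decay has rate 1; above them it has rate L + 1, of which s is
  -- lost to the weight.
  set δ : ℝ := min 1 ((L : ℝ) + 1 - s) with hδ
  have hδ0 : 0 < δ := lt_min one_pos (by linarith)
  have hδ1 : δ ≤ 1 := min_le_left _ _
  have hδL : δ ≤ (L : ℝ) + 1 - s := min_le_right _ _
  have hs0 : 0 ≤ s := hs ▸ ENNReal.toReal_nonneg
  refine ⟨C * (2 * R) ^ s, R, δ, by positivity, hδ0, fun F J N α hα hsep hcard j => ?_⟩
  have hbump : ∀ t, Continuous (dyadicBump h N t) := fun t =>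
    hh.continuous.comp (by fun_prop : Continuous fun x : ℝ => 2 ^ N * (x - t))
  have hbumpc : ∀ t, HasCompactSupport (dyadicBump h N t) := fun t => by
    have h2 : (2 : ℝ) ^ N ≠ 0 := by positivity
    exact hc.comp_homeomorph ((Homeomorph.subRight t).trans (Homeomorph.mulLeft₀ ((2 : ℝ) ^ N) h2))
  -- The local mean of one bump lives at scale 2^{-μ₀}, the coarser of the scales of kernel and
  -- bump. As s = 1/p, the measure of `F.card` such intervals contributes (card F)^s 2^{-s μ₀} to
  -- the L_p norm.
  set μ₀ := min j N with hμ₀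
  set S : Set ℝ := ⋃ t ∈ F, {x | |x - t| * 2 ^ μ₀ ≤ R} with hS
  have hSv : volume S ≤ ENNReal.ofReal (F.card * (2 * R) * (2 ^ μ₀)⁻¹) := by
    calc volume S ≤ ∑ t ∈ F, volume {x : ℝ | |x - t| * 2 ^ μ₀ ≤ R} := measure_biUnion_finset_le _ _
      _ = ∑ _t ∈ F, ENNReal.ofReal (2 * (R / 2 ^ μ₀)) := by
          refine Finset.sum_congr rfl fun t _ => ?_
          rw [← Real.volume_closedBall t]
          congr 1
          ext x
          rw [Metric.mem_closedBall, Real.dist_eq, le_div_iff₀ (by positivity)]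
          rfl
      _ = _ := by
          rw [Finset.sum_const, nsmul_eq_mul, ← ENNReal.ofReal_natCast, ← ENNReal.ofReal_mul (by positivity)]
          congr 1
          ring
  have hzero : ∀ x, x ∉ S → (K.levelConv j fun x => ∑ t ∈ F, α t * dyadicBump h N t x) x = 0 := by
    intro x hx
    rw [K.levelConv_sum j F α hbump hbumpc]
    refine Finset.sum_eq_zero fun t ht => ?_
    rw [hsupp, mul_zero]
    by_contra hle
    exact hx (Set.mem_biUnion ht (not_lt.1 hle))
  have key : ∀ A : ℝ, 0 ≤ A →
      (∀ x, ‖(K.levelConv j fun x => ∑ t ∈ F, α t * dyadicBump h N t x) x‖ ≤ A) →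
      2 ^ (s * ((j : ℝ) - μ₀)) * A ≤ C * (levelDecay δ N j + levelDecay δ J j) →
      ENNReal.ofReal (2 ^ (s * j)) *
        eLpNorm (K.levelConv j fun x => ∑ t ∈ F, α t * dyadicBump h N t x) p volume ≤
      ENNReal.ofReal (C * (2 * R) ^ s * (F.card : ℝ) ^ s * (levelDecay δ N j + levelDecay δ J j)) := by
    intro A hA hbd hfinal
    have h1 := eLpNorm_le_of_bounded_of_support (μ := volume) hbd hzero p
    rw [← hs] at h1
    calc _ ≤ ENNReal.ofReal (2 ^ (s * j)) * (ENNReal.ofReal (F.card * (2 * R) * (2 ^ μ₀)⁻¹) ^ s *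
          ENNReal.ofReal A) := by
          refine mul_le_mul' le_rfl (h1.trans ?_)
          gcongr
      _ = ENNReal.ofReal ((F.card : ℝ) ^ s * (2 * R) ^ s * (2 ^ (s * ((j : ℝ) - μ₀)) * A)) := by
          rw [ENNReal.ofReal_rpow_of_nonneg (by positivity) hs0, ← ENNReal.ofReal_mul (by positivity),
            ← ENNReal.ofReal_mul (by positivity)]
          congr 1
          rw [Real.mul_rpow (by positivity) (by positivity), Real.mul_rpow (by positivity) (by positivity),
            mul_sub, Real.rpow_sub two_pos, Real.inv_rpow (by positivity), ← Real.rpow_natCast 2 μ₀,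
            ← Real.rpow_mul two_pos.le, mul_comm (μ₀ : ℝ) s]
          ring
      _ ≤ _ := by
          refine ENNReal.ofReal_le_ofReal ?_
          calc _ ≤ (F.card : ℝ) ^ s * (2 * R) ^ s * (C * (levelDecay δ N j + levelDecay δ J j)) := by
                gcongr
            _ = _ := by ring
  have hterm : ∀ A : ℝ, (∀ t x, ‖K.levelConv j (dyadicBump h N t) x‖ ≤ A) → ∀ t x,
      ‖α t * K.levelConv j (dyadicBump h N t) x‖ ≤ A := fun A hA t x => by
    rw [norm_mul]
    exact (mul_le_of_le_one_left (norm_nonneg _) (hα t)).trans (hA t x)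
  have hsingle : ∀ A : ℝ, 0 ≤ A → (∀ t x, ‖K.levelConv j (dyadicBump h N t) x‖ ≤ A) → J ≤ μ₀ →
      ∀ x, ‖(K.levelConv j fun x => ∑ t ∈ F, α t * dyadicBump h N t x) x‖ ≤ A := by
    intro A hA0 hA hJ x
    rw [K.levelConv_sum j F α hbump hbumpc]
    refine norm_sum_le_of_forall_eq F _ hA0 (fun t _ => hterm A hA t x) fun t ht t' ht' h1 h2 => ?_
    by_contra hne
    have g1 : |x - t| * 2 ^ μ₀ ≤ R := not_lt.1 fun hlt => right_ne_zero_of_mul h1 (hsupp j N t x hlt)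
    have g2 : |x - t'| * 2 ^ μ₀ ≤ R := not_lt.1 fun hlt => right_ne_zero_of_mul h2 (hsupp j N t' x hlt)
    have g3 := hsep t ht t' ht' hne
    have g4 : |t - t'| * 2 ^ J ≤ |t - t'| * 2 ^ μ₀ := by
      gcongr
      norm_num
    have g5 : |t - t'| * 2 ^ μ₀ ≤ (|t - x| + |x - t'|) * 2 ^ μ₀ := by
      gcongr
      exact abs_sub_le t x t'
    rw [abs_sub_comm t x] at g5
    linarith
  rcases le_or_gt j N with hjN | hjN
  · have hμj : μ₀ = j := min_eq_left hjN
    have hA : ∀ t x, ‖K.levelConv j (dyadicBump h N t) x‖ ≤ C * (2 ^ j / 2 ^ N) :=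
      fun t x => (hb j N t x).1
    -- Between J and N at most one bump is visible at each point. Below J all of them may overlap,
    -- and `F.card * 2 ^ J ≤ 2 ^ N` turns the sum of their sizes into decay away from J.
    rcases le_or_gt J j with hJj | hJj
    · refine key _ (by positivity) (hsingle _ (by positivity) hA (by omega)) ?_
      rw [hμj, sub_self, mul_zero, Real.rpow_zero, one_mul, two_pow_div_two_pow]
      have h1 : (2 : ℝ) ^ ((j : ℝ) - N) ≤ levelDecay δ N j := by
        rw [levelDecay_eq_of_le hjN]
        refine Real.rpow_le_rpow_of_exponent_le one_le_two ?_
        have : (j : ℝ) ≤ N := by exact_mod_cast hjN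
        nlinarith
      have := levelDecay_pos δ J j
      gcongr
      linarith
    · refine key (F.card * (C * (2 ^ j / 2 ^ N))) (by positivity) (fun x => ?_) ?_
      · rw [K.levelConv_sum j F α hbump hbumpc]
        refine (norm_sum_le _ _).trans ?_
        rw [← nsmul_eq_mul]
        exact Finset.sum_le_card_nsmul _ _ _ fun t _ => hterm _ hA t x
      · rw [hμj, sub_self, mul_zero, Real.rpow_zero, one_mul]
        have h1 : (F.card : ℝ) * (2 ^ j / 2 ^ N) ≤ 2 ^ j / 2 ^ J := by
          have h2 : (F.card : ℝ) * 2 ^ J ≤ 2 ^ N := by exact_mod_cast hcard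
          rw [← mul_div_assoc, div_le_div_iff₀ (by positivity) (by positivity)]
          calc (F.card : ℝ) * 2 ^ j * 2 ^ J = 2 ^ j * (F.card * 2 ^ J) := by ring
            _ ≤ _ := by gcongr
        rw [two_pow_div_two_pow j J] at h1
        have h2 : (2 : ℝ) ^ ((j : ℝ) - J) ≤ levelDecay δ J j := by
          rw [levelDecay_eq_of_le hJj.le]
          refine Real.rpow_le_rpow_of_exponent_le one_le_two ?_
          have : (j : ℝ) ≤ J := by exact_mod_cast hJj.le
          nlinarith
        have := levelDecay_pos δ N j
        calc (F.card : ℝ) * (C * (2 ^ j / 2 ^ N)) = C * (F.card * (2 ^ j / 2 ^ N)) := by ring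
          _ ≤ _ := by gcongr; linarith
  · have hμN : μ₀ = N := min_eq_right hjN.le
    have hA : ∀ t x, ‖K.levelConv j (dyadicBump h N t) x‖ ≤ C * (2 ^ N / 2 ^ j) ^ (L + 1) :=
      fun t x => (hb j N t x).2 hjN.le
    rcases F.eq_empty_or_nonempty with rfl | hF
    · refine key 0 le_rfl (fun x => ?_) ?_
      · rw [K.levelConv_sum j _ α hbump hbumpc]
        simp
      · have := levelDecay_pos δ N j
        have := levelDecay_pos δ J j
        rw [mul_zero]
        positivity
    have hJN : J ≤ N := by
      have h1 : 1 * 2 ^ J ≤ F.card * 2 ^ J := Nat.mul_le_mul_right _ hF.card_pos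
      exact (Nat.pow_le_pow_iff_right (a := 2) (by norm_num)).1 (by omega)
    refine key _ (by positivity) (hsingle _ (by positivity) hA (by omega)) ?_
    have hr : (N : ℝ) < j := by exact_mod_cast hjN
    have h1 : 2 ^ (s * ((j : ℝ) - μ₀)) * (2 ^ N / 2 ^ j) ^ (L + 1) ≤ levelDecay δ N j := by
      rw [levelDecay_eq_of_ge hjN.le, hμN, two_pow_div_two_pow, ← Real.rpow_natCast,
        ← Real.rpow_mul two_pos.le, ← Real.rpow_add two_pos]
      refine Real.rpow_le_rpow_of_exponent_le one_le_two ?_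
      push_cast
      nlinarith
    have := levelDecay_pos δ J j
    calc 2 ^ (s * ((j : ℝ) - μ₀)) * (C * (2 ^ N / 2 ^ j) ^ (L + 1))
        = C * (2 ^ (s * ((j : ℝ) - μ₀)) * (2 ^ N / 2 ^ j) ^ (L + 1)) := by ring
      _ ≤ _ := by gcongr; linarith

end LocalMeans

/-! ### Sequence norms and norms of tensor products -/

theorem summable_levelDecay_zero {δ : ℝ} (hδ : 0 < δ) :
    Summable fun k : ℤ => (2 : ℝ) ^ (-(δ * |(k : ℝ)|)) := by
  have h0 : Summable fun n : ℕ => (2 : ℝ) ^ (-(δ * (n : ℝ))) := by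
    have h1 : (2 : ℝ) ^ (-δ) < 1 := Real.rpow_lt_one_of_one_lt_of_neg one_lt_two (by linarith)
    refine (summable_geometric_of_lt_one (by positivity) h1).congr fun n => ?_
    rw [← Real.rpow_natCast, ← Real.rpow_mul two_pos.le, neg_mul]
  refine Summable.of_nat_of_neg ?_ ?_ <;> simpa using h0

theorem exists_tsum_levelDecay_le {δ : ℝ} (hδ : 0 < δ) :
    ∃ B : ℝ, 0 < B ∧ ∀ c, ∑' j, ENNReal.ofReal (levelDecay δ c j) ≤ ENNReal.ofReal B := by
  have hs := summable_levelDecay_zero hδ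
  have h0 : 0 ≤ ∑' k : ℤ, (2 : ℝ) ^ (-(δ * |(k : ℝ)|)) := tsum_nonneg fun _ => by positivity
  refine ⟨1 + ∑' k : ℤ, (2 : ℝ) ^ (-(δ * |(k : ℝ)|)), by positivity, fun c => ?_⟩
  have hinj : Function.Injective fun j : ℕ => (j : ℤ) - c := fun a b h => by
    simpa using h
  calc ∑' j, ENNReal.ofReal (levelDecay δ c j)
      = ∑' j : ℕ, (fun k : ℤ => ENNReal.ofReal ((2 : ℝ) ^ (-(δ * |(k : ℝ)|)))) ((j : ℤ) - c) := by
        simp [levelDecay]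
    _ ≤ ∑' k : ℤ, ENNReal.ofReal ((2 : ℝ) ^ (-(δ * |(k : ℝ)|))) :=
        ENNReal.tsum_comp_le_tsum_of_injective hinj _
    _ = ENNReal.ofReal (∑' k : ℤ, (2 : ℝ) ^ (-(δ * |(k : ℝ)|))) :=
        (ENNReal.ofReal_tsum_of_nonneg (fun _ => by positivity) hs).symm
    _ ≤ _ := ENNReal.ofReal_le_ofReal (by linarith)

theorem levelDecay_rpow (δ r : ℝ) (c j : ℕ) : levelDecay δ c j ^ r = levelDecay (δ * r) c j := by
  rw [levelDecay, levelDecay, ← Real.rpow_mul two_pos.le]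
  congr 1
  ring

theorem ENNReal.rpow_finsetSum_le {ι : Type*} (F : Finset ι) (a : ι → ℝ≥0∞) {r : ℝ} (h0 : 0 < r)
    (h1 : r ≤ 1) : (∑ i ∈ F, a i) ^ r ≤ ∑ i ∈ F, a i ^ r := by
  classical
  induction F using Finset.induction_on with
  | empty => simp [h0]
  | insert i F hi ih =>
    rw [Finset.sum_insert hi, Finset.sum_insert hi]
    exact (ENNReal.rpow_add_le_add_rpow _ _ h0.le h1).trans (by gcongr)

/-- Sequences with exponential decay away from finitely many indices. -/
theorem exists_ellNorm_levelDecay_le {θ : ℝ≥0∞} (hθ : θ ≠ 0) (hθ1 : θ ≤ 1) {δ : ℝ} (hδ : 0 < δ) (ν : ℕ) :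
    ∃ B : ℝ, 0 < B ∧ ∀ (c : Fin ν → ℕ) (M : ℝ), 0 ≤ M → ∀ a : ℕ → ℝ≥0∞,
      (∀ j, a j ≤ ENNReal.ofReal (M * ∑ i, levelDecay δ (c i) j)) →
      ellNorm θ a ≤ ENNReal.ofReal (M * B) := by
  have hθt : θ ≠ ⊤ := (hθ1.trans_lt ENNReal.one_lt_top).ne
  set r := θ.toReal with hr
  have hr0 : 0 < r := ENNReal.toReal_pos hθ hθt
  have hr1 : r ≤ 1 := ENNReal.toReal_mono ENNReal.one_ne_top hθ1
  obtain ⟨B, hB, hle⟩ := exists_tsum_levelDecay_le (mul_pos hδ hr0)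
  refine ⟨(ν * B + 1) ^ (1 / r), by positivity, fun c M hM a ha => ?_⟩
  rw [ellNorm_of_ne_top hθt]
  have hsum : ∑' j, a j ^ r ≤ ENNReal.ofReal (M ^ r * (ν * B + 1)) := by
    calc ∑' j, a j ^ r ≤ ∑' j, ∑ i, ENNReal.ofReal (M ^ r) *
          ENNReal.ofReal (levelDecay (δ * r) (c i) j) := by
          refine ENNReal.tsum_le_tsum fun j => ?_
          rw [← Finset.mul_sum, ← ENNReal.ofReal_rpow_of_nonneg hM hr0.le]
          calc a j ^ r ≤ (ENNReal.ofReal M * ∑ i, ENNReal.ofReal (levelDecay δ (c i) j)) ^ r := by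
                rw [← ENNReal.ofReal_sum_of_nonneg fun i _ => (levelDecay_pos _ _ _).le,
                  ← ENNReal.ofReal_mul hM]
                exact ENNReal.rpow_le_rpow (ha j) hr0.le
            _ ≤ _ := by
                rw [ENNReal.mul_rpow_of_nonneg _ _ hr0.le]
                gcongr
                refine (ENNReal.rpow_finsetSum_le _ _ hr0 hr1).trans_eq ?_
                refine Finset.sum_congr rfl fun i _ => ?_
                rw [ENNReal.ofReal_rpow_of_nonneg (levelDecay_pos _ _ _).le hr0.le, levelDecay_rpow]
      _ = ENNReal.ofReal (M ^ r) * ∑ i, ∑' j, ENNReal.ofReal (levelDecay (δ * r) (c i) j) := by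
          rw [Summable.tsum_finsetSum fun _ _ => ENNReal.summable, Finset.mul_sum]
          simp_rw [ENNReal.tsum_mul_left]
      _ ≤ ENNReal.ofReal (M ^ r) * ∑ _i : Fin ν, ENNReal.ofReal B := by
          gcongr with i
          exact hle _
      _ = ENNReal.ofReal (M ^ r * (ν * B)) := by
          rw [Finset.sum_const, Finset.card_univ, Fintype.card_fin, nsmul_eq_mul, ← ENNReal.ofReal_natCast,
            ← ENNReal.ofReal_mul (by positivity), ← ENNReal.ofReal_mul (by positivity)]
      _ ≤ _ := ENNReal.ofReal_le_ofReal (by gcongr; linarith)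
  calc (∑' j, a j ^ r) ^ (1 / r) ≤ ENNReal.ofReal (M ^ r * (ν * B + 1)) ^ (1 / r) :=
        ENNReal.rpow_le_rpow hsum (by positivity)
    _ = _ := by
        rw [ENNReal.ofReal_rpow_of_nonneg (by positivity) (by positivity),
          Real.mul_rpow (by positivity) (by positivity), ← Real.rpow_mul hM,
          mul_one_div_cancel hr0.ne', Real.rpow_one]

/-- Minkowski's inequality for countable sums. -/
theorem ENNReal.lintegral_tsum_rpow_le {X ι : Type*} [MeasurableSpace X] {μ : Measure X} [Countable ι]
    {a : ι → X → ℝ≥0∞} (ha : ∀ i, Measurable (a i)) {q : ℝ} (hq : 1 ≤ q) :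
    (∫⁻ x, (∑' i, a i x) ^ q ∂μ) ^ (1 / q) ≤ ∑' i, (∫⁻ x, a i x ^ q ∂μ) ^ (1 / q) := by
  classical
  have hq0 : 0 < q := by linarith
  have hfin : ∀ F : Finset ι, (∫⁻ x, (∑ i ∈ F, a i x) ^ q ∂μ) ^ (1 / q) ≤
      ∑ i ∈ F, (∫⁻ x, a i x ^ q ∂μ) ^ (1 / q) := by
    intro F
    induction F using Finset.induction_on with
    | empty => simp [hq0]
    | insert i F hi ih =>
      simp only [Finset.sum_insert hi]
      refine (ENNReal.lintegral_Lp_add_le (ha i).aemeasurable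
        (Finset.measurable_fun_sum F fun j _ => ha j).aemeasurable hq).trans ?_
      gcongr
  have hmono : ∀ x, Monotone fun F : Finset ι => (∑ i ∈ F, a i x) ^ q := fun x F F' h =>
    ENNReal.rpow_le_rpow (Finset.sum_le_sum_of_subset h) hq0.le
  have h1 : ∀ x, (∑' i, a i x) ^ q = ⨆ F : Finset ι, (∑ i ∈ F, a i x) ^ q := fun x => by
    rw [ENNReal.tsum_eq_iSup_sum]
    exact (ENNReal.orderIsoRpow q hq0).map_iSup _
  simp_rw [h1]
  rw [lintegral_iSup_directed
    (fun F => ((Finset.measurable_fun_sum F fun j _ => ha j).pow_const q).aemeasurable)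
    (Monotone.directed_le fun F F' h x => hmono x h)]
  rw [one_div, ENNReal.rpow_inv_le_iff hq0]
  refine iSup_le fun F => ?_
  rw [← ENNReal.rpow_inv_le_iff hq0, ← one_div]
  exact (hfin F).trans (ENNReal.sum_le_tsum F)

/-- The fine index is lowered to τ ≤ θ, and Minkowski's inequality in L_{p/τ}, with p/τ ≥ 1,
exchanges the two norms. This embeds a Besov space with small fine index into a Triebel-Lizorkin
space. -/
theorem eLpNorm_ellNorm_le {X ι : Type*} [MeasurableSpace X] {μ : Measure X} [Countable ι]
    {a : ι → X → ℝ≥0∞} (ha : ∀ i, Measurable (a i)) {p θ τ : ℝ≥0∞} (hp : p ≠ ⊤) (hτ : τ ≠ 0)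
    (hτp : τ ≤ p) (hτθ : τ ≤ θ) :
    eLpNorm (fun x => ellNorm θ fun i => a i x) p μ ≤ ellNorm τ fun i => eLpNorm (a i) p μ := by
  have hτt : τ ≠ ⊤ := ne_top_of_le_ne_top hp hτp
  have hp0 : p ≠ 0 := fun h => hτ (le_zero_iff.1 (h ▸ hτp))
  have hr : 0 < τ.toReal := ENNReal.toReal_pos hτ hτt
  have hpr : 0 < p.toReal := ENNReal.toReal_pos hp0 hp
  have hrp : τ.toReal ≤ p.toReal := ENNReal.toReal_mono hp hτp
  calc eLpNorm (fun x => ellNorm θ fun i => a i x) p μ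
      ≤ eLpNorm (fun x => ellNorm τ fun i => a i x) p μ :=
        eLpNorm_mono_enorm fun x => ellNorm_anti hτ hτθ _
    _ = ((∫⁻ x, (∑' i, a i x ^ τ.toReal) ^ (p.toReal / τ.toReal) ∂μ) ^
          (1 / (p.toReal / τ.toReal))) ^ (1 / τ.toReal) := by
        rw [eLpNorm_eq_lintegral_rpow_enorm_toReal hp0 hp, ← ENNReal.rpow_mul]
        congr 1
        · refine lintegral_congr fun x => ?_
          rw [enorm_eq_self, ellNorm_of_ne_top hτt, ← ENNReal.rpow_mul]
          congr 1
          ring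
        · field_simp
    _ ≤ (∑' i, (∫⁻ x, (a i x ^ τ.toReal) ^ (p.toReal / τ.toReal) ∂μ) ^
          (1 / (p.toReal / τ.toReal))) ^ (1 / τ.toReal) := by
        refine ENNReal.rpow_le_rpow ?_ (by positivity)
        exact ENNReal.lintegral_tsum_rpow_le (fun i => (ha i).pow_const _) ((one_le_div hr).2 hrp)
    _ = _ := by
        rw [ellNorm_of_ne_top hτt]
        congr 1
        refine tsum_congr fun i => ?_
        rw [eLpNorm_eq_lintegral_rpow_enorm_toReal hp0 hp, ← ENNReal.rpow_mul]
        congr 1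
        · refine lintegral_congr fun x => ?_
          rw [enorm_eq_self, ← ENNReal.rpow_mul]
          congr 1
          field_simp
        · field_simp

theorem Complex.enorm_prod {ι : Type*} (F : Finset ι) (f : ι → ℂ) :
    ‖∏ i ∈ F, f i‖ₑ = ∏ i ∈ F, ‖f i‖ₑ := by
  simp only [enorm_eq_nnnorm, nnnorm_prod, ENNReal.ofNNReal_finsetProd]

theorem eLpNorm_tensor_le {d : ℕ} {g : Fin d → ℝ → ℂ} (hg : ∀ i, Continuous (g i)) {p : ℝ≥0∞}
    (hp : p ≠ 0) : eLpNorm (fun x : EuclideanSpace ℝ (Fin d) => ∏ i, g i (x i)) p volume ≤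
      ∏ i, eLpNorm (g i) p volume := by
  rcases eq_or_ne p ⊤ with rfl | hpt
  · simp only [eLpNorm_exponent_top]
    refine eLpNormEssSup_le_of_ae_enorm_bound ?_
    have h : ∀ i, ∀ᵐ x : EuclideanSpace ℝ (Fin d), ‖g i (x i)‖ₑ ≤ eLpNormEssSup (g i) volume := by
      intro i
      have hq : Measure.QuasiMeasurePreserving (fun x : EuclideanSpace ℝ (Fin d) => x i) volume volume :=
        (Measure.quasiMeasurePreserving_eval (fun _ : Fin d => (volume : Measure ℝ)) i).comp
          (PiLp.volume_preserving_ofLp (Fin d)).quasiMeasurePreserving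
      exact hq.ae ae_le_eLpNormEssSup
    filter_upwards [ae_all_iff.2 h] with x hx
    rw [Complex.enorm_prod]
    exact Finset.prod_le_prod' fun i _ => hx i
  · simp only [eLpNorm_eq_lintegral_rpow_enorm_toReal hp hpt]
    rw [ENNReal.prod_rpow_of_nonneg (by positivity)]
    rw [← EuclideanSpace.lintegral_prod_eq fun i => (hg i).enorm.measurable.pow_const _]
    refine le_of_eq ?_
    congr 1
    refine lintegral_congr fun x => ?_
    rw [Complex.enorm_prod, ENNReal.prod_rpow_of_nonneg (by positivity)]

theorem mixedWeight_eq_prod {d : ℕ} (s : ℝ) (m : Fin d → ℕ) :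
    mixedWeight s m = ∏ i, ENNReal.ofReal (2 ^ (s * (m i : ℝ))) := by
  rw [mixedWeight, ← ENNReal.ofReal_prod_of_nonneg fun i _ => by positivity,
    ← Real.rpow_sum_of_pos two_pos, ← Finset.mul_sum]
  push_cast
  rfl

theorem ellNorm_prod_le {d : ℕ} {ι : Type*} {θ : ℝ≥0∞} (hθ : θ ≠ ⊤) (f : Fin d → ι → ℝ≥0∞) :
    ellNorm θ (fun m : Fin d → ι => ∏ i, f i (m i)) = ∏ i, ellNorm θ (f i) := by
  simp only [ellNorm_of_ne_top hθ]
  rw [ENNReal.prod_rpow_of_nonneg (by positivity), ← ENNReal.tsum_pi_prod]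
  simp_rw [ENNReal.prod_rpow_of_nonneg ENNReal.toReal_nonneg]

theorem ellNorm_mono {ι : Type*} {θ : ℝ≥0∞} {a b : ι → ℝ≥0∞} (h : ∀ i, a i ≤ b i) :
    ellNorm θ a ≤ ellNorm θ b := by
  rcases eq_or_ne θ ⊤ with rfl | hθ
  · simp only [ellNorm_top]
    exact iSup_mono h
  · simp only [ellNorm_of_ne_top hθ]
    refine ENNReal.rpow_le_rpow (ENNReal.tsum_le_tsum fun i => ?_) (by positivity)
    exact ENNReal.rpow_le_rpow (h i) ENNReal.toReal_nonneg

namespace LocalMeans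

variable {s : ℝ} {d : ℕ}

theorem triebelLizorkinNorm_le_besovNorm (K : LocalMeans s) {p θ τ : ℝ≥0∞} (hp : p ≠ ⊤) (hτ : τ ≠ 0)
    (hτp : τ ≤ p) (hτθ : τ ≤ θ) {u : 𝓢'(EuclideanSpace ℝ (Fin d), ℂ)}
    (hu : ∀ m, Continuous (K.conv m u)) : triebelLizorkinNorm K p θ u ≤ besovNorm K p τ u := by
  refine (eLpNorm_ellNorm_le (fun m => (hu m).enorm.measurable.const_mul _) hp hτ hτp hτθ).trans_eq ?_
  unfold besovNorm
  congr 1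
  funext m
  have hp0 : p ≠ 0 := fun h => hτ (le_zero_iff.1 (h ▸ hτp))
  have hpr : 0 < p.toReal := ENNReal.toReal_pos hp0 hp
  rw [eLpNorm_eq_lintegral_rpow_enorm_toReal hp0 hp, eLpNorm_eq_lintegral_rpow_enorm_toReal hp0 hp]
  simp only [enorm_eq_self]
  simp_rw [ENNReal.mul_rpow_of_nonneg _ _ hpr.le]
  rw [lintegral_const_mul _ ((hu m).enorm.measurable.pow_const _),
    ENNReal.mul_rpow_of_nonneg _ _ (by positivity), ← ENNReal.rpow_mul, mul_one_div_cancel hpr.ne',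
    ENNReal.rpow_one]

/-- Smooth tensor products, supported in the unit cube, as distributions. -/
theorem exists_tensor (K : LocalMeans s) {G : Fin d → ℝ → ℂ} (hG : ∀ i, ContDiff ℝ ∞ (G i))
    (hG0 : ∀ i x, x ∉ Set.Icc (0 : ℝ) 1 → G i x = 0) :
    ∃ (u : 𝓢'(EuclideanSpace ℝ (Fin d), ℂ)) (f : EuclideanSpace ℝ (Fin d) →ᵇ ℂ),
      IsRepresentedBy u f ∧ (∀ x, f x = ∏ i, G i (x i)) ∧ Distribution.dsupport u ⊆ unitCube d ∧
      ∀ m x, K.conv m u x = ∏ i, K.levelConv (m i) (G i) (x i) := by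
  have hzero : ∀ x : EuclideanSpace ℝ (Fin d), x ∉ unitCube d → ∏ i, G i (x i) = 0 := by
    intro x hx
    have : ∃ i, ¬(0 ≤ x i ∧ x i ≤ 1) := by
      by_contra h
      push Not at h
      exact hx h
    obtain ⟨i, hi⟩ := this
    exact Finset.prod_eq_zero (Finset.mem_univ i) (hG0 i _ hi)
  have hcs : HasCompactSupport fun x : EuclideanSpace ℝ (Fin d) => ∏ i, G i (x i) := by
    refine EuclideanSpace.hasCompactSupport_of_forall (R := 1) fun x ⟨i, hi⟩ => hzero x fun h => ?_
    have h' := h i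
    rw [abs_of_nonneg h'.1] at hi
    linarith [h'.2]
  have hsm : ContDiff ℝ ∞ fun x : EuclideanSpace ℝ (Fin d) => ∏ i, G i (x i) := by
    refine contDiff_prod fun i _ => (hG i).comp ?_
    fun_prop
  set f : 𝓢(EuclideanSpace ℝ (Fin d), ℂ) := hcs.toSchwartzMap hsm with hf
  have hfx : ∀ x, f x = ∏ i, G i (x i) := fun x => rfl
  set u : 𝓢'(EuclideanSpace ℝ (Fin d), ℂ) := toTemperedDistributionCLM _ ℂ volume f with hu
  have hux : ∀ φ, u φ = ∫ x, φ x * f x := fun φ => by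
    exact SchwartzMap.toTemperedDistributionCLM_apply_apply volume f φ
  refine ⟨u, f.toBoundedContinuousFunction, fun φ => hux φ, hfx, ?_, fun m x => ?_⟩
  · refine Set.sInter_subset_of_mem ⟨fun φ hφ => ?_, isClosed_unitCube d⟩
    rw [hux]
    refine integral_eq_zero_of_ae (.of_forall fun x => ?_)
    by_cases hx : x ∈ unitCube d
    · have : φ x = 0 := image_eq_zero_of_notMem_tsupport fun h => hφ h hx
      simp [this]
    · simp [hfx, hzero x hx]
  · rw [conv, hux]
    calc ∫ z, K.testFunction m x z * f z
        = ∫ z : EuclideanSpace ℝ (Fin d), ∏ i, (fun y => K.level (m i) (x i - y) * G i y) (z i) := by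
          refine integral_congr_ae (.of_forall fun z => ?_)
          simp only [hfx, Finset.prod_mul_distrib]
          rfl
      _ = _ := EuclideanSpace.integral_prod_eq fun i y => K.level (m i) (x i - y) * G i y

theorem besovNorm_tensor_le (K : LocalMeans s) {G : Fin d → ℝ → ℂ} (hG : ∀ i, Continuous (G i))
    {u : 𝓢'(EuclideanSpace ℝ (Fin d), ℂ)}
    (hu : ∀ m x, K.conv m u x = ∏ i, K.levelConv (m i) (G i) (x i)) {p θ : ℝ≥0∞} (hp : p ≠ 0)
    (hθ : θ ≠ ⊤) :
    besovNorm K p θ u ≤ ∏ i, ellNorm θ fun j : ℕ =>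
      ENNReal.ofReal (2 ^ (s * (j : ℝ))) * eLpNorm (K.levelConv j (G i)) p volume := by
  rw [← ellNorm_prod_le hθ]
  refine ellNorm_mono fun m => ?_
  rw [Finset.prod_mul_distrib, ← mixedWeight_eq_prod, funext (hu m)]
  gcongr
  exact eLpNorm_tensor_le (fun i => K.continuous_levelConv _ (hG i)) hp

end LocalMeans

/-! ### Test functions vanishing on the lattice -/

/-- A nonnegative smooth bump around the origin. -/
structure IsCentralBump (φ : ℝ → ℝ) : Prop where
  smooth : ContDiff ℝ ∞ φ
  nonneg : ∀ x, 0 ≤ φ x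
  le_one : ∀ x, φ x ≤ 1
  zero : φ 0 = 1
  vanish : ∀ x, 1 / 4 ≤ |x| → φ x = 0

theorem exists_isCentralBump : ∃ φ, IsCentralBump φ := by
  let b : ContDiffBump (0 : ℝ) := ⟨1 / 8, 1 / 4, by norm_num, by norm_num⟩
  refine ⟨b, b.contDiff, fun x => b.nonneg, fun x => b.le_one, ?_, fun x hx => ?_⟩
  · exact b.one_of_mem_closedBall (Metric.mem_closedBall_self (by norm_num [b]))
  · refine b.zero_of_le_dist ?_
    rw [Real.dist_eq, sub_zero]
    exact hx

namespace IsCentralBump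

variable {φ : ℝ → ℝ}

theorem hasCompactSupport (hφ : IsCentralBump φ) : HasCompactSupport φ :=
  HasCompactSupport.intro (isCompact_Icc (a := -(1 / 4 : ℝ)) (b := 1 / 4)) fun x hx => hφ.vanish x (by
    by_contra h
    exact hx (abs_le.1 (not_le.1 h).le))

theorem integral_pos (hφ : IsCentralBump φ) : 0 < ∫ x, φ x := by
  refine hφ.smooth.continuous.integral_pos_of_hasCompactSupport_nonneg_nonzero hφ.hasCompactSupport
    hφ.nonneg (x := 0) ?_
  rw [hφ.zero]
  exact one_ne_zero

theorem contDiff_ofReal (hφ : IsCentralBump φ) : ContDiff ℝ ∞ fun x => (φ x : ℂ) :=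
  Complex.ofRealCLM.contDiff.comp hφ.smooth

theorem hasCompactSupport_ofReal (hφ : IsCentralBump φ) : HasCompactSupport fun x => (φ x : ℂ) :=
  hφ.hasCompactSupport.comp_left Complex.ofReal_zero

end IsCentralBump

theorem contDiff_dyadicBump {h : ℝ → ℂ} (hh : ContDiff ℝ ∞ h) (N : ℕ) (t : ℝ) :
    ContDiff ℝ ∞ (dyadicBump h N t) :=
  hh.comp (by fun_prop : ContDiff ℝ ∞ fun x : ℝ => 2 ^ N * (x - t))

theorem integral_dyadicBump (h : ℝ → ℂ) (N : ℕ) (t : ℝ) :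
    ∫ x, dyadicBump h N t x = (2 ^ N)⁻¹ * ∫ x, h x := by
  simp only [dyadicBump]
  rw [integral_sub_right_eq_self (fun y => h (2 ^ N * y)) t, Measure.integral_comp_mul_left,
    abs_of_pos (by positivity), Complex.real_smul]
  push_cast
  rfl

theorem IsCentralBump.dyadicBump_eq_zero {φ : ℝ → ℝ} (hφ : IsCentralBump φ) {N : ℕ} {t x : ℝ}
    (h : 1 / 4 ≤ |x - t| * 2 ^ N) : dyadicBump (fun y => (φ y : ℂ)) N t x = 0 := by
  rw [dyadicBump, hφ.vanish, Complex.ofReal_zero]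
  rwa [abs_mul, abs_of_pos (by positivity), mul_comm]

namespace LocalMeans

variable {s : ℝ}

/-- The Besov norm on the real line. -/
noncomputable def lineNorm (K : LocalMeans s) (p θ : ℝ≥0∞) (g : ℝ → ℂ) : ℝ≥0∞ :=
  ellNorm θ fun j : ℕ => ENNReal.ofReal (2 ^ (s * (j : ℝ))) * eLpNorm (K.levelConv j g) p volume

theorem lineNorm_const_mul (K : LocalMeans s) (p : ℝ≥0∞) {θ : ℝ≥0∞} (hθ : θ ≠ 0) (hθt : θ ≠ ⊤) (α : ℂ)
    (g : ℝ → ℂ) : K.lineNorm p θ (fun x => α * g x) = ‖α‖ₑ * K.lineNorm p θ g := by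
  have h1 : ∀ j, K.levelConv j (fun x => α * g x) = α • K.levelConv j g := fun j => by
    funext x
    rw [Pi.smul_apply, smul_eq_mul, levelConv, levelConv, ← integral_const_mul]
    refine integral_congr_ae (.of_forall fun y => ?_)
    dsimp only
    ring
  have hr : 0 < θ.toReal := ENNReal.toReal_pos hθ hθt
  simp only [lineNorm, ellNorm_of_ne_top hθt, h1, eLpNorm_const_smul]
  have h2 : ∀ j : ℕ, (ENNReal.ofReal (2 ^ (s * (j : ℝ))) * (‖α‖ₑ * eLpNorm (K.levelConv j g) p volume)) ^ θ.toReal =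
      ‖α‖ₑ ^ θ.toReal *
        (ENNReal.ofReal (2 ^ (s * (j : ℝ))) * eLpNorm (K.levelConv j g) p volume) ^ θ.toReal := fun j => by
    rw [← ENNReal.mul_rpow_of_nonneg _ _ hr.le]
    congr 1
    ring
  simp_rw [h2]
  rw [ENNReal.tsum_mul_left, ENNReal.mul_rpow_of_nonneg _ _ (by positivity), ← ENNReal.rpow_mul,
    mul_one_div_cancel hr.ne', ENNReal.rpow_one]

/-- The levels decay geometrically away from N and J, so the fine index θ affects only the constant.
Neither the width nor the separation of the bumps enters the bound, only their number. -/
theorem exists_lineNorm_bumps_le (K : LocalMeans s) {p θ : ℝ≥0∞} (hs : s = (p⁻¹).toReal) (hθ : θ ≠ 0)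
    (hθ1 : θ ≤ 1) {h : ℝ → ℂ} (hh : ContDiff ℝ ∞ h) (hc : HasCompactSupport h) :
    ∃ M R : ℝ, 0 < M ∧ ∀ (F : Finset ℝ) (J N : ℕ) (α : ℝ → ℂ), (∀ t, ‖α t‖ ≤ 1) →
      (∀ t ∈ F, ∀ t' ∈ F, t ≠ t' → 2 * R < |t - t'| * 2 ^ J) → F.card * 2 ^ J ≤ 2 ^ N →
      K.lineNorm p θ (fun x => ∑ t ∈ F, α t * dyadicBump h N t x) ≤
        ENNReal.ofReal (M * (F.card : ℝ) ^ s) := by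
  obtain ⟨C, R, δ, hC, hδ, hle⟩ := K.exists_eLpNorm_levelConv_le hs hh hc
  obtain ⟨B, hB, hell⟩ := exists_ellNorm_levelDecay_le hθ hθ1 hδ 2
  refine ⟨C * B, R, by positivity, fun F J N α hα hsep hcard => ?_⟩
  refine (hell ![N, J] (C * (F.card : ℝ) ^ s) (by positivity) _ fun j => ?_).trans_eq (by
    congr 1; ring)
  simpa [Fin.sum_univ_two] using hle F J N α hα hsep hcard j

/-- A bump of size one minus narrow bumps that cut out its values on a finite set. -/
theorem exists_lineNorm_sub_bumps_le (K : LocalMeans s) {p θ : ℝ≥0∞} (hp : 1 ≤ p)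
    (hs : s = (p⁻¹).toReal) (hθ : θ ≠ 0)
    (hθ1 : θ ≤ 1) {h : ℝ → ℂ} (hh : ContDiff ℝ ∞ h) (hc : HasCompactSupport h) (t₀ : ℝ) :
    ∃ M R : ℝ, 0 < M ∧ ∀ (F : Finset ℝ) (J N : ℕ) (α : ℝ → ℂ), (∀ t, ‖α t‖ ≤ 1) →
      (∀ t ∈ F, ∀ t' ∈ F, t ≠ t' → 2 * R < |t - t'| * 2 ^ J) → F.card * 2 ^ J ≤ 2 ^ N →
      K.lineNorm p θ (fun x => dyadicBump h 0 t₀ x - ∑ t ∈ F, α t * dyadicBump h N t x) ≤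
        ENNReal.ofReal (M * (1 + F.card : ℝ) ^ s) := by
  obtain ⟨C, R, δ, hC, hδ, hle⟩ := K.exists_eLpNorm_levelConv_le hs hh hc
  obtain ⟨B, hB, hell⟩ := exists_ellNorm_levelDecay_le hθ hθ1 hδ 4
  have hs0 : 0 ≤ s := hs ▸ ENNReal.toReal_nonneg
  refine ⟨C * B, R, by positivity, fun F J N α hα hsep hcard => ?_⟩
  -- The broad bump is itself a family of one member with J = N = 0, and so contributes the centre 0
  -- twice.
  refine (hell ![0, 0, N, J] (C * (1 + F.card : ℝ) ^ s) (by positivity) _ fun j => ?_).trans_eq (by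
    congr 1; ring)
  have hbump : ∀ N t, Continuous (dyadicBump h N t) := fun N t => (contDiff_dyadicBump hh N t).continuous
  have hgc : Continuous fun x => ∑ t ∈ F, α t * dyadicBump h N t x :=
    continuous_finsetSum _ fun t _ => continuous_const.mul (hbump N t)
  have hsub : K.levelConv j (fun x => dyadicBump h 0 t₀ x - ∑ t ∈ F, α t * dyadicBump h N t x) =
      K.levelConv j (dyadicBump h 0 t₀) - K.levelConv j fun x => ∑ t ∈ F, α t * dyadicBump h N t x := by
    funext x
    rw [Pi.sub_apply, levelConv, levelConv, levelConv, ← integral_sub]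
    · simp only [mul_sub]
    · exact (((K.contDiff_level j).continuous.comp (continuous_const.sub continuous_id)).mul
        (hbump 0 t₀)).integrable_of_hasCompactSupport
        (((K.hasCompactSupport_level j).comp_homeomorph (Homeomorph.subLeft x)).mul_right)
    · exact (((K.contDiff_level j).continuous.comp (continuous_const.sub continuous_id)).mul
        hgc).integrable_of_hasCompactSupport
        (((K.hasCompactSupport_level j).comp_homeomorph (Homeomorph.subLeft x)).mul_right)
  rw [hsub]
  have h1 := hle {t₀} 0 0 (fun _ => 1) (by simp) (by simp) (by simp) j
  have h2 := hle F J N α hα hsep hcard j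
  simp only [Finset.sum_singleton, one_mul, Finset.card_singleton, Nat.cast_one, Real.one_rpow] at h1
  calc ENNReal.ofReal (2 ^ (s * (j : ℝ))) * eLpNorm (K.levelConv j (dyadicBump h 0 t₀) -
        K.levelConv j fun x => ∑ t ∈ F, α t * dyadicBump h N t x) p volume
      ≤ ENNReal.ofReal (2 ^ (s * (j : ℝ))) * eLpNorm (K.levelConv j (dyadicBump h 0 t₀)) p volume +
        ENNReal.ofReal (2 ^ (s * (j : ℝ))) *
          eLpNorm (K.levelConv j fun x => ∑ t ∈ F, α t * dyadicBump h N t x) p volume := by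
        rw [← mul_add]
        gcongr
        exact eLpNorm_sub_le (K.continuous_levelConv j (hbump 0 t₀)).aestronglyMeasurable
          (K.continuous_levelConv j hgc).aestronglyMeasurable hp
    _ ≤ _ := add_le_add h1 h2
    _ = ENNReal.ofReal (C * 1 * (levelDecay δ 0 j + levelDecay δ 0 j) +
          C * (F.card : ℝ) ^ s * (levelDecay δ N j + levelDecay δ J j)) := by
        have := levelDecay_pos δ
        rw [← ENNReal.ofReal_add]
        · have := this 0 j
          positivity
        · have h3 := this N j
          have h4 := this J j
          positivity
    _ ≤ _ := by
        refine ENNReal.ofReal_le_ofReal ?_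
        have h3 : (1 : ℝ) ≤ (1 + F.card : ℝ) ^ s := Real.one_le_rpow (by simp) hs0
        have h4 : (F.card : ℝ) ^ s ≤ (1 + F.card : ℝ) ^ s := by
          gcongr
          linarith
        have d0 := levelDecay_pos δ 0 j
        have d1 := levelDecay_pos δ N j
        have d2 := levelDecay_pos δ J j
        have : ∑ i, levelDecay δ (![0, 0, N, J] i) j =
            (levelDecay δ 0 j + levelDecay δ 0 j) + (levelDecay δ N j + levelDecay δ J j) := by
          simp [Fin.sum_univ_four]
          ring
        rw [this]
        exact (add_le_add
          (mul_le_mul_of_nonneg_right (mul_le_mul_of_nonneg_left h3 hC.le) (by positivity))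
          (mul_le_mul_of_nonneg_right (mul_le_mul_of_nonneg_left h4 hC.le)
            (by positivity))).trans_eq (by ring)

end LocalMeans

/-- Projecting the O(n) lattice points of the cube to one axis reduces the lower bound to functions
of one variable that vanish on a finite set; only the number of points matters. -/
theorem exists_finset_lattice_coord {d : ℕ} (hd : 1 ≤ d) (i₀ : Fin d) : ∃ C : ℝ, 0 < C ∧ ∀ n : ℕ, 1 ≤ n →
    ∃ F : Finset ℝ, (F.card : ℝ) ≤ C * n ∧ ∀ x ∈ frolovLattice d n, x ∈ unitCube d → x i₀ ∈ F := by
  classical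
  obtain ⟨C, hC, hcount⟩ := exists_card_lattice_le hd (zero_le_one (α := ℝ))
  refine ⟨C, hC, fun n hn => ?_⟩
  obtain ⟨T, hT, -⟩ := exists_frolovEquiv hd hn
  have hfin := finite_setOf_lattice hd hn hT
  refine ⟨hfin.toFinset.image fun k => T (intPoint k) i₀, ?_, fun x hx hcube => ?_⟩
  · refine le_trans (by exact_mod_cast Finset.card_image_le) (hcount n hn T hT 0 hfin.toFinset fun k hk i => ?_)
    have : ∀ i, |T (intPoint k) i| ≤ 1 := by simpa using hk
    simpa using this i
  · rw [frolovLattice_eq_range hT] at hx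
    obtain ⟨k, rfl⟩ := hx
    refine Finset.mem_image_of_mem _ ?_
    rw [Set.Finite.mem_toFinset]
    intro i
    rw [abs_of_nonneg (hcube i).1]
    exact (hcube i).2

namespace LocalMeans

variable {s : ℝ}

/-- For `p < 1`: a narrow bump that avoids a finite set. -/
theorem exists_profile_of_lt_one (K : LocalMeans s) {p θ : ℝ≥0∞} (hs : s = (p⁻¹).toReal)
    (hθ : θ ≠ 0) (hθ1 : θ ≤ 1) {C₀ : ℝ} (hC₀ : 0 < C₀) :
    ∃ M c : ℝ, 0 < M ∧ 0 < c ∧ ∀ n : ℕ, 1 ≤ n → ∀ F : Finset ℝ, (F.card : ℝ) ≤ C₀ * n →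
      ∃ G : ℝ → ℂ, ContDiff ℝ ∞ G ∧ (∀ x, x ∉ Set.Icc (0 : ℝ) 1 → G x = 0) ∧ (∀ x ∈ F, G x = 0) ∧
        K.lineNorm p θ G ≤ ENNReal.ofReal M ∧ c * (n : ℝ) ^ (-(1 : ℝ)) ≤ ‖∫ x, G x‖ := by
  obtain ⟨φ, hφ⟩ := exists_isCentralBump
  obtain ⟨M, R, hM, hle⟩ := K.exists_lineNorm_bumps_le hs hθ hθ1 hφ.contDiff_ofReal
    hφ.hasCompactSupport_ofReal
  have hI := hφ.integral_pos
  refine ⟨M, (∫ x, φ x) / (4 * (C₀ + 1)), hM, by positivity, fun n hn F hF => ?_⟩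
  -- There are 2^{N-1} > card F candidate centres with spacing 2^{-N} in [1/4, 3/4], while 2^N is at
  -- most a constant times n. The bound 2^N ≥ 4 keeps the bumps inside the unit interval.
  set N := Nat.log 2 (F.card + 1) + 2 with hN
  have hN1 : F.card < 2 ^ (N - 1) := by
    have := Nat.lt_pow_succ_log_self one_lt_two (F.card + 1)
    have e : N - 1 = (Nat.log 2 (F.card + 1)).succ := by omega
    rw [e]
    omega
  have hN2 : (2 : ℝ) ^ N ≤ 4 * (C₀ + 1) * n := by
    have h1 : 2 ^ Nat.log 2 (F.card + 1) ≤ F.card + 1 := Nat.pow_log_le_self 2 (by omega)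
    have h2 : (2 : ℝ) ^ Nat.log 2 (F.card + 1) ≤ F.card + 1 := by exact_mod_cast h1
    have h3 : (1 : ℝ) ≤ n := by exact_mod_cast hn
    rw [hN, pow_add]
    linarith
  have h4N : (4 : ℝ) ≤ 2 ^ N := by
    rw [hN, pow_add]
    have : (1 : ℝ) ≤ 2 ^ Nat.log 2 (F.card + 1) := one_le_pow₀ one_le_two
    linarith
  set t : ℕ → ℝ := fun k => 1 / 4 + k * (2 ^ N)⁻¹ with ht
  -- Pigeonhole: a point of F comes closer than 2^{-N}/4 to at most one centre, and there are more
  -- centres than points.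
  obtain ⟨k, hk, hkF⟩ : ∃ k ∈ Finset.range (2 ^ (N - 1)), ∀ x ∈ F, 1 / 4 ≤ |x - t k| * 2 ^ N := by
    by_contra! hcon
    choose! g hgF hg using hcon
    obtain ⟨k, hk, k', hk', hne, heq⟩ := Finset.exists_ne_map_eq_of_card_lt_of_maps_to
      (s := Finset.range (2 ^ (N - 1))) (t := F) (by simpa using hN1) (f := g) (fun k hk => hgF k hk)
    have h1 := hg k hk
    have h2 := hg k' hk'
    rw [heq] at h1
    have h3 : |t k - t k'| * 2 ^ N = |(k : ℝ) - k'| := by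
      rw [ht]
      dsimp only
      rw [← abs_of_pos (show (0 : ℝ) < 2 ^ N by positivity), ← abs_mul, abs_of_pos (show (0 : ℝ) < 2 ^ N by positivity)]
      congr 1
      field_simp
      ring
    have h4 : (1 : ℝ) ≤ |(k : ℝ) - k'| := by
      have : (1 : ℤ) ≤ |(k : ℤ) - k'| := Int.one_le_abs (by omega)
      exact_mod_cast this
    have h5 : |t k - t k'| * 2 ^ N ≤ (|t k - g k'| + |g k' - t k'|) * 2 ^ N := by
      gcongr
      exact abs_sub_le _ _ _
    rw [abs_sub_comm (t k) (g k')] at h5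
    linarith
  refine ⟨dyadicBump (fun y => (φ y : ℂ)) N (t k), contDiff_dyadicBump hφ.contDiff_ofReal N _,
    fun x hx => hφ.dyadicBump_eq_zero ?_, fun x hx => hφ.dyadicBump_eq_zero (hkF x hx), ?_, ?_⟩
  · by_contra! hlt
    have h1 : |x - t k| * 4 ≤ |x - t k| * 2 ^ N := by gcongr
    have h2 : |x - t k| < 1 / 4 := by linarith [abs_nonneg (x - t k)]
    have h3 : (k : ℝ) * (2 ^ N)⁻¹ ≤ 1 / 2 := by
      have hk' : k < 2 ^ (N - 1) := Finset.mem_range.1 hk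
      have h4 : (k : ℝ) ≤ 2 ^ (N - 1) := by exact_mod_cast hk'.le
      have h5 : (2 : ℝ) ^ N = 2 * 2 ^ (N - 1) := by rw [← pow_succ']; congr 1
      rw [h5]
      rw [mul_inv_le_iff₀ (by positivity)]
      linarith
    have h4 : 0 ≤ (k : ℝ) * (2 ^ N)⁻¹ := by positivity
    rw [abs_lt] at h2
    refine hx ⟨?_, ?_⟩ <;> simp only [ht] at h2 <;> linarith
  · have := hle {t k} 0 N (fun _ => 1) (by simp) (by simp) (by simpa using Nat.one_le_two_pow)
    simpa using this
  · rw [integral_dyadicBump, integral_complex_ofReal, norm_mul, Complex.norm_real, norm_inv, norm_pow,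
      Real.norm_of_nonneg hI.le, Real.rpow_neg_one, RCLike.norm_ofNat]
    have e : (∫ x, φ x) / (4 * (C₀ + 1)) * (n : ℝ)⁻¹ = (4 * (C₀ + 1) * n)⁻¹ * ∫ x, φ x := by
      field_simp
    rw [e]
    gcongr

/-- For `p ≥ 1`: a bump with its values on a finite set cut out. -/
theorem exists_profile_of_one_le (K : LocalMeans s) {p θ : ℝ≥0∞} (hp : 1 ≤ p) (hs : s = (p⁻¹).toReal)
    (hθ : θ ≠ 0) (hθ1 : θ ≤ 1) {C₀ : ℝ} (hC₀ : 0 < C₀) :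
    ∃ M c : ℝ, 0 < M ∧ 0 < c ∧ ∀ n : ℕ, 1 ≤ n → ∀ F : Finset ℝ, (F.card : ℝ) ≤ C₀ * n →
      ∃ G : ℝ → ℂ, ContDiff ℝ ∞ G ∧ (∀ x, x ∉ Set.Icc (0 : ℝ) 1 → G x = 0) ∧ (∀ x ∈ F, G x = 0) ∧
        K.lineNorm p θ G ≤ ENNReal.ofReal M ∧ c * (n : ℝ) ^ (-s) ≤ ‖∫ x, G x‖ := by
  obtain ⟨φ, hφ⟩ := exists_isCentralBump
  set h : ℝ → ℂ := fun y => (φ y : ℂ) with hh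
  obtain ⟨M, R, hM, hle⟩ := K.exists_lineNorm_sub_bumps_le hp hs hθ hθ1 hφ.contDiff_ofReal
    hφ.hasCompactSupport_ofReal (1 / 2)
  have hI := hφ.integral_pos
  have hs0 : 0 ≤ s := hs ▸ ENNReal.toReal_nonneg
  have hθt : θ ≠ ⊤ := (hθ1.trans_lt ENNReal.one_lt_top).ne
  refine ⟨M * (1 + C₀) ^ s, (∫ x, φ x) / 2, by positivity, by positivity, fun n hn F hF => ?_⟩
  have hn1 : (1 : ℝ) ≤ n := by exact_mod_cast hn
  have htend : ∀ a b : ℝ, 0 < a → ∀ᶠ J : ℕ in Filter.atTop, b < a * 2 ^ J := fun a b ha =>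
    ((tendsto_pow_atTop_atTop_of_one_lt one_lt_two).const_mul_atTop ha).eventually_gt_atTop b
  have hsepev : ∀ b : ℝ, ∀ᶠ J : ℕ in Filter.atTop, ∀ t ∈ F, ∀ t' ∈ F, t ≠ t' → b < |t - t'| * 2 ^ J := by
    intro b
    rw [Filter.eventually_all_finset]
    intro t _
    rw [Filter.eventually_all_finset]
    intro t' _
    rcases eq_or_ne t t' with rfl | hne
    · exact .of_forall fun J hJ => absurd rfl hJ
    · filter_upwards [htend |t - t'| b (abs_pos.2 (sub_ne_zero.2 hne))] with J hJ _ using hJ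
  -- J and N depend on the position of the points of F without any quantitative control. This is
  -- harmless, since the norm bound involves only the cardinality of F.
  obtain ⟨J, hJsep, hJ1⟩ := ((hsepev (2 * R)).and (Filter.eventually_ge_atTop 1)).exists
  obtain ⟨N, hNsep, hNcard, hN1⟩ := ((hsepev (1 / 4)).and ((htend 1 (F.card * 2 ^ J) one_pos).and
    (Filter.eventually_ge_atTop 1))).exists
  have hcard : F.card * 2 ^ J ≤ 2 ^ N := by
    rw [one_mul] at hNcard
    exact_mod_cast hNcard.le
  have hα : ∀ t, ‖dyadicBump h 0 (1 / 2) t‖ ≤ 1 := fun t => by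
    rw [dyadicBump, Complex.norm_real, Real.norm_of_nonneg (hφ.nonneg _)]
    exact hφ.le_one _
  have hαt : ∀ t, dyadicBump h 0 (1 / 2) t ≠ 0 → |t - 1 / 2| < 1 / 4 := fun t ht => by
    by_contra! hge
    exact ht (hφ.dyadicBump_eq_zero (by simpa using hge))
  set g : ℝ → ℂ := fun x => dyadicBump h 0 (1 / 2) x -
    ∑ t ∈ F, dyadicBump h 0 (1 / 2) t * dyadicBump h N t x with hg
  have hgn := hle F J N (dyadicBump h 0 (1 / 2)) hα hJsep hcard
  have hgs : ContDiff ℝ ∞ g := (contDiff_dyadicBump hφ.contDiff_ofReal _ _).sub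
    (ContDiff.sum fun t _ => contDiff_const.mul (contDiff_dyadicBump hφ.contDiff_ofReal _ _))
  have hint : ∀ N t, Integrable (dyadicBump h N t) := fun N t => by
    have h2 : (2 : ℝ) ^ N ≠ 0 := by positivity
    exact (contDiff_dyadicBump hφ.contDiff_ofReal _ _).continuous.integrable_of_hasCompactSupport
      (hφ.hasCompactSupport_ofReal.comp_homeomorph
        ((Homeomorph.subRight t).trans (Homeomorph.mulLeft₀ ((2 : ℝ) ^ N) h2)))
  -- The norm of g is of order at most n^s, whereas its integral stays bounded below; the factor
  -- n^{-s} normalises.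
  refine ⟨fun x => ((n : ℝ) ^ (-s) : ℝ) * g x, contDiff_const.mul hgs, fun x hx => ?_, fun x hx => ?_, ?_, ?_⟩
  · rw [hg]
    dsimp only
    have hx1 : dyadicBump h 0 (1 / 2) x = 0 := by
      by_contra h1
      have h2 := abs_lt.1 (hαt x h1)
      exact hx ⟨by linarith, by linarith⟩
    rw [hx1, Finset.sum_eq_zero, sub_zero, mul_zero]
    intro t _
    by_contra h1
    have h2 := abs_lt.1 (hαt t (left_ne_zero_of_mul h1))
    have h3 : |x - t| < 1 / 4 := by
      by_contra! hge
      refine right_ne_zero_of_mul h1 (hφ.dyadicBump_eq_zero (hge.trans ?_))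
      exact le_mul_of_one_le_right (abs_nonneg _) (one_le_pow₀ one_le_two)
    rw [abs_lt] at h3
    exact hx ⟨by linarith, by linarith⟩
  · rw [hg]
    dsimp only
    -- By the choice of N only the narrow bump centred at x is nonzero at x, and it takes the value
    -- one there.
    rw [Finset.sum_eq_single x (fun t ht hne => by
      rw [hφ.dyadicBump_eq_zero (hNsep x hx t ht hne.symm).le, mul_zero]) (fun h => absurd hx h)]
    have : dyadicBump h N x x = 1 := by simp [dyadicBump, hh, hφ.zero]
    rw [this, mul_one, sub_self, mul_zero]
  · rw [K.lineNorm_const_mul p hθ hθt]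
    calc ‖(((n : ℝ) ^ (-s) : ℝ) : ℂ)‖ₑ * K.lineNorm p θ g
        ≤ ENNReal.ofReal ((n : ℝ) ^ (-s)) * ENNReal.ofReal (M * (1 + F.card : ℝ) ^ s) := by
          refine mul_le_mul' (le_of_eq ?_) hgn
          rw [← ofReal_norm, Complex.norm_real, Real.norm_of_nonneg (by positivity)]
      _ = ENNReal.ofReal ((n : ℝ) ^ (-s) * (M * (1 + F.card : ℝ) ^ s)) :=
          (ENNReal.ofReal_mul (by positivity)).symm
      _ ≤ _ := by
          refine ENNReal.ofReal_le_ofReal ?_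
          calc (n : ℝ) ^ (-s) * (M * (1 + F.card : ℝ) ^ s)
              ≤ (n : ℝ) ^ (-s) * (M * ((1 + C₀) * n) ^ s) := by
                gcongr
                linarith
            _ = (n : ℝ) ^ (-s) * (n : ℝ) ^ s * (M * (1 + C₀) ^ s) := by
                rw [Real.mul_rpow (by positivity) (by positivity)]
                ring
            _ = _ := by
                rw [← Real.rpow_add (by linarith), neg_add_cancel, Real.rpow_zero, one_mul]
  · rw [integral_const_mul, norm_mul, Complex.norm_real, Real.norm_of_nonneg (by positivity), mul_comm]
    gcongr
    have hgi : ∫ x, g x = (((1 - (2 ^ N)⁻¹ * ∑ t ∈ F, φ (t - 1 / 2)) * ∫ x, φ x : ℝ) : ℂ) := by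
      rw [hg, integral_sub (hint _ _) (integrable_finsetSum _ fun t _ => (hint _ _).const_mul _),
        integral_finsetSum _ fun t _ => (hint _ _).const_mul _]
      simp_rw [integral_const_mul, integral_dyadicBump]
      rw [← Finset.sum_mul, hh, integral_complex_ofReal]
      simp only [dyadicBump]
      push_cast
      simp only [pow_zero, one_mul, inv_one]
      ring
    rw [hgi, Complex.norm_real, Real.norm_eq_abs]
    refine le_trans ?_ (le_abs_self _)
    have h1 : ∑ t ∈ F, φ (t - 1 / 2) ≤ F.card := by
      have := Finset.sum_le_card_nsmul F (fun t => φ (t - 1 / 2)) 1 fun t _ => hφ.le_one _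
      simpa using this
    -- Here J ≥ 1 enters: it gives 2 card F ≤ 2^N, so the narrow bumps remove at most half of the
    -- integral.
    have h2 : (2 ^ N)⁻¹ * ∑ t ∈ F, φ (t - 1 / 2) ≤ 1 / 2 := by
      have h3 : (F.card : ℝ) * 2 ^ J ≤ 2 ^ N := by exact_mod_cast hcard
      have h4 : (2 : ℝ) ≤ 2 ^ J := by
        calc (2 : ℝ) = 2 ^ 1 := (pow_one _).symm
          _ ≤ 2 ^ J := pow_le_pow_right₀ one_le_two hJ1
      have h5 : (F.card : ℝ) * 2 ≤ F.card * 2 ^ J := by gcongr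
      rw [inv_mul_le_iff₀ (by positivity)]
      linarith
    nlinarith

end LocalMeans

/-! ### Bounds for the worst-case error and conclusion -/

theorem enorm_error_le_worstCaseError {d n : ℕ} {N : 𝓢'(EuclideanSpace ℝ (Fin d), ℂ) → ℝ≥0∞}
    {u : 𝓢'(EuclideanSpace ℝ (Fin d), ℂ)} (hu : Distribution.dsupport u ⊆ unitCube d) (hN : N u ≤ 1)
    {f : EuclideanSpace ℝ (Fin d) →ᵇ ℂ} (hf : IsRepresentedBy u f) :
    ‖(∫ x in unitCube d, f x) - frolovCubature d n f‖ₑ ≤ worstCaseError n N := by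
  unfold worstCaseError
  refine le_iSup_of_le u (le_iSup_of_le ⟨hN.trans_lt ENNReal.one_lt_top, hu⟩ (le_iSup_of_le hN
    (le_iSup_of_le f (le_iSup_of_le hf le_rfl))))

theorem frolovCubature_eq_zero {d n : ℕ} {f : EuclideanSpace ℝ (Fin d) → ℂ}
    (h : ∀ x ∈ frolovLattice d n, x ∈ unitCube d → f x = 0) : frolovCubature d n f = 0 := by
  rw [frolovCubature, finsum_mem_of_eqOn_zero, mul_zero]
  exact fun x hx => h x hx.1 fun i => ⟨(hx.2 i).1, (hx.2 i).2.le⟩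

namespace LocalMeans

variable {s : ℝ}

/-- The cubature error of a tensor product that vanishes on the lattice. -/
theorem enorm_integral_le_worstCaseError (K : LocalMeans s) {k n : ℕ} {p θ : ℝ≥0∞} (hp : p ≠ 0)
    (hθ : θ ≠ ⊤) {N : 𝓢'(EuclideanSpace ℝ (Fin (k + 1)), ℂ) → ℝ≥0∞}
    (hN : ∀ u : 𝓢'(EuclideanSpace ℝ (Fin (k + 1)), ℂ), Distribution.dsupport u ⊆ unitCube (k + 1) → N u ≤ besovNorm K p θ u) {G ψ : ℝ → ℂ}
    (hG : ContDiff ℝ ∞ G) (hψ : ContDiff ℝ ∞ ψ) (hG0 : ∀ x, x ∉ Set.Icc (0 : ℝ) 1 → G x = 0)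
    (hψ0 : ∀ x, x ∉ Set.Icc (0 : ℝ) 1 → ψ x = 0)
    (hzero : ∀ x ∈ frolovLattice (k + 1) n, x ∈ unitCube (k + 1) → G (x 0) = 0)
    (hle : K.lineNorm p θ G * K.lineNorm p θ ψ ^ k ≤ 1) :
    ‖∫ x, G x‖ₑ * ‖∫ x, ψ x‖ₑ ^ k ≤ worstCaseError n N := by
  set H : Fin (k + 1) → ℝ → ℂ := Fin.cons G fun _ => ψ with hH
  have hHs : ∀ i, ContDiff ℝ ∞ (H i) := Fin.cases hG fun _ => hψ
  have hH0 : ∀ i x, x ∉ Set.Icc (0 : ℝ) 1 → H i x = 0 := Fin.cases hG0 fun _ => hψ0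
  obtain ⟨u, f, huf, hf, hsupp, hconv⟩ := K.exists_tensor hHs hH0
  have hnorm : N u ≤ 1 := by
    refine (hN u hsupp).trans ((K.besovNorm_tensor_le (fun i => (hHs i).continuous) hconv hp hθ).trans ?_)
    rw [Fin.prod_univ_succ]
    simpa [hH, lineNorm] using hle
  have key := enorm_error_le_worstCaseError (n := n) hsupp hnorm huf
  rw [frolovCubature_eq_zero, sub_zero, setIntegral_eq_integral_of_forall_compl_eq_zero,
    integral_congr_ae (.of_forall hf), EuclideanSpace.integral_prod_eq, Complex.enorm_prod,
    Fin.prod_univ_succ] at key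
  · simpa [hH] using key
  · exact fun x hx => huf.eq_zero_of_notMem hsupp fun h => hx fun i => ⟨(h i).1.le, (h i).2.le⟩
  · intro x hx hcube
    rw [hf]
    refine Finset.prod_eq_zero (Finset.mem_univ 0) ?_
    simpa [hH] using hzero x hx hcube

/-- The lower bound for the error, given test profiles that avoid finite sets. -/
theorem exists_le_worstCaseError (K : LocalMeans s) {d : ℕ} (hd : 1 ≤ d) {p θ : ℝ≥0∞} (hp : p ≠ 0)
    (hs : s = (p⁻¹).toReal) (hθ : θ ≠ 0) (hθ1 : θ ≤ 1) {r : ℝ}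
    (hprof : ∀ C₀ : ℝ, 0 < C₀ → ∃ M c : ℝ, 0 < M ∧ 0 < c ∧ ∀ n : ℕ, 1 ≤ n → ∀ F : Finset ℝ,
      (F.card : ℝ) ≤ C₀ * n → ∃ G : ℝ → ℂ, ContDiff ℝ ∞ G ∧ (∀ x, x ∉ Set.Icc (0 : ℝ) 1 → G x = 0) ∧
        (∀ x ∈ F, G x = 0) ∧ K.lineNorm p θ G ≤ ENNReal.ofReal M ∧ c * (n : ℝ) ^ (-r) ≤ ‖∫ x, G x‖)
    {N : 𝓢'(EuclideanSpace ℝ (Fin d), ℂ) → ℝ≥0∞}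
    (hN : ∀ u : 𝓢'(EuclideanSpace ℝ (Fin d), ℂ), Distribution.dsupport u ⊆ unitCube d → N u ≤ besovNorm K p θ u) :
    ∃ c : ℝ, 0 < c ∧ ∀ n : ℕ, 1 ≤ n → ENNReal.ofReal (c * (n : ℝ) ^ (-r)) ≤ worstCaseError n N := by
  obtain ⟨k, rfl⟩ : ∃ k, d = k + 1 := ⟨d - 1, by omega⟩
  have hθt : θ ≠ ⊤ := (hθ1.trans_lt ENNReal.one_lt_top).ne
  obtain ⟨C₀, hC₀, hF⟩ := exists_finset_lattice_coord hd (0 : Fin (k + 1))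
  obtain ⟨M, c, hM, hc, hprof⟩ := hprof C₀ hC₀
  obtain ⟨φ, hφ⟩ := exists_isCentralBump
  obtain ⟨M', R, hM', hle⟩ := K.exists_lineNorm_bumps_le hs hθ hθ1 hφ.contDiff_ofReal
    hφ.hasCompactSupport_ofReal
  have hI := hφ.integral_pos
  set ψ := dyadicBump (fun y => (φ y : ℂ)) 0 (1 / 2) with hψ
  have hψn : K.lineNorm p θ ψ ≤ ENNReal.ofReal M' := by
    have := hle {1 / 2} 0 0 (fun _ => 1) (by simp) (by simp) (by simp)
    simpa only [Finset.sum_singleton, one_mul, Finset.card_singleton, Nat.cast_one, Real.one_rpow,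
      mul_one] using this
  have hψ0 : ∀ x, x ∉ Set.Icc (0 : ℝ) 1 → ψ x = 0 := fun x hx => hφ.dyadicBump_eq_zero (by
    by_contra! hlt
    rw [pow_zero, mul_one, abs_lt] at hlt
    exact hx ⟨by linarith, by linarith⟩)
  -- Normalises the product of the k + 1 one-dimensional norms to at most one.
  set α : ℝ := (M * M' ^ k)⁻¹ with hα
  have hα0 : 0 < α := by positivity
  refine ⟨α * c * (∫ x, φ x) ^ k, by positivity, fun n hn => ?_⟩
  obtain ⟨F, hFc, hFm⟩ := hF n hn
  obtain ⟨G, hG, hG0, hGF, hGn, hGi⟩ := hprof n hn F hFc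
  have hαe : ‖(α : ℂ)‖ₑ = ENNReal.ofReal α := by
    rw [← ofReal_norm, Complex.norm_real, Real.norm_of_nonneg hα0.le]
  refine le_trans ?_ (K.enorm_integral_le_worstCaseError hp hθt hN (G := fun x => α * G x) (ψ := ψ)
    (contDiff_const.mul hG) (contDiff_dyadicBump hφ.contDiff_ofReal _ _)
    (fun x hx => by rw [hG0 x hx, mul_zero]) hψ0
    (fun x hx hcube => by rw [hGF _ (hFm x hx hcube), mul_zero]) ?_)
  · rw [hψ, integral_dyadicBump, integral_complex_ofReal, integral_const_mul, enorm_mul, hαe,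
      pow_zero, inv_one, one_mul, ← ofReal_norm, ← ofReal_norm, Complex.norm_real,
      Real.norm_of_nonneg hI.le, ← ENNReal.ofReal_pow hI.le, ← ENNReal.ofReal_mul hα0.le,
      ← ENNReal.ofReal_mul (by positivity)]
    refine ENNReal.ofReal_le_ofReal ?_
    calc α * c * (∫ x, φ x) ^ k * (n : ℝ) ^ (-r) = α * (c * (n : ℝ) ^ (-r)) * (∫ x, φ x) ^ k := by ring
      _ ≤ _ := by gcongr
  · rw [K.lineNorm_const_mul p hθ hθt, hαe]
    calc ENNReal.ofReal α * K.lineNorm p θ G * K.lineNorm p θ ψ ^ k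
        ≤ ENNReal.ofReal α * ENNReal.ofReal M * ENNReal.ofReal M' ^ k := by gcongr
      _ = ENNReal.ofReal (α * M * M' ^ k) := by
          rw [← ENNReal.ofReal_pow hM'.le, ← ENNReal.ofReal_mul hα0.le,
            ← ENNReal.ofReal_mul (by positivity)]
      _ = 1 := by
          rw [hα, mul_assoc, inv_mul_cancel₀ (by positivity), ENNReal.ofReal_one]
      _ ≤ 1 := le_rfl

/-- The upper bound for the error on a class that embeds into the endpoint space. -/
theorem exists_worstCaseError_le (K : LocalMeans s) {d : ℕ} (hd : 1 ≤ d) {q : ℝ≥0∞} (hq : 1 ≤ q)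
    {N : 𝓢'(EuclideanSpace ℝ (Fin d), ℂ) → ℝ≥0∞} {D : ℝ≥0∞} (hD : D ≠ ⊤)
    (hN : ∀ u : 𝓢'(EuclideanSpace ℝ (Fin d), ℂ), Distribution.dsupport u ⊆ unitCube d → K.endpointNorm q u ≤ D * N u) :
    (∀ u ∈ cubeClass N, ∃ f : EuclideanSpace ℝ (Fin d) →ᵇ ℂ, IsRepresentedBy u f) ∧
    ∃ C : ℝ, 0 < C ∧ ∀ n : ℕ, 1 ≤ n →
      worstCaseError n N ≤ ENNReal.ofReal (C * (n : ℝ) ^ (-(q⁻¹).toReal)) := by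
  have hfin : ∀ u ∈ cubeClass N, K.endpointNorm q u ≠ ⊤ := fun u hu =>
    ne_top_of_le_ne_top (ENNReal.mul_ne_top hD hu.1.ne) (hN u hu.2)
  obtain ⟨C, hC, herr⟩ := K.exists_error_le hd
  refine ⟨fun u hu => ?_, C * (D.toReal + 1), by positivity, fun n hn => ?_⟩
  · obtain ⟨E⟩ := K.nonempty_dualMeans
    obtain ⟨f, -, hf⟩ := E.exists_isRepresentedBy hq hu.2 (hfin u hu)
    exact ⟨f, hf⟩
  · unfold worstCaseError
    refine iSup_le fun u => iSup_le fun hu => iSup_le fun hu1 => iSup_le fun f => iSup_le fun hf => ?_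
    refine (herr n hn q hq u hu.2 (hfin u hu) f hf).trans ?_
    calc _ ≤ ENNReal.ofReal (C * (n : ℝ) ^ (-(q⁻¹).toReal)) * ENNReal.ofReal (D.toReal + 1) := by
          gcongr
          refine (hN u hu.2).trans ((mul_le_of_le_one_right' hu1).trans ?_)
          rw [ENNReal.le_ofReal_iff_toReal_le hD (by positivity)]
          linarith
      _ = _ := by
          rw [← ENNReal.ofReal_mul (by positivity)]
          congr 1
          ring

end LocalMeans

theorem theorem6p3 (d : ℕ) (hd : 1 ≤ d) :
    (∀ p θ : ℝ≥0∞, 0 < p → 0 < θ → θ ≤ 1 → ∀ K : LocalMeans (p⁻¹).toReal,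
      FrolovErrorOrder (d := d) (besovNorm K p θ) ((max p 1)⁻¹).toReal) ∧
    (∀ p θ : ℝ≥0∞, 0 < p → p < 1 → 0 < θ → ∀ K : LocalMeans (p⁻¹).toReal,
      FrolovErrorOrder (d := d) (triebelLizorkinNorm K p θ) 1) := by
  refine ⟨fun p θ hp hθ hθ1 K => ?_, fun p θ hp hp1 hθ K => ?_⟩
  · rcases lt_or_ge p 1 with hp1 | hp1
    · obtain ⟨D, hD, hle⟩ := LocalMeans.exists_endpointNorm_one_le_besovNorm K hp hp1 hθ.ne' hθ1 d
      -- The endpoint exponent is q = 1 here, which `le_rfl` selects.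
      obtain ⟨hrep, C, hC, hup⟩ := K.exists_worstCaseError_le hd le_rfl hD hle
      obtain ⟨c, hc, hlow⟩ := K.exists_le_worstCaseError hd hp.ne' rfl hθ.ne' hθ1
        (fun C₀ hC₀ => K.exists_profile_of_lt_one rfl hθ.ne' hθ1 hC₀) fun u _ => le_rfl
      rw [max_eq_right hp1.le]
      refine ⟨hrep, c, C, hc, hC, fun n hn => ⟨?_, hup n hn⟩⟩
      simpa using hlow n hn
    · obtain ⟨hrep, C, hC, hup⟩ := K.exists_worstCaseError_le (N := besovNorm K p θ) hd hp1
        ENNReal.one_ne_top fun u _ => by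
          rw [one_mul]
          exact LocalMeans.endpointNorm_le_besovNorm K hθ.ne' hθ1 u
      obtain ⟨c, hc, hlow⟩ := K.exists_le_worstCaseError hd hp.ne' rfl hθ.ne' hθ1
        (fun C₀ hC₀ => K.exists_profile_of_one_le hp1 rfl hθ.ne' hθ1 hC₀) fun u _ => le_rfl
      rw [max_eq_left hp1]
      exact ⟨hrep, c, C, hc, hC, fun n hn => ⟨hlow n hn, hup n hn⟩⟩
  · obtain ⟨D, hD, hle⟩ := LocalMeans.exists_endpointNorm_one_le_triebelLizorkinNorm K hp hp1 hθ.ne' d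
    obtain ⟨hrep, C, hC, hup⟩ := K.exists_worstCaseError_le hd le_rfl hD hle
    -- For the lower bound the test functions are measured in the smaller Besov space with fine
    -- index min{p, θ}, which is below one and embeds into the Triebel-Lizorkin space for every θ.
    have hτ : min p θ ≠ 0 := (lt_min hp hθ).ne'
    have hτ1 : min p θ ≤ 1 := (min_le_left _ _).trans hp1.le
    obtain ⟨c, hc, hlow⟩ := K.exists_le_worstCaseError hd hp.ne' rfl hτ hτ1
      (fun C₀ hC₀ => K.exists_profile_of_lt_one rfl hτ hτ1 hC₀) fun u hu =>
        K.triebelLizorkinNorm_le_besovNorm (θ := θ) (hp1.trans ENNReal.one_lt_top).ne hτ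
          (min_le_left _ _) (min_le_right _ _) fun m => K.continuous_conv_of_dsupport hu m
    refine ⟨hrep, c, C, hc, hC, fun n hn => ⟨hlow n hn, ?_⟩⟩
    simpa using hup n hn
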